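/- **$M_2$-rank deviations for $M=3$ and $M=5$.** For a partition $\lambda$ of an integer $n\ge 0$ with largest part $\ell(\lambda)$ and $\nu(\lambda)$ parts let $M_2\text{-rank}(\lambda)=\lceil \ell(\lambda)/2\rceil-\nu(\lambda)$ (the empty partition of $0$ has rank $0$). Let $p_o(n)$ be the number of partitions of $n$ without repeated odd parts, and $N_2(a,M;n)$ the number of those whose $M_2$-rank is congruent to $a$ modulo $M$. For $|q|<1$ put $$D_2(a,M)=\sum_{n\ge0}\Big(N_2(a,M;n)-\frac{p_o(n)}{M}\Big)q^n,\qquad R_2(a,b,M,c,m)=\sum_{n\ge0}\big(N_2(a,M;mn+c)-N_2(b,M;mn+c)\big)q^n .$$ Write $(x;q)_\infty=\prod_{i\ge0}(1-q^ix)$, $j(x;q)=(x;q)_\infty(q/x;q)_\infty(q;q)_\infty$, $J_{a,m}=j(q^a;q^m)$, $\overline J_{a,m}=j(-q^a;q^m)$, $J_m=J_{m,3m}$, and $$m(x,q,z)=\frac1{j(z;q)}\sum_{r\in\mathbb Z}\frac{(-1)^rq^{r(r-1)/2}z^r}{1-q^{r-1}xz}.$$ Then for every complex $q$ with $0<|q|<1$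 all the series $D_2$, $R_2$ below converge, and the following identities hold. For $M=3$: $$\begin{aligned} D_2(0,3)&=2m(q^{15},q^{36},q^9)+2q^{-6}m(q^{-3},q^{36},q^{27})+\frac23\frac{\overline J_{9,18}^2J_{3,12}}{J_6^2}+\frac23q\frac{\overline J_{9,18}J_{9,36}}{J_6}+\frac23q^2\frac{J_{9,36}^2}{J_{3,12}},\\ D_2(1,3)&=-m(q^{15},q^{36},q^9)-q^{-6}m(q^{-3},q^{36},q^{27})-\frac13\frac{\overline J_{9,18}^2J_{3,12}}{J_6^2}-\frac13q\frac{\overline J_{9,18}J_{9,36}}{J_6}-\frac13q^2\frac{J_{9,36}^2}{J_{3,12}}, \end{aligned}$$ together with the rank-difference identities of Lovejoy and Osburn $$\begin{aligned} R_2(0,1,3,0,3)&=3m(q^{5},q^{12},q^3)+3q^{-2}m(q^{-1},q^{12},q^{9})+\frac{\overline J_{3,6}^2J_{1,4}}{J_2^2},\\ R_2(0,1,3,1,3)&=\frac{\overline J_{3,6}J_{3,12}}{J_2},\qquad R_2(0,1,3,2,3)=\frac{J_3J_{12}^2}{J_4J_{1,6}}. \end{aligned}$$ For $M=5$, with $$\begin{gathered}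 \Theta_0=\frac{J_{5,50}^2J_{30,100}J_{40,100}}{J_5\overline J_{50,200}J_{100}},\quad \Theta_1=\frac{J_{50}^4}{J_{10,50}J_{25}J_{100}},\quad \Theta_2=\frac{J_{25}^2J_{30,100}}{J_{10,25}J_{50}},\quad \Theta_2'=\frac{J_{10,100}J_{25}^2}{J_{5,25}J_{50}},\\ \Theta_3=\frac{\overline J_{25,50}J_{25,100}}{J_{20,50}},\quad \Theta_4=\frac{J_{10}J_{100}J_{15,50}^2}{J_5J_{30,100}J_{40,100}}, \end{gathered}$$ one has $$\begin{aligned} D_2(0,5)&=2-2q^{-55}m(q^{-55},q^{100},q^{75})-2q^{-15}m(q^{-5},q^{100},q^{25})\\ &\quad-\tfrac65\Theta_0+\tfrac45q\,\Theta_1+\tfrac25q^2(2\Theta_2-q^5\Theta_2')-\tfrac25q^3\Theta_3+\tfrac25q^4\Theta_4,\\ D_2(1,5)&=-q^{-1}m(q^{35},q^{100},q^{25})-q^{-6}m(q^{15},q^{100},q^{25})-1+q^{-55}m(q^{-55},q^{100},q^{75})+q^{-15}m(q^{-5},q^{100},q^{25})\\ &\quad+\tfrac45\Theta_0-\tfrac15q\,\Theta_1-\tfrac15q^2(\Theta_2-3q^5\Theta_2')+\tfrac35q^3\Theta_3+\tfrac25q^4\Theta_4,\\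 D_2(2,5)&=q^{-1}m(q^{35},q^{100},q^{25})+q^{-6}m(q^{15},q^{100},q^{25})\\ &\quad-\tfrac15\Theta_0-\tfrac15q\,\Theta_1-\tfrac15q^2(\Theta_2+2q^5\Theta_2')-\tfrac25q^3\Theta_3-\tfrac35q^4\Theta_4. \end{aligned}$$ -/

import Mathlib

namespace MTwoRank

/-- Partitions of `n` in which no odd part is repeated. -/
def NoRepeatedOdd {n : ℕ} (p : n.Partition) : Prop :=
  ∀ i ∈ p.parts, Odd i → p.parts.count i ≤ 1

instance {n : ℕ} : DecidablePred (NoRepeatedOdd (n := n)) := fun p =>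
  inferInstanceAs (Decidable (∀ i ∈ p.parts, Odd i → p.parts.count i ≤ 1))

/-- The largest part of a partition (`0` for the empty partition). -/
def largestPart {n : ℕ} (p : n.Partition) : ℕ := p.parts.sup

/-- The `M₂`-rank `⌈ℓ / 2⌉ - ν`, where `ℓ` is the largest part and `ν` the number of parts;
in natural numbers `⌈ℓ / 2⌉` is `(ℓ + 1) / 2`. -/
def m2Rank {n : ℕ} (p : n.Partition) : ℤ :=
  (((largestPart p + 1) / 2 : ℕ) : ℤ) - (Multiset.card p.parts : ℤ)

/-- `p_o(n)`: the number of partitions of `n` without repeated odd parts. -/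
def po (n : ℕ) : ℕ :=
  (Finset.univ.filter fun p : n.Partition => NoRepeatedOdd p).card

/-- `N₂(a, M; n)`: the number of partitions of `n` without repeated odd parts whose
`M₂`-rank is congruent to `a` modulo `M`. -/
def N2 (a M n : ℕ) : ℕ :=
  (Finset.univ.filter fun p : n.Partition =>
    NoRepeatedOdd p ∧ m2Rank p ≡ (a : ℤ) [ZMOD (M : ℤ)]).card

/-- The `n`-th coefficient of the deviation
`D₂(a, M) = ∑ₙ (N₂(a, M; n) - p_o(n) / M) qⁿ`. -/
noncomputable def deviationCoeff (a M n : ℕ) : ℂ :=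
  (N2 a M n : ℂ) - (po n : ℂ) / (M : ℂ)

/-- The `n`-th coefficient of the rank difference
`R₂(a, b, M, c, m) = ∑ₙ (N₂(a, M; m n + c) - N₂(b, M; m n + c)) qⁿ`. -/
noncomputable def rankDiffCoeff (a b M c m n : ℕ) : ℂ :=
  (N2 a M (m * n + c) : ℂ) - (N2 b M (m * n + c) : ℂ)

/-- The infinite product `(x; q)_∞ = ∏_{i ≥ 0} (1 - qⁱ x)`. -/
noncomputable def qPoch (x q : ℂ) : ℂ := ∏' i : ℕ, (1 - q ^ i * x)

/-- The theta function `j(x; q) = (x; q)_∞ (q / x; q)_∞ (q; q)_∞`. -/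
noncomputable def theta (x q : ℂ) : ℂ := qPoch x q * qPoch (q / x) q * qPoch q q

/-- `J_{a,m} = j(q^a; q^m)`. -/
noncomputable def J (a m : ℕ) (q : ℂ) : ℂ := theta (q ^ a) (q ^ m)

/-- `J̄_{a,m} = j(-q^a; q^m)`. -/
noncomputable def Jbar (a m : ℕ) (q : ℂ) : ℂ := theta (-(q ^ a)) (q ^ m)

/-- `J_m = J_{m,3m}`. -/
noncomputable def J1 (m : ℕ) (q : ℂ) : ℂ := J m (3 * m) q

/-- The Appell–Lerch sum
`m(x, q, z) = j(z; q)⁻¹ ∑_{r ∈ ℤ} (-1)^r q^{r(r-1)/2} z^r / (1 - q^{r-1} x z)`. -/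
noncomputable def appellLerch (x q z : ℂ) : ℂ :=
  1 / theta z q *
    ∑' r : ℤ, (-1 : ℂ) ^ r * q ^ (r * (r - 1) / 2) * z ^ r / (1 - q ^ (r - 1) * x * z)

end MTwoRank

namespace MTwoRank
open Filter Topology

/-! ### Triangular exponents -/

/-! The proof joins a bijection, a calculus of Appell sums and a finite set of relations between
theta constants.

Combinatorics. Let P be the generating function of the partitions without repeated odd parts. A
Dyson-type adjoint map (`raise` followed backwards, then `attachTop`) carries those of rank at most
K to those of rank at least K - 1 and adds 2K - 1 to the weight (`gf_attachTop`). Iterated, it gives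
the tails: partitions of rank greater than m are counted by P times the sum over n ≥ 1 of (-1)^(n-1)
q^(2n²+n+2mn), and symmetrically for negative ranks (`hasSum_gf_gt`, `hasSum_gf_lt`). The case K =
1, where the empty partition stands apart, closes the system and yields P θ = 1 with θ = `th (q ^ 4)
q` (`gf_oddFree_mul_th`). Summation over a progression of ranks shows that the class a, for 0 < a <
M, is counted by -P (V_a - V_(a+1)), where V_k is the sum over n ≠ 0 of (-1)^n q^(2n²+(2k-1)n) / (1
- q^(2Mn)) (`gf_rankClass`). As V_(M+1-k) = -V_k, only V_1 matters for M = 3, and only V_1 and V_2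
for M = 5.

Appell sums. Put Q = q^M and L = 4M. Splitting n modulo M and writing 1/(1-y) = (1+y)/(1-y²) turns
V_k into 2M bilateral Appell sums with base Q^L (`hasSum_rankTerm`). The change of variable formula
`apS_mul_th` moves each of them to one of two fixed Appell sums, at the price of a theta quotient.
The coefficients of each fixed sum assemble to the M-dissection of θ, so that θ factors out and
cancels P. The sums with residue b = 0 have their polar term omitted; for these `apS_one_mul_th_sub`
brings in the logarithmic derivative of theta and, after normalisation, the rational constants 1/3,
2/5, 1/5.

Theta constants. It remains to show that the accumulated theta quotients and logarithmic derivatives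
equal θ times the claimed combination. Separated by powers of q modulo M, this becomes a few
identities between the numbers j(Q^n; Q^L) and normalised logarithmic derivatives. All follow from
the three-term relation of Weierstrass (`th_weierstrass`) and a four-term relation for logarithmic
derivatives (`thLog_four_term`). `ThetaNet` isolates the rules used, and the `level_twelve` and
`level_twenty` theorems are explicit certificates over them.

The rank differences follow from the deviations for M = 3: their difference has the form X(q³) + q
Y(q³) + q² Z(q³), and a filter by cube roots of unity extracts X, Y and Z. -/

/-- The triangular exponent `n (n - 1) / 2`. -/
def tri (n : ℤ) : ℤ := n * (n - 1) / 2

lemma two_mul_tri (n : ℤ) : 2 * tri n = n * (n - 1) := by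
  have : (2 : ℤ) ∣ n * (n - 1) := by
    rcases Int.even_or_odd n with h | h
    · exact (h.mul_right _).two_dvd
    · exact ((h.sub_odd odd_one).mul_left _).two_dvd
  exact Int.mul_ediv_cancel' this

lemma tri_add (m n : ℤ) : tri (m + n) = tri m + tri n + m * n := by
  have h1 := two_mul_tri (m + n)
  have h2 := two_mul_tri m
  have h3 := two_mul_tri n
  linarith

lemma tri_zero : tri 0 = 0 := rfl

lemma tri_one : tri 1 = 0 := rfl

lemma tri_succ (n : ℤ) : tri (n + 1) = tri n + n := by
  rw [tri_add, tri_one]; ring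

lemma tri_neg (n : ℤ) : tri (-n) = tri n + n := by
  have h1 := two_mul_tri (-n)
  have h2 := two_mul_tri n
  linarith

/-! ### Theta series -/

/-- The general term of the theta series. -/
noncomputable def thTerm (B x : ℂ) (n : ℤ) : ℂ := (-1) ^ n * B ^ tri n * x ^ n

/-- The theta series `∑ (-1)^n B^(n(n-1)/2) x^n`. -/
noncomputable def th (B x : ℂ) : ℂ := ∑' n : ℤ, thTerm B x n

variable {B : ℂ}

lemma thTerm_succ (hB : B ≠ 0) {x : ℂ} (hx : x ≠ 0) (n : ℤ) :
    thTerm B x (n + 1) = -(B ^ n * x) * thTerm B x n := by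
  simp only [thTerm, tri_succ, zpow_add₀ hB, zpow_add_one₀ hx,
    zpow_add_one₀ (show (-1 : ℂ) ≠ 0 by norm_num)]
  ring

lemma thTerm_zero (B x : ℂ) : thTerm B x 0 = 1 := by simp [thTerm, tri_zero]

lemma thTerm_mul (B x c : ℂ) (n : ℤ) : thTerm B (c * x) n = c ^ n * thTerm B x n := by
  simp only [thTerm, mul_zpow]; ring

lemma norm_thTerm (B x : ℂ) (n : ℤ) : ‖thTerm B x n‖ = ‖B‖ ^ tri n * ‖x‖ ^ n := by
  simp [thTerm, norm_zpow]

/-- Consecutive terms have ratio `r ^ n * y`, which tends to zero whatever `y` is; hence theta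
series converge at every nonzero argument. -/
lemma summable_tri_nat {r : ℝ} (hr0 : 0 < r) (hr1 : r < 1) {y : ℝ} (hy : 0 ≤ y) :
    Summable fun n : ℕ => r ^ tri n * y ^ n := by
  rcases hy.eq_or_lt with rfl | hy
  · refine summable_of_ne_finset_zero (s := {0}) fun n hn => ?_
    rw [zero_pow (by simpa using hn), mul_zero]
  refine summable_of_ratio_test_tendsto_lt_one (l := 0) one_pos
    (Eventually.of_forall fun n => by positivity) ?_
  have h : Tendsto (fun n : ℕ => r ^ n * y) atTop (𝓝 (0 * y)) :=
    (tendsto_pow_atTop_nhds_zero_of_lt_one hr0.le hr1).mul_const y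
  rw [zero_mul] at h
  refine h.congr fun n => ?_
  rw [Nat.cast_succ, tri_succ, zpow_add₀ hr0.ne', zpow_natCast, Real.norm_of_nonneg (by positivity),
    Real.norm_of_nonneg (by positivity), pow_succ]
  have : r ^ tri n ≠ 0 := (zpow_pos hr0 _).ne'
  field_simp

/-- A geometric weight costs nothing against a quadratic exponent. `K = 1` gives plain summability,
and `K = 2` dominates the factor `n` in the Euler derivative `thD`. -/
lemma summable_norm_thTerm_mul_pow (hB0 : B ≠ 0) (hB : ‖B‖ < 1) {x : ℂ} (hx : x ≠ 0) {K : ℝ}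
    (hK : 0 ≤ K) : Summable fun n : ℤ => ‖thTerm B x n‖ * K ^ n.natAbs := by
  have hr : 0 < ‖B‖ := norm_pos_iff.2 hB0
  have hy : 0 < ‖x‖ := norm_pos_iff.2 hx
  refine Summable.of_nat_of_neg ?_ ?_
  · refine (summable_tri_nat hr hB (mul_nonneg hy.le hK)).congr fun n => ?_
    rw [norm_thTerm, Int.natAbs_natCast, zpow_natCast, mul_pow]; ring
  · refine (summable_tri_nat hr hB (show 0 ≤ ‖B‖ / ‖x‖ * K by positivity)).congr fun n => ?_
    rw [norm_thTerm, Int.natAbs_neg, Int.natAbs_natCast, tri_neg, zpow_add₀ hr.ne', mul_pow,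
      div_pow, zpow_neg, zpow_natCast, zpow_natCast]
    ring

lemma summable_norm_thTerm (hB0 : B ≠ 0) (hB : ‖B‖ < 1) {x : ℂ} (hx : x ≠ 0) :
    Summable fun n : ℤ => ‖thTerm B x n‖ :=
  (summable_norm_thTerm_mul_pow hB0 hB hx zero_le_one).congr fun n => by simp

lemma summable_thTerm (hB0 : B ≠ 0) (hB : ‖B‖ < 1) {x : ℂ} (hx : x ≠ 0) :
    Summable (thTerm B x) :=
  (summable_norm_thTerm hB0 hB hx).of_norm

lemma hasSum_th (hB0 : B ≠ 0) (hB : ‖B‖ < 1) {x : ℂ} (hx : x ≠ 0) :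
    HasSum (thTerm B x) (th B x) :=
  (summable_thTerm hB0 hB hx).hasSum

/-! ### The Jacobi triple product -/

lemma multipliable_qPoch {q : ℂ} (hq : ‖q‖ < 1) (x : ℂ) :
    Multipliable fun i : ℕ => 1 - q ^ i * x := by
  have h : Summable fun i : ℕ => ‖-(q ^ i * x)‖ := by
    simpa [norm_mul, norm_pow] using
      (summable_geometric_of_lt_one (norm_nonneg q) hq).mul_right ‖x‖
  simpa [sub_eq_add_neg] using multipliable_one_add_of_summable h

lemma qPoch_ne_zero {q : ℂ} (hq : ‖q‖ < 1) {x : ℂ} (hx : ∀ i : ℕ, q ^ i * x ≠ 1) :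
    qPoch x q ≠ 0 := by
  have h : Summable fun i : ℕ => ‖-(q ^ i * x)‖ := by
    simpa [norm_mul, norm_pow] using
      (summable_geometric_of_lt_one (norm_nonneg q) hq).mul_right ‖x‖
  have := tprod_one_add_ne_zero_of_summable (f := fun i : ℕ => -(q ^ i * x))
    (fun i => by rw [← sub_eq_add_neg]; exact sub_ne_zero.2 (hx i).symm) h
  simpa [qPoch, sub_eq_add_neg] using this

lemma tendsto_qPoch {q : ℂ} (hq : ‖q‖ < 1) (x : ℂ) :
    Tendsto (fun n => ∏ i ∈ Finset.range n, (1 - q ^ i * x)) atTop (𝓝 (qPoch x q)) :=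
  (multipliable_qPoch hq x).tendsto_prod_tprod_nat

/-- The finite product `(q; q)_m`. -/
noncomputable def qFac (q : ℂ) (m : ℕ) : ℂ := ∏ i ∈ Finset.range m, (1 - q ^ i * q)

/-- The reciprocal of `(q; q)_m`, extended by zero to negative `m`. -/
noncomputable def invQFac (q : ℂ) (m : ℤ) : ℂ := if 0 ≤ m then (qFac q m.toNat)⁻¹ else 0

lemma pow_mul_self_ne_one {q : ℂ} (hq : ‖q‖ < 1) (i : ℕ) : q ^ i * q ≠ 1 := by
  intro h
  have h2 : ‖q ^ i * q‖ < 1 := by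
    rw [← pow_succ, norm_pow]
    exact pow_lt_one₀ (norm_nonneg _) hq (by simp)
  rw [h, norm_one] at h2
  exact lt_irrefl _ h2

lemma qFac_ne_zero {q : ℂ} (hq : ‖q‖ < 1) (m : ℕ) : qFac q m ≠ 0 :=
  Finset.prod_ne_zero_iff.2 fun i _ => sub_ne_zero.2 (pow_mul_self_ne_one hq i).symm

/-- The extension by zero makes this hold at every integer: at `m = 0` the factor `1 - q ^ 0`
vanishes. The finite triple product can thus be a sum over all of `ℤ` without boundary cases. -/
lemma invQFac_sub_one {q : ℂ} (hq : ‖q‖ < 1) (m : ℤ) :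
    invQFac q (m - 1) = (1 - q ^ m) * invQFac q m := by
  rcases lt_trichotomy m 0 with h | rfl | h
  · simp [invQFac, h.not_ge, show ¬ (1 ≤ m) by omega]
  · simp [invQFac]
  · obtain ⟨k, rfl⟩ : ∃ k : ℕ, m = k + 1 := ⟨(m - 1).toNat, by omega⟩
    have h1 := qFac_ne_zero hq k
    have h2 := qFac_ne_zero hq (k + 1)
    have h3 : qFac q (k + 1) = qFac q k * (1 - q ^ (k + 1)) := by
      rw [qFac, Finset.prod_range_succ, ← qFac, pow_succ]
    simp only [invQFac, add_sub_cancel_right, Int.natCast_nonneg, if_true, Int.toNat_natCast]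
    rw [if_pos (by omega), show ((k : ℤ) + 1).toNat = k + 1 by omega]
    rw [show (q : ℂ) ^ ((k : ℤ) + 1) = q ^ (k + 1) by exact_mod_cast rfl]
    rw [h3] at h2 ⊢
    have h4 := right_ne_zero_of_mul h2
    field_simp

lemma hasSum_int_add {f : ℤ → ℂ} {a : ℂ} (h : HasSum f a) (m : ℤ) :
    HasSum (fun k => f (k + m)) a :=
  (Equiv.addRight m).hasSum_iff.2 h

/-- This is the q-binomial theorem in symmetric form. The two factors added at step `n` multiply to
`1 + q ^ (2n+1) - q ^ n z - q ^ (n+1) / z`, so the new coefficients combine old ones with index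
shifts 0, -1 and 1; comparison is the recurrence of the Gaussian binomials. -/
lemma hasSum_finite_triple_product {q : ℂ} (hq0 : q ≠ 0) (hq : ‖q‖ < 1) {z : ℂ} (hz : z ≠ 0)
    (n : ℕ) :
    HasSum (fun k : ℤ => thTerm q z k * (qFac q (2 * n) * invQFac q (n - k) * invQFac q (n + k)))
      ((∏ i ∈ Finset.range n, (1 - q ^ i * z)) * ∏ i ∈ Finset.range n, (1 - q ^ i * (q / z))) := by
  induction n with
  | zero =>
    convert hasSum_single (f := fun k : ℤ => thTerm q z k *
      (qFac q (2 * 0) * invQFac q ((0 : ℕ) - k) * invQFac q ((0 : ℕ) + k))) 0 ?_ using 1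
    · simp [thTerm_zero, qFac, invQFac]
    · intro k hk
      rcases lt_or_gt_of_ne hk with h | h
      · simp [invQFac, h.not_ge]
      · simp [invQFac, h.not_ge]
  | succ n ih =>
    have h1 := hasSum_int_add ih (-1)
    have h2 := hasSum_int_add ih 1
    simp only [← sub_eq_add_neg] at h1
    have h := ((ih.mul_left (1 + q ^ (2 * n + 1))).sub (h1.mul_left (q ^ n * z))).sub
      (h2.mul_left (q ^ (n + 1) / z))
    have hv : ∀ a b : ℂ, (1 + q ^ (2 * n + 1)) * (a * b) - q ^ n * z * (a * b) -
        q ^ (n + 1) / z * (a * b) = a * (1 - q ^ n * z) * (b * (1 - q ^ n * (q / z))) := fun a b =>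
            by
      field_simp
      ring
    rw [hv] at h
    rw [Finset.prod_range_succ, Finset.prod_range_succ]
    refine (congrArg (HasSum · _) (funext fun k => ?_)).mpr h
    have e1 : thTerm q z k = -(q ^ (k - 1) * z) * thTerm q z (k - 1) := by
      have := thTerm_succ hq0 hz (k - 1)
      rwa [sub_add_cancel] at this
    have e2 := thTerm_succ hq0 hz k
    rw [e2, e1]
    have f1 := invQFac_sub_one hq (n - k + 1)
    have f2 := invQFac_sub_one hq (n - k)
    have f3 := invQFac_sub_one hq (n + k + 1)
    have f4 := invQFac_sub_one hq (n + k)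
    have g : qFac q (2 * (n + 1)) =
        qFac q (2 * n) * (1 - q ^ (2 * n + 1)) * (1 - q ^ (2 * n + 2)) := by
      rw [show 2 * (n + 1) = 2 * n + 1 + 1 by ring, qFac, Finset.prod_range_succ,
        Finset.prod_range_succ, ← qFac]
      ring
    rw [add_sub_cancel_right] at f1 f3
    rw [show ((n : ℤ) - (k - 1)) = n - k + 1 by ring, show ((n : ℤ) + (k - 1)) = n + k - 1 by ring,
      show ((n : ℤ) - (k + 1)) = n - k - 1 by ring, show ((n : ℤ) + (k + 1)) = n + k + 1 by ring,
      Nat.cast_succ, show ((n : ℤ) + 1 - k) = n - k + 1 by ring,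
      show ((n : ℤ) + 1 + k) = n + k + 1 by ring, f2, f4, f1, f3, g]
    have a1 : q ^ ((n : ℤ) - k + 1) = q ^ n * q / q ^ k := by
      rw [zpow_add_one₀ hq0, zpow_sub₀ hq0, zpow_natCast]; ring
    have a2 : q ^ ((n : ℤ) - k) = q ^ n / q ^ k := by rw [zpow_sub₀ hq0, zpow_natCast]
    have a3 : q ^ ((n : ℤ) + k + 1) = q ^ n * q ^ k * q := by
      rw [zpow_add_one₀ hq0, zpow_add₀ hq0, zpow_natCast]
    have a4 : q ^ ((n : ℤ) + k) = q ^ n * q ^ k := by rw [zpow_add₀ hq0, zpow_natCast]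
    rw [a1, a2, a3, a4, zpow_sub_one₀ hq0]
    have hk : q ^ k ≠ 0 := zpow_ne_zero _ hq0
    rw [show q ^ (2 * n + 1) = (q ^ n) ^ 2 * q by ring,
      show q ^ (2 * n + 2) = (q ^ n) ^ 2 * q ^ 2 by ring, pow_succ q n]
    generalize q ^ k = w at hk ⊢
    generalize q ^ n = a
    generalize invQFac q (n - k + 1) = A
    generalize invQFac q (n + k + 1) = A'
    generalize thTerm q z (k - 1) = T
    generalize qFac q (2 * n) = F
    field_simp
    ring

/-- The Jacobi triple product identity. -/
theorem theta_eq_th {q : ℂ} (hq0 : q ≠ 0) (hq : ‖q‖ < 1) {z : ℂ} (hz : z ≠ 0) :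
    theta z q = th q z := by
  have hL : qPoch q q ≠ 0 := qPoch_ne_zero hq (pow_mul_self_ne_one hq)
  have ht : Tendsto (qFac q) atTop (𝓝 (qPoch q q)) := tendsto_qPoch hq q
  have hti : Tendsto (fun m => (qFac q m)⁻¹) atTop (𝓝 (qPoch q q)⁻¹) := ht.inv₀ hL
  obtain ⟨C1, hC1⟩ := ht.norm.bddAbove_range
  obtain ⟨C2, hC2⟩ := hti.norm.bddAbove_range
  have hC1' : ∀ m, ‖qFac q m‖ ≤ C1 := fun m => hC1 ⟨m, rfl⟩
  have hC2' : ∀ m : ℕ, ‖(qFac q m)⁻¹‖ ≤ C2 := fun m => hC2 ⟨m, rfl⟩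
  have hC20 : 0 ≤ C2 := (norm_nonneg _).trans (hC2' 0)
  have hC10 : 0 ≤ C1 := (norm_nonneg _).trans (hC1' 0)
  have hC3 : ∀ m : ℤ, ‖invQFac q m‖ ≤ C2 := fun m => by
    rw [invQFac]; split_ifs
    · exact hC2' _
    · simpa using hC20
  have key : ∀ f : ℕ → ℤ, Tendsto f atTop atTop →
      Tendsto (fun n => invQFac q (f n)) atTop (𝓝 (qPoch q q)⁻¹) := fun f hf => by
    have : Tendsto (fun n => (f n).toNat) atTop atTop :=
      tendsto_atTop.2 fun b => (hf.eventually_ge_atTop (b : ℤ)).mono fun n hn => by omega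
    refine (hti.comp this).congr' ?_
    filter_upwards [hf.eventually_ge_atTop 0] with n hn
    simp [invQFac, hn]
  -- Tannery's argument: the q-factorial coefficient is bounded by `C1 * C2 * C2` uniformly in `n`
  -- and `k` and tends to the reciprocal of `(q; q)_∞` for each `k`.
  have hlim : Tendsto (fun n : ℕ => ∑' k : ℤ, thTerm q z k *
      (qFac q (2 * n) * invQFac q (n - k) * invQFac q (n + k))) atTop
      (𝓝 (∑' k : ℤ, thTerm q z k * (qPoch q q * (qPoch q q)⁻¹ * (qPoch q q)⁻¹))) := by
    refine tendsto_tsum_of_dominated_convergence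
      (bound := fun k => ‖thTerm q z k‖ * (C1 * C2 * C2))
      ((summable_norm_thTerm hq0 hq hz).mul_right _) (fun k => ?_) (Eventually.of_forall fun n k =>
          ?_)
    · refine Tendsto.const_mul _ (Tendsto.mul (Tendsto.mul ?_ ?_) ?_)
      · exact ht.comp (tendsto_id.const_mul_atTop' two_pos)
      · exact key _ (tendsto_atTop_add_const_right _ (-k) tendsto_natCast_atTop_atTop)
      · exact key _ (tendsto_atTop_add_const_right _ k tendsto_natCast_atTop_atTop)
    · rw [norm_mul, norm_mul, norm_mul]
      gcongr
      exacts [hC1' _, hC3 _, hC3 _]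
  have hlim2 := (tendsto_qPoch hq z).mul (tendsto_qPoch hq (q / z))
  have hu := tendsto_nhds_unique hlim
    (hlim2.congr fun n => (hasSum_finite_triple_product hq0 hq hz n).tsum_eq.symm)
  rw [tsum_mul_right] at hu
  rw [theta, ← hu, th]
  field_simp

variable {B : ℂ}

/-! ### Functional equations of the theta series -/

lemma th_base_mul (hB0 : B ≠ 0) (hB : ‖B‖ < 1) {x : ℂ} (hx : x ≠ 0) :
    th B (B * x) = -x⁻¹ * th B x := by
  have h := hasSum_int_add (hasSum_th hB0 hB hx) 1
  refine (hasSum_th hB0 hB (mul_ne_zero hB0 hx)).unique ?_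
  refine (congrArg (HasSum · _) (funext fun k => ?_)).mpr (h.mul_left (-x⁻¹))
  rw [thTerm_succ hB0 hx, thTerm_mul]
  field_simp

lemma th_inv (hB0 : B ≠ 0) (hB : ‖B‖ < 1) {x : ℂ} (hx : x ≠ 0) :
    th B x⁻¹ = -x⁻¹ * th B x := by
  rw [← th_base_mul hB0 hB hx]
  refine (hasSum_th hB0 hB (inv_ne_zero hx)).unique ?_
  refine (congrArg (HasSum · _) (funext fun k => ?_)).mp
    ((Equiv.neg ℤ).hasSum_iff.2 (hasSum_th hB0 hB (mul_ne_zero hB0 hx)))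
  simp only [Function.comp_apply, Equiv.neg_apply, thTerm, tri_neg, mul_zpow, inv_zpow',
      zpow_add₀ hB0]
  rw [zpow_neg (-1 : ℂ), ← inv_zpow, inv_neg_one, zpow_neg B]
  have := zpow_ne_zero k hB0
  field_simp

lemma th_one (hB0 : B ≠ 0) (hB : ‖B‖ < 1) : th B 1 = 0 := by
  have h := th_inv hB0 hB one_ne_zero
  rw [inv_one] at h
  linear_combination h / 2

lemma th_base_div (hB0 : B ≠ 0) (hB : ‖B‖ < 1) {x : ℂ} (hx : x ≠ 0) :
    th B (B / x) = th B x := by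
  rw [div_eq_mul_inv, th_base_mul hB0 hB (inv_ne_zero hx), th_inv hB0 hB hx]
  field_simp

/-- The zeros are visible only on the product side of the triple product: the factors vanish exactly
at integral powers of `B`, the positive powers coming from the Pochhammer symbol in `B / x`. -/
lemma th_ne_zero (hB0 : B ≠ 0) (hB : ‖B‖ < 1) {x : ℂ} (hx : x ≠ 0) (h : ∀ k : ℤ, B ^ k * x ≠ 1) :
    th B x ≠ 0 := by
  rw [← theta_eq_th hB0 hB hx, theta]
  refine mul_ne_zero (mul_ne_zero ?_ ?_) (qPoch_ne_zero hB (pow_mul_self_ne_one hB))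
  · exact qPoch_ne_zero hB fun i => by exact_mod_cast h i
  · refine qPoch_ne_zero hB fun i hi => h (-(i + 1 : ℤ)) ?_
    have h1 : x = B ^ (i + 1) := by
      field_simp at hi
      rw [← hi, pow_succ]
    rw [h1, ← zpow_natCast, ← zpow_add₀ hB0]
    simp

/-! ### The product formula and the three-term relation -/

/-- A pair `(m, n)` is classified by the parity of `m + n`, so that half sum and half difference can
serve as new summation variables. -/
lemma isCompl_range_parity :
    IsCompl (Set.range fun p : ℤ × ℤ => (p.1 + p.2, p.1 - p.2))
      (Set.range fun p : ℤ × ℤ => (p.1 + p.2 + 1, p.1 - p.2)) := by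
  rw [isCompl_iff, disjoint_iff, codisjoint_iff]
  constructor
  · ext ⟨m, n⟩
    simp only [Set.inf_eq_inter, Set.mem_inter_iff, Set.mem_range, Prod.mk.injEq, Prod.exists,
      Set.bot_eq_empty, Set.mem_empty_iff_false, iff_false]
    rintro ⟨⟨a, b, h1, h2⟩, c, d, h3, h4⟩
    omega
  · ext ⟨m, n⟩
    simp only [Set.sup_eq_union, Set.mem_union, Set.mem_range, Prod.mk.injEq, Prod.exists,
      Set.top_eq_univ, Set.mem_univ, iff_true]
    rcases Int.even_or_odd (m + n) with ⟨s, h⟩ | ⟨s, h⟩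
    · exact Or.inl ⟨s, m - s, by omega, by omega⟩
    · exact Or.inr ⟨s, m - s - 1, by omega, by omega⟩

/-- The odd companion in the product formula for two theta series. -/
noncomputable def thOdd (B x : ℂ) : ℂ := x * th (B ^ 2) (-(B * x ^ 2))

/-- The even companion in the product formula for two theta series. -/
noncomputable def thEven (B x : ℂ) : ℂ := th (B ^ 2) (-x ^ 2)

lemma neg_one_zpow_mul_self (n : ℤ) : (-1 : ℂ) ^ n * (-1) ^ n = 1 := by
  rw [← mul_zpow]; simp

/-- The parallelogram law `tri (S + D) + tri (S - D) = 2 tri S + 2 tri D + D` separates the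
variables and replaces the base by its square. -/
lemma thTerm_mul_even (hB0 : B ≠ 0) {x y : ℂ} (hx : x ≠ 0) (hy : y ≠ 0) (S D : ℤ) :
    y * (thTerm B (x * y) (S + D) * thTerm B (x / y) (S - D)) =
      y * (thTerm (B ^ 2) (-x ^ 2) S * thTerm (B ^ 2) (-(B * y ^ 2)) D) := by
  have ht : tri (S + D) + tri (S - D) = 2 * tri S + (2 * tri D + D) := by
    have h1 := two_mul_tri (S + D); have h2 := two_mul_tri (S - D)
    have h3 := two_mul_tri S; have h4 := two_mul_tri D
    linarith
  have hBe : B ^ tri (S + D) * B ^ tri (S - D) = (B ^ 2) ^ tri S * ((B ^ 2) ^ tri D * B ^ D) := by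
    rw [← zpow_add₀ hB0, ht, zpow_add₀ hB0, zpow_add₀ hB0, zpow_mul, zpow_mul]; norm_cast
  have hsgn : (-1 : ℂ) ^ (S + D) * (-1) ^ (S - D) = (-1) ^ S * (-1) ^ S := by
    rw [zpow_add₀ (by norm_num), zpow_sub₀ (by norm_num)]
    have : (-1 : ℂ) ^ D ≠ 0 := zpow_ne_zero _ (by norm_num)
    field_simp
  have hxe : (x * y) ^ (S + D) * (x / y) ^ (S - D) = (x ^ 2) ^ S * (y ^ 2) ^ D := by
    rw [mul_zpow, div_zpow, zpow_add₀ hx, zpow_add₀ hy, zpow_sub₀ hx, zpow_sub₀ hy, pow_two,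
        pow_two,
      mul_zpow, mul_zpow]
    have := zpow_ne_zero D hx; have := zpow_ne_zero D hy; have := zpow_ne_zero S hy
    field_simp
  have hs1 := neg_one_zpow_mul_self S
  have hs2 := neg_one_zpow_mul_self D
  simp only [thTerm]
  rw [neg_eq_neg_one_mul (x ^ 2), neg_eq_neg_one_mul (B * y ^ 2), mul_zpow (-1 : ℂ),
    mul_zpow (-1 : ℂ), mul_zpow B]
  linear_combination y * ((-1 : ℂ) ^ (S + D) * (-1) ^ (S - D)) *
      ((x * y) ^ (S + D) * (x / y) ^ (S - D)) * hBe +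
    y * ((B ^ 2) ^ tri S * ((B ^ 2) ^ tri D * B ^ D)) * ((-1 : ℂ) ^ (S + D) * (-1) ^ (S - D)) * hxe
        +
    y * ((B ^ 2) ^ tri S * ((B ^ 2) ^ tri D * B ^ D)) * ((x ^ 2) ^ S * (y ^ 2) ^ D) * hsgn +
    y * ((B ^ 2) ^ tri S * ((B ^ 2) ^ tri D * B ^ D)) * ((x ^ 2) ^ S * (y ^ 2) ^ D) *
      ((-1) ^ S * (-1) ^ S) * (-hs2)

lemma thTerm_mul_odd (hB0 : B ≠ 0) {x y : ℂ} (hx : x ≠ 0) (hy : y ≠ 0) (S D : ℤ) :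
    y * (thTerm B (x * y) (S + D + 1) * thTerm B (x / y) (S - D)) =
      -x * (thTerm (B ^ 2) (-(B * x ^ 2)) S * thTerm (B ^ 2) (-y ^ 2) (D + 1)) := by
  have hxy := mul_ne_zero hx hy
  have hB20 : B ^ 2 ≠ 0 := pow_ne_zero 2 hB0
  have hy2 : -y ^ 2 ≠ 0 := neg_ne_zero.2 (pow_ne_zero 2 hy)
  rw [thTerm_succ hB0 hxy, thTerm_succ hB20 hy2]
  have h0 : thTerm (B ^ 2) (-(B * x ^ 2)) S = B ^ S * thTerm (B ^ 2) (-x ^ 2) S := by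
    rw [← thTerm_mul]; ring_nf
  have h1 : thTerm (B ^ 2) (-(B * y ^ 2)) D = B ^ D * thTerm (B ^ 2) (-y ^ 2) D := by
    rw [← thTerm_mul]; ring_nf
  have h2 : (B ^ 2) ^ D = B ^ D * B ^ D := by rw [pow_two, mul_zpow]
  have h3 := thTerm_mul_even hB0 hx hy S D
  rw [h1] at h3
  rw [h0, zpow_add₀ hB0, h2]
  linear_combination (-(B ^ S * B ^ D * (x * y))) * h3

lemma hasSum_thTerm_mul {C D u v : ℂ} (hC0 : C ≠ 0) (hC : ‖C‖ < 1) (hD0 : D ≠ 0) (hD : ‖D‖ < 1)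
    (hu : u ≠ 0) (hv : v ≠ 0) :
    HasSum (fun p : ℤ × ℤ => thTerm C u p.1 * thTerm D v p.2) (th C u * th D v) := by
  have hs := summable_mul_of_summable_norm (summable_norm_thTerm hC0 hC hu)
    (summable_norm_thTerm hD0 hD hv)
  have := hs.hasSum
  rwa [← tsum_mul_tsum_of_summable_norm (summable_norm_thTerm hC0 hC hu)
    (summable_norm_thTerm hD0 hD hv)] at this

lemma hasSum_of_parity {f : ℤ × ℤ → ℂ} {a b : ℂ}
    (h0 : HasSum (fun p : ℤ × ℤ => f (p.1 + p.2, p.1 - p.2)) a)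
    (h1 : HasSum (fun p : ℤ × ℤ => f (p.1 + p.2 + 1, p.1 - p.2)) b) : HasSum f (a + b) := by
  refine HasSum.add_isCompl isCompl_range_parity ?_ ?_
  · exact (Function.Injective.hasSum_range_iff (fun p p' hp => by
      simp only [Prod.mk.injEq] at hp; ext <;> omega)).2 h0
  · exact (Function.Injective.hasSum_range_iff (fun p p' hp => by
      simp only [Prod.mk.injEq] at hp; ext <;> omega)).2 h1

lemma hasSum_shift_snd {f : ℤ × ℤ → ℂ} {a : ℂ} (h : HasSum f a) :
    HasSum (fun p : ℤ × ℤ => f (p.1, p.2 + 1)) a :=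
  ((Equiv.refl ℤ).prodCongr (Equiv.addRight (1 : ℤ))).hasSum_iff.2 h

/-- The right side is the two-by-two determinant of the vectors (`thEven`, `thOdd`) at `x` and at
`y`. The three-term relation of Weierstrass is then the Plücker relation between four vectors in a
plane. -/
lemma th_mul_th (hB0 : B ≠ 0) (hB : ‖B‖ < 1) {x y : ℂ} (hx : x ≠ 0) (hy : y ≠ 0) :
    y * (th B (x * y) * th B (x / y)) = thEven B x * thOdd B y - thOdd B x * thEven B y := by
  have hxy := mul_ne_zero hx hy
  have hxy' := div_ne_zero hx hy
  have hB20 : B ^ 2 ≠ 0 := pow_ne_zero 2 hB0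
  have hB2 : ‖B ^ 2‖ < 1 := by rw [norm_pow]; exact pow_lt_one₀ (norm_nonneg _) hB two_ne_zero
  have h := (hasSum_thTerm_mul hB0 hB hB0 hB hxy hxy').mul_left y
  have hx2 : -x ^ 2 ≠ 0 := neg_ne_zero.2 (pow_ne_zero 2 hx)
  have hx3 : -(B * x ^ 2) ≠ 0 := neg_ne_zero.2 (mul_ne_zero hB0 (pow_ne_zero 2 hx))
  have hy2 : -y ^ 2 ≠ 0 := neg_ne_zero.2 (pow_ne_zero 2 hy)
  have hy3 : -(B * y ^ 2) ≠ 0 := neg_ne_zero.2 (mul_ne_zero hB0 (pow_ne_zero 2 hy))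
  have e1 := (hasSum_thTerm_mul hB20 hB2 hB20 hB2 hx2 hy3).mul_left y
  have e2 := (hasSum_shift_snd (hasSum_thTerm_mul hB20 hB2 hB20 hB2 hx3 hy2)).mul_left (-x)
  simp only [← thTerm_mul_even hB0 hx hy] at e1
  simp only [← thTerm_mul_odd hB0 hx hy] at e2
  have hc := h.unique (hasSum_of_parity e1 e2)
  rw [hc, thEven, thEven, thOdd, thOdd]
  ring

/-- The three-term relation of Weierstrass. -/
theorem th_weierstrass (hB0 : B ≠ 0) (hB : ‖B‖ < 1) {x y z w : ℂ} (hx : x ≠ 0) (hy : y ≠ 0)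
    (hz : z ≠ 0) (hw : w ≠ 0) :
    y * w * (th B (x * y) * th B (x / y) * (th B (z * w) * th B (z / w))) -
      z * w * (th B (x * z) * th B (x / z) * (th B (y * w) * th B (y / w))) +
      w * z * (th B (x * w) * th B (x / w) * (th B (y * z) * th B (y / z))) = 0 := by
  have h1 := th_mul_th hB0 hB hx hy
  have h2 := th_mul_th hB0 hB hz hw
  have h3 := th_mul_th hB0 hB hx hz
  have h4 := th_mul_th hB0 hB hy hw
  have h5 := th_mul_th hB0 hB hx hw
  have h6 := th_mul_th hB0 hB hy hz
  have e : ∀ a b c d : ℂ, a * b * (c * d) = (a * c) * (b * d) := fun a b c d => by ring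
  rw [show ∀ a b : ℂ, y * w * (a * b) = (y * a) * (w * b) from fun a b => by ring,
    show ∀ a b : ℂ, z * w * (a * b) = (z * a) * (w * b) from fun a b => by ring,
    show ∀ a b : ℂ, w * z * (a * b) = (w * a) * (z * b) from fun a b => by ring, h1, h2, h3, h4,
        h5, h6]
  ring

variable {B : ℂ}

/-! ### Cauchy products over the integers -/

lemma hasSum_int_cauchy {a b : ℤ → ℂ} (ha : Summable fun n => ‖a n‖) (hb : Summable fun n => ‖b n‖)
    :
    HasSum (fun N => ∑' r, a r * b (N - r)) ((∑' n, a n) * ∑' n, b n) ∧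
      ∀ N, Summable fun r => a r * b (N - r) := by
  have hs := (summable_mul_of_summable_norm ha hb)
  have h := hs.hasSum
  rw [← tsum_mul_tsum_of_summable_norm ha hb] at h
  let e : ℤ × ℤ ≃ ℤ × ℤ :=
    { toFun := fun p => (p.2, p.1 - p.2)
      invFun := fun p => (p.1 + p.2, p.1)
      left_inv := fun p => by ext <;> simp
      right_inv := fun p => by ext <;> simp }
  have h2 : HasSum (fun p : ℤ × ℤ => a p.2 * b (p.1 - p.2)) ((∑' n, a n) * ∑' n, b n) :=
    e.hasSum_iff.2 h
  have h3 : ∀ N, Summable fun r => a r * b (N - r) := fun N => h2.summable.prod_factor N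
  exact ⟨h2.prod_fiberwise fun N => (h3 N).hasSum, h3⟩

/-! ### The bilateral Appell sums -/

/-- The sum `∑ (-1)^r B^(r(r-1)/2) w^r / (1 - B^r p)`; terms with a vanishing denominator are
omitted. -/
noncomputable def apS (B p w : ℂ) : ℂ := ∑' r : ℤ, thTerm B w r / (1 - B ^ r * p)

/-- `B ^ r * p` tends to zero in one direction and to infinity in the other, so the reciprocal is at
most 2 outside a finite window, inside which a finite sum bounds it. A vanishing denominator
contributes zero, hence `p` may be a power of `B`. -/
lemma exists_bound_inv_one_sub (hB0 : B ≠ 0) (hB : ‖B‖ < 1) {p : ℂ} (hp : p ≠ 0) :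
    ∃ C : ℝ, ∀ r : ℤ, ‖(1 - B ^ r * p)⁻¹‖ ≤ C := by
  have hr : 0 < ‖B‖ := norm_pos_iff.2 hB0
  have hpp : 0 < ‖p‖ := norm_pos_iff.2 hp
  have t1 : Tendsto (fun n : ℕ => ‖B‖ ^ n * ‖p‖) atTop (𝓝 (0 * ‖p‖)) :=
    (tendsto_pow_atTop_nhds_zero_of_lt_one hr.le hB).mul_const _
  have t2 : Tendsto (fun n : ℕ => ‖B‖ ^ n * 2) atTop (𝓝 (0 * 2)) :=
    (tendsto_pow_atTop_nhds_zero_of_lt_one hr.le hB).mul_const _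
  rw [zero_mul] at t1 t2
  obtain ⟨R1,
      h1⟩ := eventually_atTop.1 (t1.eventually (gt_mem_nhds (show (0 : ℝ) < 1 / 2 by norm_num)))
  obtain ⟨R2, h2⟩ := eventually_atTop.1 (t2.eventually (gt_mem_nhds hpp))
  refine ⟨2 + ∑ r ∈ Finset.Icc (-(R2 : ℤ)) R1, ‖(1 - B ^ r * p)⁻¹‖, fun r => ?_⟩
  have hs : 0 ≤ ∑ r ∈ Finset.Icc (-(R2 : ℤ)) R1, ‖(1 - B ^ r * p)⁻¹‖ :=
    Finset.sum_nonneg fun _ _ => norm_nonneg _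
  have big : ∀ u : ℂ, (1 : ℝ) / 2 ≤ ‖u‖ → ‖u⁻¹‖ ≤ 2 := fun u hu => by
    rw [norm_inv]
    exact inv_le_of_inv_le₀ two_pos (by simpa using hu)
  by_cases hm : r ∈ Finset.Icc (-(R2 : ℤ)) R1
  · have := Finset.single_le_sum (f := fun r : ℤ => ‖(1 - B ^ r * p)⁻¹‖)
      (fun _ _ => norm_nonneg _) hm
    linarith
  · rw [Finset.mem_Icc, not_and_or, not_le, not_le] at hm
    refine (big _ ?_).trans (by linarith)
    rcases hm with hm | hm
    · obtain ⟨k, rfl⟩ : ∃ k : ℕ, r = -(k : ℤ) := ⟨r.natAbs, by omega⟩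
      have hk := h2 k (by omega)
      have h3 : ‖B ^ (-(k : ℤ)) * p‖ = ‖p‖ / ‖B‖ ^ k := by
        rw [norm_mul, norm_zpow, zpow_neg, zpow_natCast]; ring
      have h4 : 2 < ‖B ^ (-(k : ℤ)) * p‖ := by
        rw [h3, lt_div_iff₀ (by positivity)]; linarith
      have h5 := norm_sub_norm_le (B ^ (-(k : ℤ)) * p) 1
      rw [norm_one, norm_sub_rev] at h5
      linarith
    · obtain ⟨k, rfl⟩ : ∃ k : ℕ, r = k := ⟨r.toNat, by omega⟩
      have hk := h1 k (by omega)
      have h3 : ‖B ^ (k : ℤ) * p‖ = ‖B‖ ^ k * ‖p‖ := by rw [norm_mul, norm_zpow, zpow_natCast]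
      have h5 := norm_sub_norm_le 1 (B ^ (k : ℤ) * p)
      rw [norm_one] at h5
      linarith

lemma summable_norm_apS (hB0 : B ≠ 0) (hB : ‖B‖ < 1) {p w : ℂ} (hp : p ≠ 0) (hw : w ≠ 0) :
    Summable fun r : ℤ => ‖thTerm B w r / (1 - B ^ r * p)‖ := by
  obtain ⟨C, hC⟩ := exists_bound_inv_one_sub hB0 hB hp
  refine Summable.of_nonneg_of_le (fun _ => norm_nonneg _) (fun r => ?_)
    ((summable_norm_thTerm hB0 hB hw).mul_right C)
  rw [div_eq_mul_inv, norm_mul]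
  exact mul_le_mul_of_nonneg_left (hC r) (norm_nonneg _)

lemma hasSum_apS (hB0 : B ≠ 0) (hB : ‖B‖ < 1) {p w : ℂ} (hp : p ≠ 0) (hw : w ≠ 0) :
    HasSum (fun r : ℤ => thTerm B w r / (1 - B ^ r * p)) (apS B p w) :=
  (summable_norm_apS hB0 hB hp hw).of_norm.hasSum

/-- A first-order recurrence with nonzero multiplier has a one-dimensional solution space.
Identities of products of series thereby reduce to a recurrence for their coefficients, up to one
constant. -/
lemma eq_mul_thTerm_of_succ (hB0 : B ≠ 0) {x : ℂ} (hx : x ≠ 0) {f : ℤ → ℂ}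
    (h : ∀ N, f (N + 1) = -(B ^ N * x) * f N) (N : ℤ) : f N = f 0 * thTerm B x N := by
  induction N using Int.induction_on with
  | zero => simp [thTerm_zero]
  | succ i ih => rw [h, ih, thTerm_succ hB0 hx]; ring
  | pred i ih =>
    have h1 := h (-(i : ℤ) - 1)
    have h2 := thTerm_succ hB0 hx (-(i : ℤ) - 1)
    rw [sub_add_cancel] at h1 h2
    have h3 : -(B ^ (-(i : ℤ) - 1) * x) ≠ 0 := neg_ne_zero.2 (mul_ne_zero (zpow_ne_zero _ hB0) hx)
    apply mul_left_cancel₀ h3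
    rw [← h1, ih, h2]
    ring

/-- Coefficient recursion behind the change of variable formulas. -/
lemma cauchy_apS_succ (hB0 : B ≠ 0) (hB : ‖B‖ < 1) {p c w : ℂ} (hp : p ≠ 0) (hc : c ≠ 0)
    (hw : w ≠ 0) (δ : ℤ → ℂ)
    (hδ : ∀ r, B ^ r * p / (1 - B ^ r * p) = 1 / (1 - B ^ r * p) - 1 + δ r)
    (hδs : ∀ N, Summable fun r => δ r * thTerm B w r * thTerm B (c * w) (N - r)) (N : ℤ) :
    ∑' r, thTerm B w r / (1 - B ^ r * p) * thTerm B (c * w) (N + 1 - r) =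
      -(B ^ N * (p * c * w)) * (∑' r, thTerm B w r / (1 - B ^ r * p) * thTerm B (c * w) (N - r)) +
      (∑' r, thTerm B w r * thTerm B (c * w) (N + 1 - r)) -
      ∑' r, δ r * thTerm B w r * thTerm B (c * w) (N + 1 - r) := by
  have hcw := mul_ne_zero hc hw
  have s1 := (hasSum_int_cauchy (summable_norm_apS hB0 hB hp hw) (summable_norm_thTerm hB0 hB
      hcw)).2
  have s2 := (hasSum_int_cauchy (summable_norm_thTerm hB0 hB hw) (summable_norm_thTerm hB0 hB
      hcw)).2
  rw [← tsum_mul_left, ← ((s1 N).mul_left _).tsum_add (s2 (N + 1)),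
    ← (((s1 N).mul_left _).add (s2 (N + 1))).tsum_sub (hδs (N + 1))]
  refine tsum_congr fun r => ?_
  have h1 : thTerm B (c * w) (N + 1 - r) = -(B ^ (N - r) * (c * w)) * thTerm B (c * w) (N - r) := by
    rw [← thTerm_succ hB0 hcw]; ring_nf
  have h2 : B ^ N = B ^ (N - r) * B ^ r := by rw [← zpow_add₀ hB0]; ring_nf
  rw [h1, h2]
  linear_combination (thTerm B w r * B ^ (N - r) * c * w * thTerm B (c * w) (N - r)) * hδ r

lemma cauchy_thTerm_comm (c w : ℂ) (N : ℤ) :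
    ∑' r, thTerm B w r * thTerm B (c * w) (N - r) = ∑' r,
        thTerm B (c * w) r * thTerm B w (N - r) := by
  rw [← (Equiv.subLeft N).tsum_eq]
  refine tsum_congr fun r => ?_
  simp only [Equiv.subLeft_apply, sub_sub_cancel]
  ring

lemma div_one_sub_eq {u : ℂ} (hu : u ≠ 1) : u / (1 - u) = 1 / (1 - u) - 1 + 0 := by
  have : 1 - u ≠ 0 := sub_ne_zero.2 hu.symm
  field_simp
  ring

/-- The coefficients of each Cauchy product satisfy the recurrence of `th B (p * c * w)` with an
inhomogeneous term, namely the coefficient of `th B w * th B (c * w)`. That term is the same for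
both products and drops out of the difference. -/
lemma apS_mul_th_aux (hB0 : B ≠ 0) (hB : ‖B‖ < 1) {p c : ℂ} (hp0 : p ≠ 0) (hc0 : c ≠ 0)
    (hp : ∀ k : ℤ, B ^ k * p ≠ 1) (hpc : ∀ k : ℤ, B ^ k * (p * c) ≠ 1) :
    ∃ l : ℂ, ∀ w : ℂ, w ≠ 0 →
      apS B p w * th B (c * w) - apS B (p * c) (c * w) * th B w = l * th B (p * c * w) := by
  have hpc0 := mul_ne_zero hp0 hc0
  refine ⟨∑' r : ℤ, (thTerm B 1 r / (1 - B ^ r * p) * thTerm B c (0 - r)) -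
    ∑' r : ℤ, thTerm B c r / (1 - B ^ r * (p * c)) * thTerm B 1 (0 - r), fun w hw => ?_⟩
  have hcw := mul_ne_zero hc0 hw
  have h1 := hasSum_int_cauchy (summable_norm_apS hB0 hB hp0 hw) (summable_norm_thTerm hB0 hB hcw)
  have h2 := hasSum_int_cauchy (summable_norm_apS hB0 hB hpc0 hcw) (summable_norm_thTerm hB0 hB hw)
  have h3 := h1.1.sub h2.1
  set f : ℤ → ℂ := fun N => (∑' r, thTerm B w r / (1 - B ^ r * p) * thTerm B (c * w) (N - r)) -
    ∑' r, thTerm B (c * w) r / (1 - B ^ r * (p * c)) * thTerm B w (N - r) with hf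
  have hrec : ∀ N, f (N + 1) = -(B ^ N * (p * c * w)) * f N := by
    intro N
    have e1 := cauchy_apS_succ hB0 hB hp0 hc0 hw (fun _ => 0) (fun r => div_one_sub_eq (hp r))
      (fun N => by simp [summable_zero]) N
    have e2 := cauchy_apS_succ hB0 hB hpc0 (inv_ne_zero hc0) hcw (fun _ => 0)
      (fun r => div_one_sub_eq (hpc r)) (fun N => by simp [summable_zero]) N
    rw [inv_mul_cancel_left₀ hc0, show p * c * c⁻¹ * (c * w) = p * c * w by field_simp] at e2
    have e3 := cauchy_thTerm_comm (B := B) c w (N + 1)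
    simp only [hf]
    rw [e1, e2, e3]
    simp only [zero_mul, tsum_zero]
    ring
  -- In total index zero the powers of `w` cancel. The constant is therefore independent of `w` and
  -- may be found by specialising `w`.
  have h0 : f 0 = ∑' r : ℤ, (thTerm B 1 r / (1 - B ^ r * p) * thTerm B c (0 - r)) -
      ∑' r : ℤ, thTerm B c r / (1 - B ^ r * (p * c)) * thTerm B 1 (0 - r) := by
    have aux : ∀ r : ℤ, w ^ r * w ^ (-r) = 1 := fun r => by
      rw [← zpow_add₀ hw]; simp
    simp only [hf]
    congr 1 <;> refine tsum_congr fun r => ?_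
    · rw [show thTerm B w r = w ^ r * thTerm B 1 r by rw [← thTerm_mul, mul_one], mul_comm c w,
        thTerm_mul, zero_sub]
      linear_combination (thTerm B 1 r / (1 - B ^ r * p) * thTerm B c (-r)) * aux r
    · rw [show thTerm B w (0 - r) = w ^ (0 - r) * thTerm B 1 (0 - r) by rw [← thTerm_mul, mul_one],
        mul_comm c w, thTerm_mul, zero_sub]
      linear_combination (thTerm B c r / (1 - B ^ r * (p * c)) * thTerm B 1 (-r)) * aux r
  rw [← h0]
  have h4 := (hasSum_th hB0 hB (mul_ne_zero hpc0 hw)).mul_left (f 0)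
  refine h3.unique ?_
  refine (congrArg (HasSum · _) (funext fun N => ?_)).mp h4
  exact (eq_mul_thTerm_of_succ hB0 (mul_ne_zero hpc0 hw) hrec N).symm

/-! ### The Appell sum at `w = 1` -/

/-- With `c = p' / p`, the zero `th B 1 = 0` kills one Appell sum at `w = 1` and the other at `w =
c⁻¹`. Both specialisations determine the same constant, and eliminating it shows that the quotient
does not depend on `p`. -/
lemma apS_one_mul_th (hB0 : B ≠ 0) (hB : ‖B‖ < 1) {p p' : ℂ} (hp0 : p ≠ 0) (hp0' : p' ≠ 0)
    (hp : ∀ k : ℤ, B ^ k * p ≠ 1) (hp' : ∀ k : ℤ, B ^ k * p' ≠ 1)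
    (hpp : ∀ k : ℤ, B ^ k * (p' / p) ≠ 1) :
    apS B p 1 * th B p / p = apS B p' 1 * th B p' / p' := by
  have hc0 : p' / p ≠ 0 := div_ne_zero hp0' hp0
  have hc := th_ne_zero hB0 hB hc0 hpp
  have hpc : p * (p' / p) = p' := by field_simp
  obtain ⟨l, hl⟩ := apS_mul_th_aux hB0 hB hp0 hc0 hp (by rwa [hpc])
  have h1 := hl 1 one_ne_zero
  have h2 := hl (p' / p)⁻¹ (inv_ne_zero hc0)
  rw [mul_one, mul_one, hpc, th_one hB0 hB, mul_zero, sub_zero] at h1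
  rw [mul_inv_cancel₀ hc0, hpc, th_one hB0 hB, mul_zero, zero_sub, th_inv hB0 hB hc0,
    show p' * (p' / p)⁻¹ = p by field_simp] at h2
  apply mul_right_cancel₀ hc
  rw [div_mul_eq_mul_div, div_mul_eq_mul_div, div_eq_div_iff hp0 hp0']
  have h3 : apS B p' 1 * th B (p' / p) * p = l * th B p * p' := by
    rw [← h2]; field_simp
  linear_combination (th B p * p') * h1 - th B p' * h3

/-- Near `p = 1` the denominators with `r ≠ 0` stay at least `(1 - ‖B‖) / 2` in absolute value. This
supplies the dominating series for the residue at `p = 1`. -/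
lemma one_sub_mul_bound (hB0 : B ≠ 0) (hB : ‖B‖ < 1) {p : ℂ} (hp : ‖1 - p‖ < (1 - ‖B‖) / 2)
    (r : ℤ) : ‖(1 - p) / (1 - B ^ r * p)‖ ≤ 1 := by
  have hr : 0 < ‖B‖ := norm_pos_iff.2 hB0
  have hp1 := norm_sub_norm_le p 1
  rw [norm_one, norm_sub_rev] at hp1
  have hp2 := norm_sub_norm_le 1 p
  rw [norm_one] at hp2
  rcases lt_trichotomy r 0 with h | rfl | h
  · have e : ‖B‖⁻¹ ≤ ‖B‖ ^ r := by
      rw [← zpow_neg_one]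
      exact zpow_le_zpow_right_of_le_one₀ hr hB.le (by omega)
    have h5 := norm_sub_norm_le (B ^ r * p) 1
    rw [norm_one, norm_sub_rev, norm_mul, norm_zpow] at h5
    have h6 : (1 + ‖B‖) / 2 < ‖p‖ := by linarith
    have h7 : ‖B‖⁻¹ * ((1 + ‖B‖) / 2) ≤ ‖B‖ ^ r * ‖p‖ :=
      mul_le_mul e h6.le (by positivity) (by positivity)
    have h8 : 1 + (1 - ‖B‖) / 2 ≤ ‖B‖⁻¹ * ((1 + ‖B‖) / 2) := by
      rw [← sub_nonneg]
      have : ‖B‖⁻¹ * ((1 + ‖B‖) / 2) - (1 + (1 - ‖B‖) / 2) = (1 - ‖B‖) ^ 2 / (2 * ‖B‖) := by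
        field_simp; ring
      rw [this]; positivity
    rw [norm_div]
    exact div_le_one_of_le₀ (by linarith) (norm_nonneg _)
  · simp only [zpow_zero, one_mul]
    rw [norm_div]
    exact div_self_le_one _
  · have e : ‖B‖ ^ r ≤ ‖B‖ := by
      conv_rhs => rw [← zpow_one ‖B‖]
      exact zpow_le_zpow_right_of_le_one₀ hr hB.le (by omega)
    have h5 := norm_sub_norm_le 1 (B ^ r * p)
    rw [norm_one, norm_mul, norm_zpow] at h5
    have h6 : ‖p‖ < 1 + (1 - ‖B‖) / 2 := by linarith
    have h7 : ‖B‖ ^ r * ‖p‖ ≤ ‖B‖ * (1 + (1 - ‖B‖) / 2) :=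
      mul_le_mul e h6.le (norm_nonneg _) hr.le
    rw [norm_div]
    refine div_le_one_of_le₀ ?_ (norm_nonneg _)
    nlinarith

/-- Only the term `r = 0` has a pole at `p = 1`, and its residue factor is one. -/
lemma tendsto_one_sub_mul_apS (hB0 : B ≠ 0) (hB : ‖B‖ < 1) :
    Tendsto (fun p => (1 - p) * apS B p 1) (𝓝[≠] 1) (𝓝 1) := by
  have h : Tendsto (fun p : ℂ => ∑' r : ℤ, thTerm B 1 r * ((1 - p) / (1 - B ^ r * p))) (𝓝[≠] 1)
      (𝓝 (∑' r : ℤ, thTerm B 1 r * (if r = 0 then 1 else 0))) := by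
    refine tendsto_tsum_of_dominated_convergence (bound := fun r => ‖thTerm B 1 r‖)
      (summable_norm_thTerm hB0 hB one_ne_zero) (fun r => Tendsto.const_mul _ ?_) ?_
    · split_ifs with hr
      · subst hr
        refine tendsto_const_nhds.congr' ?_
        filter_upwards [self_mem_nhdsWithin] with p hp
        rw [zpow_zero, one_mul, div_self (sub_ne_zero.2 (Ne.symm hp))]
      · have hBr : 1 - B ^ r ≠ 0 := by
          intro h0
          have h1 : ‖B‖ ^ r = 1 := by rw [← norm_zpow, ← sub_eq_zero.1 h0, norm_one]
          rw [zpow_eq_one_iff_right₀ (norm_nonneg _) hB.ne] at h1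
          exact hr h1
        have hc : ContinuousAt (fun p : ℂ => (1 - p) / (1 - B ^ r * p)) 1 := by
          refine ContinuousAt.div (by fun_prop) (by fun_prop) ?_
          simpa using hBr
        have := hc.tendsto
        simp only [sub_self, zero_div] at this
        exact this.mono_left nhdsWithin_le_nhds
    · have h0 : Tendsto (fun p : ℂ => ‖1 - p‖) (𝓝 1) (𝓝 0) := by
        have : ContinuousAt (fun p : ℂ => ‖1 - p‖) 1 := by fun_prop
        simpa using this.tendsto
      have := (h0.eventually (gt_mem_nhds (show 0 < (1 - ‖B‖) / 2 by linarith)))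
      filter_upwards [this.filter_mono nhdsWithin_le_nhds] with p hp r
      rw [norm_mul]
      exact mul_le_of_le_one_right (norm_nonneg _) (one_sub_mul_bound hB0 hB hp r)
  have e : ∑' r : ℤ, thTerm B 1 r * (if r = 0 then 1 else 0) = 1 := by
    rw [tsum_eq_single 0 (fun r hr => by simp [hr])]
    simp [thTerm_zero]
  rw [e] at h
  refine h.congr fun p => ?_
  rw [apS, ← tsum_mul_left]
  exact tsum_congr fun r => by ring

/-- Once the factor `1 - p` is split off the product, each of the three remaining Pochhammer symbols
tends to `(B; B)_∞`. -/
lemma tendsto_th_div_one_sub (hB0 : B ≠ 0) (hB : ‖B‖ < 1) :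
    Tendsto (fun p => th B p / (1 - p)) (𝓝[≠] 1) (𝓝 (qPoch B B ^ 3)) := by
  have hcont : ∀ {f : ℂ → ℂ} {a : ℂ}, Tendsto f (𝓝[≠] 1) (𝓝 a) →
      Tendsto (fun p => qPoch (f p) B) (𝓝[≠] 1) (𝓝 (qPoch a B)) := by
    intro f a hf
    have h1 := tendsto_tprod_one_add_of_dominated_convergence (𝓕 := 𝓝[≠] (1 : ℂ))
      (f := fun p (i : ℕ) => -(B ^ i * f p)) (g := fun i => -(B ^ i * a))
      (bound := fun i => ‖B‖ ^ i * (‖a‖ + 1))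
      ((summable_geometric_of_lt_one (norm_nonneg _) hB).mul_right _)
      (fun k => (hf.const_mul _).neg) (by
        filter_upwards [hf.norm.eventually (gt_mem_nhds (lt_add_one ‖a‖))] with p hp k
        rw [norm_neg, norm_mul, norm_pow]
        gcongr)
    simpa [qPoch, sub_eq_add_neg] using h1
  have hid : Tendsto (fun p : ℂ => p) (𝓝[≠] 1) (𝓝 1) := tendsto_id.mono_left nhdsWithin_le_nhds
  have h1 := hcont (hid.const_mul B)
  have h2 := hcont (hid.inv₀ one_ne_zero |>.const_mul B)
  rw [mul_one] at h1
  rw [inv_one, mul_one] at h2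
  have h3 := (h1.mul h2).mul_const (qPoch B B)
  rw [show qPoch B B * qPoch B B * qPoch B B = qPoch B B ^ 3 by ring] at h3
  refine h3.congr' ?_
  have h0 : ∀ᶠ p : ℂ in 𝓝[≠] 1, p ≠ 0 :=
    (eventually_ne_nhds one_ne_zero).filter_mono nhdsWithin_le_nhds
  filter_upwards [self_mem_nhdsWithin, h0] with p hp hp0
  have hp1 : 1 - p ≠ 0 := sub_ne_zero.2 (Ne.symm hp)
  have e : qPoch p B = (1 - p) * qPoch (B * p) B := by
    rw [qPoch, tprod_eq_zero_mul']
    · simp only [pow_zero, one_mul, qPoch, pow_succ, mul_assoc]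
    · simpa only [pow_succ, mul_assoc] using multipliable_qPoch hB (B * p)
  rw [← theta_eq_th hB0 hB hp0, theta, e, div_eq_mul_inv B p]
  field_simp

/-- Partial fractions of the reciprocal of the theta function. -/
theorem apS_one (hB0 : B ≠ 0) (hB : ‖B‖ < 1) {p : ℂ} (hp0 : p ≠ 0) (hp : ∀ k : ℤ, B ^ k * p ≠ 1) :
    apS B p 1 * th B p = p * qPoch B B ^ 3 := by
  -- `apS_one_mul_th` compares `p` only with points outside this set. Being countable, it has dense
  -- complement, so the comparison point can still tend to 1, where residue and simple zero are
  -- known.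
  set s : Set ℂ := (Set.range fun k : ℤ => B ^ k) ∪ (Set.range fun k : ℤ => p * B ^ k) ∪ {0} with hs
  have hsc : s.Countable :=
    ((Set.countable_range _).union (Set.countable_range _)).union (Set.countable_singleton 0)
  have hne : (𝓝[sᶜ] (1 : ℂ)).NeBot :=
    mem_closure_iff_nhdsWithin_neBot.1 (hsc.dense_compl ℂ 1)
  have hle : 𝓝[sᶜ] (1 : ℂ) ≤ 𝓝[≠] 1 := nhdsWithin_mono _ fun x hx h1 => hx (by
    rw [Set.mem_singleton_iff.1 h1]
    exact Or.inl (Or.inl ⟨0, zpow_zero _⟩))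
  have hid : Tendsto (fun p : ℂ => p⁻¹) (𝓝[≠] 1) (𝓝 1⁻¹) :=
    (tendsto_id.mono_left nhdsWithin_le_nhds).inv₀ one_ne_zero
  have h1 := (((tendsto_one_sub_mul_apS hB0 hB).mul (tendsto_th_div_one_sub hB0 hB)).mul
      hid).mono_left hle
  have h2 : Tendsto (fun _ : ℂ => apS B p 1 * th B p / p) (𝓝[sᶜ] 1) (𝓝 (1 * qPoch B B ^ 3 * 1⁻¹))
      := by
    refine h1.congr' ?_
    filter_upwards [self_mem_nhdsWithin, self_mem_nhdsWithin (s := {(1 : ℂ)}ᶜ) |> hle] with x hx hx1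
    have hx1' : 1 - x ≠ 0 := sub_ne_zero.2 (Ne.symm hx1)
    have hx0 : x ≠ 0 := fun h => hx (Or.inr h)
    rw [apS_one_mul_th hB0 hB hp0 hx0 hp (fun k hk => hx (Or.inl (Or.inl ⟨-k, ?_⟩)))
      (fun k hk => hx (Or.inl (Or.inr ⟨-k, ?_⟩)))]
    · field_simp
    · simp only [zpow_neg]; exact inv_eq_of_mul_eq_one_right hk
    · have : B ^ k ≠ 0 := zpow_ne_zero _ hB0
      field_simp at hk
      simp only [zpow_neg]
      rw [← hk]; field_simp
  have h3 := tendsto_nhds_unique tendsto_const_nhds h2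
  rw [div_eq_iff hp0] at h3
  rw [h3]
  simp [mul_comm]

/-- The change of variable formula for Appell sums. -/
theorem apS_mul_th (hB0 : B ≠ 0) (hB : ‖B‖ < 1) {p c w : ℂ} (hp0 : p ≠ 0) (hc0 : c ≠ 0) (hw : w ≠ 0)
    (hp : ∀ k : ℤ, B ^ k * p ≠ 1) (hpc : ∀ k : ℤ, B ^ k * (p * c) ≠ 1) :
    apS B p w * th B (c * w) - apS B (p * c) (c * w) * th B w =
      p * qPoch B B ^ 3 * th B c * th B (p * c * w) / (th B p * th B (p * c)) := by
  obtain ⟨l, hl⟩ := apS_mul_th_aux hB0 hB hp0 hc0 hp hpc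
  -- At `w = 1` the second Appell sum is multiplied by `th B 1 = 0`, and the first is evaluated by
  -- `apS_one`; this determines `l`.
  have h1 := hl 1 one_ne_zero
  rw [mul_one, mul_one, th_one hB0 hB, mul_zero, sub_zero] at h1
  have h2 := apS_one hB0 hB hp0 hp
  have n1 := th_ne_zero hB0 hB hp0 hp
  have n2 := th_ne_zero hB0 hB (mul_ne_zero hp0 hc0) hpc
  rw [hl w hw, eq_div_iff (mul_ne_zero n1 n2)]
  linear_combination (-th B (p * c * w) * th B p) * h1 + (th B (p * c * w) * th B c) * h2

variable {B : ℂ}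

/-! ### The logarithmic derivative of theta and Appell sums at a pole -/

/-- The Euler derivative `∑ n (-1)^n B^(n(n-1)/2) x^n` of the theta series. -/
noncomputable def thD (B x : ℂ) : ℂ := ∑' n : ℤ, n * thTerm B x n

/-- The logarithmic Euler derivative of the theta series. -/
noncomputable def thLog (B x : ℂ) : ℂ := thD B x / th B x

lemma summable_norm_thD (hB0 : B ≠ 0) (hB : ‖B‖ < 1) {x : ℂ} (hx : x ≠ 0) :
    Summable fun n : ℤ => ‖(n : ℂ) * thTerm B x n‖ := by
  refine Summable.of_nonneg_of_le (fun _ => norm_nonneg _) (fun n => ?_)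
    (summable_norm_thTerm_mul_pow hB0 hB hx zero_le_two)
  rw [norm_mul, mul_comm]
  refine mul_le_mul_of_nonneg_left ?_ (norm_nonneg _)
  rw [Complex.norm_intCast, ← Int.cast_abs, Int.abs_eq_natAbs, Int.cast_natCast]
  exact_mod_cast n.natAbs.lt_two_pow_self.le

lemma hasSum_thD (hB0 : B ≠ 0) (hB : ‖B‖ < 1) {x : ℂ} (hx : x ≠ 0) :
    HasSum (fun n : ℤ => n * thTerm B x n) (thD B x) :=
  (summable_norm_thD hB0 hB hx).of_norm.hasSum

lemma thD_base_mul (hB0 : B ≠ 0) (hB : ‖B‖ < 1) {x : ℂ} (hx : x ≠ 0) :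
    thD B (B * x) = -x⁻¹ * (thD B x - th B x) := by
  have h := (hasSum_int_add (hasSum_thD hB0 hB hx) 1).sub (hasSum_int_add (hasSum_th hB0 hB hx) 1)
  refine (hasSum_thD hB0 hB (mul_ne_zero hB0 hx)).unique ?_
  refine (congrArg (HasSum · _) (funext fun k => ?_)).mpr (h.mul_left (-x⁻¹))
  rw [thTerm_succ hB0 hx, thTerm_mul]
  push_cast
  field_simp
  ring

lemma thD_inv (hB0 : B ≠ 0) (hB : ‖B‖ < 1) {x : ℂ} (hx : x ≠ 0) :
    thD B x⁻¹ = x⁻¹ * (thD B x - th B x) := by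
  have h1 := thD_base_mul hB0 hB hx
  have h2 : thD B x⁻¹ = -thD B (B * x) := by
    refine (hasSum_thD hB0 hB (inv_ne_zero hx)).unique ?_
    refine (congrArg (HasSum · _) (funext fun k => ?_)).mp
      ((Equiv.neg ℤ).hasSum_iff.2 (hasSum_thD hB0 hB (mul_ne_zero hB0 hx)).neg)
    simp only [Function.comp_apply, Equiv.neg_apply, thTerm, tri_neg, mul_zpow, inv_zpow',
      zpow_add₀ hB0]
    rw [zpow_neg (-1 : ℂ), ← inv_zpow, inv_neg_one, zpow_neg B]
    have := zpow_ne_zero k hB0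
    push_cast
    field_simp
  rw [h2, h1]; ring

lemma thLog_base_mul (hB0 : B ≠ 0) (hB : ‖B‖ < 1) {x : ℂ} (hx : x ≠ 0) (h : th B x ≠ 0) :
    thLog B (B * x) = thLog B x - 1 := by
  rw [thLog, thLog, thD_base_mul hB0 hB hx, th_base_mul hB0 hB hx]
  field_simp

lemma thLog_inv (hB0 : B ≠ 0) (hB : ‖B‖ < 1) {x : ℂ} (hx : x ≠ 0) (h : th B x ≠ 0) :
    thLog B x⁻¹ = 1 - thLog B x := by
  rw [thLog, thLog, thD_inv hB0 hB hx, th_inv hB0 hB hx]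
  field_simp
  ring

lemma base_zpow_ne_one (hB : ‖B‖ < 1) {r : ℤ} (hr : r ≠ 0) : B ^ r ≠ 1 := by
  intro h0
  have h1 : ‖B‖ ^ r = 1 := by rw [← norm_zpow, h0, norm_one]
  rw [zpow_eq_one_iff_right₀ (norm_nonneg _) hB.ne] at h1
  exact hr h1

/-- For `r ≠ 0` the terms at `r` and `-r` add up to `thTerm B 1 r * (1 + B ^ r)`, and `th B 1 + th B
B = 0`. Only the correction `-2` at the omitted index `r = 0` survives, and it is halved. -/
lemma apS_one_one (hB0 : B ≠ 0) (hB : ‖B‖ < 1) : apS B 1 1 = -1 := by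
  have h := hasSum_apS hB0 hB one_ne_zero one_ne_zero
  have h1 := h.add ((Equiv.neg ℤ).hasSum_iff.2 h)
  have h2 : HasSum (fun r : ℤ => (thTerm B 1 r + thTerm B (B * 1) r) - if r = 0 then 2 else 0)
      (th B 1 + th B (B * 1) - 2) :=
    ((hasSum_th hB0 hB one_ne_zero).add (hasSum_th hB0 hB (mul_ne_zero hB0 one_ne_zero))).sub
      (hasSum_ite_eq 0 2)
  rw [th_base_mul hB0 hB one_ne_zero, th_one hB0 hB] at h2
  have h3 := h1.unique ((congrArg (HasSum · _) (funext fun r => ?_)).mp h2)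
  · linear_combination h3 / 2
  · simp only [Function.comp_apply, Equiv.neg_apply]
    rcases eq_or_ne r 0 with rfl | hr
    · norm_num [thTerm_zero]
    · have hBr := sub_ne_zero.2 (base_zpow_ne_one hB hr).symm
      have hBr' := sub_ne_zero.2 (base_zpow_ne_one hB hr)
      have hz := zpow_ne_zero r hB0
      have e : thTerm B 1 (-r) = thTerm B 1 r * B ^ r := by
        simp only [thTerm, tri_neg, one_zpow, zpow_add₀ hB0]
        rw [zpow_neg (-1 : ℂ), ← inv_zpow, inv_neg_one]
        ring
      rw [e, thTerm_mul, zpow_neg, if_neg hr, mul_one, mul_one]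
      have e2 : 1 - (B ^ r)⁻¹ = -(1 - B ^ r) / B ^ r := by field_simp; ring
      rw [e2]
      field_simp
      ring

/-- The change of variable formula for the Appell sum with its polar term omitted. -/
theorem apS_one_mul_th_sub (hB0 : B ≠ 0) (hB : ‖B‖ < 1) {c w : ℂ} (hc0 : c ≠ 0) (hw : w ≠ 0)
    (hc : ∀ k : ℤ, B ^ k * c ≠ 1) :
    apS B 1 w * th B (c * w) - apS B c (c * w) * th B w =
      -thD B (c * w) + (thLog B c - 1) * th B (c * w) := by
  -- As in `apS_mul_th_aux`, the identity is first proved up to a constant; at `w = 1` the value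
  -- `apS B 1 1 = -1` fixes it as `thLog B c - 1`.
  suffices H : ∃ l : ℂ, ∀ w : ℂ, w ≠ 0 →
      apS B 1 w * th B (c * w) - apS B c (c * w) * th B w + thD B (c * w) = l * th B (c * w) by
    obtain ⟨l, hl⟩ := H
    have h1 := hl 1 one_ne_zero
    rw [mul_one, th_one hB0 hB, apS_one_one hB0 hB, mul_zero, sub_zero] at h1
    have h2 : thLog B c * th B c = thD B c := div_mul_cancel₀ _ (th_ne_zero hB0 hB hc0 hc)
    have h3 : l = thLog B c - 1 := by
      apply mul_right_cancel₀ (th_ne_zero hB0 hB hc0 hc)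
      linear_combination -h1 - h2
    rw [← h3]
    linear_combination hl w hw
  refine ⟨∑' r : ℤ, (thTerm B 1 r / (1 - B ^ r * 1) * thTerm B c (0 - r)) -
    ∑' r : ℤ, thTerm B c r / (1 - B ^ r * c) * thTerm B 1 (0 - r), fun w hw => ?_⟩
  have hcw := mul_ne_zero hc0 hw
  have h1 := hasSum_int_cauchy (summable_norm_apS hB0 hB one_ne_zero hw) (summable_norm_thTerm hB0
      hB hcw)
  have h2 := hasSum_int_cauchy (summable_norm_apS hB0 hB hc0 hcw) (summable_norm_thTerm hB0 hB hw)
  have h3 := (h1.1.sub h2.1).add (hasSum_thD hB0 hB hcw)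
  -- The summand `N * thTerm B (c * w) N` compensates the inhomogeneity produced by the omitted pole
  -- and restores a homogeneous recurrence.
  set f : ℤ → ℂ := fun N => (∑' r, thTerm B w r / (1 - B ^ r * 1) * thTerm B (c * w) (N - r)) -
    (∑' r, thTerm B (c * w) r / (1 - B ^ r * c) * thTerm B w (N - r)) + N * thTerm B (c * w) N with
        hf
  have hrec : ∀ N, f (N + 1) = -(B ^ N * (c * w)) * f N := by
    intro N
    have hd : ∀ N : ℤ, HasSum (fun r : ℤ => (if r = 0 then 1 else 0) * thTerm B w r *
        thTerm B (c * w) (N - r)) (thTerm B (c * w) N) := fun N => by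
      convert hasSum_single (f := fun r : ℤ => (if r = 0 then 1 else 0) * thTerm B w r *
        thTerm B (c * w) (N - r)) 0 (fun r hr => by simp [hr]) using 1
      simp [thTerm_zero]
    -- At `r = 0` the denominator is zero and `1 / 0 = 0`, so the geometric relation `u / (1 - u) =
    -- 1 / (1 - u) - 1` fails there by exactly 1; this is the defect `δ`.
    have e1 := cauchy_apS_succ hB0 hB one_ne_zero hc0 hw (fun r => if r = 0 then 1 else 0) (fun r
        => by
      rcases eq_or_ne r 0 with rfl | hr
      · simp
      · rw [if_neg hr]
        exact div_one_sub_eq (by rw [mul_one]; exact base_zpow_ne_one hB hr))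
      (fun N => (hd N).summable) N
    have e2 := cauchy_apS_succ hB0 hB hc0 (inv_ne_zero hc0) hcw (fun _ => 0)
      (fun r => div_one_sub_eq (hc r)) (fun N => by simp [summable_zero]) N
    rw [inv_mul_cancel_left₀ hc0, show c * c⁻¹ * (c * w) = c * w by field_simp] at e2
    have e3 := cauchy_thTerm_comm (B := B) c w (N + 1)
    have e4 := thTerm_succ hB0 hcw N
    rw [(hd (N + 1)).tsum_eq] at e1
    simp only [hf]
    rw [e1, e2, e3, e4]
    simp only [zero_mul, tsum_zero]
    push_cast
    ring
  have h0 : f 0 = ∑' r : ℤ, (thTerm B 1 r / (1 - B ^ r * 1) * thTerm B c (0 - r)) -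
      ∑' r : ℤ, thTerm B c r / (1 - B ^ r * c) * thTerm B 1 (0 - r) := by
    have aux : ∀ r : ℤ, w ^ r * w ^ (-r) = 1 := fun r => by
      rw [← zpow_add₀ hw]; simp
    simp only [hf, Int.cast_zero, zero_mul, add_zero]
    congr 1 <;> refine tsum_congr fun r => ?_
    · rw [show thTerm B w r = w ^ r * thTerm B 1 r by rw [← thTerm_mul, mul_one], mul_comm c w,
        thTerm_mul, zero_sub]
      linear_combination (thTerm B 1 r / (1 - B ^ r * 1) * thTerm B c (-r)) * aux r
    · rw [show thTerm B w (0 - r) = w ^ (0 - r) * thTerm B 1 (0 - r) by rw [← thTerm_mul, mul_one],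
        mul_comm c w, thTerm_mul, zero_sub]
      linear_combination (thTerm B c r / (1 - B ^ r * c) * thTerm B 1 (-r)) * aux r
  rw [← h0]
  have h4 := (hasSum_th hB0 hB hcw).mul_left (f 0)
  refine h3.unique ?_
  refine (congrArg (HasSum · _) (funext fun N => ?_)).mp h4
  exact (eq_mul_thTerm_of_succ hB0 hcw hrec N).symm

/-- The four-term relation for the logarithmic derivative of theta. -/
theorem thLog_four_term (hB0 : B ≠ 0) (hB : ‖B‖ < 1) {c d w : ℂ} (hc0 : c ≠ 0) (hd0 : d ≠ 0)
    (hw : w ≠ 0) (hc : ∀ k : ℤ, B ^ k * c ≠ 1) (hd : ∀ k : ℤ, B ^ k * d ≠ 1)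
    (hcw : ∀ k : ℤ, B ^ k * (c * w) ≠ 1) (hdw : ∀ k : ℤ, B ^ k * (d * w) ≠ 1) :
    thLog B c - thLog B d + thLog B (d * w) - thLog B (c * w) =
      -(c * qPoch B B ^ 3 * th B w * th B (d / c) * th B (c * d * w)) /
        (th B c * th B d * th B (c * w) * th B (d * w)) := by
  have n1 := th_ne_zero hB0 hB hc0 hc
  have n2 := th_ne_zero hB0 hB hd0 hd
  have n3 := th_ne_zero hB0 hB (mul_ne_zero hc0 hw) hcw
  have n4 := th_ne_zero hB0 hB (mul_ne_zero hd0 hw) hdw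
  -- The sum `apS B 1 w` is expressed once through `c` and once through `d`. The two resulting sums
  -- are related by `apS_mul_th`, so every Appell sum cancels and only logarithmic derivatives and
  -- one theta quotient remain.
  have h1 := apS_one_mul_th_sub hB0 hB hc0 hw hc
  have h2 := apS_one_mul_th_sub hB0 hB hd0 hw hd
  have e1 : c * (d / c) = d := by field_simp
  have h3 := apS_mul_th hB0 hB hc0 (div_ne_zero hd0 hc0) (mul_ne_zero hc0 hw) hc (by rwa [e1])
  rw [e1, show d / c * (c * w) = d * w by field_simp, show d * (c * w) = c * d * w by ring,
    eq_div_iff (mul_ne_zero n1 n2)] at h3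
  have g1 : thLog B (c * w) * th B (c * w) = thD B (c * w) := div_mul_cancel₀ _ n3
  have g2 : thLog B (d * w) * th B (d * w) = thD B (d * w) := div_mul_cancel₀ _ n4
  rw [eq_div_iff (mul_ne_zero (mul_ne_zero (mul_ne_zero n1 n2) n3) n4)]
  linear_combination (-th B c * th B d * th B (d * w)) * h1 + (th B c * th B d * th B (c * w)) * h2
      -
    th B w * h3 - (th B c * th B d * th B (d * w)) * g1 + (th B c * th B d * th B (c * w)) * g2

/-! ### Functional equations of the Appell sums -/

/-- Shifting the index leaves one numerator factor `B ^ r * p`, which is written as 1 minus the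
denominator. The resulting theta term is the source of the integer constants in the formulas for `M
= 5`. -/
lemma apS_base_mul_left (hB0 : B ≠ 0) (hB : ‖B‖ < 1) {p w : ℂ} (hp0 : p ≠ 0) (hw : w ≠ 0)
    (hp : ∀ k : ℤ, B ^ k * p ≠ 1) : apS B (B * p) w = th B w - B * p / w * apS B p w := by
  have h := ((hasSum_int_add (hasSum_th hB0 hB hw) (-1)).sub
    ((hasSum_int_add (hasSum_apS hB0 hB (mul_ne_zero hB0 hp0) hw) (-1))))
  have h2 := (hasSum_apS hB0 hB hp0 hw).mul_left (B * p / w)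
  have := h.unique ((congrArg (HasSum · _) (funext fun r => ?_)).mp h2)
  · linear_combination -this
  · have e := thTerm_succ hB0 hw (r + -1)
    rw [neg_add_cancel_right] at e
    have hr : B ^ r = B ^ (r + -1) * B := by rw [← zpow_add_one₀ hB0]; simp
    have hd := sub_ne_zero.2 (hp r).symm
    rw [e, show B ^ (r + -1) * (B * p) = B ^ r * p by rw [hr]; ring]
    rw [hr] at hd ⊢
    generalize B ^ (r + -1) = z at hd ⊢
    generalize thTerm B w (r + -1) = T
    rw [show z * B * p = B * p * z by ring] at hd ⊢
    field_simp
    ring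

lemma apS_base_mul_right (hB0 : B ≠ 0) (hB : ‖B‖ < 1) {p w : ℂ} (hp0 : p ≠ 0) (hw : w ≠ 0) :
    apS B (B * p) (B * w) = -w⁻¹ * apS B p w := by
  have h := (hasSum_int_add (hasSum_apS hB0 hB hp0 hw) 1).mul_left (-w⁻¹)
  refine (hasSum_apS hB0 hB (mul_ne_zero hB0 hp0) (mul_ne_zero hB0 hw)).unique ?_
  refine (congrArg (HasSum · _) (funext fun r => ?_)).mp h
  rw [thTerm_succ hB0 hw, thTerm_mul, zpow_add_one₀ hB0, mul_assoc (B ^ r) B p]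
  field_simp

lemma apS_inv (hB0 : B ≠ 0) (hB : ‖B‖ < 1) {p w : ℂ} (hp0 : p ≠ 0) (hw : w ≠ 0) :
    apS B p w = -p⁻¹ * apS B p⁻¹ (B ^ 2 / w) := by
  have hBw : B ^ 2 / w ≠ 0 := div_ne_zero (pow_ne_zero 2 hB0) hw
  have h := ((Equiv.neg ℤ).hasSum_iff.2 (hasSum_apS hB0 hB hp0 hw))
  refine h.unique ?_
  refine (congrArg (HasSum · _) (funext fun r => ?_)).mp
    ((hasSum_apS hB0 hB (inv_ne_zero hp0) hBw).mul_left (-p⁻¹))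
  simp only [Function.comp_apply, Equiv.neg_apply]
  have hz := zpow_ne_zero r hB0
  have e : thTerm B w (-r) = thTerm B (B ^ 2 / w) r * (B ^ r)⁻¹ := by
    simp only [thTerm, tri_neg, zpow_add₀ hB0, div_zpow, pow_two, mul_zpow]
    rw [zpow_neg (-1 : ℂ), ← inv_zpow, inv_neg_one, zpow_neg w]
    field_simp
  rw [e, zpow_neg]
  have e2 : 1 - (B ^ r)⁻¹ * p = -(p * (B ^ r)⁻¹) * (1 - B ^ r * p⁻¹) := by
    field_simp; ring
  rw [e2]
  simp only [div_eq_mul_inv, mul_inv, neg_mul, inv_neg, inv_inv]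
  generalize (1 - B ^ r * p⁻¹)⁻¹ = d
  field_simp


/-! ### Theta constants at powers of the nome -/

/-- The relations satisfied by `t n = j(Q^n; Q^L)` and by the normalised logarithmic derivatives
`ε n` at the same points. -/
structure ThetaNet (L : ℕ) (Q κ : ℂ) (t ε : ℤ → ℂ) : Prop where
  base_ne : Q ≠ 0
  ne : ∀ n : ℤ, ¬ (L : ℤ) ∣ n → t n ≠ 0
  refl : ∀ n, t (L - n) = t n
  neg : ∀ n, t (-n) = -(Q ^ n)⁻¹ * t n
  three : ∀ a b c d e : ℤ, Q ^ (b - c) * (t (a + b + e) * t (a - b) * (t (c + d + e) * t (c - d))) -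
    t (a + c + e) * t (a - c) * (t (b + d + e) * t (b - d)) +
    t (a + d + e) * t (a - d) * (t (b + c + e) * t (b - c)) = 0
  log_neg : ∀ n : ℤ, ¬ (L : ℤ) ∣ n → ε (-n) = -ε n
  log_refl : ∀ n : ℤ, ¬ (L : ℤ) ∣ n → ε (L - n) = -ε n
  four : ∀ a b c : ℤ, ¬ (L : ℤ) ∣ a → ¬ (L : ℤ) ∣ b → ¬ (L : ℤ) ∣ c → ¬ (L : ℤ) ∣ a + b + c →
    ε a + ε b + ε c - ε (a + b + c) =
      -κ * (t (a + b) * t (b + c) * t (a + c) / (t a * t b * t c * t (a + b + c)))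

/-- The theta constant `j(Q^n; Q^L)`. -/
noncomputable def tc (L : ℕ) (Q : ℂ) (n : ℤ) : ℂ := th (Q ^ L) (Q ^ n)

/-- The normalised logarithmic derivative of theta at `Q^n`. -/
noncomputable def lc (L : ℕ) (Q : ℂ) (n : ℤ) : ℂ := thLog (Q ^ L) (Q ^ n) + n / L - 1 / 2

/-- The Appell sum with arguments `Q^p` and `Q^w`. -/
noncomputable def ac (L : ℕ) (Q : ℂ) (p w : ℤ) : ℂ := apS (Q ^ L) (Q ^ p) (Q ^ w)

section
variable {L : ℕ} {Q : ℂ}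

lemma base_pow_mul_ne_one (hQ : ‖Q‖ < 1) {n : ℤ} (hn : ¬ (L : ℤ) ∣ n) (hQ0 : Q ≠ 0) (k : ℤ) :
    (Q ^ L) ^ k * Q ^ n ≠ 1 := by
  rw [← zpow_natCast, ← zpow_mul, ← zpow_add₀ hQ0]
  refine base_zpow_ne_one hQ fun h => hn ⟨-k, ?_⟩
  linear_combination h

lemma base_pow_norm_lt (hQ : ‖Q‖ < 1) (hL : L ≠ 0) : ‖Q ^ L‖ < 1 := by
  rw [norm_pow]; exact pow_lt_one₀ (norm_nonneg _) hQ hL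

/-- The summands `n / L - 1 / 2` in `lc` absorb the additive terms in `thLog_inv` and
`thLog_base_mul`. The normalised logarithmic derivative is odd and, off the multiples of `L`,
invariant under `n ↦ n + L`, which makes the four-term relation homogeneous. -/
theorem thetaNet (hQ0 : Q ≠ 0) (hQ : ‖Q‖ < 1) (hL : L ≠ 0) :
    ThetaNet L Q (qPoch (Q ^ L) (Q ^ L) ^ 3) (tc L Q) (lc L Q) := by
  have hB0 : Q ^ L ≠ 0 := pow_ne_zero _ hQ0
  have hB := base_pow_norm_lt hQ hL
  have hz : ∀ n : ℤ, Q ^ n ≠ 0 := fun n => zpow_ne_zero _ hQ0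
  have hne : ∀ n : ℤ, ¬ (L : ℤ) ∣ n → tc L Q n ≠ 0 := fun n hn =>
    th_ne_zero hB0 hB (hz n) (base_pow_mul_ne_one hQ hn hQ0)
  have hneg : ∀ n, tc L Q (-n) = -(Q ^ n)⁻¹ * tc L Q n := fun n => by
    rw [tc, zpow_neg, th_inv hB0 hB (hz n), tc]
  have hbm : ∀ n : ℤ, Q ^ ((L : ℤ) + n) = Q ^ L * Q ^ n := fun n => by
    rw [zpow_add₀ hQ0, zpow_natCast]
  have hL' : (L : ℂ) ≠ 0 := Nat.cast_ne_zero.2 hL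
  have hlneg : ∀ n : ℤ, ¬ (L : ℤ) ∣ n → lc L Q (-n) = -lc L Q n := fun n hn => by
    rw [lc, lc, zpow_neg, thLog_inv hB0 hB (hz n) (hne n hn)]
    push_cast
    ring
  refine ⟨hQ0, hne, fun n => ?_, hneg, fun a b c d e => ?_, hlneg, fun n hn => ?_,
    fun a b c ha hb hc habc => ?_⟩
  · rw [tc, zpow_sub₀ hQ0, zpow_natCast, th_base_div hB0 hB (hz n), tc]
  · obtain ⟨s, hs⟩ := IsAlgClosed.exists_pow_nat_eq Q (n := 2) two_pos
    have hs0 : s ≠ 0 := by rintro rfl; exact hQ0 (by rw [← hs]; simp)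
    have hx : ∀ a : ℤ, Q ^ a * s ^ e ≠ 0 := fun a => mul_ne_zero (hz a) (zpow_ne_zero _ hs0)
    have h := th_weierstrass hB0 hB (hx a) (hx b) (hx c) (hx d)
    have hse : s ^ e * s ^ e = Q ^ e := by rw [← mul_zpow, ← pow_two, hs]
    have e1 : ∀ a b : ℤ, Q ^ a * s ^ e * (Q ^ b * s ^ e) = Q ^ (a + b + e) := fun a b => by
      rw [zpow_add₀ hQ0, zpow_add₀ hQ0, ← hse]; ring
    have e2 : ∀ a b : ℤ, Q ^ a * s ^ e / (Q ^ b * s ^ e) = Q ^ (a - b) := fun a b => by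
      rw [mul_div_mul_right _ _ (zpow_ne_zero _ hs0), zpow_sub₀ hQ0]
    simp only [e1, e2] at h
    simp only [tc]
    -- The prefactors in Weierstrass' relation are powers of `Q`. Division by the common one leaves
    -- the single weight `Q ^ (b - c)`.
    apply mul_left_cancel₀ (hz (c + d + e))
    rw [mul_zero, ← h, show d + c + e = c + d + e by ring,
        show b + d + e = b - c + (c + d + e) by ring,
      zpow_add₀ hQ0 (b - c)]
    ring
  · rw [sub_eq_add_neg, lc, hbm, thLog_base_mul hB0 hB (hz _) (by
      have := hne (-n) (by rwa [dvd_neg]); rwa [tc] at this)]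
    have := hlneg n hn
    rw [← this, lc]
    push_cast
    field_simp
    ring
  · have hnb : ¬ (L : ℤ) ∣ -b := by rwa [dvd_neg]
    -- The choice `c = Q ^ a`, `d = Q ^ (-b)`, `w = Q ^ (b + c)` makes the relation symmetric in the
    -- three exponents.
    have h := thLog_four_term hB0 hB (hz a) (hz (-b)) (hz (b + c)) (base_pow_mul_ne_one hQ ha hQ0)
      (base_pow_mul_ne_one hQ hnb hQ0)
      (by rw [← zpow_add₀ hQ0, ← add_assoc]; exact base_pow_mul_ne_one hQ habc hQ0)
      (by rw [← zpow_add₀ hQ0, neg_add_cancel_left]; exact base_pow_mul_ne_one hQ hc hQ0)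
    rw [← zpow_add₀ hQ0, ← zpow_add₀ hQ0, ← zpow_add₀ hQ0, ← zpow_sub₀ hQ0, neg_add_cancel_left,
      ← zpow_add₀ hQ0, show -b - a = -(a + b) by ring, show a + -b + (b + c) = a + c by ring,
      ← add_assoc a b c] at h
    have h1 := hlneg b hb
    have h2 := hneg b
    have h3 := hneg (a + b)
    have n1 := hne a ha
    have n2 := hne b hb
    have n3 := hne c hc
    have n4 := hne _ habc
    rw [zpow_add₀ hQ0 a b] at h3
    simp only [tc] at h2 h3 n1 n2 n3 n4 ⊢
    rw [h2, h3] at h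
    simp only [lc] at h1 ⊢
    push_cast at h1 ⊢
    have hza := hz a
    have hzb := hz b
    have key : thLog (Q ^ L) (Q ^ a) - thLog (Q ^ L) (Q ^ (-b)) + thLog (Q ^ L) (Q ^ c) -
        thLog (Q ^ L) (Q ^ (a + b + c)) = -qPoch (Q ^ L) (Q ^ L) ^ 3 * (th (Q ^ L) (Q ^ (a + b)) *
        th (Q ^ L) (Q ^ (b + c)) * th (Q ^ L) (Q ^ (a + c)) / (th (Q ^ L) (Q ^ a) * th (Q ^ L) (Q ^
            b) *
        th (Q ^ L) (Q ^ c) * th (Q ^ L) (Q ^ (a + b + c)))) := by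
      rw [h]
      field_simp
    rw [← key]
    linear_combination h1

/-- This is `apS_mul_th` with multiplier `Q ^ (z - w)`. The difference of the two exponents is
invariant, `r - z = p - w`, which decides what sums can be moved to the same target. -/
lemma ac_shift (hQ0 : Q ≠ 0) (hQ : ‖Q‖ < 1) (hL : L ≠ 0) {p w z r : ℤ} (hr : r = p + z - w)
    (hp : ¬ (L : ℤ) ∣ p) (hpz : ¬ (L : ℤ) ∣ r) (hz : ¬ (L : ℤ) ∣ z) :
    ac L Q p w = tc L Q w * (ac L Q r z / tc L Q z) + Q ^ p * qPoch (Q ^ L) (Q ^ L) ^ 3 *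
      (tc L Q (z - w) * tc L Q (p + z) / (tc L Q p * tc L Q r * tc L Q z)) := by
  have hB0 : Q ^ L ≠ 0 := pow_ne_zero _ hQ0
  have hB := base_pow_norm_lt hQ hL
  have hne := (thetaNet hQ0 hQ hL).ne
  have hq : ∀ n : ℤ, Q ^ n ≠ 0 := fun n => zpow_ne_zero _ hQ0
  have h := apS_mul_th hB0 hB (hq p) (hq (z - w)) (hq w) (base_pow_mul_ne_one hQ hp hQ0)
    (by rw [← zpow_add₀ hQ0, ← add_sub_assoc, ← hr]; exact base_pow_mul_ne_one hQ hpz hQ0)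
  rw [← zpow_add₀ hQ0, ← zpow_add₀ hQ0, ← zpow_add₀ hQ0, ← add_sub_assoc, ← hr, sub_add_cancel,
    show r + w = p + z by rw [hr]; ring] at h
  have n1 := hne p hp
  have n2 := hne r hpz
  have n3 := hne z hz
  simp only [tc, ac] at n1 n2 n3 ⊢
  rw [sub_eq_iff_eq_add, ← eq_div_iff n3] at h
  rw [h]
  field_simp
  ring

/-- The counterpart of `ac_shift` at the pole. Passing from `thLog` to `lc` leaves the rational
constant `w / L - 1`. -/
lemma ac_zero_shift (hQ0 : Q ≠ 0) (hQ : ‖Q‖ < 1) (hL : L ≠ 0) {w z r : ℤ} (hr : r = z - w)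
    (hzw : ¬ (L : ℤ) ∣ r) (hz : ¬ (L : ℤ) ∣ z) :
    ac L Q 0 w = tc L Q w * (ac L Q r z / tc L Q z) - lc L Q z + lc L Q r + w / L - 1 := by
  have hB0 : Q ^ L ≠ 0 := pow_ne_zero _ hQ0
  have hB := base_pow_norm_lt hQ hL
  have hne := (thetaNet hQ0 hQ hL).ne
  have hq : ∀ n : ℤ, Q ^ n ≠ 0 := fun n => zpow_ne_zero _ hQ0
  have h := apS_one_mul_th_sub hB0 hB (hq r) (hq w) (base_pow_mul_ne_one hQ hzw hQ0)
  rw [← zpow_add₀ hQ0, show r + w = z by rw [hr]; ring] at h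
  have n1 := hne z hz
  simp only [tc, ac, lc, zpow_zero] at n1 ⊢
  have hL' : (L : ℂ) ≠ 0 := Nat.cast_ne_zero.2 hL
  have hD : thLog (Q ^ L) (Q ^ z) = thD (Q ^ L) (Q ^ z) / th (Q ^ L) (Q ^ z) := rfl
  rw [sub_eq_iff_eq_add, ← eq_div_iff n1] at h
  rw [h, hD, hr]
  push_cast
  field_simp
  ring

end

/-! ### Identities between theta constants of levels 12 and 20 -/

namespace ThetaNet
variable {Q κ : ℂ} {t ε : ℤ → ℂ} {L : ℕ}

lemma neg_nat (h : ThetaNet L Q κ t ε) (n : ℕ) : t (-(n : ℤ)) = -(Q ^ n)⁻¹ * t n := by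
  rw [h.neg, zpow_natCast]

/-- A natural exponent keeps the relations polynomial in `Q`, as the certificates below require. -/
lemma three_nat (h : ThetaNet L Q κ t ε) (k : ℕ) (a b c d e : ℤ) (hk : b - c = k) :
    Q ^ k * (t (a + b + e) * t (a - b) * (t (c + d + e) * t (c - d))) -
      t (a + c + e) * t (a - c) * (t (b + d + e) * t (b - d)) +
      t (a + d + e) * t (a - d) * (t (b + c + e) * t (b - c)) = 0 := by
  rw [← zpow_natCast, ← hk]
  exact h.three a b c d e

lemma log_refl_of (h : ThetaNet L Q κ t ε) {m n : ℤ} (hmn : (L : ℤ) - n = m)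
    (hn : ¬ (L : ℤ) ∣ n) : ε m = -ε n :=
  hmn ▸ h.log_refl n hn

/-- The part of the remainder in `AppellNet.rank_three` that carries powers of `q` divisible by 3.
Four-term relations trade the logarithmic derivatives for theta quotients; the purely multiplicative
identity left over is a consequence of one instance of Weierstrass' relation. -/
theorem level_twelve_zero (h : ThetaNet 12 Q κ t ε) :
    κ * (-(1 / 3 * (t 1 * t 5 ^ 2 * t 6 ^ 2 / (t 2 ^ 2 * t 3 ^ 3 * t 4))) + 1 / 3 * (Q * t 1 ^ 2 *
      t 5 * t 6 ^ 2 / (t 2 ^ 2 * t 3 ^ 3 * t 4)) + 1 / 3 * (Q * t 3 ^ 2 / (t 1 * t 4 * t 5)) - Q *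
      t 5 / (t 3 * t 4) + Q ^ 2 * t 1 / (t 3 * t 4)) - 2 * ε 4 = 0 := by
  have n1 : t 1 ≠ 0 := h.ne 1 (by decide)
  have n2 : t 2 ≠ 0 := h.ne 2 (by decide)
  have n3 : t 3 ≠ 0 := h.ne 3 (by decide)
  have n4 : t 4 ≠ 0 := h.ne 4 (by decide)
  have n5 : t 5 ≠ 0 := h.ne 5 (by decide)
  have n6 : t 6 ≠ 0 := h.ne 6 (by decide)
  have hQ := h.base_ne
  have r1 : -(Q * t 2 ^ 2 * t 3 ^ 2) + t 3 ^ 2 * t 4 ^ 2 - t 1 * t 5 * t 6 ^ 2 = 0 := by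
    have e : Q ^ 1 * (t 9 * t 3 * (t 2 * t 2)) - t 8 * t 4 * (t 3 * t 3) + t 6 * t 6 * (t 5 * t 1)
      = 0 := h.three_nat 1 6 3 2 0 0 rfl
    rw [show t 8 = t 4 from h.refl 4, show t 9 = t 3 from h.refl 3] at e
    linear_combination -1 * e
  have key : -(1 / 3 * t 1 ^ 3 * t 4 * t 5 ^ 4 * t 6 ^ 4) + 1 / 3 * Q * t 1 ^ 4 * t 4 * t 5 ^ 3 *
      t 6 ^ 4 - 1 / 3 * Q * t 1 ^ 2 * t 2 ^ 2 * t 3 ^ 2 * t 4 * t 5 ^ 3 * t 6 ^ 2 + 1 / 3 * Q ^ 2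
      * t 1 ^ 3 * t 2 ^ 2 * t 3 ^ 2 * t 4 * t 5 ^ 2 * t 6 ^ 2 + 1 / 3 * t 1 ^ 2 * t 3 ^ 2 *
      t 4 ^ 3 * t 5 ^ 3 * t 6 ^ 2 - 1 / 3 * Q * t 1 ^ 3 * t 3 ^ 2 * t 4 ^ 3 * t 5 ^ 2 * t 6 ^ 2 =
      0 := by
    linear_combination 1 / 3 * t 1 ^ 2 * t 4 * t 5 ^ 3 * t 6 ^ 2 * r1 - 1 / 3 * Q * t 1 ^ 3 * t 4
      * t 5 ^ 2 * t 6 ^ 2 * r1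
  -- Besides theta quotients from the goal, this identity contains quotients supplied by the
  -- four-term relations `f1` to `f5`. Its numerator over the common denominator is `key`.
  have e : -(1 / 3 * (t 1 * t 5 ^ 2 * t 6 ^ 2 / (t 2 ^ 2 * t 3 ^ 3 * t 4))) + 1 / 3 * (Q * t 1 ^ 2
      * t 5 * t 6 ^ 2 / (t 2 ^ 2 * t 3 ^ 3 * t 4)) - 1 / 3 * (Q * t 5 / (t 3 * t 4)) + 1 / 3 *
      (Q ^ 2 * t 1 / (t 3 * t 4)) + 1 / 3 * (t 4 * t 5 / (t 2 ^ 2 * t 3)) - 1 / 3 * (Q * t 1 * t 4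
      / (t 2 ^ 2 * t 3)) = (-(1 / 3 * t 1 ^ 3 * t 4 * t 5 ^ 4 * t 6 ^ 4) + 1 / 3 * Q * t 1 ^ 4 *
      t 4 * t 5 ^ 3 * t 6 ^ 4 - 1 / 3 * Q * t 1 ^ 2 * t 2 ^ 2 * t 3 ^ 2 * t 4 * t 5 ^ 3 * t 6 ^ 2
      + 1 / 3 * Q ^ 2 * t 1 ^ 3 * t 2 ^ 2 * t 3 ^ 2 * t 4 * t 5 ^ 2 * t 6 ^ 2 + 1 / 3 * t 1 ^ 2 *
      t 3 ^ 2 * t 4 ^ 3 * t 5 ^ 3 * t 6 ^ 2 - 1 / 3 * Q * t 1 ^ 3 * t 3 ^ 2 * t 4 ^ 3 * t 5 ^ 2 *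
      t 6 ^ 2) / (t 1 ^ 2 * t 2 ^ 2 * t 3 ^ 3 * t 4 ^ 2 * t 5 ^ 2 * t 6 ^ 2) := by
    field_simp
  rw [key, zero_div] at e
  have t_m13 : t (-13) = -(Q ^ 13)⁻¹ * t 13 := h.neg_nat 13
  have t_m10 : t (-10) = -(Q ^ 10)⁻¹ * t 10 := h.neg_nat 10
  have t_m9 : t (-9) = -(Q ^ 9)⁻¹ * t 9 := h.neg_nat 9
  have t_m8 : t (-8) = -(Q ^ 8)⁻¹ * t 8 := h.neg_nat 8
  have t_m7 : t (-7) = -(Q ^ 7)⁻¹ * t 7 := h.neg_nat 7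
  have t_m5 : t (-5) = -(Q ^ 5)⁻¹ * t 5 := h.neg_nat 5
  have t_m4 : t (-4) = -(Q ^ 4)⁻¹ * t 4 := h.neg_nat 4
  have t_m3 : t (-3) = -(Q ^ 3)⁻¹ * t 3 := h.neg_nat 3
  have t_m2 : t (-2) = -(Q ^ 2)⁻¹ * t 2 := h.neg_nat 2
  have t_m1 : t (-1) = -(Q ^ 1)⁻¹ * t 1 := h.neg_nat 1
  have t_7 : t 7 = t 5 := h.refl 5
  have t_8 : t 8 = t 4 := h.refl 4
  have t_9 : t 9 = t 3 := h.refl 3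
  have t_10 : t 10 = t 2 := h.refl 2
  have t_13 : t 13 = t (-1) := (h.refl 13).symm
  have l_m13 : ε (-13) = -ε 13 := h.log_neg 13 (by decide)
  have l_m10 : ε (-10) = -ε 10 := h.log_neg 10 (by decide)
  have l_m5 : ε (-5) = -ε 5 := h.log_neg 5 (by decide)
  have l_m4 : ε (-4) = -ε 4 := h.log_neg 4 (by decide)
  have l_m3 : ε (-3) = -ε 3 := h.log_neg 3 (by decide)
  have l_m2 : ε (-2) = -ε 2 := h.log_neg 2 (by decide)
  have l_m1 : ε (-1) = -ε 1 := h.log_neg 1 (by decide)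
  have l_10 : ε 10 = -ε 2 := h.log_refl_of (by norm_num) (by decide)
  have l_13 : ε 13 = -ε (-1) := h.log_refl_of (by norm_num) (by decide)
  have f1 : -ε 5 - ε 3 - 2 * ε 2 + κ * (-(t 4 * t 5 / (t 2 ^ 2 * t 3))) = 0 := by
    have e : ε (-5) + ε (-3) + ε (-2) - ε (-10) = -κ * (t (-8) * t (-5) * t (-7) / (t (-5) *
        t (-3) * t (-2) * t (-10))) := h.four (-5) (-3) (-2) (by decide) (by decide) (by decide)
        (by decide)
    have e' : t (-8) * t (-5) * t (-7) / (t (-5) * t (-3) * t (-2) * t (-10)) = -(t 4 * t 5 /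
        (t 2 ^ 2 * t 3)) := by
      simp only [t_m10, t_m8, t_m7, t_m5, t_m3, t_m2, t_7, t_8, t_10]
      field_simp
    simp only [l_m10, l_m5, l_m3, l_m2, l_10] at e
    rw [e'] at e
    linear_combination e
  have f2 : -ε 4 - ε 1 + ε 2 + ε 3 + κ * (-(Q * t 5 / (t 3 * t 4))) = 0 := by
    have e : ε (-4) + ε (-1) + ε 2 - ε (-3) = -κ * (t (-5) * t 1 * t (-2) / (t (-4) * t (-1) * t 2
        * t (-3))) := h.four (-4) (-1) 2 (by decide) (by decide) (by decide) (by decide)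
    have e' : t (-5) * t 1 * t (-2) / (t (-4) * t (-1) * t 2 * t (-3)) = -(Q * t 5 / (t 3 * t 4))
        := by
      simp only [t_m5, t_m4, t_m3, t_m2, t_m1]
      field_simp
    simp only [l_m4, l_m3, l_m1] at e
    rw [e'] at e
    linear_combination e
  have f3 : -ε 3 - ε 1 + 2 * ε 2 + κ * (-(Q * t 1 * t 4 / (t 2 ^ 2 * t 3))) = 0 := by
    have e : ε (-3) + ε (-1) + ε 2 - ε (-2) = -κ * (t (-4) * t 1 * t (-1) / (t (-3) * t (-1) * t 2
        * t (-2))) := h.four (-3) (-1) 2 (by decide) (by decide) (by decide) (by decide)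
    have e' : t (-4) * t 1 * t (-1) / (t (-3) * t (-1) * t 2 * t (-2)) = -(Q * t 1 * t 4 /
        (t 2 ^ 2 * t 3)) := by
      simp only [t_m4, t_m3, t_m2, t_m1]
      field_simp
    simp only [l_m3, l_m2, l_m1] at e
    rw [e'] at e
    linear_combination e
  have f4 : -ε 5 - ε 2 + ε 3 + ε 4 + κ * (-(Q ^ 2 * t 1 / (t 3 * t 4))) = 0 := by
    have e : ε (-5) + ε (-2) + ε 3 - ε (-4) = -κ * (t (-7) * t 1 * t (-2) / (t (-5) * t (-2) * t 3
        * t (-4))) := h.four (-5) (-2) 3 (by decide) (by decide) (by decide) (by decide)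
    have e' : t (-7) * t 1 * t (-2) / (t (-5) * t (-2) * t 3 * t (-4)) = -(Q ^ 2 * t 1 / (t 3 *
        t 4)) := by
      simp only [t_m7, t_m5, t_m4, t_m2, t_7]
      field_simp
    simp only [l_m5, l_m4, l_m2] at e
    rw [e'] at e
    linear_combination e
  have f5 : -ε 5 - 2 * ε 4 + ε 1 + κ * (Q * t 3 ^ 2 / (t 1 * t 4 * t 5)) = 0 := by
    have e : ε (-5) + ε (-4) + ε (-4) - ε (-13) = -κ * (t (-9) * t (-8) * t (-9) / (t (-5) *
        t (-4) * t (-4) * t (-13))) := h.four (-5) (-4) (-4) (by decide) (by decide) (by decide)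
        (by decide)
    have e' : t (-9) * t (-8) * t (-9) / (t (-5) * t (-4) * t (-4) * t (-13)) = Q * t 3 ^ 2 / (t 1
        * t 4 * t 5) := by
      simp only [t_m13, t_m9, t_m8, t_m5, t_m4, t_m1, t_8, t_9, t_13]
      field_simp
    simp only [l_m13, l_m5, l_m4, l_m1, l_13] at e
    rw [e'] at e
    linear_combination e
  -- The multipliers of `f1` to `f5` are chosen so that `ε 1`, `ε 2`, `ε 3` and `ε 5` cancel and `-2
  -- * ε 4` remains.
  linear_combination κ * e + 1/3 * f1 + 2/3 * f2 - 1/3 * f3 - 2/3 * f4 + 1/3 * f5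

/-- The part with exponents of `q` congruent to 1 modulo 3. No logarithmic derivatives occur, since
these come only from the sums with `p = 0`. -/
theorem level_twelve_one (h : ThetaNet 12 Q κ t ε) :
    -(1 / 3 * (t 5 * t 6 / (t 2 * t 3 * t 4))) + 1 / 3 * (Q * t 1 * t 6 / (t 2 * t 3 * t 4)) + 1 /
      3 * (t 1 * t 5 * t 6 ^ 2 / (t 2 ^ 2 * t 3 ^ 2 * t 4)) = 0 := by
  have n2 : t 2 ≠ 0 := h.ne 2 (by decide)
  have n3 : t 3 ≠ 0 := h.ne 3 (by decide)
  have n4 : t 4 ≠ 0 := h.ne 4 (by decide)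
  have n6 : t 6 ≠ 0 := h.ne 6 (by decide)
  have hQ := h.base_ne
  have r1 : -(Q * t 1 * t 2 * t 3) + t 2 * t 3 * t 5 - t 1 * t 5 * t 6 = 0 := by
    have e : Q ^ 1 * (t 8 * t 2 * (t 3 * t 1)) - t 7 * t 3 * (t 4 * t 2) + t 6 * t 4 * (t 5 * t 1)
      = 0 := h.three_nat 1 5 3 2 1 0 rfl
    rw [show t 7 = t 5 from h.refl 5, show t 8 = t 4 from h.refl 4] at e
    -- This instance of Weierstrass' relation has the common factor `t 4`, which is nonzero.
    refine (mul_eq_zero.1 ?_).resolve_left (h.ne 4 (by decide))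
    linear_combination -1 * e
  have key : -(1 / 3 * t 2 * t 3 * t 5) + 1 / 3 * Q * t 1 * t 2 * t 3 + 1 / 3 * t 1 * t 5 * t 6 =
      0 := by
    linear_combination -(1/3) * r1
  have e : -(1 / 3 * (t 5 * t 6 / (t 2 * t 3 * t 4))) + 1 / 3 * (Q * t 1 * t 6 / (t 2 * t 3 *
      t 4)) + 1 / 3 * (t 1 * t 5 * t 6 ^ 2 / (t 2 ^ 2 * t 3 ^ 2 * t 4)) = t 6 * (-(1 / 3 * t 2 *
      t 3 * t 5) + 1 / 3 * Q * t 1 * t 2 * t 3 + 1 / 3 * t 1 * t 5 * t 6) / (t 2 ^ 2 * t 3 ^ 2 *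
      t 4) := by
    field_simp
  rw [key, mul_zero, zero_div] at e
  exact e

/-- The part with exponents congruent to 2 modulo 3; after clearing denominators it is the same
relation as in `level_twelve_one`. -/
theorem level_twelve_two (h : ThetaNet 12 Q κ t ε) :
    -(1 / 3 * (t 3 / (t 1 * t 4))) + 1 / 3 * (Q * t 3 / (t 4 * t 5)) + 1 / 3 * (t 6 / (t 2 * t 4))
      = 0 := by
  have n1 : t 1 ≠ 0 := h.ne 1 (by decide)
  have n2 : t 2 ≠ 0 := h.ne 2 (by decide)
  have n4 : t 4 ≠ 0 := h.ne 4 (by decide)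
  have n5 : t 5 ≠ 0 := h.ne 5 (by decide)
  have hQ := h.base_ne
  have r1 : -(Q * t 1 * t 2 * t 3) + t 2 * t 3 * t 5 - t 1 * t 5 * t 6 = 0 := by
    have e : Q ^ 1 * (t 8 * t 2 * (t 3 * t 1)) - t 7 * t 3 * (t 4 * t 2) + t 6 * t 4 * (t 5 * t 1)
      = 0 := h.three_nat 1 5 3 2 1 0 rfl
    rw [show t 7 = t 5 from h.refl 5, show t 8 = t 4 from h.refl 4] at e
    refine (mul_eq_zero.1 ?_).resolve_left (h.ne 4 (by decide))
    linear_combination -1 * e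
  have key : -(1 / 3 * t 2 * t 3 * t 5) + 1 / 3 * Q * t 1 * t 2 * t 3 + 1 / 3 * t 1 * t 5 * t 6 =
      0 := by
    linear_combination -(1/3) * r1
  have e : -(1 / 3 * (t 3 / (t 1 * t 4))) + 1 / 3 * (Q * t 3 / (t 4 * t 5)) + 1 / 3 * (t 6 / (t 2
      * t 4)) = (-(1 / 3 * t 2 * t 3 * t 5) + 1 / 3 * Q * t 1 * t 2 * t 3 + 1 / 3 * t 1 * t 5 *
      t 6) / (t 1 * t 2 * t 4 * t 5) := by
    field_simp
  rw [key, zero_div] at e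
  exact e

/-- First of five residue components, modulo 5 in the exponent of `q`, of the remainder in
`AppellNet.rank_five_first`. It is the only one with a logarithmic derivative; thirteen four-term
relations remove the others, and nine instances of Weierstrass' relation certify the quotient
identity left behind. -/
theorem level_twenty_first_zero (h : ThetaNet 20 Q κ t ε) :
    κ * (3 / 5 * (t 1 * t 9 ^ 2 * t 10 / (t 2 * t 3 * t 4 * t 5 * t 7)) + 3 / 5 * (Q ^ 2 * t 1 ^ 2
      * t 9 * t 10 / (t 2 * t 3 * t 4 * t 5 * t 7)) + 1 / 5 * (Q * t 3 * t 7 ^ 2 * t 10 / (t 1 *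
      t 5 * t 6 * t 8 * t 9)) - 1 / 5 * (Q ^ 2 * t 3 ^ 2 * t 7 * t 10 / (t 1 * t 5 * t 6 * t 8 *
      t 9)) + 2 / 5 * (Q * t 5 ^ 2 * t 6 / (t 2 * t 3 * t 7 * t 8)) - 1 / 5 * (Q ^ 2 * t 2 *
      t 5 ^ 2 / (t 1 * t 4 * t 6 * t 9)) + Q ^ 3 * t 3 / (t 5 * t 8) - Q ^ 2 * t 7 / (t 5 * t 8))
      + 2 * ε 4 = 0 := by
  have n1 : t 1 ≠ 0 := h.ne 1 (by decide)
  have n2 : t 2 ≠ 0 := h.ne 2 (by decide)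
  have n3 : t 3 ≠ 0 := h.ne 3 (by decide)
  have n4 : t 4 ≠ 0 := h.ne 4 (by decide)
  have n5 : t 5 ≠ 0 := h.ne 5 (by decide)
  have n6 : t 6 ≠ 0 := h.ne 6 (by decide)
  have n7 : t 7 ≠ 0 := h.ne 7 (by decide)
  have n8 : t 8 ≠ 0 := h.ne 8 (by decide)
  have n9 : t 9 ≠ 0 := h.ne 9 (by decide)
  have hQ := h.base_ne
  have r1 : -(Q * t 3 * t 4 * t 5 * t 6) + t 4 * t 5 * t 6 * t 7 - t 1 * t 8 * t 9 * t 10 = 0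
      := by
    have e : Q ^ 1 * (t 14 * t 4 * (t 5 * t 3)) - t 13 * t 5 * (t 6 * t 4) + t 10 * t 8 * (t 9 *
      t 1) = 0 := h.three_nat 1 9 5 4 1 0 rfl
    rw [show t 13 = t 7 from h.refl 7, show t 14 = t 6 from h.refl 6] at e
    linear_combination -1 * e
  have r2 : -(Q ^ 3 * t 2 * t 3 ^ 2 * t 6) + t 5 * t 6 ^ 2 * t 9 - t 3 * t 8 ^ 2 * t 9 = 0 := by
    have e : Q ^ 3 * (t 14 * t 2 * (t 3 * t 3)) - t 11 * t 5 * (t 6 * t 6) + t 8 * t 8 * (t 9 *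
      t 3) = 0 := h.three_nat 3 8 6 3 0 0 rfl
    rw [show t 11 = t 9 from h.refl 9, show t 14 = t 6 from h.refl 6] at e
    linear_combination -1 * e
  have r3 : -(Q ^ 2 * t 1 * t 2 * t 4 * t 9) + t 3 * t 4 * t 6 * t 9 - t 2 * t 5 * t 7 * t 8 = 0
      := by
    have e : Q ^ 2 * (t 11 * t 1 * (t 4 * t 2)) - t 9 * t 3 * (t 6 * t 4) + t 7 * t 5 * (t 8 *
      t 2) = 0 := h.three_nat 2 6 5 3 1 0 rfl
    rw [show t 11 = t 9 from h.refl 9] at e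
    linear_combination -1 * e
  have r4 : -(Q ^ 2 * t 1 * t 2 * t 5 * t 8) + t 3 * t 4 * t 7 * t 10 - t 2 * t 5 * t 8 * t 9 = 0
      := by
    have e : Q ^ 2 * (t 12 * t 2 * (t 5 * t 1)) - t 10 * t 4 * (t 7 * t 3) + t 9 * t 5 * (t 8 *
      t 2) = 0 := h.three_nat 2 7 5 3 2 0 rfl
    rw [show t 12 = t 8 from h.refl 8] at e
    linear_combination -1 * e
  have r5 : -(Q ^ 2 * t 2 * t 3 * t 4 * t 7) + t 4 * t 5 * t 6 * t 9 - t 2 * t 7 * t 8 * t 9 = 0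
      := by
    have e : Q ^ 2 * (t 13 * t 3 * (t 4 * t 2)) - t 11 * t 5 * (t 6 * t 4) + t 9 * t 7 * (t 8 *
      t 2) = 0 := h.three_nat 2 8 5 3 1 0 rfl
    rw [show t 11 = t 9 from h.refl 9, show t 13 = t 7 from h.refl 7] at e
    linear_combination -1 * e
  have r6 : -(Q ^ 3 * t 1 * t 3 * t 4 * t 6) + t 4 * t 6 * t 7 * t 9 - t 3 * t 7 * t 8 * t 10 = 0
      := by
    have e : Q ^ 3 * (t 14 * t 4 * (t 3 * t 1)) - t 11 * t 7 * (t 6 * t 4) + t 10 * t 8 * (t 7 *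
      t 3) = 0 := h.three_nat 3 9 5 2 1 0 rfl
    rw [show t 11 = t 9 from h.refl 9, show t 14 = t 6 from h.refl 6] at e
    linear_combination -1 * e
  have r7 : -(Q ^ 2 * t 2 ^ 2 * t 5 * t 7) + t 4 ^ 2 * t 7 * t 9 - t 2 * t 6 * t 9 ^ 2 = 0 := by
    have e : Q ^ 2 * (t 13 * t 5 * (t 2 * t 2)) - t 11 * t 7 * (t 4 * t 4) + t 9 * t 9 * (t 6 *
      t 2) = 0 := h.three_nat 2 9 4 2 0 0 rfl
    rw [show t 11 = t 9 from h.refl 9, show t 13 = t 7 from h.refl 7] at e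
    linear_combination -1 * e
  have r8 : -(Q * t 2 * t 3 * t 5 * t 8) + t 3 * t 4 * t 6 * t 9 - t 1 * t 6 * t 8 * t 9 = 0 := by
    have e : Q ^ 1 * (t 12 * t 2 * (t 5 * t 3)) - t 11 * t 3 * (t 6 * t 4) + t 8 * t 6 * (t 9 *
      t 1) = 0 := h.three_nat 1 7 5 4 1 0 rfl
    rw [show t 11 = t 9 from h.refl 9, show t 12 = t 8 from h.refl 8] at e
    linear_combination -1 * e
  have r9 : -(Q * t 2 * t 3 * t 6 * t 7) + t 3 * t 4 * t 7 * t 8 - t 1 * t 6 * t 9 * t 10 = 0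
      := by
    have e : Q ^ 1 * (t 13 * t 3 * (t 6 * t 2)) - t 12 * t 4 * (t 7 * t 3) + t 10 * t 6 * (t 9 *
      t 1) = 0 := h.three_nat 1 8 5 4 2 0 rfl
    rw [show t 12 = t 8 from h.refl 8, show t 13 = t 7 from h.refl 7] at e
    linear_combination -1 * e
  have key : 3 / 5 * t 1 ^ 2 * t 6 * t 8 * t 9 ^ 3 * t 10 + 3 / 5 * Q ^ 2 * t 1 ^ 3 * t 6 * t 8 *
      t 9 ^ 2 * t 10 + 1 / 5 * Q * t 2 * t 3 ^ 2 * t 4 * t 7 ^ 3 * t 10 - 1 / 5 * Q ^ 2 * t 2 *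
      t 3 ^ 3 * t 4 * t 7 ^ 2 * t 10 + 2 / 5 * Q * t 1 * t 4 * t 5 ^ 3 * t 6 ^ 2 * t 9 - 1 / 5 *
      Q ^ 2 * t 2 ^ 2 * t 3 * t 5 ^ 3 * t 7 * t 8 + Q ^ 3 * t 1 * t 2 * t 3 ^ 2 * t 4 * t 6 * t 7
      * t 9 - Q ^ 2 * t 1 * t 2 * t 3 * t 4 * t 6 * t 7 ^ 2 * t 9 + 3 / 5 * Q * t 1 * t 3 * t 4 *
      t 5 * t 6 ^ 2 * t 9 ^ 2 + 1 / 5 * t 3 ^ 2 * t 4 * t 5 * t 6 * t 7 * t 9 * t 10 + 1 / 5 * t 3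
      * t 4 ^ 2 * t 5 ^ 2 * t 7 * t 8 * t 9 - 1 / 5 * Q * t 2 ^ 2 * t 3 * t 5 * t 7 ^ 2 * t 8 *
      t 9 + 1 / 5 * Q ^ 5 * t 1 ^ 2 * t 2 ^ 2 * t 3 * t 4 * t 7 * t 9 - 1 / 5 * t 2 * t 3 * t 4 *
      t 6 * t 7 ^ 2 * t 9 ^ 2 - 2 / 5 * Q * t 1 * t 3 * t 4 * t 5 ^ 2 * t 8 ^ 2 * t 9 - 1 / 5 *
      t 2 * t 3 * t 5 ^ 2 * t 6 * t 8 * t 9 ^ 2 - 3 / 5 * Q ^ 4 * t 1 * t 2 ^ 2 * t 3 ^ 2 * t 5 *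
      t 7 * t 8 - 3 / 5 * Q ^ 2 * t 1 ^ 2 * t 3 * t 4 * t 7 * t 8 ^ 2 * t 9 - t 1 * t 2 * t 6 *
      t 7 ^ 2 * t 8 * t 9 ^ 2 + 2 / 5 * t 1 * t 3 * t 4 * t 7 * t 8 ^ 2 * t 9 ^ 2 - 2 / 5 * Q ^ 4
      * t 1 * t 2 * t 3 ^ 2 * t 4 * t 5 ^ 2 * t 6 = 0 := by
    linear_combination -(3 / 5 * t 1 * t 6 * t 9 ^ 2) * r1 - 2 / 5 * t 1 * t 4 * t 7 * t 9 * r2 -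
      1 / 5 * Q ^ 3 * t 1 * t 2 * t 3 * t 7 * r3 + 1 / 5 * Q * t 2 * t 3 * t 7 ^ 2 * r4 + 1 / 5 *
      t 3 ^ 2 * t 7 * t 10 * r5 - 1 / 5 * t 2 * t 3 * t 7 * t 9 * r6 + 2 / 5 * Q * t 1 * t 4 *
      t 5 ^ 2 * r2 + 1 / 5 * t 3 * t 5 ^ 2 * t 8 * r7 + 3 / 5 * Q ^ 3 * t 1 * t 2 * t 3 * t 7 * r8
      - 3 / 5 * Q ^ 2 * t 1 ^ 2 * t 8 * t 9 * r9 + t 1 * t 6 * t 7 * t 9 * r5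
  -- The quotients after `Q ^ 2 * t 7 / (t 5 * t 8)` are those introduced by `f1` to `f13`, with
  -- signs for which `κ * e` cancels them.
  have e : 3 / 5 * (t 1 * t 9 ^ 2 * t 10 / (t 2 * t 3 * t 4 * t 5 * t 7)) + 3 / 5 * (Q ^ 2 *
      t 1 ^ 2 * t 9 * t 10 / (t 2 * t 3 * t 4 * t 5 * t 7)) + 1 / 5 * (Q * t 3 * t 7 ^ 2 * t 10 /
      (t 1 * t 5 * t 6 * t 8 * t 9)) - 1 / 5 * (Q ^ 2 * t 3 ^ 2 * t 7 * t 10 / (t 1 * t 5 * t 6 *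
      t 8 * t 9)) + 2 / 5 * (Q * t 5 ^ 2 * t 6 / (t 2 * t 3 * t 7 * t 8)) - 1 / 5 * (Q ^ 2 * t 2 *
      t 5 ^ 2 / (t 1 * t 4 * t 6 * t 9)) + Q ^ 3 * t 3 / (t 5 * t 8) - Q ^ 2 * t 7 / (t 5 * t 8) +
      3 / 5 * (Q * t 6 * t 9 / (t 2 * t 7 * t 8)) + 1 / 5 * (t 3 * t 10 / (t 1 * t 2 * t 8)) + 1 /
      5 * (t 4 * t 5 / (t 1 * t 2 * t 6)) - 1 / 5 * (Q * t 2 * t 7 / (t 1 * t 4 * t 6)) + 1 / 5 *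
      (Q ^ 5 * t 1 * t 2 / (t 5 * t 6 * t 8)) - 1 / 5 * (t 7 * t 9 / (t 1 * t 5 * t 8)) - 2 / 5 *
      (Q * t 5 * t 8 / (t 2 * t 6 * t 7)) - 1 / 5 * (t 5 * t 9 / (t 1 * t 4 * t 7)) - 3 / 5 *
      (Q ^ 4 * t 2 * t 3 / (t 4 * t 6 * t 9)) - 3 / 5 * (Q ^ 2 * t 1 * t 8 / (t 2 * t 5 * t 6)) -
      t 7 * t 9 / (t 3 * t 4 * t 5) + 2 / 5 * (t 8 * t 9 / (t 2 * t 5 * t 6)) - 2 / 5 * (Q ^ 4 *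
      t 3 * t 5 / (t 7 * t 8 * t 9)) = (3 / 5 * t 1 ^ 2 * t 6 * t 8 * t 9 ^ 3 * t 10 + 3 / 5 *
      Q ^ 2 * t 1 ^ 3 * t 6 * t 8 * t 9 ^ 2 * t 10 + 1 / 5 * Q * t 2 * t 3 ^ 2 * t 4 * t 7 ^ 3 *
      t 10 - 1 / 5 * Q ^ 2 * t 2 * t 3 ^ 3 * t 4 * t 7 ^ 2 * t 10 + 2 / 5 * Q * t 1 * t 4 *
      t 5 ^ 3 * t 6 ^ 2 * t 9 - 1 / 5 * Q ^ 2 * t 2 ^ 2 * t 3 * t 5 ^ 3 * t 7 * t 8 + Q ^ 3 * t 1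
      * t 2 * t 3 ^ 2 * t 4 * t 6 * t 7 * t 9 - Q ^ 2 * t 1 * t 2 * t 3 * t 4 * t 6 * t 7 ^ 2 *
      t 9 + 3 / 5 * Q * t 1 * t 3 * t 4 * t 5 * t 6 ^ 2 * t 9 ^ 2 + 1 / 5 * t 3 ^ 2 * t 4 * t 5 *
      t 6 * t 7 * t 9 * t 10 + 1 / 5 * t 3 * t 4 ^ 2 * t 5 ^ 2 * t 7 * t 8 * t 9 - 1 / 5 * Q *
      t 2 ^ 2 * t 3 * t 5 * t 7 ^ 2 * t 8 * t 9 + 1 / 5 * Q ^ 5 * t 1 ^ 2 * t 2 ^ 2 * t 3 * t 4 *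
      t 7 * t 9 - 1 / 5 * t 2 * t 3 * t 4 * t 6 * t 7 ^ 2 * t 9 ^ 2 - 2 / 5 * Q * t 1 * t 3 * t 4
      * t 5 ^ 2 * t 8 ^ 2 * t 9 - 1 / 5 * t 2 * t 3 * t 5 ^ 2 * t 6 * t 8 * t 9 ^ 2 - 3 / 5 *
      Q ^ 4 * t 1 * t 2 ^ 2 * t 3 ^ 2 * t 5 * t 7 * t 8 - 3 / 5 * Q ^ 2 * t 1 ^ 2 * t 3 * t 4 *
      t 7 * t 8 ^ 2 * t 9 - t 1 * t 2 * t 6 * t 7 ^ 2 * t 8 * t 9 ^ 2 + 2 / 5 * t 1 * t 3 * t 4 *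
      t 7 * t 8 ^ 2 * t 9 ^ 2 - 2 / 5 * Q ^ 4 * t 1 * t 2 * t 3 ^ 2 * t 4 * t 5 ^ 2 * t 6) / (t 1
      * t 2 * t 3 * t 4 * t 5 * t 6 * t 7 * t 8 * t 9) := by
    field_simp
  rw [key, zero_div] at e
  have t_m24 : t (-24) = -(Q ^ 24)⁻¹ * t 24 := h.neg_nat 24
  have t_m19 : t (-19) = -(Q ^ 19)⁻¹ * t 19 := h.neg_nat 19
  have t_m18 : t (-18) = -(Q ^ 18)⁻¹ * t 18 := h.neg_nat 18
  have t_m17 : t (-17) = -(Q ^ 17)⁻¹ * t 17 := h.neg_nat 17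
  have t_m16 : t (-16) = -(Q ^ 16)⁻¹ * t 16 := h.neg_nat 16
  have t_m15 : t (-15) = -(Q ^ 15)⁻¹ * t 15 := h.neg_nat 15
  have t_m14 : t (-14) = -(Q ^ 14)⁻¹ * t 14 := h.neg_nat 14
  have t_m13 : t (-13) = -(Q ^ 13)⁻¹ * t 13 := h.neg_nat 13
  have t_m12 : t (-12) = -(Q ^ 12)⁻¹ * t 12 := h.neg_nat 12
  have t_m11 : t (-11) = -(Q ^ 11)⁻¹ * t 11 := h.neg_nat 11
  have t_m10 : t (-10) = -(Q ^ 10)⁻¹ * t 10 := h.neg_nat 10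
  have t_m9 : t (-9) = -(Q ^ 9)⁻¹ * t 9 := h.neg_nat 9
  have t_m8 : t (-8) = -(Q ^ 8)⁻¹ * t 8 := h.neg_nat 8
  have t_m7 : t (-7) = -(Q ^ 7)⁻¹ * t 7 := h.neg_nat 7
  have t_m6 : t (-6) = -(Q ^ 6)⁻¹ * t 6 := h.neg_nat 6
  have t_m5 : t (-5) = -(Q ^ 5)⁻¹ * t 5 := h.neg_nat 5
  have t_m4 : t (-4) = -(Q ^ 4)⁻¹ * t 4 := h.neg_nat 4
  have t_m3 : t (-3) = -(Q ^ 3)⁻¹ * t 3 := h.neg_nat 3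
  have t_m2 : t (-2) = -(Q ^ 2)⁻¹ * t 2 := h.neg_nat 2
  have t_m1 : t (-1) = -(Q ^ 1)⁻¹ * t 1 := h.neg_nat 1
  have t_11 : t 11 = t 9 := h.refl 9
  have t_12 : t 12 = t 8 := h.refl 8
  have t_13 : t 13 = t 7 := h.refl 7
  have t_14 : t 14 = t 6 := h.refl 6
  have t_15 : t 15 = t 5 := h.refl 5
  have t_16 : t 16 = t 4 := h.refl 4
  have t_17 : t 17 = t 3 := h.refl 3
  have t_18 : t 18 = t 2 := h.refl 2
  have t_19 : t 19 = t 1 := h.refl 1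
  have t_24 : t 24 = t (-4) := (h.refl 24).symm
  have l_m24 : ε (-24) = -ε 24 := h.log_neg 24 (by decide)
  have l_m19 : ε (-19) = -ε 19 := h.log_neg 19 (by decide)
  have l_m18 : ε (-18) = -ε 18 := h.log_neg 18 (by decide)
  have l_m17 : ε (-17) = -ε 17 := h.log_neg 17 (by decide)
  have l_m9 : ε (-9) = -ε 9 := h.log_neg 9 (by decide)
  have l_m8 : ε (-8) = -ε 8 := h.log_neg 8 (by decide)
  have l_m7 : ε (-7) = -ε 7 := h.log_neg 7 (by decide)
  have l_m6 : ε (-6) = -ε 6 := h.log_neg 6 (by decide)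
  have l_m5 : ε (-5) = -ε 5 := h.log_neg 5 (by decide)
  have l_m4 : ε (-4) = -ε 4 := h.log_neg 4 (by decide)
  have l_m3 : ε (-3) = -ε 3 := h.log_neg 3 (by decide)
  have l_m2 : ε (-2) = -ε 2 := h.log_neg 2 (by decide)
  have l_m1 : ε (-1) = -ε 1 := h.log_neg 1 (by decide)
  have l_17 : ε 17 = -ε 3 := h.log_refl_of (by norm_num) (by decide)
  have l_18 : ε 18 = -ε 2 := h.log_refl_of (by norm_num) (by decide)
  have l_19 : ε 19 = -ε 1 := h.log_refl_of (by norm_num) (by decide)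
  have l_24 : ε 24 = -ε (-4) := h.log_refl_of (by norm_num) (by decide)
  have f1 : -ε 8 - ε 1 + ε 2 + ε 7 + κ * (-(Q * t 6 * t 9 / (t 2 * t 7 * t 8))) = 0 := by
    have e : ε (-8) + ε (-1) + ε 2 - ε (-7) = -κ * (t (-9) * t 1 * t (-6) / (t (-8) * t (-1) * t 2
        * t (-7))) := h.four (-8) (-1) 2 (by decide) (by decide) (by decide) (by decide)
    have e' : t (-9) * t 1 * t (-6) / (t (-8) * t (-1) * t 2 * t (-7)) = -(Q * t 6 * t 9 / (t 2 *
        t 7 * t 8)) := by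
      simp only [t_m9, t_m8, t_m7, t_m6, t_m1]
      field_simp
    simp only [l_m8, l_m7, l_m1] at e
    rw [e'] at e
    linear_combination e
  have f2 : -ε 9 - ε 8 - ε 2 - ε 1 + κ * (-(t 3 * t 10 / (t 1 * t 2 * t 8))) = 0 := by
    have e : ε (-9) + ε (-8) + ε (-2) - ε (-19) = -κ * (t (-17) * t (-10) * t (-11) / (t (-9) *
        t (-8) * t (-2) * t (-19))) := h.four (-9) (-8) (-2) (by decide) (by decide) (by decide)
        (by decide)
    have e' : t (-17) * t (-10) * t (-11) / (t (-9) * t (-8) * t (-2) * t (-19)) = -(t 3 * t 10 /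
        (t 1 * t 2 * t 8)) := by
      simp only [t_m19, t_m17, t_m11, t_m10, t_m9, t_m8, t_m2, t_11, t_17, t_19]
      field_simp
    simp only [l_m19, l_m9, l_m8, l_m2, l_19] at e
    rw [e'] at e
    linear_combination e
  have f3 : -ε 6 + ε 1 + ε 2 + ε 3 + κ * (t 4 * t 5 / (t 1 * t 2 * t 6)) = 0 := by
    have e : ε (-6) + ε 1 + ε 2 - ε (-3) = -κ * (t (-5) * t 3 * t (-4) / (t (-6) * t 1 * t 2 *
        t (-3))) := h.four (-6) 1 2 (by decide) (by decide) (by decide) (by decide)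
    have e' : t (-5) * t 3 * t (-4) / (t (-6) * t 1 * t 2 * t (-3)) = t 4 * t 5 / (t 1 * t 2 *
        t 6) := by
      simp only [t_m6, t_m5, t_m4, t_m3]
      field_simp
    simp only [l_m6, l_m3] at e
    rw [e'] at e
    linear_combination e
  have f4 : -ε 6 - ε 1 + ε 3 + ε 4 + κ * (-(Q * t 2 * t 7 / (t 1 * t 4 * t 6))) = 0 := by
    have e : ε (-6) + ε (-1) + ε 3 - ε (-4) = -κ * (t (-7) * t 2 * t (-3) / (t (-6) * t (-1) * t 3
        * t (-4))) := h.four (-6) (-1) 3 (by decide) (by decide) (by decide) (by decide)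
    have e' : t (-7) * t 2 * t (-3) / (t (-6) * t (-1) * t 3 * t (-4)) = -(Q * t 2 * t 7 / (t 1 *
        t 4 * t 6)) := by
      simp only [t_m7, t_m6, t_m4, t_m3, t_m1]
      field_simp
    simp only [l_m6, l_m4, l_m1] at e
    rw [e'] at e
    linear_combination e
  have f5 : -ε 8 - ε 5 + ε 6 + ε 7 + κ * (-(Q ^ 5 * t 1 * t 2 / (t 5 * t 6 * t 8))) = 0 := by
    have e : ε (-8) + ε (-5) + ε 6 - ε (-7) = -κ * (t (-13) * t 1 * t (-2) / (t (-8) * t (-5) *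
        t 6 * t (-7))) := h.four (-8) (-5) 6 (by decide) (by decide) (by decide) (by decide)
    have e' : t (-13) * t 1 * t (-2) / (t (-8) * t (-5) * t 6 * t (-7)) = -(Q ^ 5 * t 1 * t 2 /
        (t 5 * t 6 * t 8)) := by
      simp only [t_m13, t_m8, t_m7, t_m5, t_m2, t_13]
      field_simp
    simp only [l_m8, l_m7, l_m5] at e
    rw [e'] at e
    linear_combination e
  have f6 : -ε 8 - ε 6 - ε 5 - ε 1 + κ * (-(t 7 * t 9 / (t 1 * t 5 * t 8))) = 0 := by
    have e : ε (-8) + ε (-6) + ε (-5) - ε (-19) = -κ * (t (-14) * t (-11) * t (-13) / (t (-8) *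
        t (-6) * t (-5) * t (-19))) := h.four (-8) (-6) (-5) (by decide) (by decide) (by decide)
        (by decide)
    have e' : t (-14) * t (-11) * t (-13) / (t (-8) * t (-6) * t (-5) * t (-19)) = -(t 7 * t 9 /
        (t 1 * t 5 * t 8)) := by
      simp only [t_m19, t_m14, t_m13, t_m11, t_m8, t_m6, t_m5, t_11, t_13, t_14, t_19]
      field_simp
    simp only [l_m19, l_m8, l_m6, l_m5, l_19] at e
    rw [e'] at e
    linear_combination e
  have f7 : -ε 7 - ε 1 + ε 2 + ε 6 + κ * (-(Q * t 5 * t 8 / (t 2 * t 6 * t 7))) = 0 := by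
    have e : ε (-7) + ε (-1) + ε 2 - ε (-6) = -κ * (t (-8) * t 1 * t (-5) / (t (-7) * t (-1) * t 2
        * t (-6))) := h.four (-7) (-1) 2 (by decide) (by decide) (by decide) (by decide)
    have e' : t (-8) * t 1 * t (-5) / (t (-7) * t (-1) * t 2 * t (-6)) = -(Q * t 5 * t 8 / (t 2 *
        t 6 * t 7)) := by
      simp only [t_m8, t_m7, t_m6, t_m5, t_m1]
      field_simp
    simp only [l_m7, l_m6, l_m1] at e
    rw [e'] at e
    linear_combination e
  have f8 : -ε 8 - ε 7 - ε 4 - ε 1 + κ * (-(t 5 * t 9 / (t 1 * t 4 * t 7))) = 0 := by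
    have e : ε (-8) + ε (-7) + ε (-4) - ε (-19) = -κ * (t (-15) * t (-11) * t (-12) / (t (-8) *
        t (-7) * t (-4) * t (-19))) := h.four (-8) (-7) (-4) (by decide) (by decide) (by decide)
        (by decide)
    have e' : t (-15) * t (-11) * t (-12) / (t (-8) * t (-7) * t (-4) * t (-19)) = -(t 5 * t 9 /
        (t 1 * t 4 * t 7)) := by
      simp only [t_m19, t_m15, t_m12, t_m11, t_m8, t_m7, t_m4, t_11, t_12, t_15, t_19]
      field_simp
    simp only [l_m19, l_m8, l_m7, l_m4, l_19] at e
    rw [e'] at e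
    linear_combination e
  have f9 : -ε 9 - ε 4 + ε 6 + ε 7 + κ * (-(Q ^ 4 * t 2 * t 3 / (t 4 * t 6 * t 9))) = 0 := by
    have e : ε (-9) + ε (-4) + ε 6 - ε (-7) = -κ * (t (-13) * t 2 * t (-3) / (t (-9) * t (-4) *
        t 6 * t (-7))) := h.four (-9) (-4) 6 (by decide) (by decide) (by decide) (by decide)
    have e' : t (-13) * t 2 * t (-3) / (t (-9) * t (-4) * t 6 * t (-7)) = -(Q ^ 4 * t 2 * t 3 /
        (t 4 * t 6 * t 9)) := by
      simp only [t_m13, t_m9, t_m7, t_m4, t_m3, t_13]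
      field_simp
    simp only [l_m9, l_m7, l_m4] at e
    rw [e'] at e
    linear_combination e
  have f10 : -ε 6 - ε 2 + ε 3 + ε 5 + κ * (-(Q ^ 2 * t 1 * t 8 / (t 2 * t 5 * t 6))) = 0 := by
    have e : ε (-6) + ε (-2) + ε 3 - ε (-5) = -κ * (t (-8) * t 1 * t (-3) / (t (-6) * t (-2) * t 3
        * t (-5))) := h.four (-6) (-2) 3 (by decide) (by decide) (by decide) (by decide)
    have e' : t (-8) * t 1 * t (-3) / (t (-6) * t (-2) * t 3 * t (-5)) = -(Q ^ 2 * t 1 * t 8 /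
        (t 2 * t 5 * t 6)) := by
      simp only [t_m8, t_m6, t_m5, t_m3, t_m2]
      field_simp
    simp only [l_m6, l_m5, l_m2] at e
    rw [e'] at e
    linear_combination e
  have f11 : -ε 8 - ε 5 - ε 4 - ε 3 + κ * (-(t 7 * t 9 / (t 3 * t 4 * t 5))) = 0 := by
    have e : ε (-8) + ε (-5) + ε (-4) - ε (-17) = -κ * (t (-13) * t (-9) * t (-12) / (t (-8) *
        t (-5) * t (-4) * t (-17))) := h.four (-8) (-5) (-4) (by decide) (by decide) (by decide)
        (by decide)
    have e' : t (-13) * t (-9) * t (-12) / (t (-8) * t (-5) * t (-4) * t (-17)) = -(t 7 * t 9 /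
        (t 3 * t 4 * t 5)) := by
      simp only [t_m17, t_m13, t_m12, t_m9, t_m8, t_m5, t_m4, t_12, t_13, t_17]
      field_simp
    simp only [l_m17, l_m8, l_m5, l_m4, l_17] at e
    rw [e'] at e
    linear_combination e
  have f12 : -ε 7 - ε 6 - ε 5 - ε 2 + κ * (-(t 8 * t 9 / (t 2 * t 5 * t 6))) = 0 := by
    have e : ε (-7) + ε (-6) + ε (-5) - ε (-18) = -κ * (t (-13) * t (-11) * t (-12) / (t (-7) *
        t (-6) * t (-5) * t (-18))) := h.four (-7) (-6) (-5) (by decide) (by decide) (by decide)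
        (by decide)
    have e' : t (-13) * t (-11) * t (-12) / (t (-7) * t (-6) * t (-5) * t (-18)) = -(t 8 * t 9 /
        (t 2 * t 5 * t 6)) := by
      simp only [t_m18, t_m13, t_m12, t_m11, t_m7, t_m6, t_m5, t_11, t_12, t_13, t_18]
      field_simp
    simp only [l_m18, l_m7, l_m6, l_m5, l_18] at e
    rw [e'] at e
    linear_combination e
  have f13 : -ε 9 - ε 8 - ε 7 + ε 4 + κ * (Q ^ 4 * t 3 * t 5 / (t 7 * t 8 * t 9)) = 0 := by
    have e : ε (-9) + ε (-8) + ε (-7) - ε (-24) = -κ * (t (-17) * t (-15) * t (-16) / (t (-9) *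
        t (-8) * t (-7) * t (-24))) := h.four (-9) (-8) (-7) (by decide) (by decide) (by decide)
        (by decide)
    have e' : t (-17) * t (-15) * t (-16) / (t (-9) * t (-8) * t (-7) * t (-24)) = Q ^ 4 * t 3 *
        t 5 / (t 7 * t 8 * t 9) := by
      simp only [t_m24, t_m17, t_m16, t_m15, t_m9, t_m8, t_m7, t_m4, t_15, t_16, t_17, t_24]
      field_simp
    simp only [l_m24, l_m9, l_m8, l_m7, l_m4, l_24] at e
    rw [e'] at e
    linear_combination e
  -- These multipliers solve the linear system that eliminates every logarithmic derivative except
  -- `ε 4`.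
  linear_combination κ * e + 3/5 * f1 + 1/5 * f2 - 1/5 * f3 - 1/5 * f4 + 1/5 * f5 - 1/5 * f6 - 2/5
      * f7 - 1/5 * f8 - 3/5 * f9 - 3/5 * f10 - 1 * f11 + 2/5 * f12 + 2/5 * f13

/-- The components of exponent 1, 2, 3 and 4 modulo 5 contain no logarithmic derivatives: over the
common denominator, each is a polynomial combination of instances of Weierstrass' relation. -/
theorem level_twenty_first_one (h : ThetaNet 20 Q κ t ε) :
    -(2 / 5 * (t 9 * t 10 / (t 2 * t 5 * t 8))) - 2 / 5 * (Q ^ 2 * t 1 * t 10 / (t 2 * t 5 * t 8))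
      - 3 / 5 * (t 1 * t 9 * t 10 / (t 2 * t 3 * t 4 * t 5)) + 3 / 5 * (Q * t 1 * t 9 * t 10 /
      (t 2 * t 4 * t 5 * t 7)) - 1 / 5 * (Q * t 10 / (t 4 * t 6)) - Q * t 7 / (t 4 * t 5) + Q ^ 2
      * t 3 / (t 4 * t 5) + t 8 * t 9 / (t 4 ^ 2 * t 5) + Q ^ 2 * t 1 * t 8 / (t 4 ^ 2 * t 5) = 0
      := by
  have n2 : t 2 ≠ 0 := h.ne 2 (by decide)
  have n3 : t 3 ≠ 0 := h.ne 3 (by decide)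
  have n4 : t 4 ≠ 0 := h.ne 4 (by decide)
  have n5 : t 5 ≠ 0 := h.ne 5 (by decide)
  have n6 : t 6 ≠ 0 := h.ne 6 (by decide)
  have n7 : t 7 ≠ 0 := h.ne 7 (by decide)
  have n8 : t 8 ≠ 0 := h.ne 8 (by decide)
  have hQ := h.base_ne
  have r1 : -(Q * t 1 * t 4 * t 6 * t 7) + t 2 * t 5 * t 7 * t 8 - t 1 * t 6 * t 8 * t 9 = 0 := by
    have e : Q ^ 1 * (t 13 * t 1 * (t 6 * t 4)) - t 12 * t 2 * (t 7 * t 5) + t 8 * t 6 * (t 11 *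
      t 1) = 0 := h.three_nat 1 7 6 5 1 0 rfl
    rw [show t 11 = t 9 from h.refl 9, show t 12 = t 8 from h.refl 8, show t 13 = t 7 from h.refl
      7] at e
    linear_combination -1 * e
  have r2 : -(Q ^ 3 * t 1 * t 2 * t 4 * t 7) + t 4 * t 5 * t 7 * t 10 - t 3 * t 6 * t 8 * t 9 = 0
      := by
    have e : Q ^ 3 * (t 13 * t 1 * (t 4 * t 2)) - t 10 * t 4 * (t 7 * t 5) + t 8 * t 6 * (t 9 *
      t 3) = 0 := h.three_nat 3 7 6 3 1 0 rfl
    rw [show t 13 = t 7 from h.refl 7] at e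
    linear_combination -1 * e
  have r3 : -(Q ^ 3 * t 1 * t 4 ^ 2 * t 5) + t 4 * t 7 ^ 2 * t 8 - t 3 * t 8 ^ 2 * t 9 = 0 := by
    have e : Q ^ 3 * (t 15 * t 1 * (t 4 * t 4)) - t 12 * t 4 * (t 7 * t 7) + t 8 * t 8 * (t 11 *
      t 3) = 0 := h.three_nat 3 8 7 4 0 0 rfl
    rw [show t 11 = t 9 from h.refl 9, show t 12 = t 8 from h.refl 8, show t 15 = t 5 from h.refl
      5] at e
    linear_combination -1 * e
  have r4 : -(Q ^ 3 * t 1 * t 2 * t 3 * t 8) + t 4 * t 5 * t 6 * t 9 - t 3 * t 6 * t 7 * t 8 = 0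
      := by
    have e : Q ^ 3 * (t 12 * t 2 * (t 3 * t 1)) - t 9 * t 5 * (t 6 * t 4) + t 8 * t 6 * (t 7 *
      t 3) = 0 := h.three_nat 3 7 5 2 1 0 rfl
    rw [show t 12 = t 8 from h.refl 8] at e
    linear_combination -1 * e
  have r5 : -(Q * t 2 * t 4 * t 5 * t 7) + t 3 * t 5 * t 6 * t 8 - t 1 * t 7 * t 8 * t 10 = 0
      := by
    have e : Q ^ 1 * (t 13 * t 5 * (t 4 * t 2)) - t 12 * t 6 * (t 5 * t 3) + t 10 * t 8 * (t 7 *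
      t 1) = 0 := h.three_nat 1 9 4 3 1 0 rfl
    rw [show t 12 = t 8 from h.refl 8, show t 13 = t 7 from h.refl 7] at e
    linear_combination -1 * e
  have r6 : -(Q ^ 2 * t 2 ^ 2 * t 4 * t 8) + t 4 ^ 2 * t 6 * t 10 - t 2 * t 6 * t 8 ^ 2 = 0 := by
    have e : Q ^ 2 * (t 12 * t 4 * (t 2 * t 2)) - t 10 * t 6 * (t 4 * t 4) + t 8 * t 8 * (t 6 *
      t 2) = 0 := h.three_nat 2 8 4 2 0 0 rfl
    rw [show t 12 = t 8 from h.refl 8] at e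
    linear_combination -1 * e
  have r7 : -(Q ^ 4 * t 1 * t 2 * t 4 * t 5) + t 5 * t 6 * t 8 * t 9 - t 4 * t 7 * t 9 * t 10 = 0
      := by
    have e : Q ^ 4 * (t 15 * t 1 * (t 4 * t 2)) - t 11 * t 5 * (t 8 * t 6) + t 9 * t 7 * (t 10 *
      t 4) = 0 := h.three_nat 4 8 7 3 1 0 rfl
    rw [show t 11 = t 9 from h.refl 9, show t 15 = t 5 from h.refl 5] at e
    linear_combination -1 * e
  have r8 : -(Q ^ 2 * t 2 * t 3 * t 4 * t 7) + t 4 * t 5 * t 6 * t 9 - t 2 * t 7 * t 8 * t 9 = 0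
      := by
    have e : Q ^ 2 * (t 13 * t 3 * (t 4 * t 2)) - t 11 * t 5 * (t 6 * t 4) + t 9 * t 7 * (t 8 *
      t 2) = 0 := h.three_nat 2 8 5 3 1 0 rfl
    rw [show t 11 = t 9 from h.refl 9, show t 13 = t 7 from h.refl 7] at e
    linear_combination -1 * e
  have key : -(2 / 5 * t 3 * t 4 ^ 2 * t 6 * t 7 * t 9 * t 10) - 2 / 5 * Q ^ 2 * t 1 * t 3 *
      t 4 ^ 2 * t 6 * t 7 * t 10 - 3 / 5 * t 1 * t 4 * t 6 * t 7 * t 8 * t 9 * t 10 + 3 / 5 * Q *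
      t 1 * t 3 * t 4 * t 6 * t 8 * t 9 * t 10 - 1 / 5 * Q * t 2 * t 3 * t 4 * t 5 * t 7 * t 8 *
      t 10 - Q * t 2 * t 3 * t 4 * t 6 * t 7 ^ 2 * t 8 + Q ^ 2 * t 2 * t 3 ^ 2 * t 4 * t 6 * t 7 *
      t 8 + t 2 * t 3 * t 6 * t 7 * t 8 ^ 2 * t 9 + Q ^ 2 * t 1 * t 2 * t 3 * t 6 * t 7 * t 8 ^ 2
      = 0 := by
    linear_combination -(3 / 5 * Q * t 3 * t 4 * t 10) * r1 + 2 / 5 * Q * t 2 * t 3 * t 8 * r2 - 2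
      / 5 * Q * t 2 * t 3 * t 6 * r3 + 3 / 5 * Q * t 2 * t 4 * t 7 * r4 + 3 / 5 * t 4 * t 6 * t 9
      * r5 - Q ^ 2 * t 1 * t 3 * t 7 * r6 + 2 / 5 * t 3 * t 4 * t 6 * r7 - t 3 * t 6 * t 8 * r8
  have e : -(2 / 5 * (t 9 * t 10 / (t 2 * t 5 * t 8))) - 2 / 5 * (Q ^ 2 * t 1 * t 10 / (t 2 * t 5
      * t 8)) - 3 / 5 * (t 1 * t 9 * t 10 / (t 2 * t 3 * t 4 * t 5)) + 3 / 5 * (Q * t 1 * t 9 *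
      t 10 / (t 2 * t 4 * t 5 * t 7)) - 1 / 5 * (Q * t 10 / (t 4 * t 6)) - Q * t 7 / (t 4 * t 5) +
      Q ^ 2 * t 3 / (t 4 * t 5) + t 8 * t 9 / (t 4 ^ 2 * t 5) + Q ^ 2 * t 1 * t 8 / (t 4 ^ 2 *
      t 5) = (-(2 / 5 * t 3 * t 4 ^ 2 * t 6 * t 7 * t 9 * t 10) - 2 / 5 * Q ^ 2 * t 1 * t 3 *
      t 4 ^ 2 * t 6 * t 7 * t 10 - 3 / 5 * t 1 * t 4 * t 6 * t 7 * t 8 * t 9 * t 10 + 3 / 5 * Q *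
      t 1 * t 3 * t 4 * t 6 * t 8 * t 9 * t 10 - 1 / 5 * Q * t 2 * t 3 * t 4 * t 5 * t 7 * t 8 *
      t 10 - Q * t 2 * t 3 * t 4 * t 6 * t 7 ^ 2 * t 8 + Q ^ 2 * t 2 * t 3 ^ 2 * t 4 * t 6 * t 7 *
      t 8 + t 2 * t 3 * t 6 * t 7 * t 8 ^ 2 * t 9 + Q ^ 2 * t 1 * t 2 * t 3 * t 6 * t 7 * t 8 ^ 2)
      / (t 2 * t 3 * t 4 ^ 2 * t 5 * t 6 * t 7 * t 8) := by
    field_simp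
  rw [key, zero_div] at e
  exact e

theorem level_twenty_first_two (h : ThetaNet 20 Q κ t ε) :
    -(2 / 5 * (t 5 * t 6 * t 9 / (t 2 * t 3 * t 7 * t 8))) + 1 / 5 * (Q * t 2 * t 5 / (t 1 * t 4 *
      t 6)) - 2 / 5 * (Q ^ 2 * t 1 * t 5 * t 6 / (t 2 * t 3 * t 7 * t 8)) + 1 / 5 * (Q ^ 3 * t 2 *
      t 5 / (t 4 * t 6 * t 9)) + 2 / 5 * (t 7 * t 10 / (t 2 * t 5 * t 8)) - 2 / 5 * (Q * t 3 *
      t 10 / (t 2 * t 5 * t 8)) + 1 / 5 * (Q * t 3 * t 7 * t 10 / (t 1 * t 6 * t 8 * t 9)) = 0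
      := by
  have n1 : t 1 ≠ 0 := h.ne 1 (by decide)
  have n2 : t 2 ≠ 0 := h.ne 2 (by decide)
  have n3 : t 3 ≠ 0 := h.ne 3 (by decide)
  have n4 : t 4 ≠ 0 := h.ne 4 (by decide)
  have n5 : t 5 ≠ 0 := h.ne 5 (by decide)
  have n6 : t 6 ≠ 0 := h.ne 6 (by decide)
  have n7 : t 7 ≠ 0 := h.ne 7 (by decide)
  have n8 : t 8 ≠ 0 := h.ne 8 (by decide)
  have n9 : t 9 ≠ 0 := h.ne 9 (by decide)
  have hQ := h.base_ne
  have r1 : -(Q ^ 3 * t 1 * t 3 ^ 2 * t 7) + t 4 * t 6 ^ 2 * t 10 - t 3 * t 7 ^ 2 * t 9 = 0 := by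
    have e : Q ^ 3 * (t 13 * t 3 * (t 3 * t 1)) - t 10 * t 6 * (t 6 * t 4) + t 9 * t 7 * (t 7 *
      t 3) = 0 := h.three_nat 3 8 5 2 1 0 rfl
    rw [show t 13 = t 7 from h.refl 7] at e
    linear_combination -1 * e
  have r2 : -(Q ^ 4 * t 1 ^ 2 * t 4 * t 6) + t 5 ^ 2 * t 8 * t 10 - t 4 * t 6 * t 9 ^ 2 = 0 := by
    have e : Q ^ 4 * (t 14 * t 4 * (t 1 * t 1)) - t 10 * t 8 * (t 5 * t 5) + t 9 * t 9 * (t 6 *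
      t 4) = 0 := h.three_nat 4 9 5 1 0 0 rfl
    rw [show t 14 = t 6 from h.refl 6] at e
    linear_combination -1 * e
  have r3 : -(Q ^ 4 * t 1 ^ 2 * t 5 ^ 2) + t 5 ^ 2 * t 9 ^ 2 - t 4 * t 6 * t 10 ^ 2 = 0 := by
    have e : Q ^ 4 * (t 15 * t 5 * (t 1 * t 1)) - t 11 * t 9 * (t 5 * t 5) + t 10 * t 10 * (t 6 *
      t 4) = 0 := h.three_nat 4 10 5 1 0 0 rfl
    rw [show t 11 = t 9 from h.refl 9, show t 15 = t 5 from h.refl 5] at e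
    linear_combination -1 * e
  have r4 : -(Q ^ 3 * t 1 * t 3 * t 4 * t 6) + t 4 * t 6 * t 7 * t 9 - t 3 * t 7 * t 8 * t 10 = 0
      := by
    have e : Q ^ 3 * (t 14 * t 4 * (t 3 * t 1)) - t 11 * t 7 * (t 6 * t 4) + t 10 * t 8 * (t 7 *
      t 3) = 0 := h.three_nat 3 9 5 2 1 0 rfl
    rw [show t 11 = t 9 from h.refl 9, show t 14 = t 6 from h.refl 6] at e
    linear_combination -1 * e
  have r5 : -(Q ^ 3 * t 2 ^ 2 * t 5 ^ 2) + t 5 ^ 2 * t 8 ^ 2 - t 3 * t 7 * t 10 ^ 2 = 0 := by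
    have e : Q ^ 3 * (t 15 * t 5 * (t 2 * t 2)) - t 12 * t 8 * (t 5 * t 5) + t 10 * t 10 * (t 7 *
      t 3) = 0 := h.three_nat 3 10 5 2 0 0 rfl
    rw [show t 12 = t 8 from h.refl 8, show t 15 = t 5 from h.refl 5] at e
    linear_combination -1 * e
  have r6 : -(Q ^ 3 * t 2 ^ 2 * t 3 * t 7) + t 5 ^ 2 * t 6 * t 10 - t 3 * t 7 * t 8 ^ 2 = 0 := by
    have e : Q ^ 3 * (t 13 * t 3 * (t 2 * t 2)) - t 10 * t 6 * (t 5 * t 5) + t 8 * t 8 * (t 7 *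
      t 3) = 0 := h.three_nat 3 8 5 2 0 0 rfl
    rw [show t 13 = t 7 from h.refl 7] at e
    linear_combination -1 * e
  have r7 : -(Q ^ 3 * t 2 * t 3 * t 4 * t 5) + t 5 * t 6 * t 7 * t 8 - t 3 * t 8 * t 9 * t 10 = 0
      := by
    have e : Q ^ 3 * (t 15 * t 3 * (t 4 * t 2)) - t 12 * t 6 * (t 7 * t 5) + t 10 * t 8 * (t 9 *
      t 3) = 0 := h.three_nat 3 9 6 3 1 0 rfl
    rw [show t 12 = t 8 from h.refl 8, show t 15 = t 5 from h.refl 5] at e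
    linear_combination -1 * e
  have r8 : -(Q ^ 5 * t 1 * t 2 ^ 2 * t 5) + t 6 * t 7 ^ 2 * t 10 - t 5 * t 8 ^ 2 * t 9 = 0 := by
    have e : Q ^ 5 * (t 15 * t 1 * (t 2 * t 2)) - t 10 * t 6 * (t 7 * t 7) + t 8 * t 8 * (t 9 *
      t 5) = 0 := h.three_nat 5 8 7 2 0 0 rfl
    rw [show t 15 = t 5 from h.refl 5] at e
    linear_combination -1 * e
  -- The numerator is multiplied by an additional `Q ^ 2`: this multiple is a combination of the
  -- relations with polynomial coefficients. The factor is restored in the denominator of `e`.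
  have key : -(2 / 5 * Q ^ 2 * t 1 * t 4 * t 5 ^ 2 * t 6 ^ 2 * t 9 ^ 2) + 1 / 5 * Q ^ 3 * t 2 ^ 2
      * t 3 * t 5 ^ 2 * t 7 * t 8 * t 9 - 2 / 5 * Q ^ 4 * t 1 ^ 2 * t 4 * t 5 ^ 2 * t 6 ^ 2 * t 9
      + 1 / 5 * Q ^ 5 * t 1 * t 2 ^ 2 * t 3 * t 5 ^ 2 * t 7 * t 8 + 2 / 5 * Q ^ 2 * t 1 * t 3 *
      t 4 * t 6 * t 7 ^ 2 * t 9 * t 10 - 2 / 5 * Q ^ 3 * t 1 * t 3 ^ 2 * t 4 * t 6 * t 7 * t 9 *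
      t 10 + 1 / 5 * Q ^ 3 * t 2 * t 3 ^ 2 * t 4 * t 5 * t 7 ^ 2 * t 10 = 0 := by
    linear_combination -(1 / 5 * Q ^ 2 * t 1 * t 4 * t 6 * t 10) * r1 + 1 / 5 * Q ^ 2 * t 1 *
      t 5 ^ 2 * t 6 * r2 - 1 / 5 * Q ^ 2 * t 1 * t 4 * t 6 ^ 2 * r3 + 1 / 5 * Q ^ 2 * t 1 * t 3 *
      t 7 * t 10 * r4 - 1 / 5 * Q ^ 2 * t 1 * t 3 * t 7 * t 8 * r5 - 1 / 5 * Q ^ 2 * t 1 * t 5 ^ 2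
      * t 8 * r6 + 1 / 5 * t 3 * t 7 * t 9 * t 10 * r4 + 1 / 5 * t 5 ^ 2 * t 6 * t 9 * r2 + 1 / 5
      * t 4 * t 6 * t 9 * t 10 * r1 + 1 / 5 * t 4 * t 6 ^ 2 * t 9 * r3 - 1 / 5 * t 3 * t 7 ^ 2 *
      t 10 * r7 - 1 / 5 * t 5 ^ 2 * t 8 * t 9 * r6 + 1 / 5 * t 3 * t 5 * t 7 * t 8 * r8
  have e : -(2 / 5 * (t 5 * t 6 * t 9 / (t 2 * t 3 * t 7 * t 8))) + 1 / 5 * (Q * t 2 * t 5 / (t 1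
      * t 4 * t 6)) - 2 / 5 * (Q ^ 2 * t 1 * t 5 * t 6 / (t 2 * t 3 * t 7 * t 8)) + 1 / 5 * (Q ^ 3
      * t 2 * t 5 / (t 4 * t 6 * t 9)) + 2 / 5 * (t 7 * t 10 / (t 2 * t 5 * t 8)) - 2 / 5 * (Q *
      t 3 * t 10 / (t 2 * t 5 * t 8)) + 1 / 5 * (Q * t 3 * t 7 * t 10 / (t 1 * t 6 * t 8 * t 9)) =
      (-(2 / 5 * Q ^ 2 * t 1 * t 4 * t 5 ^ 2 * t 6 ^ 2 * t 9 ^ 2) + 1 / 5 * Q ^ 3 * t 2 ^ 2 * t 3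
      * t 5 ^ 2 * t 7 * t 8 * t 9 - 2 / 5 * Q ^ 4 * t 1 ^ 2 * t 4 * t 5 ^ 2 * t 6 ^ 2 * t 9 + 1 /
      5 * Q ^ 5 * t 1 * t 2 ^ 2 * t 3 * t 5 ^ 2 * t 7 * t 8 + 2 / 5 * Q ^ 2 * t 1 * t 3 * t 4 *
      t 6 * t 7 ^ 2 * t 9 * t 10 - 2 / 5 * Q ^ 3 * t 1 * t 3 ^ 2 * t 4 * t 6 * t 7 * t 9 * t 10 +
      1 / 5 * Q ^ 3 * t 2 * t 3 ^ 2 * t 4 * t 5 * t 7 ^ 2 * t 10) / (Q ^ 2 * t 1 * t 2 * t 3 * t 4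
      * t 5 * t 6 * t 7 * t 8 * t 9) := by
    field_simp
  rw [key, zero_div] at e
  exact e

theorem level_twenty_first_three (h : ThetaNet 20 Q κ t ε) :
    1 / 5 * (t 9 * t 10 / (t 4 * t 5 * t 6)) + 1 / 5 * (Q ^ 2 * t 1 * t 10 / (t 4 * t 5 * t 6)) +
      2 / 5 * (t 5 * t 6 / (t 2 * t 3 * t 8)) - 1 / 5 * (Q * t 2 * t 5 * t 7 / (t 1 * t 4 * t 6 *
      t 9)) - 2 / 5 * (Q * t 5 * t 6 / (t 2 * t 7 * t 8)) + 1 / 5 * (Q ^ 2 * t 2 * t 3 * t 5 /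
      (t 1 * t 4 * t 6 * t 9)) - 3 / 5 * (t 1 * t 9 * t 10 / (t 2 * t 3 * t 4 * t 7)) = 0 := by
  have n1 : t 1 ≠ 0 := h.ne 1 (by decide)
  have n2 : t 2 ≠ 0 := h.ne 2 (by decide)
  have n3 : t 3 ≠ 0 := h.ne 3 (by decide)
  have n4 : t 4 ≠ 0 := h.ne 4 (by decide)
  have n5 : t 5 ≠ 0 := h.ne 5 (by decide)
  have n6 : t 6 ≠ 0 := h.ne 6 (by decide)
  have n7 : t 7 ≠ 0 := h.ne 7 (by decide)
  have n8 : t 8 ≠ 0 := h.ne 8 (by decide)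
  have n9 : t 9 ≠ 0 := h.ne 9 (by decide)
  have hQ := h.base_ne
  have r1 : -(Q * t 2 * t 3 * t 5 * t 8) + t 3 * t 4 * t 6 * t 9 - t 1 * t 6 * t 8 * t 9 = 0 := by
    have e : Q ^ 1 * (t 12 * t 2 * (t 5 * t 3)) - t 11 * t 3 * (t 6 * t 4) + t 8 * t 6 * (t 9 *
      t 1) = 0 := h.three_nat 1 7 5 4 1 0 rfl
    rw [show t 11 = t 9 from h.refl 9, show t 12 = t 8 from h.refl 8] at e
    linear_combination -1 * e
  have r2 : -(Q ^ 2 * t 2 * t 3 * t 4 * t 7) + t 4 * t 5 * t 6 * t 9 - t 2 * t 7 * t 8 * t 9 = 0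
      := by
    have e : Q ^ 2 * (t 13 * t 3 * (t 4 * t 2)) - t 11 * t 5 * (t 6 * t 4) + t 9 * t 7 * (t 8 *
      t 2) = 0 := h.three_nat 2 8 5 3 1 0 rfl
    rw [show t 11 = t 9 from h.refl 9, show t 13 = t 7 from h.refl 7] at e
    linear_combination -1 * e
  have r3 : -(Q ^ 2 * t 1 * t 2 * t 4 * t 9) + t 3 * t 4 * t 6 * t 9 - t 2 * t 5 * t 7 * t 8 = 0
      := by
    have e : Q ^ 2 * (t 11 * t 1 * (t 4 * t 2)) - t 9 * t 3 * (t 6 * t 4) + t 7 * t 5 * (t 8 *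
      t 2) = 0 := h.three_nat 2 6 5 3 1 0 rfl
    rw [show t 11 = t 9 from h.refl 9] at e
    linear_combination -1 * e
  have r4 : -(Q ^ 3 * t 2 * t 3 * t 4 * t 5) + t 5 * t 6 * t 7 * t 8 - t 3 * t 8 * t 9 * t 10 = 0
      := by
    have e : Q ^ 3 * (t 15 * t 3 * (t 4 * t 2)) - t 12 * t 6 * (t 7 * t 5) + t 10 * t 8 * (t 9 *
      t 3) = 0 := h.three_nat 3 9 6 3 1 0 rfl
    rw [show t 12 = t 8 from h.refl 8, show t 15 = t 5 from h.refl 5] at e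
    linear_combination -1 * e
  have r5 : -(Q * t 3 * t 4 * t 5 * t 6) + t 4 * t 5 * t 6 * t 7 - t 1 * t 8 * t 9 * t 10 = 0
      := by
    have e : Q ^ 1 * (t 14 * t 4 * (t 5 * t 3)) - t 13 * t 5 * (t 6 * t 4) + t 10 * t 8 * (t 9 *
      t 1) = 0 := h.three_nat 1 9 5 4 1 0 rfl
    rw [show t 13 = t 7 from h.refl 7, show t 14 = t 6 from h.refl 6] at e
    linear_combination -1 * e
  have key : 1 / 5 * t 1 * t 2 * t 3 * t 7 * t 8 * t 9 ^ 2 * t 10 + 1 / 5 * Q ^ 2 * t 1 ^ 2 * t 2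
      * t 3 * t 7 * t 8 * t 9 * t 10 + 2 / 5 * t 1 * t 4 * t 5 ^ 2 * t 6 ^ 2 * t 7 * t 9 - 1 / 5 *
      Q * t 2 ^ 2 * t 3 * t 5 ^ 2 * t 7 ^ 2 * t 8 - 2 / 5 * Q * t 1 * t 3 * t 4 * t 5 ^ 2 *
      t 6 ^ 2 * t 9 + 1 / 5 * Q ^ 2 * t 2 ^ 2 * t 3 ^ 2 * t 5 ^ 2 * t 7 * t 8 - 3 / 5 * t 1 ^ 2 *
      t 5 * t 6 * t 8 * t 9 ^ 2 * t 10 = 0 := by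
    linear_combination -(1 / 5 * Q * t 2 * t 3 * t 5 * t 7) * r1 + 1 / 5 * Q * t 1 * t 3 * t 5 *
      t 6 * r2 + 1 / 5 * Q * t 2 * t 3 * t 5 * t 7 * r3 - 1 / 5 * t 1 * t 2 * t 7 * t 9 * r4 - 1 /
      5 * Q ^ 2 * t 1 * t 2 * t 3 * t 7 * r5 - 1 / 5 * t 1 * t 5 * t 6 * t 7 * r2 + 3 / 5 * t 1 *
      t 5 * t 6 * t 9 * r5
  have e : 1 / 5 * (t 9 * t 10 / (t 4 * t 5 * t 6)) + 1 / 5 * (Q ^ 2 * t 1 * t 10 / (t 4 * t 5 *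
      t 6)) + 2 / 5 * (t 5 * t 6 / (t 2 * t 3 * t 8)) - 1 / 5 * (Q * t 2 * t 5 * t 7 / (t 1 * t 4
      * t 6 * t 9)) - 2 / 5 * (Q * t 5 * t 6 / (t 2 * t 7 * t 8)) + 1 / 5 * (Q ^ 2 * t 2 * t 3 *
      t 5 / (t 1 * t 4 * t 6 * t 9)) - 3 / 5 * (t 1 * t 9 * t 10 / (t 2 * t 3 * t 4 * t 7)) = (1 /
      5 * t 1 * t 2 * t 3 * t 7 * t 8 * t 9 ^ 2 * t 10 + 1 / 5 * Q ^ 2 * t 1 ^ 2 * t 2 * t 3 * t 7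
      * t 8 * t 9 * t 10 + 2 / 5 * t 1 * t 4 * t 5 ^ 2 * t 6 ^ 2 * t 7 * t 9 - 1 / 5 * Q * t 2 ^ 2
      * t 3 * t 5 ^ 2 * t 7 ^ 2 * t 8 - 2 / 5 * Q * t 1 * t 3 * t 4 * t 5 ^ 2 * t 6 ^ 2 * t 9 + 1
      / 5 * Q ^ 2 * t 2 ^ 2 * t 3 ^ 2 * t 5 ^ 2 * t 7 * t 8 - 3 / 5 * t 1 ^ 2 * t 5 * t 6 * t 8 *
      t 9 ^ 2 * t 10) / (t 1 * t 2 * t 3 * t 4 * t 5 * t 6 * t 7 * t 8 * t 9) := by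
    field_simp
  rw [key, zero_div] at e
  exact e

theorem level_twenty_first_four (h : ThetaNet 20 Q κ t ε) :
    -(1 / 5 * (t 3 * t 7 * t 10 / (t 1 * t 5 * t 6 * t 8))) - 1 / 5 * (Q ^ 2 * t 3 * t 7 * t 10 /
      (t 5 * t 6 * t 8 * t 9)) - 1 / 5 * (t 7 * t 10 / (t 4 * t 5 * t 6)) + 1 / 5 * (Q * t 3 *
      t 10 / (t 4 * t 5 * t 6)) + 2 / 5 * (t 10 / (t 2 * t 8)) = 0 := by
  have n1 : t 1 ≠ 0 := h.ne 1 (by decide)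
  have n2 : t 2 ≠ 0 := h.ne 2 (by decide)
  have n4 : t 4 ≠ 0 := h.ne 4 (by decide)
  have n5 : t 5 ≠ 0 := h.ne 5 (by decide)
  have n6 : t 6 ≠ 0 := h.ne 6 (by decide)
  have n8 : t 8 ≠ 0 := h.ne 8 (by decide)
  have n9 : t 9 ≠ 0 := h.ne 9 (by decide)
  have n10 : t 10 ≠ 0 := h.ne 10 (by decide)
  have hQ := h.base_ne
  have r1 : -(Q ^ 2 * t 2 * t 3 * t 4 * t 7) + t 4 * t 5 * t 6 * t 9 - t 2 * t 7 * t 8 * t 9 = 0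
      := by
    have e : Q ^ 2 * (t 13 * t 3 * (t 4 * t 2)) - t 11 * t 5 * (t 6 * t 4) + t 9 * t 7 * (t 8 *
      t 2) = 0 := h.three_nat 2 8 5 3 1 0 rfl
    rw [show t 11 = t 9 from h.refl 9, show t 13 = t 7 from h.refl 7] at e
    linear_combination -1 * e
  have r2 : -(Q * t 1 * t 2 * t 3 * t 8) + t 2 * t 3 * t 4 * t 7 - t 1 * t 4 * t 5 * t 6 = 0 := by
    have e : Q ^ 1 * (t 8 * t 2 * (t 3 * t 1)) - t 7 * t 3 * (t 4 * t 2) + t 6 * t 4 * (t 5 * t 1)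
      = 0 := h.three_nat 1 5 3 2 1 0 rfl
    linear_combination -1 * e
  have key : -(1 / 5 * t 2 * t 3 * t 4 * t 7 * t 9) - 1 / 5 * Q ^ 2 * t 1 * t 2 * t 3 * t 4 * t 7
      - 1 / 5 * t 1 * t 2 * t 7 * t 8 * t 9 + 1 / 5 * Q * t 1 * t 2 * t 3 * t 8 * t 9 + 2 / 5 *
      t 1 * t 4 * t 5 * t 6 * t 9 = 0 := by
    linear_combination 1 / 5 * t 1 * r1 - 1 / 5 * t 9 * r2
  have e : -(1 / 5 * (t 3 * t 7 * t 10 / (t 1 * t 5 * t 6 * t 8))) - 1 / 5 * (Q ^ 2 * t 3 * t 7 *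
      t 10 / (t 5 * t 6 * t 8 * t 9)) - 1 / 5 * (t 7 * t 10 / (t 4 * t 5 * t 6)) + 1 / 5 * (Q *
      t 3 * t 10 / (t 4 * t 5 * t 6)) + 2 / 5 * (t 10 / (t 2 * t 8)) = t 10 * (-(1 / 5 * t 2 * t 3
      * t 4 * t 7 * t 9) - 1 / 5 * Q ^ 2 * t 1 * t 2 * t 3 * t 4 * t 7 - 1 / 5 * t 1 * t 2 * t 7 *
      t 8 * t 9 + 1 / 5 * Q * t 1 * t 2 * t 3 * t 8 * t 9 + 2 / 5 * t 1 * t 4 * t 5 * t 6 * t 9) /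
      (t 1 * t 2 * t 4 * t 5 * t 6 * t 8 * t 9) := by
    field_simp
  rw [key, mul_zero, zero_div] at e
  exact e

/-- Same role as `level_twenty_first_zero`, for the series with `k = 2`; its two target Appell sums
leave the single logarithmic derivative `ε 8`. -/
theorem level_twenty_second_zero (h : ThetaNet 20 Q κ t ε) :
    κ * (-(1 / 5 * (t 1 * t 9 ^ 2 * t 10 / (t 2 * t 3 * t 4 * t 5 * t 7))) - 1 / 5 * (Q ^ 2 *
      t 1 ^ 2 * t 9 * t 10 / (t 2 * t 3 * t 4 * t 5 * t 7)) + 3 / 5 * (Q * t 3 * t 7 ^ 2 * t 10 /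
      (t 1 * t 5 * t 6 * t 8 * t 9)) - 3 / 5 * (Q ^ 2 * t 3 ^ 2 * t 7 * t 10 / (t 1 * t 5 * t 6 *
      t 8 * t 9)) + 1 / 5 * (Q * t 5 ^ 2 * t 6 / (t 2 * t 3 * t 7 * t 8)) + 2 / 5 * (Q ^ 2 * t 2 *
      t 5 ^ 2 / (t 1 * t 4 * t 6 * t 9)) - Q * t 9 / (t 4 * t 5) - Q ^ 3 * t 1 / (t 4 * t 5)) - 2
      * ε 8 = 0 := by
  have n1 : t 1 ≠ 0 := h.ne 1 (by decide)
  have n2 : t 2 ≠ 0 := h.ne 2 (by decide)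
  have n3 : t 3 ≠ 0 := h.ne 3 (by decide)
  have n4 : t 4 ≠ 0 := h.ne 4 (by decide)
  have n5 : t 5 ≠ 0 := h.ne 5 (by decide)
  have n6 : t 6 ≠ 0 := h.ne 6 (by decide)
  have n7 : t 7 ≠ 0 := h.ne 7 (by decide)
  have n8 : t 8 ≠ 0 := h.ne 8 (by decide)
  have n9 : t 9 ≠ 0 := h.ne 9 (by decide)
  have hQ := h.base_ne
  have r1 : -(Q * t 3 * t 4 * t 5 * t 6) + t 4 * t 5 * t 6 * t 7 - t 1 * t 8 * t 9 * t 10 = 0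
      := by
    have e : Q ^ 1 * (t 14 * t 4 * (t 5 * t 3)) - t 13 * t 5 * (t 6 * t 4) + t 10 * t 8 * (t 9 *
      t 1) = 0 := h.three_nat 1 9 5 4 1 0 rfl
    rw [show t 13 = t 7 from h.refl 7, show t 14 = t 6 from h.refl 6] at e
    linear_combination -1 * e
  have r2 : -(Q ^ 2 * t 2 * t 3 * t 4 * t 7) + t 4 * t 5 * t 6 * t 9 - t 2 * t 7 * t 8 * t 9 = 0
      := by
    have e : Q ^ 2 * (t 13 * t 3 * (t 4 * t 2)) - t 11 * t 5 * (t 6 * t 4) + t 9 * t 7 * (t 8 *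
      t 2) = 0 := h.three_nat 2 8 5 3 1 0 rfl
    rw [show t 11 = t 9 from h.refl 9, show t 13 = t 7 from h.refl 7] at e
    linear_combination -1 * e
  have r3 : -(Q ^ 3 * t 1 * t 2 * t 3 * t 8) + t 4 * t 5 * t 6 * t 9 - t 3 * t 6 * t 7 * t 8 = 0
      := by
    have e : Q ^ 3 * (t 12 * t 2 * (t 3 * t 1)) - t 9 * t 5 * (t 6 * t 4) + t 8 * t 6 * (t 7 *
      t 3) = 0 := h.three_nat 3 7 5 2 1 0 rfl
    rw [show t 12 = t 8 from h.refl 8] at e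
    linear_combination -1 * e
  have r4 : -(Q ^ 2 * t 1 * t 2 * t 5 * t 8) + t 3 * t 4 * t 7 * t 10 - t 2 * t 5 * t 8 * t 9 = 0
      := by
    have e : Q ^ 2 * (t 12 * t 2 * (t 5 * t 1)) - t 10 * t 4 * (t 7 * t 3) + t 9 * t 5 * (t 8 *
      t 2) = 0 := h.three_nat 2 7 5 3 2 0 rfl
    rw [show t 12 = t 8 from h.refl 8] at e
    linear_combination -1 * e
  have r5 : -(Q ^ 2 * t 2 ^ 2 * t 5 * t 7) + t 4 ^ 2 * t 7 * t 9 - t 2 * t 6 * t 9 ^ 2 = 0 := by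
    have e : Q ^ 2 * (t 13 * t 5 * (t 2 * t 2)) - t 11 * t 7 * (t 4 * t 4) + t 9 * t 9 * (t 6 *
      t 2) = 0 := h.three_nat 2 9 4 2 0 0 rfl
    rw [show t 11 = t 9 from h.refl 9, show t 13 = t 7 from h.refl 7] at e
    linear_combination -1 * e
  have r6 : -(Q ^ 3 * t 2 * t 3 ^ 2 * t 6) + t 5 * t 6 ^ 2 * t 9 - t 3 * t 8 ^ 2 * t 9 = 0 := by
    have e : Q ^ 3 * (t 14 * t 2 * (t 3 * t 3)) - t 11 * t 5 * (t 6 * t 6) + t 8 * t 8 * (t 9 *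
      t 3) = 0 := h.three_nat 3 8 6 3 0 0 rfl
    rw [show t 11 = t 9 from h.refl 9, show t 14 = t 6 from h.refl 6] at e
    linear_combination -1 * e
  have r7 : -(Q * t 2 * t 3 * t 5 * t 8) + t 3 * t 4 * t 6 * t 9 - t 1 * t 6 * t 8 * t 9 = 0 := by
    have e : Q ^ 1 * (t 12 * t 2 * (t 5 * t 3)) - t 11 * t 3 * (t 6 * t 4) + t 8 * t 6 * (t 9 *
      t 1) = 0 := h.three_nat 1 7 5 4 1 0 rfl
    rw [show t 11 = t 9 from h.refl 9, show t 12 = t 8 from h.refl 8] at e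
    linear_combination -1 * e
  have r8 : -(Q ^ 2 * t 1 * t 4 * t 5 * t 6) + t 3 * t 6 * t 7 * t 8 - t 2 * t 7 * t 8 * t 9 = 0
      := by
    have e : Q ^ 2 * (t 14 * t 4 * (t 5 * t 1)) - t 12 * t 6 * (t 7 * t 3) + t 11 * t 7 * (t 8 *
      t 2) = 0 := h.three_nat 2 9 5 3 2 0 rfl
    rw [show t 11 = t 9 from h.refl 9, show t 12 = t 8 from h.refl 8, show t 14 = t 6 from h.refl
      6] at e
    linear_combination -1 * e
  have key : -(1 / 5 * t 1 ^ 2 * t 6 * t 8 * t 9 ^ 3 * t 10) - 1 / 5 * Q ^ 2 * t 1 ^ 3 * t 6 * t 8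
      * t 9 ^ 2 * t 10 + 3 / 5 * Q * t 2 * t 3 ^ 2 * t 4 * t 7 ^ 3 * t 10 - 3 / 5 * Q ^ 2 * t 2 *
      t 3 ^ 3 * t 4 * t 7 ^ 2 * t 10 + 1 / 5 * Q * t 1 * t 4 * t 5 ^ 3 * t 6 ^ 2 * t 9 + 2 / 5 *
      Q ^ 2 * t 2 ^ 2 * t 3 * t 5 ^ 3 * t 7 * t 8 - Q * t 1 * t 2 * t 3 * t 6 * t 7 * t 8 *
      t 9 ^ 2 - Q ^ 3 * t 1 ^ 2 * t 2 * t 3 * t 6 * t 7 * t 8 * t 9 - 1 / 5 * Q * t 1 * t 3 * t 4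
      * t 5 * t 6 ^ 2 * t 9 ^ 2 + 1 / 5 * Q ^ 2 * t 1 ^ 2 * t 4 * t 5 * t 6 ^ 2 * t 7 * t 9 - 6 /
      5 * Q ^ 5 * t 1 ^ 2 * t 2 * t 3 ^ 2 * t 4 * t 6 * t 7 - 3 / 5 * Q * t 2 ^ 2 * t 3 * t 5 *
      t 7 ^ 2 * t 8 * t 9 - 3 / 5 * Q * t 1 * t 3 * t 4 ^ 2 * t 7 ^ 2 * t 8 * t 9 - 1 / 5 * Q *
      t 1 * t 3 * t 4 * t 5 ^ 2 * t 8 ^ 2 * t 9 + 2 / 5 * t 2 * t 3 * t 5 ^ 2 * t 6 * t 8 *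
      t 9 ^ 2 + 3 / 5 * Q * t 2 * t 3 ^ 2 * t 4 * t 6 * t 7 * t 9 ^ 2 + Q * t 1 * t 3 ^ 2 *
      t 6 ^ 2 * t 7 * t 8 * t 9 + 1 / 5 * t 1 * t 3 * t 6 ^ 2 * t 7 ^ 2 * t 8 * t 9 + 3 / 5 *
      Q ^ 4 * t 1 * t 2 ^ 2 * t 3 ^ 2 * t 5 * t 7 * t 8 - 2 / 5 * t 3 * t 4 ^ 2 * t 5 ^ 2 * t 7 *
      t 8 * t 9 - 1 / 5 * Q ^ 4 * t 1 * t 2 * t 3 ^ 2 * t 4 * t 5 ^ 2 * t 6 = 0 := by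
    linear_combination 1 / 5 * t 1 * t 6 * t 9 ^ 2 * r1 + 1 / 5 * Q ^ 2 * t 1 ^ 2 * t 6 * t 9 * r1
      + 6 / 5 * Q ^ 3 * t 1 ^ 2 * t 3 * t 6 * r2 - 1 / 5 * t 1 * t 6 * t 7 * t 9 * r3 + 3 / 5 * Q
      * t 2 * t 3 * t 7 ^ 2 * r4 - 3 / 5 * Q * t 1 * t 3 * t 7 * t 8 * r5 + 1 / 5 * Q * t 1 * t 4
      * t 5 ^ 2 * r6 - 2 / 5 * t 3 * t 5 ^ 2 * t 8 * r5 + 3 / 5 * Q * t 2 * t 3 * t 7 * t 9 * r7 -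
      3 / 5 * Q ^ 2 * t 2 * t 3 ^ 2 * t 7 * r4 + Q * t 1 * t 3 * t 6 * t 9 * r8
  have e : -(1 / 5 * (t 1 * t 9 ^ 2 * t 10 / (t 2 * t 3 * t 4 * t 5 * t 7))) - 1 / 5 * (Q ^ 2 *
      t 1 ^ 2 * t 9 * t 10 / (t 2 * t 3 * t 4 * t 5 * t 7)) + 3 / 5 * (Q * t 3 * t 7 ^ 2 * t 10 /
      (t 1 * t 5 * t 6 * t 8 * t 9)) - 3 / 5 * (Q ^ 2 * t 3 ^ 2 * t 7 * t 10 / (t 1 * t 5 * t 6 *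
      t 8 * t 9)) + 1 / 5 * (Q * t 5 ^ 2 * t 6 / (t 2 * t 3 * t 7 * t 8)) + 2 / 5 * (Q ^ 2 * t 2 *
      t 5 ^ 2 / (t 1 * t 4 * t 6 * t 9)) - Q * t 9 / (t 4 * t 5) - Q ^ 3 * t 1 / (t 4 * t 5) - 1 /
      5 * (Q * t 6 * t 9 / (t 2 * t 7 * t 8)) + 1 / 5 * (Q ^ 2 * t 1 * t 6 / (t 2 * t 3 * t 8)) -
      6 / 5 * (Q ^ 5 * t 1 * t 3 / (t 5 * t 8 * t 9)) - 3 / 5 * (Q * t 2 * t 7 / (t 1 * t 4 *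
      t 6)) - 3 / 5 * (Q * t 4 * t 7 / (t 2 * t 5 * t 6)) - 1 / 5 * (Q * t 5 * t 8 / (t 2 * t 6 *
      t 7)) + 2 / 5 * (t 5 * t 9 / (t 1 * t 4 * t 7)) + 3 / 5 * (Q * t 3 * t 9 / (t 1 * t 5 *
      t 8)) + Q * t 3 * t 6 / (t 2 * t 4 * t 5) + 1 / 5 * (t 6 * t 7 / (t 2 * t 4 * t 5)) + 3 / 5
      * (Q ^ 4 * t 2 * t 3 / (t 4 * t 6 * t 9)) - 2 / 5 * (t 4 * t 5 / (t 1 * t 2 * t 6)) - 1 / 5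
      * (Q ^ 4 * t 3 * t 5 / (t 7 * t 8 * t 9)) = (-(1 / 5 * t 1 ^ 2 * t 6 * t 8 * t 9 ^ 3 * t 10)
      - 1 / 5 * Q ^ 2 * t 1 ^ 3 * t 6 * t 8 * t 9 ^ 2 * t 10 + 3 / 5 * Q * t 2 * t 3 ^ 2 * t 4 *
      t 7 ^ 3 * t 10 - 3 / 5 * Q ^ 2 * t 2 * t 3 ^ 3 * t 4 * t 7 ^ 2 * t 10 + 1 / 5 * Q * t 1 *
      t 4 * t 5 ^ 3 * t 6 ^ 2 * t 9 + 2 / 5 * Q ^ 2 * t 2 ^ 2 * t 3 * t 5 ^ 3 * t 7 * t 8 - Q *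
      t 1 * t 2 * t 3 * t 6 * t 7 * t 8 * t 9 ^ 2 - Q ^ 3 * t 1 ^ 2 * t 2 * t 3 * t 6 * t 7 * t 8
      * t 9 - 1 / 5 * Q * t 1 * t 3 * t 4 * t 5 * t 6 ^ 2 * t 9 ^ 2 + 1 / 5 * Q ^ 2 * t 1 ^ 2 *
      t 4 * t 5 * t 6 ^ 2 * t 7 * t 9 - 6 / 5 * Q ^ 5 * t 1 ^ 2 * t 2 * t 3 ^ 2 * t 4 * t 6 * t 7
      - 3 / 5 * Q * t 2 ^ 2 * t 3 * t 5 * t 7 ^ 2 * t 8 * t 9 - 3 / 5 * Q * t 1 * t 3 * t 4 ^ 2 *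
      t 7 ^ 2 * t 8 * t 9 - 1 / 5 * Q * t 1 * t 3 * t 4 * t 5 ^ 2 * t 8 ^ 2 * t 9 + 2 / 5 * t 2 *
      t 3 * t 5 ^ 2 * t 6 * t 8 * t 9 ^ 2 + 3 / 5 * Q * t 2 * t 3 ^ 2 * t 4 * t 6 * t 7 * t 9 ^ 2
      + Q * t 1 * t 3 ^ 2 * t 6 ^ 2 * t 7 * t 8 * t 9 + 1 / 5 * t 1 * t 3 * t 6 ^ 2 * t 7 ^ 2 *
      t 8 * t 9 + 3 / 5 * Q ^ 4 * t 1 * t 2 ^ 2 * t 3 ^ 2 * t 5 * t 7 * t 8 - 2 / 5 * t 3 *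
      t 4 ^ 2 * t 5 ^ 2 * t 7 * t 8 * t 9 - 1 / 5 * Q ^ 4 * t 1 * t 2 * t 3 ^ 2 * t 4 * t 5 ^ 2 *
      t 6) / (t 1 * t 2 * t 3 * t 4 * t 5 * t 6 * t 7 * t 8 * t 9) := by
    field_simp
  rw [key, zero_div] at e
  have t_m24 : t (-24) = -(Q ^ 24)⁻¹ * t 24 := h.neg_nat 24
  have t_m19 : t (-19) = -(Q ^ 19)⁻¹ * t 19 := h.neg_nat 19
  have t_m18 : t (-18) = -(Q ^ 18)⁻¹ * t 18 := h.neg_nat 18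
  have t_m17 : t (-17) = -(Q ^ 17)⁻¹ * t 17 := h.neg_nat 17
  have t_m16 : t (-16) = -(Q ^ 16)⁻¹ * t 16 := h.neg_nat 16
  have t_m15 : t (-15) = -(Q ^ 15)⁻¹ * t 15 := h.neg_nat 15
  have t_m14 : t (-14) = -(Q ^ 14)⁻¹ * t 14 := h.neg_nat 14
  have t_m13 : t (-13) = -(Q ^ 13)⁻¹ * t 13 := h.neg_nat 13
  have t_m12 : t (-12) = -(Q ^ 12)⁻¹ * t 12 := h.neg_nat 12
  have t_m11 : t (-11) = -(Q ^ 11)⁻¹ * t 11 := h.neg_nat 11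
  have t_m9 : t (-9) = -(Q ^ 9)⁻¹ * t 9 := h.neg_nat 9
  have t_m8 : t (-8) = -(Q ^ 8)⁻¹ * t 8 := h.neg_nat 8
  have t_m7 : t (-7) = -(Q ^ 7)⁻¹ * t 7 := h.neg_nat 7
  have t_m6 : t (-6) = -(Q ^ 6)⁻¹ * t 6 := h.neg_nat 6
  have t_m5 : t (-5) = -(Q ^ 5)⁻¹ * t 5 := h.neg_nat 5
  have t_m4 : t (-4) = -(Q ^ 4)⁻¹ * t 4 := h.neg_nat 4
  have t_m3 : t (-3) = -(Q ^ 3)⁻¹ * t 3 := h.neg_nat 3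
  have t_m2 : t (-2) = -(Q ^ 2)⁻¹ * t 2 := h.neg_nat 2
  have t_m1 : t (-1) = -(Q ^ 1)⁻¹ * t 1 := h.neg_nat 1
  have t_11 : t 11 = t 9 := h.refl 9
  have t_12 : t 12 = t 8 := h.refl 8
  have t_13 : t 13 = t 7 := h.refl 7
  have t_14 : t 14 = t 6 := h.refl 6
  have t_15 : t 15 = t 5 := h.refl 5
  have t_16 : t 16 = t 4 := h.refl 4
  have t_17 : t 17 = t 3 := h.refl 3
  have t_18 : t 18 = t 2 := h.refl 2
  have t_19 : t 19 = t 1 := h.refl 1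
  have t_24 : t 24 = t (-4) := (h.refl 24).symm
  have l_m24 : ε (-24) = -ε 24 := h.log_neg 24 (by decide)
  have l_m19 : ε (-19) = -ε 19 := h.log_neg 19 (by decide)
  have l_m18 : ε (-18) = -ε 18 := h.log_neg 18 (by decide)
  have l_m9 : ε (-9) = -ε 9 := h.log_neg 9 (by decide)
  have l_m8 : ε (-8) = -ε 8 := h.log_neg 8 (by decide)
  have l_m7 : ε (-7) = -ε 7 := h.log_neg 7 (by decide)
  have l_m6 : ε (-6) = -ε 6 := h.log_neg 6 (by decide)
  have l_m5 : ε (-5) = -ε 5 := h.log_neg 5 (by decide)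
  have l_m4 : ε (-4) = -ε 4 := h.log_neg 4 (by decide)
  have l_m3 : ε (-3) = -ε 3 := h.log_neg 3 (by decide)
  have l_m2 : ε (-2) = -ε 2 := h.log_neg 2 (by decide)
  have l_m1 : ε (-1) = -ε 1 := h.log_neg 1 (by decide)
  have l_18 : ε 18 = -ε 2 := h.log_refl_of (by norm_num) (by decide)
  have l_19 : ε 19 = -ε 1 := h.log_refl_of (by norm_num) (by decide)
  have l_24 : ε 24 = -ε (-4) := h.log_refl_of (by norm_num) (by decide)
  have f1 : -ε 8 - ε 1 + ε 2 + ε 7 + κ * (-(Q * t 6 * t 9 / (t 2 * t 7 * t 8))) = 0 := by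
    have e : ε (-8) + ε (-1) + ε 2 - ε (-7) = -κ * (t (-9) * t 1 * t (-6) / (t (-8) * t (-1) * t 2
        * t (-7))) := h.four (-8) (-1) 2 (by decide) (by decide) (by decide) (by decide)
    have e' : t (-9) * t 1 * t (-6) / (t (-8) * t (-1) * t 2 * t (-7)) = -(Q * t 6 * t 9 / (t 2 *
        t 7 * t 8)) := by
      simp only [t_m9, t_m8, t_m7, t_m6, t_m1]
      field_simp
    simp only [l_m8, l_m7, l_m1] at e
    rw [e'] at e
    linear_combination e
  have f2 : -ε 9 - ε 2 + ε 3 + ε 8 + κ * (-(Q ^ 2 * t 1 * t 6 / (t 2 * t 3 * t 8))) = 0 := by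
    have e : ε (-9) + ε (-2) + ε 3 - ε (-8) = -κ * (t (-11) * t 1 * t (-6) / (t (-9) * t (-2) *
        t 3 * t (-8))) := h.four (-9) (-2) 3 (by decide) (by decide) (by decide) (by decide)
    have e' : t (-11) * t 1 * t (-6) / (t (-9) * t (-2) * t 3 * t (-8)) = -(Q ^ 2 * t 1 * t 6 /
        (t 2 * t 3 * t 8)) := by
      simp only [t_m11, t_m9, t_m8, t_m6, t_m2, t_11]
      field_simp
    simp only [l_m9, l_m8, l_m2] at e
    rw [e'] at e
    linear_combination e
  have f3 : -ε 9 - ε 5 + ε 6 + ε 8 + κ * (-(Q ^ 5 * t 1 * t 3 / (t 5 * t 8 * t 9))) = 0 := by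
    have e : ε (-9) + ε (-5) + ε 6 - ε (-8) = -κ * (t (-14) * t 1 * t (-3) / (t (-9) * t (-5) *
        t 6 * t (-8))) := h.four (-9) (-5) 6 (by decide) (by decide) (by decide) (by decide)
    have e' : t (-14) * t 1 * t (-3) / (t (-9) * t (-5) * t 6 * t (-8)) = -(Q ^ 5 * t 1 * t 3 /
        (t 5 * t 8 * t 9)) := by
      simp only [t_m14, t_m9, t_m8, t_m5, t_m3, t_14]
      field_simp
    simp only [l_m9, l_m8, l_m5] at e
    rw [e'] at e
    linear_combination e
  have f4 : -ε 6 - ε 1 + ε 3 + ε 4 + κ * (-(Q * t 2 * t 7 / (t 1 * t 4 * t 6))) = 0 := by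
    have e : ε (-6) + ε (-1) + ε 3 - ε (-4) = -κ * (t (-7) * t 2 * t (-3) / (t (-6) * t (-1) * t 3
        * t (-4))) := h.four (-6) (-1) 3 (by decide) (by decide) (by decide) (by decide)
    have e' : t (-7) * t 2 * t (-3) / (t (-6) * t (-1) * t 3 * t (-4)) = -(Q * t 2 * t 7 / (t 1 *
        t 4 * t 6)) := by
      simp only [t_m7, t_m6, t_m4, t_m3, t_m1]
      field_simp
    simp only [l_m6, l_m4, l_m1] at e
    rw [e'] at e
    linear_combination e
  have f5 : -ε 6 - ε 1 + ε 2 + ε 5 + κ * (-(Q * t 4 * t 7 / (t 2 * t 5 * t 6))) = 0 := by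
    have e : ε (-6) + ε (-1) + ε 2 - ε (-5) = -κ * (t (-7) * t 1 * t (-4) / (t (-6) * t (-1) * t 2
        * t (-5))) := h.four (-6) (-1) 2 (by decide) (by decide) (by decide) (by decide)
    have e' : t (-7) * t 1 * t (-4) / (t (-6) * t (-1) * t 2 * t (-5)) = -(Q * t 4 * t 7 / (t 2 *
        t 5 * t 6)) := by
      simp only [t_m7, t_m6, t_m5, t_m4, t_m1]
      field_simp
    simp only [l_m6, l_m5, l_m1] at e
    rw [e'] at e
    linear_combination e
  have f6 : -ε 7 - ε 1 + ε 2 + ε 6 + κ * (-(Q * t 5 * t 8 / (t 2 * t 6 * t 7))) = 0 := by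
    have e : ε (-7) + ε (-1) + ε 2 - ε (-6) = -κ * (t (-8) * t 1 * t (-5) / (t (-7) * t (-1) * t 2
        * t (-6))) := h.four (-7) (-1) 2 (by decide) (by decide) (by decide) (by decide)
    have e' : t (-8) * t 1 * t (-5) / (t (-7) * t (-1) * t 2 * t (-6)) = -(Q * t 5 * t 8 / (t 2 *
        t 6 * t 7)) := by
      simp only [t_m8, t_m7, t_m6, t_m5, t_m1]
      field_simp
    simp only [l_m7, l_m6, l_m1] at e
    rw [e'] at e
    linear_combination e
  have f7 : -ε 8 - ε 7 - ε 4 - ε 1 + κ * (-(t 5 * t 9 / (t 1 * t 4 * t 7))) = 0 := by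
    have e : ε (-8) + ε (-7) + ε (-4) - ε (-19) = -κ * (t (-15) * t (-11) * t (-12) / (t (-8) *
        t (-7) * t (-4) * t (-19))) := h.four (-8) (-7) (-4) (by decide) (by decide) (by decide)
        (by decide)
    have e' : t (-15) * t (-11) * t (-12) / (t (-8) * t (-7) * t (-4) * t (-19)) = -(t 5 * t 9 /
        (t 1 * t 4 * t 7)) := by
      simp only [t_m19, t_m15, t_m12, t_m11, t_m8, t_m7, t_m4, t_11, t_12, t_15, t_19]
      field_simp
    simp only [l_m19, l_m8, l_m7, l_m4, l_19] at e
    rw [e'] at e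
    linear_combination e
  have f8 : -ε 8 - ε 1 + ε 4 + ε 5 + κ * (-(Q * t 3 * t 9 / (t 1 * t 5 * t 8))) = 0 := by
    have e : ε (-8) + ε (-1) + ε 4 - ε (-5) = -κ * (t (-9) * t 3 * t (-4) / (t (-8) * t (-1) * t 4
        * t (-5))) := h.four (-8) (-1) 4 (by decide) (by decide) (by decide) (by decide)
    have e' : t (-9) * t 3 * t (-4) / (t (-8) * t (-1) * t 4 * t (-5)) = -(Q * t 3 * t 9 / (t 1 *
        t 5 * t 8)) := by
      simp only [t_m9, t_m8, t_m5, t_m4, t_m1]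
      field_simp
    simp only [l_m8, l_m5, l_m1] at e
    rw [e'] at e
    linear_combination e
  have f9 : -ε 5 - ε 1 + ε 2 + ε 4 + κ * (-(Q * t 3 * t 6 / (t 2 * t 4 * t 5))) = 0 := by
    have e : ε (-5) + ε (-1) + ε 2 - ε (-4) = -κ * (t (-6) * t 1 * t (-3) / (t (-5) * t (-1) * t 2
        * t (-4))) := h.four (-5) (-1) 2 (by decide) (by decide) (by decide) (by decide)
    have e' : t (-6) * t 1 * t (-3) / (t (-5) * t (-1) * t 2 * t (-4)) = -(Q * t 3 * t 6 / (t 2 *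
        t 4 * t 5)) := by
      simp only [t_m6, t_m5, t_m4, t_m3, t_m1]
      field_simp
    simp only [l_m5, l_m4, l_m1] at e
    rw [e'] at e
    linear_combination e
  have f10 : -ε 9 - ε 5 - ε 4 - ε 2 + κ * (-(t 6 * t 7 / (t 2 * t 4 * t 5))) = 0 := by
    have e : ε (-9) + ε (-5) + ε (-4) - ε (-18) = -κ * (t (-14) * t (-9) * t (-13) / (t (-9) *
        t (-5) * t (-4) * t (-18))) := h.four (-9) (-5) (-4) (by decide) (by decide) (by decide)
        (by decide)
    have e' : t (-14) * t (-9) * t (-13) / (t (-9) * t (-5) * t (-4) * t (-18)) = -(t 6 * t 7 /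
        (t 2 * t 4 * t 5)) := by
      simp only [t_m18, t_m14, t_m13, t_m9, t_m5, t_m4, t_13, t_14, t_18]
      field_simp
    simp only [l_m18, l_m9, l_m5, l_m4, l_18] at e
    rw [e'] at e
    linear_combination e
  have f11 : -ε 9 - ε 4 + ε 6 + ε 7 + κ * (-(Q ^ 4 * t 2 * t 3 / (t 4 * t 6 * t 9))) = 0 := by
    have e : ε (-9) + ε (-4) + ε 6 - ε (-7) = -κ * (t (-13) * t 2 * t (-3) / (t (-9) * t (-4) *
        t 6 * t (-7))) := h.four (-9) (-4) 6 (by decide) (by decide) (by decide) (by decide)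
    have e' : t (-13) * t 2 * t (-3) / (t (-9) * t (-4) * t 6 * t (-7)) = -(Q ^ 4 * t 2 * t 3 /
        (t 4 * t 6 * t 9)) := by
      simp only [t_m13, t_m9, t_m7, t_m4, t_m3, t_13]
      field_simp
    simp only [l_m9, l_m7, l_m4] at e
    rw [e'] at e
    linear_combination e
  have f12 : -ε 6 + ε 1 + ε 2 + ε 3 + κ * (t 4 * t 5 / (t 1 * t 2 * t 6)) = 0 := by
    have e : ε (-6) + ε 1 + ε 2 - ε (-3) = -κ * (t (-5) * t 3 * t (-4) / (t (-6) * t 1 * t 2 *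
        t (-3))) := h.four (-6) 1 2 (by decide) (by decide) (by decide) (by decide)
    have e' : t (-5) * t 3 * t (-4) / (t (-6) * t 1 * t 2 * t (-3)) = t 4 * t 5 / (t 1 * t 2 *
        t 6) := by
      simp only [t_m6, t_m5, t_m4, t_m3]
      field_simp
    simp only [l_m6, l_m3] at e
    rw [e'] at e
    linear_combination e
  have f13 : -ε 9 - ε 8 - ε 7 + ε 4 + κ * (Q ^ 4 * t 3 * t 5 / (t 7 * t 8 * t 9)) = 0 := by
    have e : ε (-9) + ε (-8) + ε (-7) - ε (-24) = -κ * (t (-17) * t (-15) * t (-16) / (t (-9) *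
        t (-8) * t (-7) * t (-24))) := h.four (-9) (-8) (-7) (by decide) (by decide) (by decide)
        (by decide)
    have e' : t (-17) * t (-15) * t (-16) / (t (-9) * t (-8) * t (-7) * t (-24)) = Q ^ 4 * t 3 *
        t 5 / (t 7 * t 8 * t 9) := by
      simp only [t_m24, t_m17, t_m16, t_m15, t_m9, t_m8, t_m7, t_m4, t_15, t_16, t_17, t_24]
      field_simp
    simp only [l_m24, l_m9, l_m8, l_m7, l_m4, l_24] at e
    rw [e'] at e
    linear_combination e
  -- Multipliers that eliminate all logarithmic derivatives except `ε 8`.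
  linear_combination κ * e - 1/5 * f1 + 1/5 * f2 - 6/5 * f3 - 3/5 * f4 - 3/5 * f5 - 1/5 * f6 + 2/5
      * f7 + 3/5 * f8 + 1 * f9 + 1/5 * f10 + 3/5 * f11 + 2/5 * f12 + 1/5 * f13

theorem level_twenty_second_one (h : ThetaNet 20 Q κ t ε) :
    -(1 / 5 * (t 9 * t 10 / (t 2 * t 5 * t 8))) - 1 / 5 * (Q ^ 2 * t 1 * t 10 / (t 2 * t 5 * t 8))
      + 1 / 5 * (t 1 * t 9 * t 10 / (t 2 * t 3 * t 4 * t 5)) - 1 / 5 * (Q * t 1 * t 9 * t 10 /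
      (t 2 * t 4 * t 5 * t 7)) + 2 / 5 * (Q * t 10 / (t 4 * t 6)) = 0 := by
  have n2 : t 2 ≠ 0 := h.ne 2 (by decide)
  have n3 : t 3 ≠ 0 := h.ne 3 (by decide)
  have n4 : t 4 ≠ 0 := h.ne 4 (by decide)
  have n5 : t 5 ≠ 0 := h.ne 5 (by decide)
  have n6 : t 6 ≠ 0 := h.ne 6 (by decide)
  have n7 : t 7 ≠ 0 := h.ne 7 (by decide)
  have n8 : t 8 ≠ 0 := h.ne 8 (by decide)
  have n10 : t 10 ≠ 0 := h.ne 10 (by decide)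
  have hQ := h.base_ne
  have r1 : -(Q * t 1 * t 4 * t 6 * t 7) + t 2 * t 5 * t 7 * t 8 - t 1 * t 6 * t 8 * t 9 = 0 := by
    have e : Q ^ 1 * (t 13 * t 1 * (t 6 * t 4)) - t 12 * t 2 * (t 7 * t 5) + t 8 * t 6 * (t 11 *
      t 1) = 0 := h.three_nat 1 7 6 5 1 0 rfl
    rw [show t 11 = t 9 from h.refl 9, show t 12 = t 8 from h.refl 8, show t 13 = t 7 from h.refl
      7] at e
    linear_combination -1 * e
  have r2 : -(Q * t 2 * t 3 * t 5 * t 8) + t 3 * t 4 * t 6 * t 9 - t 1 * t 6 * t 8 * t 9 = 0 := by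
    have e : Q ^ 1 * (t 12 * t 2 * (t 5 * t 3)) - t 11 * t 3 * (t 6 * t 4) + t 8 * t 6 * (t 9 *
      t 1) = 0 := h.three_nat 1 7 5 4 1 0 rfl
    rw [show t 11 = t 9 from h.refl 9, show t 12 = t 8 from h.refl 8] at e
    linear_combination -1 * e
  have key : -(1 / 5 * t 3 * t 4 * t 6 * t 7 * t 9) - 1 / 5 * Q ^ 2 * t 1 * t 3 * t 4 * t 6 * t 7
      + 1 / 5 * t 1 * t 6 * t 7 * t 8 * t 9 - 1 / 5 * Q * t 1 * t 3 * t 6 * t 8 * t 9 + 2 / 5 * Q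
      * t 2 * t 3 * t 5 * t 7 * t 8 = 0 := by
    linear_combination 1 / 5 * Q * t 3 * r1 - 1 / 5 * t 7 * r2
  have e : -(1 / 5 * (t 9 * t 10 / (t 2 * t 5 * t 8))) - 1 / 5 * (Q ^ 2 * t 1 * t 10 / (t 2 * t 5
      * t 8)) + 1 / 5 * (t 1 * t 9 * t 10 / (t 2 * t 3 * t 4 * t 5)) - 1 / 5 * (Q * t 1 * t 9 *
      t 10 / (t 2 * t 4 * t 5 * t 7)) + 2 / 5 * (Q * t 10 / (t 4 * t 6)) = t 10 * (-(1 / 5 * t 3 *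
      t 4 * t 6 * t 7 * t 9) - 1 / 5 * Q ^ 2 * t 1 * t 3 * t 4 * t 6 * t 7 + 1 / 5 * t 1 * t 6 *
      t 7 * t 8 * t 9 - 1 / 5 * Q * t 1 * t 3 * t 6 * t 8 * t 9 + 2 / 5 * Q * t 2 * t 3 * t 5 *
      t 7 * t 8) / (t 2 * t 3 * t 4 * t 5 * t 6 * t 7 * t 8) := by
    field_simp
  rw [key, mul_zero, zero_div] at e
  exact e

theorem level_twenty_second_two (h : ThetaNet 20 Q κ t ε) :
    -(1 / 5 * (t 5 * t 6 * t 9 / (t 2 * t 3 * t 7 * t 8))) - 2 / 5 * (Q * t 2 * t 5 / (t 1 * t 4 *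
      t 6)) - 1 / 5 * (Q ^ 2 * t 1 * t 5 * t 6 / (t 2 * t 3 * t 7 * t 8)) - 2 / 5 * (Q ^ 3 * t 2 *
      t 5 / (t 4 * t 6 * t 9)) + 1 / 5 * (t 7 * t 10 / (t 2 * t 5 * t 8)) - 1 / 5 * (Q * t 3 *
      t 10 / (t 2 * t 5 * t 8)) + 3 / 5 * (Q * t 3 * t 7 * t 10 / (t 1 * t 6 * t 8 * t 9)) = 0
      := by
  have n1 : t 1 ≠ 0 := h.ne 1 (by decide)
  have n2 : t 2 ≠ 0 := h.ne 2 (by decide)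
  have n3 : t 3 ≠ 0 := h.ne 3 (by decide)
  have n4 : t 4 ≠ 0 := h.ne 4 (by decide)
  have n5 : t 5 ≠ 0 := h.ne 5 (by decide)
  have n6 : t 6 ≠ 0 := h.ne 6 (by decide)
  have n7 : t 7 ≠ 0 := h.ne 7 (by decide)
  have n8 : t 8 ≠ 0 := h.ne 8 (by decide)
  have n9 : t 9 ≠ 0 := h.ne 9 (by decide)
  have hQ := h.base_ne
  have r1 : -(Q ^ 3 * t 1 * t 3 ^ 2 * t 7) + t 4 * t 6 ^ 2 * t 10 - t 3 * t 7 ^ 2 * t 9 = 0 := by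
    have e : Q ^ 3 * (t 13 * t 3 * (t 3 * t 1)) - t 10 * t 6 * (t 6 * t 4) + t 9 * t 7 * (t 7 *
      t 3) = 0 := h.three_nat 3 8 5 2 1 0 rfl
    rw [show t 13 = t 7 from h.refl 7] at e
    linear_combination -1 * e
  have r2 : -(Q ^ 4 * t 1 ^ 2 * t 4 * t 6) + t 5 ^ 2 * t 8 * t 10 - t 4 * t 6 * t 9 ^ 2 = 0 := by
    have e : Q ^ 4 * (t 14 * t 4 * (t 1 * t 1)) - t 10 * t 8 * (t 5 * t 5) + t 9 * t 9 * (t 6 *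
      t 4) = 0 := h.three_nat 4 9 5 1 0 0 rfl
    rw [show t 14 = t 6 from h.refl 6] at e
    linear_combination -1 * e
  have r3 : -(Q ^ 4 * t 1 ^ 2 * t 5 ^ 2) + t 5 ^ 2 * t 9 ^ 2 - t 4 * t 6 * t 10 ^ 2 = 0 := by
    have e : Q ^ 4 * (t 15 * t 5 * (t 1 * t 1)) - t 11 * t 9 * (t 5 * t 5) + t 10 * t 10 * (t 6 *
      t 4) = 0 := h.three_nat 4 10 5 1 0 0 rfl
    rw [show t 11 = t 9 from h.refl 9, show t 15 = t 5 from h.refl 5] at e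
    linear_combination -1 * e
  have r4 : -(Q ^ 3 * t 1 * t 3 * t 4 * t 6) + t 4 * t 6 * t 7 * t 9 - t 3 * t 7 * t 8 * t 10 = 0
      := by
    have e : Q ^ 3 * (t 14 * t 4 * (t 3 * t 1)) - t 11 * t 7 * (t 6 * t 4) + t 10 * t 8 * (t 7 *
      t 3) = 0 := h.three_nat 3 9 5 2 1 0 rfl
    rw [show t 11 = t 9 from h.refl 9, show t 14 = t 6 from h.refl 6] at e
    linear_combination -1 * e
  have r5 : -(Q ^ 3 * t 2 ^ 2 * t 5 ^ 2) + t 5 ^ 2 * t 8 ^ 2 - t 3 * t 7 * t 10 ^ 2 = 0 := by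
    have e : Q ^ 3 * (t 15 * t 5 * (t 2 * t 2)) - t 12 * t 8 * (t 5 * t 5) + t 10 * t 10 * (t 7 *
      t 3) = 0 := h.three_nat 3 10 5 2 0 0 rfl
    rw [show t 12 = t 8 from h.refl 8, show t 15 = t 5 from h.refl 5] at e
    linear_combination -1 * e
  have r6 : -(Q ^ 3 * t 2 ^ 2 * t 3 * t 7) + t 5 ^ 2 * t 6 * t 10 - t 3 * t 7 * t 8 ^ 2 = 0 := by
    have e : Q ^ 3 * (t 13 * t 3 * (t 2 * t 2)) - t 10 * t 6 * (t 5 * t 5) + t 8 * t 8 * (t 7 *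
      t 3) = 0 := h.three_nat 3 8 5 2 0 0 rfl
    rw [show t 13 = t 7 from h.refl 7] at e
    linear_combination -1 * e
  have r7 : -(Q ^ 3 * t 2 * t 3 * t 4 * t 5) + t 5 * t 6 * t 7 * t 8 - t 3 * t 8 * t 9 * t 10 = 0
      := by
    have e : Q ^ 3 * (t 15 * t 3 * (t 4 * t 2)) - t 12 * t 6 * (t 7 * t 5) + t 10 * t 8 * (t 9 *
      t 3) = 0 := h.three_nat 3 9 6 3 1 0 rfl
    rw [show t 12 = t 8 from h.refl 8, show t 15 = t 5 from h.refl 5] at e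
    linear_combination -1 * e
  have r8 : -(Q ^ 5 * t 1 * t 2 ^ 2 * t 5) + t 6 * t 7 ^ 2 * t 10 - t 5 * t 8 ^ 2 * t 9 = 0 := by
    have e : Q ^ 5 * (t 15 * t 1 * (t 2 * t 2)) - t 10 * t 6 * (t 7 * t 7) + t 8 * t 8 * (t 9 *
      t 5) = 0 := h.three_nat 5 8 7 2 0 0 rfl
    rw [show t 15 = t 5 from h.refl 5] at e
    linear_combination -1 * e
  have key : -(1 / 5 * Q ^ 2 * t 1 * t 4 * t 5 ^ 2 * t 6 ^ 2 * t 9 ^ 2) - 2 / 5 * Q ^ 3 * t 2 ^ 2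
      * t 3 * t 5 ^ 2 * t 7 * t 8 * t 9 - 1 / 5 * Q ^ 4 * t 1 ^ 2 * t 4 * t 5 ^ 2 * t 6 ^ 2 * t 9
      - 2 / 5 * Q ^ 5 * t 1 * t 2 ^ 2 * t 3 * t 5 ^ 2 * t 7 * t 8 + 1 / 5 * Q ^ 2 * t 1 * t 3 *
      t 4 * t 6 * t 7 ^ 2 * t 9 * t 10 - 1 / 5 * Q ^ 3 * t 1 * t 3 ^ 2 * t 4 * t 6 * t 7 * t 9 *
      t 10 + 3 / 5 * Q ^ 3 * t 2 * t 3 ^ 2 * t 4 * t 5 * t 7 ^ 2 * t 10 = 0 := by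
    linear_combination -(1 / 10 * Q ^ 2 * t 1 * t 4 * t 6 * t 10) * r1 + 1 / 10 * Q ^ 2 * t 1 *
      t 5 ^ 2 * t 6 * r2 - 1 / 10 * Q ^ 2 * t 1 * t 4 * t 6 ^ 2 * r3 + 1 / 10 * Q ^ 2 * t 1 * t 3
      * t 7 * t 10 * r4 - 1 / 10 * Q ^ 2 * t 1 * t 3 * t 7 * t 8 * r5 - 1 / 10 * Q ^ 2 * t 1 *
      t 5 ^ 2 * t 8 * r6 + 1 / 10 * t 3 * t 7 * t 9 * t 10 * r4 - 1 / 10 * t 5 ^ 2 * t 8 * t 9 *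
      r6 + 1 / 2 * t 3 * t 7 * t 8 * t 9 * r5 + 1 / 10 * t 5 ^ 2 * t 6 * t 9 * r2 + 1 / 10 * t 4 *
      t 6 * t 9 * t 10 * r1 + 1 / 10 * t 4 * t 6 ^ 2 * t 9 * r3 - 3 / 5 * t 3 * t 7 ^ 2 * t 10 *
      r7 + 3 / 5 * t 3 * t 5 * t 7 * t 8 * r8
  have e : -(1 / 5 * (t 5 * t 6 * t 9 / (t 2 * t 3 * t 7 * t 8))) - 2 / 5 * (Q * t 2 * t 5 / (t 1
      * t 4 * t 6)) - 1 / 5 * (Q ^ 2 * t 1 * t 5 * t 6 / (t 2 * t 3 * t 7 * t 8)) - 2 / 5 * (Q ^ 3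
      * t 2 * t 5 / (t 4 * t 6 * t 9)) + 1 / 5 * (t 7 * t 10 / (t 2 * t 5 * t 8)) - 1 / 5 * (Q *
      t 3 * t 10 / (t 2 * t 5 * t 8)) + 3 / 5 * (Q * t 3 * t 7 * t 10 / (t 1 * t 6 * t 8 * t 9)) =
      (-(1 / 5 * Q ^ 2 * t 1 * t 4 * t 5 ^ 2 * t 6 ^ 2 * t 9 ^ 2) - 2 / 5 * Q ^ 3 * t 2 ^ 2 * t 3
      * t 5 ^ 2 * t 7 * t 8 * t 9 - 1 / 5 * Q ^ 4 * t 1 ^ 2 * t 4 * t 5 ^ 2 * t 6 ^ 2 * t 9 - 2 /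
      5 * Q ^ 5 * t 1 * t 2 ^ 2 * t 3 * t 5 ^ 2 * t 7 * t 8 + 1 / 5 * Q ^ 2 * t 1 * t 3 * t 4 *
      t 6 * t 7 ^ 2 * t 9 * t 10 - 1 / 5 * Q ^ 3 * t 1 * t 3 ^ 2 * t 4 * t 6 * t 7 * t 9 * t 10 +
      3 / 5 * Q ^ 3 * t 2 * t 3 ^ 2 * t 4 * t 5 * t 7 ^ 2 * t 10) / (Q ^ 2 * t 1 * t 2 * t 3 * t 4
      * t 5 * t 6 * t 7 * t 8 * t 9) := by
    field_simp
  rw [key, zero_div] at e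
  exact e

theorem level_twenty_second_three (h : ThetaNet 20 Q κ t ε) :
    -(2 / 5 * (t 9 * t 10 / (t 4 * t 5 * t 6))) - 2 / 5 * (Q ^ 2 * t 1 * t 10 / (t 4 * t 5 * t 6))
      + 1 / 5 * (t 5 * t 6 / (t 2 * t 3 * t 8)) + 2 / 5 * (Q * t 2 * t 5 * t 7 / (t 1 * t 4 * t 6
      * t 9)) - 1 / 5 * (Q * t 5 * t 6 / (t 2 * t 7 * t 8)) - 2 / 5 * (Q ^ 2 * t 2 * t 3 * t 5 /
      (t 1 * t 4 * t 6 * t 9)) + 1 / 5 * (t 1 * t 9 * t 10 / (t 2 * t 3 * t 4 * t 7)) = 0 := by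
  have n1 : t 1 ≠ 0 := h.ne 1 (by decide)
  have n2 : t 2 ≠ 0 := h.ne 2 (by decide)
  have n3 : t 3 ≠ 0 := h.ne 3 (by decide)
  have n4 : t 4 ≠ 0 := h.ne 4 (by decide)
  have n5 : t 5 ≠ 0 := h.ne 5 (by decide)
  have n6 : t 6 ≠ 0 := h.ne 6 (by decide)
  have n7 : t 7 ≠ 0 := h.ne 7 (by decide)
  have n8 : t 8 ≠ 0 := h.ne 8 (by decide)
  have n9 : t 9 ≠ 0 := h.ne 9 (by decide)
  have hQ := h.base_ne
  have r1 : -(Q * t 2 * t 3 * t 5 * t 8) + t 3 * t 4 * t 6 * t 9 - t 1 * t 6 * t 8 * t 9 = 0 := by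
    have e : Q ^ 1 * (t 12 * t 2 * (t 5 * t 3)) - t 11 * t 3 * (t 6 * t 4) + t 8 * t 6 * (t 9 *
      t 1) = 0 := h.three_nat 1 7 5 4 1 0 rfl
    rw [show t 11 = t 9 from h.refl 9, show t 12 = t 8 from h.refl 8] at e
    linear_combination -1 * e
  have r2 : -(Q ^ 2 * t 2 * t 3 * t 4 * t 7) + t 4 * t 5 * t 6 * t 9 - t 2 * t 7 * t 8 * t 9 = 0
      := by
    have e : Q ^ 2 * (t 13 * t 3 * (t 4 * t 2)) - t 11 * t 5 * (t 6 * t 4) + t 9 * t 7 * (t 8 *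
      t 2) = 0 := h.three_nat 2 8 5 3 1 0 rfl
    rw [show t 11 = t 9 from h.refl 9, show t 13 = t 7 from h.refl 7] at e
    linear_combination -1 * e
  have r3 : -(Q ^ 2 * t 1 * t 2 * t 4 * t 9) + t 3 * t 4 * t 6 * t 9 - t 2 * t 5 * t 7 * t 8 = 0
      := by
    have e : Q ^ 2 * (t 11 * t 1 * (t 4 * t 2)) - t 9 * t 3 * (t 6 * t 4) + t 7 * t 5 * (t 8 *
      t 2) = 0 := h.three_nat 2 6 5 3 1 0 rfl
    rw [show t 11 = t 9 from h.refl 9] at e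
    linear_combination -1 * e
  have r4 : -(Q ^ 3 * t 2 * t 3 * t 4 * t 5) + t 5 * t 6 * t 7 * t 8 - t 3 * t 8 * t 9 * t 10 = 0
      := by
    have e : Q ^ 3 * (t 15 * t 3 * (t 4 * t 2)) - t 12 * t 6 * (t 7 * t 5) + t 10 * t 8 * (t 9 *
      t 3) = 0 := h.three_nat 3 9 6 3 1 0 rfl
    rw [show t 12 = t 8 from h.refl 8, show t 15 = t 5 from h.refl 5] at e
    linear_combination -1 * e
  have r5 : -(Q * t 3 * t 4 * t 5 * t 6) + t 4 * t 5 * t 6 * t 7 - t 1 * t 8 * t 9 * t 10 = 0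
      := by
    have e : Q ^ 1 * (t 14 * t 4 * (t 5 * t 3)) - t 13 * t 5 * (t 6 * t 4) + t 10 * t 8 * (t 9 *
      t 1) = 0 := h.three_nat 1 9 5 4 1 0 rfl
    rw [show t 13 = t 7 from h.refl 7, show t 14 = t 6 from h.refl 6] at e
    linear_combination -1 * e
  have key : -(2 / 5 * t 1 * t 2 * t 3 * t 7 * t 8 * t 9 ^ 2 * t 10) - 2 / 5 * Q ^ 2 * t 1 ^ 2 *
      t 2 * t 3 * t 7 * t 8 * t 9 * t 10 + 1 / 5 * t 1 * t 4 * t 5 ^ 2 * t 6 ^ 2 * t 7 * t 9 + 2 /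
      5 * Q * t 2 ^ 2 * t 3 * t 5 ^ 2 * t 7 ^ 2 * t 8 - 1 / 5 * Q * t 1 * t 3 * t 4 * t 5 ^ 2 *
      t 6 ^ 2 * t 9 - 2 / 5 * Q ^ 2 * t 2 ^ 2 * t 3 ^ 2 * t 5 ^ 2 * t 7 * t 8 + 1 / 5 * t 1 ^ 2 *
      t 5 * t 6 * t 8 * t 9 ^ 2 * t 10 = 0 := by
    linear_combination 2 / 5 * Q * t 2 * t 3 * t 5 * t 7 * r1 - 2 / 5 * Q * t 1 * t 3 * t 5 * t 6
      * r2 - 2 / 5 * Q * t 2 * t 3 * t 5 * t 7 * r3 + 2 / 5 * t 1 * t 2 * t 7 * t 9 * r4 + 2 / 5 *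
      Q ^ 2 * t 1 * t 2 * t 3 * t 7 * r5 + 2 / 5 * t 1 * t 5 * t 6 * t 7 * r2 - 1 / 5 * t 1 * t 5
      * t 6 * t 9 * r5
  have e : -(2 / 5 * (t 9 * t 10 / (t 4 * t 5 * t 6))) - 2 / 5 * (Q ^ 2 * t 1 * t 10 / (t 4 * t 5
      * t 6)) + 1 / 5 * (t 5 * t 6 / (t 2 * t 3 * t 8)) + 2 / 5 * (Q * t 2 * t 5 * t 7 / (t 1 *
      t 4 * t 6 * t 9)) - 1 / 5 * (Q * t 5 * t 6 / (t 2 * t 7 * t 8)) - 2 / 5 * (Q ^ 2 * t 2 * t 3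
      * t 5 / (t 1 * t 4 * t 6 * t 9)) + 1 / 5 * (t 1 * t 9 * t 10 / (t 2 * t 3 * t 4 * t 7)) =
      (-(2 / 5 * t 1 * t 2 * t 3 * t 7 * t 8 * t 9 ^ 2 * t 10) - 2 / 5 * Q ^ 2 * t 1 ^ 2 * t 2 *
      t 3 * t 7 * t 8 * t 9 * t 10 + 1 / 5 * t 1 * t 4 * t 5 ^ 2 * t 6 ^ 2 * t 7 * t 9 + 2 / 5 * Q
      * t 2 ^ 2 * t 3 * t 5 ^ 2 * t 7 ^ 2 * t 8 - 1 / 5 * Q * t 1 * t 3 * t 4 * t 5 ^ 2 * t 6 ^ 2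
      * t 9 - 2 / 5 * Q ^ 2 * t 2 ^ 2 * t 3 ^ 2 * t 5 ^ 2 * t 7 * t 8 + 1 / 5 * t 1 ^ 2 * t 5 *
      t 6 * t 8 * t 9 ^ 2 * t 10) / (t 1 * t 2 * t 3 * t 4 * t 5 * t 6 * t 7 * t 8 * t 9) := by
    field_simp
  rw [key, zero_div] at e
  exact e

theorem level_twenty_second_four (h : ThetaNet 20 Q κ t ε) :
    -(3 / 5 * (t 3 * t 7 * t 10 / (t 1 * t 5 * t 6 * t 8))) - 3 / 5 * (Q ^ 2 * t 3 * t 7 * t 10 /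
      (t 5 * t 6 * t 8 * t 9)) + 2 / 5 * (t 7 * t 10 / (t 4 * t 5 * t 6)) - 2 / 5 * (Q * t 3 *
      t 10 / (t 4 * t 5 * t 6)) + 1 / 5 * (t 10 / (t 2 * t 8)) + Q ^ 2 * t 4 * t 7 / (t 5 *
      t 8 ^ 2) - Q ^ 3 * t 3 * t 4 / (t 5 * t 8 ^ 2) + Q ^ 3 * t 1 / (t 5 * t 8) + Q * t 9 / (t 5
      * t 8) = 0 := by
  have n1 : t 1 ≠ 0 := h.ne 1 (by decide)
  have n2 : t 2 ≠ 0 := h.ne 2 (by decide)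
  have n4 : t 4 ≠ 0 := h.ne 4 (by decide)
  have n5 : t 5 ≠ 0 := h.ne 5 (by decide)
  have n6 : t 6 ≠ 0 := h.ne 6 (by decide)
  have n8 : t 8 ≠ 0 := h.ne 8 (by decide)
  have n9 : t 9 ≠ 0 := h.ne 9 (by decide)
  have hQ := h.base_ne
  have r1 : -(Q ^ 3 * t 1 * t 3 * t 4 * t 6) + t 4 * t 6 * t 7 * t 9 - t 3 * t 7 * t 8 * t 10 = 0
      := by
    have e : Q ^ 3 * (t 14 * t 4 * (t 3 * t 1)) - t 11 * t 7 * (t 6 * t 4) + t 10 * t 8 * (t 7 *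
      t 3) = 0 := h.three_nat 3 9 5 2 1 0 rfl
    rw [show t 11 = t 9 from h.refl 9, show t 14 = t 6 from h.refl 6] at e
    linear_combination -1 * e
  have r2 : -(Q ^ 5 * t 1 * t 2 * t 3 * t 4) + t 6 * t 7 * t 8 * t 9 - t 5 * t 8 * t 9 * t 10 = 0
      := by
    have e : Q ^ 5 * (t 16 * t 2 * (t 3 * t 1)) - t 11 * t 7 * (t 8 * t 6) + t 10 * t 8 * (t 9 *
      t 5) = 0 := h.three_nat 5 9 7 2 1 0 rfl
    rw [show t 11 = t 9 from h.refl 9, show t 16 = t 4 from h.refl 4] at e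
    linear_combination -1 * e
  have r3 : -(Q ^ 3 * t 2 * t 3 * t 4 * t 5) + t 5 * t 6 * t 7 * t 8 - t 3 * t 8 * t 9 * t 10 = 0
      := by
    have e : Q ^ 3 * (t 15 * t 3 * (t 4 * t 2)) - t 12 * t 6 * (t 7 * t 5) + t 10 * t 8 * (t 9 *
      t 3) = 0 := h.three_nat 3 9 6 3 1 0 rfl
    rw [show t 12 = t 8 from h.refl 8, show t 15 = t 5 from h.refl 5] at e
    linear_combination -1 * e
  have r4 : -(Q ^ 4 * t 1 * t 2 * t 4 * t 5) + t 5 * t 6 * t 8 * t 9 - t 4 * t 7 * t 9 * t 10 = 0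
      := by
    have e : Q ^ 4 * (t 15 * t 1 * (t 4 * t 2)) - t 11 * t 5 * (t 8 * t 6) + t 9 * t 7 * (t 10 *
      t 4) = 0 := h.three_nat 4 8 7 3 1 0 rfl
    rw [show t 11 = t 9 from h.refl 9, show t 15 = t 5 from h.refl 5] at e
    linear_combination -1 * e
  have r5 : -(Q ^ 2 * t 2 * t 4 ^ 2 * t 6) + t 4 * t 6 ^ 2 * t 8 - t 2 * t 8 ^ 2 * t 10 = 0 := by
    have e : Q ^ 2 * (t 14 * t 4 * (t 4 * t 2)) - t 12 * t 6 * (t 6 * t 4) + t 10 * t 8 * (t 8 *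
      t 2) = 0 := h.three_nat 2 9 5 3 1 0 rfl
    rw [show t 12 = t 8 from h.refl 8, show t 14 = t 6 from h.refl 6] at e
    linear_combination -1 * e
  have r6 : -(Q ^ 3 * t 1 ^ 2 * t 4 * t 8) + t 4 ^ 2 * t 7 * t 9 - t 3 * t 5 * t 8 ^ 2 = 0 := by
    have e : Q ^ 3 * (t 12 * t 4 * (t 1 * t 1)) - t 9 * t 7 * (t 4 * t 4) + t 8 * t 8 * (t 5 *
      t 3) = 0 := h.three_nat 3 8 4 1 0 0 rfl
    rw [show t 12 = t 8 from h.refl 8] at e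
    linear_combination -1 * e
  have r7 : -(Q ^ 4 * t 1 * t 3 * t 4 ^ 2) + t 5 * t 7 * t 8 ^ 2 - t 4 * t 8 * t 9 ^ 2 = 0 := by
    have e : Q ^ 4 * (t 16 * t 4 * (t 3 * t 1)) - t 12 * t 8 * (t 7 * t 5) + t 11 * t 9 * (t 8 *
      t 4) = 0 := h.three_nat 4 10 6 2 1 0 rfl
    rw [show t 11 = t 9 from h.refl 9, show t 12 = t 8 from h.refl 8, show t 16 = t 4 from h.refl
      4] at e
    linear_combination -1 * e
  have r8 : -(Q * t 1 * t 4 * t 6 * t 7) + t 2 * t 5 * t 7 * t 8 - t 1 * t 6 * t 8 * t 9 = 0 := by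
    have e : Q ^ 1 * (t 13 * t 1 * (t 6 * t 4)) - t 12 * t 2 * (t 7 * t 5) + t 8 * t 6 * (t 11 *
      t 1) = 0 := h.three_nat 1 7 6 5 1 0 rfl
    rw [show t 11 = t 9 from h.refl 9, show t 12 = t 8 from h.refl 8, show t 13 = t 7 from h.refl
      7] at e
    linear_combination -1 * e
  have r9 : -(Q * t 2 * t 4 * t 5 * t 7) + t 3 * t 5 * t 6 * t 8 - t 1 * t 7 * t 8 * t 10 = 0
      := by
    have e : Q ^ 1 * (t 13 * t 5 * (t 4 * t 2)) - t 12 * t 6 * (t 5 * t 3) + t 10 * t 8 * (t 7 *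
      t 1) = 0 := h.three_nat 1 9 4 3 1 0 rfl
    rw [show t 12 = t 8 from h.refl 8, show t 13 = t 7 from h.refl 7] at e
    linear_combination -1 * e
  have key : -(3 / 5 * t 2 * t 3 * t 4 * t 7 * t 8 * t 9 * t 10) - 3 / 5 * Q ^ 2 * t 1 * t 2 * t 3
      * t 4 * t 7 * t 8 * t 10 + 2 / 5 * t 1 * t 2 * t 7 * t 8 ^ 2 * t 9 * t 10 - 2 / 5 * Q * t 1
      * t 2 * t 3 * t 8 ^ 2 * t 9 * t 10 + 1 / 5 * t 1 * t 4 * t 5 * t 6 * t 8 * t 9 * t 10 +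
      Q ^ 2 * t 1 * t 2 * t 4 ^ 2 * t 6 * t 7 * t 9 - Q ^ 3 * t 1 * t 2 * t 3 * t 4 ^ 2 * t 6 *
      t 9 + Q ^ 3 * t 1 ^ 2 * t 2 * t 4 * t 6 * t 8 * t 9 + Q * t 1 * t 2 * t 4 * t 6 * t 8 *
      t 9 ^ 2 = 0 := by
    linear_combination 3 / 5 * Q ^ 2 * t 1 * t 2 * t 4 * r1 - 1 / 5 * t 1 * t 4 * t 6 * r2 + 2 / 5
      * Q * t 1 * t 2 * t 8 * r3 - 2 / 5 * t 2 * t 3 * t 8 * r4 + 1 / 5 * t 1 * t 7 * t 9 * r5 +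
      t 2 * t 4 * t 9 * r1 - t 2 * t 6 * t 9 * r6 - 2 / 5 * Q * t 1 * t 2 * t 6 * r7 - 3 / 5 * Q *
      t 2 * t 4 * t 9 * r8 - 3 / 5 * t 2 * t 8 * t 9 * r9
  have e : -(3 / 5 * (t 3 * t 7 * t 10 / (t 1 * t 5 * t 6 * t 8))) - 3 / 5 * (Q ^ 2 * t 3 * t 7 *
      t 10 / (t 5 * t 6 * t 8 * t 9)) + 2 / 5 * (t 7 * t 10 / (t 4 * t 5 * t 6)) - 2 / 5 * (Q *
      t 3 * t 10 / (t 4 * t 5 * t 6)) + 1 / 5 * (t 10 / (t 2 * t 8)) + Q ^ 2 * t 4 * t 7 / (t 5 *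
      t 8 ^ 2) - Q ^ 3 * t 3 * t 4 / (t 5 * t 8 ^ 2) + Q ^ 3 * t 1 / (t 5 * t 8) + Q * t 9 / (t 5
      * t 8) = (-(3 / 5 * t 2 * t 3 * t 4 * t 7 * t 8 * t 9 * t 10) - 3 / 5 * Q ^ 2 * t 1 * t 2 *
      t 3 * t 4 * t 7 * t 8 * t 10 + 2 / 5 * t 1 * t 2 * t 7 * t 8 ^ 2 * t 9 * t 10 - 2 / 5 * Q *
      t 1 * t 2 * t 3 * t 8 ^ 2 * t 9 * t 10 + 1 / 5 * t 1 * t 4 * t 5 * t 6 * t 8 * t 9 * t 10 +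
      Q ^ 2 * t 1 * t 2 * t 4 ^ 2 * t 6 * t 7 * t 9 - Q ^ 3 * t 1 * t 2 * t 3 * t 4 ^ 2 * t 6 *
      t 9 + Q ^ 3 * t 1 ^ 2 * t 2 * t 4 * t 6 * t 8 * t 9 + Q * t 1 * t 2 * t 4 * t 6 * t 8 *
      t 9 ^ 2) / (t 1 * t 2 * t 4 * t 5 * t 6 * t 8 ^ 2 * t 9) := by
    field_simp
  rw [key, zero_div] at e
  exact e

end ThetaNet

/-! ### Dissection of theta and rank series along residue classes -/

lemma hasSum_int_residues {f : ℤ → ℂ} {M : ℕ} (hM : 0 < M) {s : ℕ → ℂ}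
    (h : ∀ b < M, HasSum (fun N : ℤ => f (M * N + b)) (s b)) :
    HasSum f (∑ b ∈ Finset.range M, s b) := by
  have hM' : (M : ℤ) ≠ 0 := by exact_mod_cast hM.ne'
  have h1 : ∀ b ∈ Finset.range M, HasSum (fun n : ℤ => if n % M = b then f n else 0) (s b) := by
    intro b hb
    have hb' := Finset.mem_range.1 hb
    have hbm : (b : ℤ) % M = b := Int.emod_eq_of_lt (by positivity) (by exact_mod_cast hb')
    have hinj : Function.Injective fun N : ℤ => (M : ℤ) * N + b := fun x y hxy => by
      simpa [hM.ne.symm] using hxy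
    refine (hinj.hasSum_iff fun n hn => if_neg fun hnb => hn ⟨n / M, ?_⟩).1 ?_
    · simp only [← hnb]
      exact Int.mul_ediv_add_emod n M
    · convert h b hb' using 2 with N
      simp [hbm]
  convert hasSum_sum h1 using 2 with n
  have h0 := Int.emod_nonneg n hM'
  have h2 := Int.emod_lt_of_pos n (by exact_mod_cast hM : (0 : ℤ) < M)
  obtain ⟨b, hb⟩ := Int.eq_ofNat_of_zero_le h0
  rw [hb] at h2 ⊢
  simp only [Nat.cast_inj]
  rw [Finset.sum_ite_eq, if_pos]
  exact Finset.mem_range.2 (by exact_mod_cast h2)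

/-- The `n`-th term of the theta series with exponent `2 n² + s n`. -/
noncomputable def quadTerm (q : ℂ) (s n : ℤ) : ℂ := (-1) ^ n * q ^ (2 * n ^ 2 + s * n)

lemma quadTerm_eq (q : ℂ) (hq0 : q ≠ 0) (s n : ℤ) : quadTerm q s n = thTerm (q ^ 4) (q ^ (s + 2)) n
    := by
  rw [quadTerm, thTerm, ← zpow_natCast q 4, ← zpow_mul, ← zpow_mul, mul_assoc, ← zpow_add₀ hq0]
  congr 2
  push_cast
  linear_combination -2 * two_mul_tri n

/-- For odd `M` the sign `(-1) ^ (M * N)` is `(-1) ^ N`, so each residue class is again a theta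
series. The quadratic exponent `2 M² N²` accounts for the base `(q ^ M) ^ (4 * M)`. -/
lemma quadTerm_residue {q : ℂ} (hq0 : q ≠ 0) {M : ℕ} (hM : Odd M) (s N b : ℤ) :
    quadTerm q s (M * N + b) = quadTerm q s b *
      thTerm ((q ^ M) ^ (4 * M)) ((q ^ M) ^ (2 * M + 4 * b + s)) N := by
  have h1 : (-1 : ℂ) ^ ((M : ℤ) * N + b) = (-1) ^ N * (-1) ^ b := by
    rw [zpow_add₀ (by norm_num), zpow_mul, zpow_natCast, hM.neg_one_pow]
  have h2 : q ^ (2 * ((M : ℤ) * N + b) ^ 2 + s * (M * N + b)) = q ^ (2 * b ^ 2 + s * b) *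
      (((q ^ M) ^ (4 * M)) ^ tri N * ((q ^ M) ^ (2 * M + 4 * b + s)) ^ N) := by
    rw [← zpow_natCast (q ^ M), ← zpow_natCast q M, ← zpow_mul, ← zpow_mul, ← zpow_mul, ← zpow_mul,
      ← zpow_add₀ hq0, ← zpow_add₀ hq0]
    congr 1
    push_cast
    linear_combination -2 * (M : ℤ) ^ 2 * two_mul_tri N
  rw [quadTerm, h1, h2, quadTerm, thTerm]
  ring

/-- The bilateral series attached to ranks modulo `M`; the term `n = 0` vanishes. -/
noncomputable def rankTerm (q : ℂ) (M : ℕ) (k n : ℤ) : ℂ :=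
  quadTerm q (2 * k - 1) n / (1 - (q ^ (2 * M)) ^ n)

/-- The case `y = 1` is the index `n = 0`, where both sides are zero by the convention for division;
only `y = -1` would break the formula. -/
lemma inv_one_sub_eq {y : ℂ} (hy : y = 1 ∨ y ^ 2 ≠ 1) : (1 - y)⁻¹ = (1 + y) / (1 - y ^ 2) := by
  rcases hy with rfl | hy
  · simp
  · have h1 : 1 - y ≠ 0 := fun h => hy (by rw [← sub_eq_zero.1 h]; ring)
    have h2 : 1 - y ^ 2 ≠ 0 := fun h => hy (sub_eq_zero.1 h).symm
    field_simp
    ring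

/-- The denominators `1 - (q ^ (2 * M)) ^ n` advance by `(q ^ M) ^ (2 * M)` within a residue class,
only half the exponent of the theta base. Replacing `1 / (1 - y)` by `(1 + y) / (1 - y ^ 2)` makes
the bases agree; the summands 1 and `y` of the numerator give the two Appell sums. -/
theorem hasSum_rankTerm {q : ℂ} (hq0 : q ≠ 0) (hq : ‖q‖ < 1) {M : ℕ} (hM : Odd M) (k : ℤ) :
    HasSum (rankTerm q M k) (∑ b ∈ Finset.range M, quadTerm q (2 * k - 1) b *
      (ac (4 * M) (q ^ M) (4 * b) (2 * M + 4 * b + (2 * k - 1)) +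
        (q ^ M) ^ (2 * b) * ac (4 * M) (q ^ M) (4 * b) (4 * M + 4 * b + (2 * k - 1)))) := by
  have hM0 : M ≠ 0 := hM.pos.ne'
  have hQ0 : q ^ M ≠ 0 := pow_ne_zero _ hq0
  have hQ : ‖q ^ M‖ < 1 := base_pow_norm_lt hq hM0
  have hB0 : (q ^ M) ^ (4 * M) ≠ 0 := pow_ne_zero _ hQ0
  have hB : ‖(q ^ M) ^ (4 * M)‖ < 1 := base_pow_norm_lt hQ (by positivity)
  have hz : ∀ n : ℤ, (q ^ M) ^ n ≠ 0 := fun n => zpow_ne_zero _ hQ0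
  refine hasSum_int_residues hM.pos fun b _ => ?_
  have s1 := hasSum_apS hB0 hB (hz (4 * b)) (hz (2 * M + 4 * b + (2 * k - 1)))
  have s2 := (hasSum_apS hB0 hB (hz (4 * b)) (hz (4 * M + 4 * b + (2 * k - 1)))).mul_left
    ((q ^ M) ^ (2 * b))
  refine ((s1.add s2).mul_left (quadTerm q (2 * k - 1) b)).congr_fun ?_
  intro N
  rw [rankTerm, quadTerm_residue hq0 hM, show (4 * M + 4 * b + (2 * k - 1) : ℤ) =
    2 * M + (2 * M + 4 * b + (2 * k - 1)) by ring, zpow_add₀ hQ0 (2 * M), thTerm_mul]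
  have hy : (q ^ (2 * M)) ^ ((M : ℤ) * N + b) = (q ^ M) ^ (2 * b) * ((q ^ M) ^ (2 * M : ℤ)) ^ N :=
      by
    rw [← zpow_natCast (q ^ M), ← zpow_natCast q, ← zpow_natCast q, ← zpow_mul, ← zpow_mul,
      ← zpow_mul, ← zpow_mul, ← zpow_add₀ hq0]
    congr 1
    push_cast
    ring
  have hy2 : ((q ^ (2 * M)) ^ ((M : ℤ) * N + b)) ^ 2 = ((q ^ M) ^ (4 * M)) ^ N * (q ^ M) ^ (4 * b :
      ℤ) := by
    rw [← zpow_natCast (q ^ M), ← zpow_natCast q, ← zpow_natCast q, ← zpow_mul, ← zpow_mul,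
      ← zpow_mul, ← zpow_mul, ← zpow_natCast, ← zpow_mul, ← zpow_add₀ hq0]
    congr 1
    push_cast
    ring
  have hcase : (q ^ (2 * M)) ^ ((M : ℤ) * N + b) = 1 ∨
      ((q ^ (2 * M)) ^ ((M : ℤ) * N + b)) ^ 2 ≠ 1 := by
    rcases eq_or_ne ((M : ℤ) * N + b) 0 with h | h
    · left; rw [h, zpow_zero]
    · right
      rw [← zpow_natCast, ← zpow_mul]
      exact base_zpow_ne_one (base_pow_norm_lt hq (by positivity)) (by simpa using h)
  rw [div_eq_mul_inv, inv_one_sub_eq hcase, hy2, hy]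
  ring


/-- A theta net together with Appell sums `a p w` at powers of the nome and the rules which change
their second argument. -/
structure AppellNet (L : ℕ) (Q κ : ℂ) (t ε : ℤ → ℂ) (a : ℤ → ℤ → ℂ) : Prop
    extends ThetaNet L Q κ t ε where
  shift : ∀ {p w z r : ℤ}, r = p + z - w → ¬ (L : ℤ) ∣ p → ¬ (L : ℤ) ∣ r → ¬ (L : ℤ) ∣ z →
    a p w = t w * (a r z / t z) + Q ^ p * κ * (t (z - w) * t (p + z) / (t p * t r * t z))
  zero_shift : ∀ {w z r : ℤ}, r = z - w → ¬ (L : ℤ) ∣ r → ¬ (L : ℤ) ∣ z →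
    a 0 w = t w * (a r z / t z) - ε z + ε r + w / L - 1

theorem appellNet {L : ℕ} {Q : ℂ} (hQ0 : Q ≠ 0) (hQ : ‖Q‖ < 1) (hL : L ≠ 0) :
    AppellNet L Q (qPoch (Q ^ L) (Q ^ L) ^ 3) (tc L Q) (lc L Q) (ac L Q) where
  toThetaNet := thetaNet hQ0 hQ hL
  shift hr hp hrr hz := ac_shift hQ0 hQ hL hr hp hrr hz
  zero_shift hr hrr hz := ac_zero_shift hQ0 hQ hL hr hrr hz

/-! ### Reduction of the dissected rank series to two fixed Appell sums. -/

section
variable {κ : ℂ} {t ε : ℤ → ℂ} {a : ℤ → ℤ → ℂ}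

lemma ThetaNet.zero {L : ℕ} {Q : ℂ} (h : ThetaNet L Q κ t ε) : t 0 = 0 := by
  have := h.neg 0
  rw [neg_zero, zpow_zero] at this
  linear_combination this / 2

/-- In the first half of the sums the exponents satisfy `p - w = -7`, in the second `p - w = -13`;
with `z = 3` and `z = 9` both give `r = -4`. The transformed coefficients are, up to a common
factor, the terms of the 3-dissection of `th (q ^ 4) q`. The constant is `1 / 3` because `7 / 12 +
13 / 12 - 2 = -1 / 3`. -/
theorem AppellNet.rank_three {q : ℂ} (hq0 : q ≠ 0) (h : AppellNet 12 (q ^ 3) κ t ε a) :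
    (a 0 7 + a 0 13) - q ^ 3 * (a 4 11 + (q ^ 3) ^ 2 * a 4 17) + q ^ 10 * (a 8 15 + (q ^ 3) ^ 4 *
      a 8 21) + 1 / 3 = (t 5 - q * t 3 - q ^ 3 * t 1) * ((a (-4) 3 / t 3) + (q ^ 6)⁻¹ * (a (-4) 9
      / t 9) - κ * (-(1/3 * (t 1 * t 5 * t 6 ^ 2 / (t 2 ^ 2 * t 3 ^ 3 * t 4))) - 1/3 * (q * t 6 /
      (t 2 * t 3 * t 4)) - 1/3 * (q ^ 2 * t 3 / (t 1 * t 4 * t 5)))) := by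
  have h' := h.toThetaNet
  have hQ : q ^ 3 ≠ 0 := h'.base_ne
  have t_m12 : t (-12) = -((q ^ 3) ^ 12)⁻¹ * t 12 := h'.neg_nat 12
  have t_m9 : t (-9) = -((q ^ 3) ^ 9)⁻¹ * t 9 := h'.neg_nat 9
  have t_m8 : t (-8) = -((q ^ 3) ^ 8)⁻¹ * t 8 := h'.neg_nat 8
  have t_m5 : t (-5) = -((q ^ 3) ^ 5)⁻¹ * t 5 := h'.neg_nat 5
  have t_m4 : t (-4) = -((q ^ 3) ^ 4)⁻¹ * t 4 := h'.neg_nat 4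
  have t_m3 : t (-3) = -((q ^ 3) ^ 3)⁻¹ * t 3 := h'.neg_nat 3
  have t_m1 : t (-1) = -((q ^ 3) ^ 1)⁻¹ * t 1 := h'.neg_nat 1
  have t_0 : t 0 = 0 := h'.zero
  have t_7 : t 7 = t 5 := h'.refl 5
  have t_8 : t 8 = t 4 := h'.refl 4
  have t_9 : t 9 = t 3 := h'.refl 3
  have t_11 : t 11 = t 1 := h'.refl 1
  have t_12 : t 12 = t 0 := h'.refl 0
  have t_13 : t 13 = t (-1) := (h'.refl 13).symm
  have t_15 : t 15 = t (-3) := (h'.refl 15).symm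
  have t_17 : t 17 = t (-5) := (h'.refl 17).symm
  have t_21 : t 21 = t (-9) := (h'.refl 21).symm
  have l_m4 : ε (-4) = -ε 4 := h'.log_neg 4 (by decide)
  have l_9 : ε 9 = -ε 3 := h'.log_refl_of (by norm_num) (by decide)
  have n1 : t 1 ≠ 0 := h'.ne 1 (by decide)
  have n2 : t 2 ≠ 0 := h'.ne 2 (by decide)
  have n3 : t 3 ≠ 0 := h'.ne 3 (by decide)
  have n4 : t 4 ≠ 0 := h'.ne 4 (by decide)
  have n5 : t 5 ≠ 0 := h'.ne 5 (by decide)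
  have s0 : a 0 7 = t 5 * (a (-4) 3 / t 3) - ε 3 + ε (-4) + 7 / 12 - 1 := by
    rw [h.zero_shift (z := 3) (r := (-4)) (by norm_num) (by decide) (by decide), show t 7 = t 5 by
      simp only [t_7]]
    norm_num
  have s1 : q ^ 3 * a 4 11 = q ^ 3 * t 1 * (a (-4) 3 / t 3) + κ * (q ^ 3 * t 5 / (t 3 * t 4))
      := by
    have e1 : q ^ 3 * t 11 = q ^ 3 * t 1 := by
      simp only [t_11]
    have e2 : q ^ 3 * ((q ^ 3) ^ (4 : ℤ) * (t (-8) * t 7 / (t 4 * t (-4) * t 3))) = q ^ 3 * t 5 /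
      (t 3 * t 4) := by
      simp only [t_m8, t_m4, t_7, t_8]
      field_simp
    rw [h.shift (z := 3) (r := (-4)) (by norm_num) (by decide) (by decide) (by decide),
        show (3 : ℤ) - 11 = -8 by norm_num, show (4 : ℤ) + 3 = 7 by norm_num]
    linear_combination (a (-4) 3 / t 3) * e1 + κ * e2
  have s2 : q ^ 10 * a 8 15 = -(q * t 3) * (a (-4) 3 / t 3) + κ * (0) := by
    have e1 : q ^ 10 * t 15 = -(q * t 3) := by
      simp only [t_15, t_m3]
      try field_simp
    -- The correction vanishes because `z - w = -12` is a multiple of the level, so the theta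
    -- constant there is zero.
    have e2 : q ^ 10 * ((q ^ 3) ^ (8 : ℤ) * (t (-12) * t 11 / (t 8 * t (-4) * t 3))) = 0 := by
      simp [t_m12, t_m4, t_0, t_8, t_11, t_12]
    rw [h.shift (z := 3) (r := (-4)) (by norm_num) (by decide) (by decide) (by decide),
        show (3 : ℤ) - 15 = -12 by norm_num, show (8 : ℤ) + 3 = 11 by norm_num]
    linear_combination (a (-4) 3 / t 3) * e1 + κ * e2
  have s3 : a 0 13 = (q ^ 6)⁻¹ * (-(q ^ 3 * t 1)) * (a (-4) 9 / t 9) - ε 9 + ε (-4) + 13 / 12 - 1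
      := by
    rw [h.zero_shift (z := 9) (r := (-4)) (by norm_num) (by decide) (by decide),
        show t 13 = (q ^ 6)⁻¹ * (-(q ^ 3 * t 1)) by
      simp only [t_13, t_m1]
      field_simp]
    norm_num
  have s4 : q ^ 9 * a 4 17 = (q ^ 6)⁻¹ * (-(t 5)) * (a (-4) 9 / t 9) + κ * (-(q ^ 6 * t 1 / (t 3 *
      t 4))) := by
    have e1 : q ^ 9 * t 17 = (q ^ 6)⁻¹ * (-(t 5)) := by
      simp only [t_17, t_m5]
      try field_simp
    have e2 : q ^ 9 * ((q ^ 3) ^ (4 : ℤ) * (t (-8) * t 13 / (t 4 * t (-4) * t 9))) = -(q ^ 6 * t 1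
      / (t 3 * t 4)) := by
      simp only [t_m8, t_m4, t_m1, t_8, t_9, t_13]
      field_simp
    rw [h.shift (z := 9) (r := (-4)) (by norm_num) (by decide) (by decide) (by decide),
        show (9 : ℤ) - 17 = -8 by norm_num, show (4 : ℤ) + 9 = 13 by norm_num]
    linear_combination (a (-4) 9 / t 9) * e1 + κ * e2
  have s5 : q ^ 22 * a 8 21 = (q ^ 6)⁻¹ * (-(q * t 3)) * (a (-4) 9 / t 9) + κ * (0) := by
    have e1 : q ^ 22 * t 21 = (q ^ 6)⁻¹ * (-(q * t 3)) := by
      simp only [t_21, t_m9, t_9]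
      try field_simp
    have e2 : q ^ 22 * ((q ^ 3) ^ (8 : ℤ) * (t (-12) * t 17 / (t 8 * t (-4) * t 9))) = 0 := by
      simp [t_m12, t_m5, t_m4, t_0, t_8, t_9, t_12, t_17]
    rw [h.shift (z := 9) (r := (-4)) (by norm_num) (by decide) (by decide) (by decide),
        show (9 : ℤ) - 21 = -12 by norm_num, show (8 : ℤ) + 9 = 17 by norm_num]
    linear_combination (a (-4) 9 / t 9) * e1 + κ * e2
  -- Products of the dissection terms with the claimed theta quotients are simplified here, so that
  -- the last step only compares coefficients of monomials.
  have p0 : t 5 * (t 3 / (t 1 * t 4 * t 5)) = t 3 / (t 1 * t 4) := by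
    field_simp
  have p1 : t 3 * (t 1 * t 5 * t 6 ^ 2 / (t 2 ^ 2 * t 3 ^ 3 * t 4)) = t 1 * t 5 * t 6 ^ 2 /
      (t 2 ^ 2 * t 3 ^ 2 * t 4) := by
    field_simp
  have p2 : t 3 * (t 6 / (t 2 * t 3 * t 4)) = t 6 / (t 2 * t 4) := by
    field_simp
  have p3 : t 1 * (t 3 / (t 1 * t 4 * t 5)) = t 3 / (t 4 * t 5) := by
    field_simp
  simp only [l_m4, l_9] at s0 s3
  -- The three level-12 identities enter with the weights 1, `q` and `q ^ 2` of their residue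
  -- classes.
  linear_combination s0 - s1 + s2 + s3 - s4 + s5 + h'.level_twelve_zero - 1 / 3 * q ^ 2 * κ * p0 +
      1 / 3 * q * κ * p1 + 1 / 3 * q ^ 2 * κ * p2 + 1 / 3 * q ^ 5 * κ * p3 + κ * q *
      h'.level_twelve_one + κ * q ^ 2 * h'.level_twelve_two

/-- Here `p - w` is `-11` or `-21`, and the targets `z = 15` and `z = 5` give `r = 4` and `r = -16`.
The constant comes from `11 / 20 + 21 / 20 - 2 = -2 / 5`. The first target is moved on to the
Appell–Lerch sum of the theorem only in `hasSum_rank_five_first`. -/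
theorem AppellNet.rank_five_first {q : ℂ} (hq0 : q ≠ 0) (h : AppellNet 20 (q ^ 5) κ t ε a) :
    (a 0 11 + a 0 21) - q ^ 3 * (a 4 15 + (q ^ 5) ^ 2 * a 4 25) + q ^ 10 * (a 8 19 + (q ^ 5) ^ 4 *
      a 8 29) - q ^ 21 * (a 12 23 + (q ^ 5) ^ 6 * a 12 33) + q ^ 36 * (a 16 27 + (q ^ 5) ^ 8 * a
      16 37) + 2 / 5 = (t 9 - q * t 7 + q ^ 6 * t 3 + q ^ 10 * t 1 - q ^ 3 * t 5) * ((a 4 15 /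
      t 15) - (q ^ 15)⁻¹ * (a (-16) 5 / t 5) - κ * (3/5 * (t 1 * t 9 * t 10 / (t 2 * t 3 * t 4 *
      t 5 * t 7)) - 2/5 * (q * t 10 / (t 2 * t 5 * t 8)) - 2/5 * (q ^ 2 * t 5 * t 6 / (t 2 * t 3 *
      t 7 * t 8)) + 1/5 * (q ^ 7 * t 2 * t 5 / (t 1 * t 4 * t 6 * t 9)) + 1/5 * (q ^ 3 * t 10 /
      (t 4 * t 5 * t 6)) - 1/5 * (q ^ 4 * t 3 * t 7 * t 10 / (t 1 * t 5 * t 6 * t 8 * t 9))))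
      := by
  have h' := h.toThetaNet
  have hQ : q ^ 5 ≠ 0 := h'.base_ne
  have t_m32 : t (-32) = -((q ^ 5) ^ 32)⁻¹ * t 32 := h'.neg_nat 32
  have t_m28 : t (-28) = -((q ^ 5) ^ 28)⁻¹ * t 28 := h'.neg_nat 28
  have t_m24 : t (-24) = -((q ^ 5) ^ 24)⁻¹ * t 24 := h'.neg_nat 24
  have t_m20 : t (-20) = -((q ^ 5) ^ 20)⁻¹ * t 20 := h'.neg_nat 20
  have t_m17 : t (-17) = -((q ^ 5) ^ 17)⁻¹ * t 17 := h'.neg_nat 17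
  have t_m16 : t (-16) = -((q ^ 5) ^ 16)⁻¹ * t 16 := h'.neg_nat 16
  have t_m13 : t (-13) = -((q ^ 5) ^ 13)⁻¹ * t 13 := h'.neg_nat 13
  have t_m12 : t (-12) = -((q ^ 5) ^ 12)⁻¹ * t 12 := h'.neg_nat 12
  have t_m11 : t (-11) = -((q ^ 5) ^ 11)⁻¹ * t 11 := h'.neg_nat 11
  have t_m9 : t (-9) = -((q ^ 5) ^ 9)⁻¹ * t 9 := h'.neg_nat 9
  have t_m8 : t (-8) = -((q ^ 5) ^ 8)⁻¹ * t 8 := h'.neg_nat 8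
  have t_m7 : t (-7) = -((q ^ 5) ^ 7)⁻¹ * t 7 := h'.neg_nat 7
  have t_m5 : t (-5) = -((q ^ 5) ^ 5)⁻¹ * t 5 := h'.neg_nat 5
  have t_m4 : t (-4) = -((q ^ 5) ^ 4)⁻¹ * t 4 := h'.neg_nat 4
  have t_m3 : t (-3) = -((q ^ 5) ^ 3)⁻¹ * t 3 := h'.neg_nat 3
  have t_m1 : t (-1) = -((q ^ 5) ^ 1)⁻¹ * t 1 := h'.neg_nat 1
  have t_0 : t 0 = 0 := h'.zero
  have t_11 : t 11 = t 9 := h'.refl 9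
  have t_12 : t 12 = t 8 := h'.refl 8
  have t_13 : t 13 = t 7 := h'.refl 7
  have t_15 : t 15 = t 5 := h'.refl 5
  have t_16 : t 16 = t 4 := h'.refl 4
  have t_17 : t 17 = t 3 := h'.refl 3
  have t_19 : t 19 = t 1 := h'.refl 1
  have t_20 : t 20 = t 0 := h'.refl 0
  have t_21 : t 21 = t (-1) := (h'.refl 21).symm
  have t_23 : t 23 = t (-3) := (h'.refl 23).symm
  have t_24 : t 24 = t (-4) := (h'.refl 24).symm
  have t_25 : t 25 = t (-5) := (h'.refl 25).symm
  have t_27 : t 27 = t (-7) := (h'.refl 27).symm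
  have t_28 : t 28 = t (-8) := (h'.refl 28).symm
  have t_29 : t 29 = t (-9) := (h'.refl 29).symm
  have t_31 : t 31 = t (-11) := (h'.refl 31).symm
  have t_32 : t 32 = t (-12) := (h'.refl 32).symm
  have t_33 : t 33 = t (-13) := (h'.refl 33).symm
  have t_37 : t 37 = t (-17) := (h'.refl 37).symm
  have l_m16 : ε (-16) = -ε 16 := h'.log_neg 16 (by decide)
  have l_15 : ε 15 = -ε 5 := h'.log_refl_of (by norm_num) (by decide)
  have l_16 : ε 16 = -ε 4 := h'.log_refl_of (by norm_num) (by decide)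
  have n1 : t 1 ≠ 0 := h'.ne 1 (by decide)
  have n2 : t 2 ≠ 0 := h'.ne 2 (by decide)
  have n3 : t 3 ≠ 0 := h'.ne 3 (by decide)
  have n4 : t 4 ≠ 0 := h'.ne 4 (by decide)
  have n5 : t 5 ≠ 0 := h'.ne 5 (by decide)
  have n6 : t 6 ≠ 0 := h'.ne 6 (by decide)
  have n7 : t 7 ≠ 0 := h'.ne 7 (by decide)
  have n8 : t 8 ≠ 0 := h'.ne 8 (by decide)
  have n9 : t 9 ≠ 0 := h'.ne 9 (by decide)
  have s0 : a 0 11 = t 9 * (a 4 15 / t 15) - ε 15 + ε 4 + 11 / 20 - 1 := by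
    rw [h.zero_shift (z := 15) (r := 4) (by norm_num) (by decide) (by decide), show t 11 = t 9 by
      simp only [t_11]]
    norm_num
  -- This sum is already the target, so no shift is needed.
  have s1 : q ^ 3 * a 4 15 = q ^ 3 * t 5 * (a 4 15 / t 15) + κ * (0) := by
    rw [mul_zero, add_zero, t_15]
    field_simp
  have s2 : q ^ 10 * a 8 19 = q ^ 10 * t 1 * (a 4 15 / t 15) + κ * (q ^ 15 * t 3 / (t 5 * t 8))
      := by
    have e1 : q ^ 10 * t 19 = q ^ 10 * t 1 := by
      simp only [t_19]
    have e2 : q ^ 10 * ((q ^ 5) ^ (8 : ℤ) * (t (-4) * t 23 / (t 8 * t 4 * t 15))) = q ^ 15 * t 3 /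
      (t 5 * t 8) := by
      simp only [t_m4, t_m3, t_15, t_23]
      field_simp
    rw [h.shift (z := 15) (r := 4) (by norm_num) (by decide) (by decide) (by decide),
        show (15 : ℤ) - 19 = -4 by norm_num, show (8 : ℤ) + 15 = 23 by norm_num]
    linear_combination (a 4 15 / t 15) * e1 + κ * e2
  have s3 : q ^ 21 * a 12 23 = -(q ^ 6 * t 3) * (a 4 15 / t 15) + κ * (q ^ 6 * t 7 / (t 4 * t 5))
      := by
    have e1 : q ^ 21 * t 23 = -(q ^ 6 * t 3) := by
      simp only [t_23, t_m3]
      try field_simp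
    have e2 : q ^ 21 * ((q ^ 5) ^ (12 : ℤ) * (t (-8) * t 27 / (t 12 * t 4 * t 15))) = q ^ 6 * t 7
      / (t 4 * t 5) := by
      simp only [t_m8, t_m7, t_12, t_15, t_27]
      field_simp
    rw [h.shift (z := 15) (r := 4) (by norm_num) (by decide) (by decide) (by decide),
        show (15 : ℤ) - 23 = -8 by norm_num, show (12 : ℤ) + 15 = 27 by norm_num]
    linear_combination (a 4 15 / t 15) * e1 + κ * e2
  have s4 : q ^ 36 * a 16 27 = -(q * t 7) * (a 4 15 / t 15) + κ * (q * t 8 * t 9 / (t 4 ^ 2 *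
      t 5)) := by
    have e1 : q ^ 36 * t 27 = -(q * t 7) := by
      simp only [t_27, t_m7]
      try field_simp
    have e2 : q ^ 36 * ((q ^ 5) ^ (16 : ℤ) * (t (-12) * t 31 / (t 16 * t 4 * t 15))) = q * t 8 *
      t 9 / (t 4 ^ 2 * t 5) := by
      simp only [t_m12, t_m11, t_11, t_12, t_15, t_16, t_31]
      field_simp
    rw [h.shift (z := 15) (r := 4) (by norm_num) (by decide) (by decide) (by decide),
        show (15 : ℤ) - 27 = -12 by norm_num, show (16 : ℤ) + 15 = 31 by norm_num]
    linear_combination (a 4 15 / t 15) * e1 + κ * e2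
  have s5 : a 0 21 = (q ^ 15)⁻¹ * (-(q ^ 10 * t 1)) * (a (-16) 5 / t 5) - ε 5 + ε (-16) + 21 / 20
      - 1 := by
    rw [h.zero_shift (z := 5) (r := (-16)) (by norm_num) (by decide) (by decide),
        show t 21 = (q ^ 15)⁻¹ * (-(q ^ 10 * t 1)) by
      simp only [t_21, t_m1]
      field_simp]
    norm_num
  have s6 : q ^ 13 * a 4 25 = (q ^ 15)⁻¹ * (-(q ^ 3 * t 5)) * (a (-16) 5 / t 5) + κ * (0) := by
    have e1 : q ^ 13 * t 25 = (q ^ 15)⁻¹ * (-(q ^ 3 * t 5)) := by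
      simp only [t_25, t_m5]
      try field_simp
    have e2 : q ^ 13 * ((q ^ 5) ^ (4 : ℤ) * (t (-20) * t 9 / (t 4 * t (-16) * t 5))) = 0 := by
      simp [t_m20, t_m16, t_0, t_16, t_20]
    rw [h.shift (z := 5) (r := (-16)) (by norm_num) (by decide) (by decide) (by decide),
        show (5 : ℤ) - 25 = -20 by norm_num, show (4 : ℤ) + 5 = 9 by norm_num]
    linear_combination (a (-16) 5 / t 5) * e1 + κ * e2
  have s7 : q ^ 30 * a 8 29 = (q ^ 15)⁻¹ * (-(t 9)) * (a (-16) 5 / t 5) + κ * (-(q ^ 10 * t 7 /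
      (t 5 * t 8))) := by
    have e1 : q ^ 30 * t 29 = (q ^ 15)⁻¹ * (-(t 9)) := by
      simp only [t_29, t_m9]
      try field_simp
    have e2 : q ^ 30 * ((q ^ 5) ^ (8 : ℤ) * (t (-24) * t 13 / (t 8 * t (-16) * t 5))) = -(q ^ 10 *
      t 7 / (t 5 * t 8)) := by
      simp only [t_m24, t_m16, t_m4, t_13, t_16, t_24]
      field_simp
    rw [h.shift (z := 5) (r := (-16)) (by norm_num) (by decide) (by decide) (by decide),
        show (5 : ℤ) - 29 = -24 by norm_num, show (8 : ℤ) + 5 = 13 by norm_num]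
    linear_combination (a (-16) 5 / t 5) * e1 + κ * e2
  have s8 : q ^ 51 * a 12 33 = (q ^ 15)⁻¹ * (-(q * t 7)) * (a (-16) 5 / t 5) + κ * (-(q ^ 11 * t 3
      / (t 4 * t 5))) := by
    have e1 : q ^ 51 * t 33 = (q ^ 15)⁻¹ * (-(q * t 7)) := by
      simp only [t_33, t_m13, t_13]
      try field_simp
    have e2 : q ^ 51 * ((q ^ 5) ^ (12 : ℤ) * (t (-28) * t 17 / (t 12 * t (-16) * t 5))) = -(q ^ 11
      * t 3 / (t 4 * t 5)) := by
      simp only [t_m28, t_m16, t_m8, t_12, t_16, t_17, t_28]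
      field_simp
    rw [h.shift (z := 5) (r := (-16)) (by norm_num) (by decide) (by decide) (by decide),
        show (5 : ℤ) - 33 = -28 by norm_num, show (12 : ℤ) + 5 = 17 by norm_num]
    linear_combination (a (-16) 5 / t 5) * e1 + κ * e2
  have s9 : q ^ 76 * a 16 37 = (q ^ 15)⁻¹ * (-(q ^ 6 * t 3)) * (a (-16) 5 / t 5) + κ * (q ^ 11 *
      t 1 * t 8 / (t 4 ^ 2 * t 5)) := by
    have e1 : q ^ 76 * t 37 = (q ^ 15)⁻¹ * (-(q ^ 6 * t 3)) := by
      simp only [t_37, t_m17, t_17]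
      try field_simp
    have e2 : q ^ 76 * ((q ^ 5) ^ (16 : ℤ) * (t (-32) * t 21 / (t 16 * t (-16) * t 5))) = q ^ 11 *
      t 1 * t 8 / (t 4 ^ 2 * t 5) := by
      simp only [t_m32, t_m16, t_m12, t_m1, t_12, t_16, t_21, t_32]
      field_simp
    rw [h.shift (z := 5) (r := (-16)) (by norm_num) (by decide) (by decide) (by decide),
        show (5 : ℤ) - 37 = -32 by norm_num, show (16 : ℤ) + 5 = 21 by norm_num]
    linear_combination (a (-16) 5 / t 5) * e1 + κ * e2
  have p0 : t 9 * (t 2 * t 5 / (t 1 * t 4 * t 6 * t 9)) = t 2 * t 5 / (t 1 * t 4 * t 6) := by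
    field_simp
  have p1 : t 9 * (t 3 * t 7 * t 10 / (t 1 * t 5 * t 6 * t 8 * t 9)) = t 3 * t 7 * t 10 / (t 1 *
      t 5 * t 6 * t 8) := by
    field_simp
  have p2 : t 7 * (t 1 * t 9 * t 10 / (t 2 * t 3 * t 4 * t 5 * t 7)) = t 1 * t 9 * t 10 / (t 2 *
      t 3 * t 4 * t 5) := by
    field_simp
  have p3 : t 7 * (t 5 * t 6 / (t 2 * t 3 * t 7 * t 8)) = t 5 * t 6 / (t 2 * t 3 * t 8) := by
    field_simp
  have p4 : t 3 * (t 1 * t 9 * t 10 / (t 2 * t 3 * t 4 * t 5 * t 7)) = t 1 * t 9 * t 10 / (t 2 *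
      t 4 * t 5 * t 7) := by
    field_simp
  have p5 : t 3 * (t 5 * t 6 / (t 2 * t 3 * t 7 * t 8)) = t 5 * t 6 / (t 2 * t 7 * t 8) := by
    field_simp
  have p6 : t 1 * (t 2 * t 5 / (t 1 * t 4 * t 6 * t 9)) = t 2 * t 5 / (t 4 * t 6 * t 9) := by
    field_simp
  have p7 : t 1 * (t 3 * t 7 * t 10 / (t 1 * t 5 * t 6 * t 8 * t 9)) = t 3 * t 7 * t 10 / (t 5 *
      t 6 * t 8 * t 9) := by
    field_simp
  have p8 : t 5 * (t 1 * t 9 * t 10 / (t 2 * t 3 * t 4 * t 5 * t 7)) = t 1 * t 9 * t 10 / (t 2 *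
      t 3 * t 4 * t 7) := by
    field_simp
  have p9 : t 5 * (t 10 / (t 2 * t 5 * t 8)) = t 10 / (t 2 * t 8) := by
    field_simp
  have p10 : t 5 * (t 10 / (t 4 * t 5 * t 6)) = t 10 / (t 4 * t 6) := by
    field_simp
  have p11 : t 5 * (t 3 * t 7 * t 10 / (t 1 * t 5 * t 6 * t 8 * t 9)) = t 3 * t 7 * t 10 / (t 1 *
      t 6 * t 8 * t 9) := by
    field_simp
  simp only [l_m16, l_15, l_16] at s0 s5
  linear_combination s0 - s1 + s2 - s3 + s4 + s5 - s6 + s7 - s8 + s9 + h'.level_twenty_first_zero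
      + 1 / 5 * q ^ 7 * κ * p0 - 1 / 5 * q ^ 4 * κ * p1 - 3 / 5 * q * κ * p2 + 2 / 5 * q ^ 3 * κ *
      p3 + 3 / 5 * q ^ 6 * κ * p4 - 2 / 5 * q ^ 8 * κ * p5 + 1 / 5 * q ^ 17 * κ * p6 - 1 / 5 * q ^
      14 * κ * p7 - 3 / 5 * q ^ 3 * κ * p8 + 2 / 5 * q ^ 4 * κ * p9 - 1 / 5 * q ^ 6 * κ * p10 + 1
      / 5 * q ^ 7 * κ * p11 + κ * q * h'.level_twenty_first_one + κ * q ^ 2 *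
      h'.level_twenty_first_two + κ * q ^ 3 * h'.level_twenty_first_three + κ * q ^ 4 *
      h'.level_twenty_first_four

/-- Here `p - w` is `-13` or `-23`, and both targets `z = 5` and `z = 15` give `r = -8`; the
constant comes from `13 / 20 + 23 / 20 - 2 = -1 / 5`. -/
theorem AppellNet.rank_five_second {q : ℂ} (hq0 : q ≠ 0) (h : AppellNet 20 (q ^ 5) κ t ε a) :
    (a 0 13 + a 0 23) - q ^ 5 * (a 4 17 + (q ^ 5) ^ 2 * a 4 27) + q ^ 14 * (a 8 21 + (q ^ 5) ^ 4 *
      a 8 31) - q ^ 27 * (a 12 25 + (q ^ 5) ^ 6 * a 12 35) + q ^ 44 * (a 16 29 + (q ^ 5) ^ 8 * a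
      16 39) + 1 / 5 = (t 9 - q * t 7 + q ^ 6 * t 3 + q ^ 10 * t 1 - q ^ 3 * t 5) * (-(q ^ 1)⁻¹ *
      (a (-8) 5 / t 5) - (q ^ 21)⁻¹ * (a (-8) 15 / t 15) - κ * (-(1/5 * (t 1 * t 9 * t 10 / (t 2 *
      t 3 * t 4 * t 5 * t 7))) - 1/5 * (q * t 10 / (t 2 * t 5 * t 8)) - 1/5 * (q ^ 2 * t 5 * t 6 /
      (t 2 * t 3 * t 7 * t 8)) - 2/5 * (q ^ 7 * t 2 * t 5 / (t 1 * t 4 * t 6 * t 9)) - 2/5 * (q ^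
      3 * t 10 / (t 4 * t 5 * t 6)) - 3/5 * (q ^ 4 * t 3 * t 7 * t 10 / (t 1 * t 5 * t 6 * t 8 *
      t 9)))) := by
  have h' := h.toThetaNet
  have hQ : q ^ 5 ≠ 0 := h'.base_ne
  have t_m24 : t (-24) = -((q ^ 5) ^ 24)⁻¹ * t 24 := h'.neg_nat 24
  have t_m20 : t (-20) = -((q ^ 5) ^ 20)⁻¹ * t 20 := h'.neg_nat 20
  have t_m19 : t (-19) = -((q ^ 5) ^ 19)⁻¹ * t 19 := h'.neg_nat 19
  have t_m16 : t (-16) = -((q ^ 5) ^ 16)⁻¹ * t 16 := h'.neg_nat 16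
  have t_m15 : t (-15) = -((q ^ 5) ^ 15)⁻¹ * t 15 := h'.neg_nat 15
  have t_m12 : t (-12) = -((q ^ 5) ^ 12)⁻¹ * t 12 := h'.neg_nat 12
  have t_m11 : t (-11) = -((q ^ 5) ^ 11)⁻¹ * t 11 := h'.neg_nat 11
  have t_m9 : t (-9) = -((q ^ 5) ^ 9)⁻¹ * t 9 := h'.neg_nat 9
  have t_m8 : t (-8) = -((q ^ 5) ^ 8)⁻¹ * t 8 := h'.neg_nat 8
  have t_m7 : t (-7) = -((q ^ 5) ^ 7)⁻¹ * t 7 := h'.neg_nat 7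
  have t_m5 : t (-5) = -((q ^ 5) ^ 5)⁻¹ * t 5 := h'.neg_nat 5
  have t_m4 : t (-4) = -((q ^ 5) ^ 4)⁻¹ * t 4 := h'.neg_nat 4
  have t_m3 : t (-3) = -((q ^ 5) ^ 3)⁻¹ * t 3 := h'.neg_nat 3
  have t_m1 : t (-1) = -((q ^ 5) ^ 1)⁻¹ * t 1 := h'.neg_nat 1
  have t_0 : t 0 = 0 := h'.zero
  have t_11 : t 11 = t 9 := h'.refl 9
  have t_12 : t 12 = t 8 := h'.refl 8
  have t_13 : t 13 = t 7 := h'.refl 7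
  have t_15 : t 15 = t 5 := h'.refl 5
  have t_16 : t 16 = t 4 := h'.refl 4
  have t_17 : t 17 = t 3 := h'.refl 3
  have t_19 : t 19 = t 1 := h'.refl 1
  have t_20 : t 20 = t 0 := h'.refl 0
  have t_21 : t 21 = t (-1) := (h'.refl 21).symm
  have t_23 : t 23 = t (-3) := (h'.refl 23).symm
  have t_24 : t 24 = t (-4) := (h'.refl 24).symm
  have t_25 : t 25 = t (-5) := (h'.refl 25).symm
  have t_27 : t 27 = t (-7) := (h'.refl 27).symm
  have t_29 : t 29 = t (-9) := (h'.refl 29).symm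
  have t_31 : t 31 = t (-11) := (h'.refl 31).symm
  have t_35 : t 35 = t (-15) := (h'.refl 35).symm
  have t_39 : t 39 = t (-19) := (h'.refl 39).symm
  have l_m8 : ε (-8) = -ε 8 := h'.log_neg 8 (by decide)
  have l_15 : ε 15 = -ε 5 := h'.log_refl_of (by norm_num) (by decide)
  have n1 : t 1 ≠ 0 := h'.ne 1 (by decide)
  have n2 : t 2 ≠ 0 := h'.ne 2 (by decide)
  have n3 : t 3 ≠ 0 := h'.ne 3 (by decide)
  have n4 : t 4 ≠ 0 := h'.ne 4 (by decide)
  have n5 : t 5 ≠ 0 := h'.ne 5 (by decide)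
  have n6 : t 6 ≠ 0 := h'.ne 6 (by decide)
  have n7 : t 7 ≠ 0 := h'.ne 7 (by decide)
  have n8 : t 8 ≠ 0 := h'.ne 8 (by decide)
  have n9 : t 9 ≠ 0 := h'.ne 9 (by decide)
  have s0 : a 0 13 = (q ^ 1)⁻¹ * (q * t 7) * (a (-8) 5 / t 5) - ε 5 + ε (-8) + 13 / 20 - 1 := by
    rw [h.zero_shift (z := 5) (r := (-8)) (by norm_num) (by decide) (by decide),
        show t 13 = (q ^ 1)⁻¹ * (q * t 7) by
      simp only [t_13]
      field_simp]
    norm_num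
  have s1 : q ^ 5 * a 4 17 = (q ^ 1)⁻¹ * (q ^ 6 * t 3) * (a (-8) 5 / t 5) + κ * (q ^ 5 * t 9 /
      (t 4 * t 5)) := by
    have e1 : q ^ 5 * t 17 = (q ^ 1)⁻¹ * (q ^ 6 * t 3) := by
      simp only [t_17]
      try field_simp
    have e2 : q ^ 5 * ((q ^ 5) ^ (4 : ℤ) * (t (-12) * t 9 / (t 4 * t (-8) * t 5))) = q ^ 5 * t 9 /
      (t 4 * t 5) := by
      simp only [t_m12, t_m8, t_12]
      field_simp
    rw [h.shift (z := 5) (r := (-8)) (by norm_num) (by decide) (by decide) (by decide),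
        show (5 : ℤ) - 17 = -12 by norm_num, show (4 : ℤ) + 5 = 9 by norm_num]
    linear_combination (a (-8) 5 / t 5) * e1 + κ * e2
  have s2 : q ^ 14 * a 8 21 = (q ^ 1)⁻¹ * (-(q ^ 10 * t 1)) * (a (-8) 5 / t 5) + κ * (q ^ 14 * t 4
      * t 7 / (t 5 * t 8 ^ 2)) := by
    have e1 : q ^ 14 * t 21 = (q ^ 1)⁻¹ * (-(q ^ 10 * t 1)) := by
      simp only [t_21, t_m1]
      try field_simp
    have e2 : q ^ 14 * ((q ^ 5) ^ (8 : ℤ) * (t (-16) * t 13 / (t 8 * t (-8) * t 5))) = q ^ 14 *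
      t 4 * t 7 / (t 5 * t 8 ^ 2) := by
      simp only [t_m16, t_m8, t_13, t_16]
      field_simp
    rw [h.shift (z := 5) (r := (-8)) (by norm_num) (by decide) (by decide) (by decide),
        show (5 : ℤ) - 21 = -16 by norm_num, show (8 : ℤ) + 5 = 13 by norm_num]
    linear_combination (a (-8) 5 / t 5) * e1 + κ * e2
  have s3 : q ^ 27 * a 12 25 = (q ^ 1)⁻¹ * (-(q ^ 3 * t 5)) * (a (-8) 5 / t 5) + κ * (0) := by
    have e1 : q ^ 27 * t 25 = (q ^ 1)⁻¹ * (-(q ^ 3 * t 5)) := by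
      simp only [t_25, t_m5]
      try field_simp
    have e2 : q ^ 27 * ((q ^ 5) ^ (12 : ℤ) * (t (-20) * t 17 / (t 12 * t (-8) * t 5))) = 0 := by
      simp [t_m20, t_m8, t_0, t_12, t_17, t_20]
    rw [h.shift (z := 5) (r := (-8)) (by norm_num) (by decide) (by decide) (by decide),
        show (5 : ℤ) - 25 = -20 by norm_num, show (12 : ℤ) + 5 = 17 by norm_num]
    linear_combination (a (-8) 5 / t 5) * e1 + κ * e2
  have s4 : q ^ 44 * a 16 29 = (q ^ 1)⁻¹ * (-(t 9)) * (a (-8) 5 / t 5) + κ * (q ^ 19 * t 1 / (t 5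
      * t 8)) := by
    have e1 : q ^ 44 * t 29 = (q ^ 1)⁻¹ * (-(t 9)) := by
      simp only [t_29, t_m9]
      try field_simp
    have e2 : q ^ 44 * ((q ^ 5) ^ (16 : ℤ) * (t (-24) * t 21 / (t 16 * t (-8) * t 5))) = q ^ 19 *
      t 1 / (t 5 * t 8) := by
      simp only [t_m24, t_m8, t_m4, t_m1, t_16, t_21, t_24]
      field_simp
    rw [h.shift (z := 5) (r := (-8)) (by norm_num) (by decide) (by decide) (by decide),
        show (5 : ℤ) - 29 = -24 by norm_num, show (16 : ℤ) + 5 = 21 by norm_num]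
    linear_combination (a (-8) 5 / t 5) * e1 + κ * e2
  have s5 : a 0 23 = (q ^ 21)⁻¹ * (-(q ^ 6 * t 3)) * (a (-8) 15 / t 15) - ε 15 + ε (-8) + 23 / 20
      - 1 := by
    rw [h.zero_shift (z := 15) (r := (-8)) (by norm_num) (by decide) (by decide),
        show t 23 = (q ^ 21)⁻¹ * (-(q ^ 6 * t 3)) by
      simp only [t_23, t_m3]
      field_simp]
    norm_num
  have s6 : q ^ 15 * a 4 27 = (q ^ 21)⁻¹ * (-(q * t 7)) * (a (-8) 15 / t 15) + κ * (q ^ 15 * t 1 /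
      (t 4 * t 5)) := by
    have e1 : q ^ 15 * t 27 = (q ^ 21)⁻¹ * (-(q * t 7)) := by
      simp only [t_27, t_m7]
      try field_simp
    have e2 : q ^ 15 * ((q ^ 5) ^ (4 : ℤ) * (t (-12) * t 19 / (t 4 * t (-8) * t 15))) = q ^ 15 *
      t 1 / (t 4 * t 5) := by
      simp only [t_m12, t_m8, t_12, t_15, t_19]
      field_simp
    rw [h.shift (z := 15) (r := (-8)) (by norm_num) (by decide) (by decide) (by decide),
        show (15 : ℤ) - 27 = -12 by norm_num, show (4 : ℤ) + 15 = 19 by norm_num]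
    linear_combination (a (-8) 15 / t 15) * e1 + κ * e2
  have s7 : q ^ 34 * a 8 31 = (q ^ 21)⁻¹ * (-(t 9)) * (a (-8) 15 / t 15) + κ * (-(q ^ 19 * t 3 *
      t 4 / (t 5 * t 8 ^ 2))) := by
    have e1 : q ^ 34 * t 31 = (q ^ 21)⁻¹ * (-(t 9)) := by
      simp only [t_31, t_m11, t_11]
      try field_simp
    have e2 : q ^ 34 * ((q ^ 5) ^ (8 : ℤ) * (t (-16) * t 23 / (t 8 * t (-8) * t 15))) = -(q ^ 19 *
      t 3 * t 4 / (t 5 * t 8 ^ 2)) := by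
      simp only [t_m16, t_m8, t_m3, t_15, t_16, t_23]
      field_simp
    rw [h.shift (z := 15) (r := (-8)) (by norm_num) (by decide) (by decide) (by decide),
        show (15 : ℤ) - 31 = -16 by norm_num, show (8 : ℤ) + 15 = 23 by norm_num]
    linear_combination (a (-8) 15 / t 15) * e1 + κ * e2
  have s8 : q ^ 57 * a 12 35 = (q ^ 21)⁻¹ * (-(q ^ 3 * t 5)) * (a (-8) 15 / t 15) + κ * (0) := by
    have e1 : q ^ 57 * t 35 = (q ^ 21)⁻¹ * (-(q ^ 3 * t 5)) := by
      simp only [t_35, t_m15, t_15]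
      try field_simp
    have e2 : q ^ 57 * ((q ^ 5) ^ (12 : ℤ) * (t (-20) * t 27 / (t 12 * t (-8) * t 15))) = 0 := by
      simp [t_m20, t_m8, t_m7, t_0, t_12, t_15, t_20, t_27]
    rw [h.shift (z := 15) (r := (-8)) (by norm_num) (by decide) (by decide) (by decide),
        show (15 : ℤ) - 35 = -20 by norm_num, show (12 : ℤ) + 15 = 27 by norm_num]
    linear_combination (a (-8) 15 / t 15) * e1 + κ * e2
  have s9 : q ^ 84 * a 16 39 = (q ^ 21)⁻¹ * (-(q ^ 10 * t 1)) * (a (-8) 15 / t 15) + κ * (q ^ 9 *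
      t 9 / (t 5 * t 8)) := by
    have e1 : q ^ 84 * t 39 = (q ^ 21)⁻¹ * (-(q ^ 10 * t 1)) := by
      simp only [t_39, t_m19, t_19]
      try field_simp
    have e2 : q ^ 84 * ((q ^ 5) ^ (16 : ℤ) * (t (-24) * t 31 / (t 16 * t (-8) * t 15))) = q ^ 9 *
      t 9 / (t 5 * t 8) := by
      simp only [t_m24, t_m11, t_m8, t_m4, t_11, t_15, t_16, t_24, t_31]
      field_simp
    rw [h.shift (z := 15) (r := (-8)) (by norm_num) (by decide) (by decide) (by decide),
        show (15 : ℤ) - 39 = -24 by norm_num, show (16 : ℤ) + 15 = 31 by norm_num]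
    linear_combination (a (-8) 15 / t 15) * e1 + κ * e2
  have p0 : t 9 * (t 2 * t 5 / (t 1 * t 4 * t 6 * t 9)) = t 2 * t 5 / (t 1 * t 4 * t 6) := by
    field_simp
  have p1 : t 9 * (t 3 * t 7 * t 10 / (t 1 * t 5 * t 6 * t 8 * t 9)) = t 3 * t 7 * t 10 / (t 1 *
      t 5 * t 6 * t 8) := by
    field_simp
  have p2 : t 7 * (t 1 * t 9 * t 10 / (t 2 * t 3 * t 4 * t 5 * t 7)) = t 1 * t 9 * t 10 / (t 2 *
      t 3 * t 4 * t 5) := by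
    field_simp
  have p3 : t 7 * (t 5 * t 6 / (t 2 * t 3 * t 7 * t 8)) = t 5 * t 6 / (t 2 * t 3 * t 8) := by
    field_simp
  have p4 : t 3 * (t 1 * t 9 * t 10 / (t 2 * t 3 * t 4 * t 5 * t 7)) = t 1 * t 9 * t 10 / (t 2 *
      t 4 * t 5 * t 7) := by
    field_simp
  have p5 : t 3 * (t 5 * t 6 / (t 2 * t 3 * t 7 * t 8)) = t 5 * t 6 / (t 2 * t 7 * t 8) := by
    field_simp
  have p6 : t 1 * (t 2 * t 5 / (t 1 * t 4 * t 6 * t 9)) = t 2 * t 5 / (t 4 * t 6 * t 9) := by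
    field_simp
  have p7 : t 1 * (t 3 * t 7 * t 10 / (t 1 * t 5 * t 6 * t 8 * t 9)) = t 3 * t 7 * t 10 / (t 5 *
      t 6 * t 8 * t 9) := by
    field_simp
  have p8 : t 5 * (t 1 * t 9 * t 10 / (t 2 * t 3 * t 4 * t 5 * t 7)) = t 1 * t 9 * t 10 / (t 2 *
      t 3 * t 4 * t 7) := by
    field_simp
  have p9 : t 5 * (t 10 / (t 2 * t 5 * t 8)) = t 10 / (t 2 * t 8) := by
    field_simp
  have p10 : t 5 * (t 10 / (t 4 * t 5 * t 6)) = t 10 / (t 4 * t 6) := by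
    field_simp
  have p11 : t 5 * (t 3 * t 7 * t 10 / (t 1 * t 5 * t 6 * t 8 * t 9)) = t 3 * t 7 * t 10 / (t 1 *
      t 6 * t 8 * t 9) := by
    field_simp
  simp only [l_m8, l_15] at s0 s5
  linear_combination s0 - s1 + s2 - s3 + s4 + s5 - s6 + s7 - s8 + s9 + h'.level_twenty_second_zero
      - 2 / 5 * q ^ 7 * κ * p0 - 3 / 5 * q ^ 4 * κ * p1 + 1 / 5 * q * κ * p2 + 1 / 5 * q ^ 3 * κ *
      p3 - 1 / 5 * q ^ 6 * κ * p4 - 1 / 5 * q ^ 8 * κ * p5 - 2 / 5 * q ^ 17 * κ * p6 - 3 / 5 * q ^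
      14 * κ * p7 + 1 / 5 * q ^ 3 * κ * p8 + 1 / 5 * q ^ 4 * κ * p9 + 2 / 5 * q ^ 6 * κ * p10 + 3
      / 5 * q ^ 7 * κ * p11 + κ * q * h'.level_twenty_second_one + κ * q ^ 2 *
      h'.level_twenty_second_two + κ * q ^ 3 * h'.level_twenty_second_three + κ * q ^ 4 *
      h'.level_twenty_second_four

end

/-! ### Theta quotients as products -/

lemma qPoch_eq_prod {q : ℂ} (hq : ‖q‖ < 1) {k : ℕ} (hk : k ≠ 0) (x : ℂ) :
    qPoch x q = ∏ i ∈ Finset.range k, qPoch (q ^ i * x) (q ^ k) := by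
  have hqk : ‖q ^ k‖ < 1 := base_pow_norm_lt hq hk
  have h1 : Tendsto (fun n : ℕ => ∏ i ∈ Finset.range (k * n), (1 - q ^ i * x)) atTop
      (𝓝 (qPoch x q)) :=
    (tendsto_qPoch hq x).comp (tendsto_id.const_mul_atTop' (Nat.pos_of_ne_zero hk))
  have h2 : Tendsto (fun n : ℕ => ∏ i ∈ Finset.range k, ∏ j ∈ Finset.range n,
      (1 - (q ^ k) ^ j * (q ^ i * x))) atTop (𝓝 (∏ i ∈ Finset.range k,
          qPoch (q ^ i * x) (q ^ k))) :=
    tendsto_finsetProd _ fun i _ => tendsto_qPoch hqk _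
  refine tendsto_nhds_unique h1 (h2.congr fun n => ?_)
  induction n with
  | zero => simp
  | succ n ih =>
    rw [mul_add, mul_one, Finset.prod_range_add, ← ih, ← Finset.prod_mul_distrib]
    refine Finset.prod_congr rfl fun i _ => ?_
    rw [Finset.prod_range_succ]
    congr 2
    ring

lemma qPoch_neg_mul {q : ℂ} (hq : ‖q‖ < 1) (x : ℂ) :
    qPoch (-x) q * qPoch x q = qPoch (x ^ 2) (q ^ 2) := by
  refine tendsto_nhds_unique ((tendsto_qPoch hq (-x)).mul (tendsto_qPoch hq x))
    ((tendsto_qPoch (base_pow_norm_lt hq two_ne_zero) (x ^ 2)).congr fun n => ?_)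
  rw [← Finset.prod_mul_distrib]
  refine Finset.prod_congr rfl fun i _ => ?_
  ring

lemma qPoch_pow_ne_zero {Q : ℂ} (hQ : ‖Q‖ < 1) {a L : ℕ} (ha : a ≠ 0) (hL : L ≠ 0) :
    qPoch (Q ^ a) (Q ^ L) ≠ 0 := by
  refine qPoch_ne_zero (base_pow_norm_lt hQ hL) fun i => ?_
  rw [← pow_mul, ← pow_add]
  have : ‖Q ^ (L * i + a)‖ < 1 := base_pow_norm_lt hQ (by omega)
  intro h
  rw [h] at this
  simp at this

lemma qPoch_pow_eq_prod {Q : ℂ} (hQ : ‖Q‖ < 1) {m : ℕ} (hm : m ≠ 0) {k : ℕ} (hk : k ≠ 0) (a : ℕ) :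
    qPoch (Q ^ a) (Q ^ m) = ∏ i ∈ Finset.range k, qPoch (Q ^ (m * i + a)) (Q ^ (m * k)) := by
  rw [qPoch_eq_prod (base_pow_norm_lt hQ hm) hk]
  refine Finset.prod_congr rfl fun i _ => ?_
  rw [← pow_mul, ← pow_mul, ← pow_add]

lemma J_mul (m a b : ℕ) (q : ℂ) : J (m * a) (m * b) q = J a b (q ^ m) := by
  rw [J, J, pow_mul, pow_mul]

lemma Jbar_mul (m a b : ℕ) (q : ℂ) : Jbar (m * a) (m * b) q = Jbar a b (q ^ m) := by
  rw [Jbar, Jbar, pow_mul, pow_mul]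

lemma J1_mul (m a : ℕ) (q : ℂ) : J1 (m * a) q = J1 a (q ^ m) := by
  rw [J1, J1, ← J_mul, show 3 * (m * a) = m * (3 * a) by ring]

section
variable {Q : ℂ}

lemma J_eq {a m : ℕ} (hQ0 : Q ≠ 0) (ham : a ≤ m) :
    J a m Q = qPoch (Q ^ a) (Q ^ m) * qPoch (Q ^ (m - a)) (Q ^ m) * qPoch (Q ^ m) (Q ^ m) := by
  rw [J, theta, pow_sub₀ Q hQ0 ham, div_eq_mul_inv]

/-- The three Pochhammer symbols of `J m (3 * m) Q` are the residue classes modulo 3 of the factors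
of `(Q ^ m; Q ^ m)_∞`. -/
lemma J1_eq {m : ℕ} (hQ0 : Q ≠ 0) (hQ : ‖Q‖ < 1) (hm : m ≠ 0) : J1 m Q = qPoch (Q ^ m) (Q ^ m) := by
  rw [J1, J_eq hQ0 (by omega), qPoch_pow_eq_prod hQ hm three_ne_zero m, mul_comm m 3,
    show 3 * m - m = m * 1 + m by omega]
  simp only [Finset.prod_range_succ, Finset.prod_range_zero, one_mul, mul_zero, zero_add]
  rw [show m * 2 + m = 3 * m by ring]

/-- At the half period the two negative Pochhammer symbols coincide; `(-x; q)_∞ (x; q)_∞ = (x²;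
q²)_∞` then rewrites everything with positive arguments. -/
lemma Jbar_half {a : ℕ} (hQ0 : Q ≠ 0) (hQ : ‖Q‖ < 1) (ha : a ≠ 0) :
    Jbar a (2 * a) Q * qPoch (Q ^ a) (Q ^ (2 * a)) ^ 2 =
      qPoch (Q ^ (2 * a)) (Q ^ (4 * a)) ^ 2 * qPoch (Q ^ (2 * a)) (Q ^ (2 * a)) := by
  have h := qPoch_neg_mul (base_pow_norm_lt hQ (show 2 * a ≠ 0 by omega)) (Q ^ a)
  rw [← pow_mul, ← pow_mul, mul_comm a 2, show 2 * a * 2 = 4 * a by ring] at h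
  rw [Jbar, theta, div_neg, ← h, show Q ^ (2 * a) / Q ^ a = Q ^ a by
    rw [two_mul, pow_add, mul_div_cancel_right₀ _ (pow_ne_zero _ hQ0)]]
  ring

/-- The arguments `-Q ^ a` and `-Q ^ (3 * a)` to the base `Q ^ (4 * a)` are the two residue classes
of `(-Q ^ a; Q ^ (2 * a))_∞`. -/
lemma Jbar_quarter {a : ℕ} (hQ0 : Q ≠ 0) (hQ : ‖Q‖ < 1) (ha : a ≠ 0) :
    Jbar a (4 * a) Q * qPoch (Q ^ a) (Q ^ (2 * a)) = qPoch (Q ^ (2 * a)) (Q ^ (2 * a)) := by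
  have hq2 := base_pow_norm_lt hQ (show 2 * a ≠ 0 by omega)
  have h := qPoch_neg_mul hq2 (Q ^ a)
  have h1 := qPoch_eq_prod hq2 two_ne_zero (-Q ^ a)
  have h2 := qPoch_eq_prod hq2 two_ne_zero (Q ^ (2 * a))
  simp only [Finset.prod_range_succ, Finset.prod_range_zero, one_mul, pow_zero, pow_one] at h1 h2
  rw [← pow_mul, ← pow_mul, mul_comm a 2, show 2 * a * 2 = 4 * a by ring] at h
  rw [← pow_mul, show 2 * a * 2 = 4 * a by ring] at h1 h2
  rw [← pow_add, show 2 * a + 2 * a = 4 * a by ring] at h2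
  rw [mul_neg, ← pow_add] at h1
  rw [Jbar, theta, div_neg, h2, ← h, h1, show Q ^ (4 * a) / Q ^ a = Q ^ (2 * a + a) by
    rw [show 4 * a = 2 * a + a + a by ring, pow_add _ (2 * a + a),
      mul_div_cancel_right₀ _ (pow_ne_zero _ hQ0)]]
  ring

lemma tc_eq {L a b : ℕ} (hQ0 : Q ≠ 0) (hQ : ‖Q‖ < 1) (hL : L ≠ 0) (hab : a + b = L) :
    tc L Q a = qPoch (Q ^ a) (Q ^ L) * qPoch (Q ^ b) (Q ^ L) * qPoch (Q ^ L) (Q ^ L) := by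
  rw [tc, ← theta_eq_th (pow_ne_zero _ hQ0) (base_pow_norm_lt hQ hL) (zpow_ne_zero _ hQ0), theta,
    zpow_natCast, ← hab, pow_add, mul_div_cancel_left₀ _ (pow_ne_zero _ hQ0)]

/-- Both sides become quotients of monomials in `P a = (Q ^ a; Q ^ 12)_∞` after each product is
split into residue classes, and the factors cancel. The other quotient lemmas follow the same
scheme, at level 20 with base `Q ^ 20`. -/
theorem theta_quotient_twelve_zero (hQ0 : Q ≠ 0) (hQ : ‖Q‖ < 1) :
    Jbar 3 6 Q ^ 2 * J 1 4 Q / J1 2 Q ^ 2 =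
      qPoch (Q ^ 12) (Q ^ 12) ^ 3 * (tc 12 Q 1 * tc 12 Q 5 * tc 12 Q 6 ^ 2 /
        (tc 12 Q 2 ^ 2 * tc 12 Q 3 ^ 3 * tc 12 Q 4)) := by
  obtain ⟨P, hP⟩ : ∃ P : ℕ → ℂ, P = fun a => qPoch (Q ^ a) (Q ^ 12) := ⟨_, rfl⟩
  have hP0 : ∀ a, a ≠ 0 → P a ≠ 0 := fun a ha => by
    rw [hP]; exact qPoch_pow_ne_zero hQ ha (by norm_num)
  have n1 := hP0 1 (by norm_num)
  have n2 := hP0 2 (by norm_num)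
  have n3 := hP0 3 (by norm_num)
  have n4 := hP0 4 (by norm_num)
  have n5 := hP0 5 (by norm_num)
  have n6 := hP0 6 (by norm_num)
  have n7 := hP0 7 (by norm_num)
  have n8 := hP0 8 (by norm_num)
  have n9 := hP0 9 (by norm_num)
  have n10 := hP0 10 (by norm_num)
  have n11 := hP0 11 (by norm_num)
  have n12 := hP0 12 (by norm_num)
  have j0 : J 1 4 Q = (P 1 * P 5 * P 9) * (P 3 * P 7 * P 11) * (P 4 * P 8 * P 12) := by
    rw [hP, J_eq hQ0 (by norm_num),
      qPoch_pow_eq_prod hQ (by norm_num) (show 3 ≠ 0 by norm_num) 1,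
      qPoch_pow_eq_prod hQ (by norm_num) (show 3 ≠ 0 by norm_num) (4 - 1),
      qPoch_pow_eq_prod hQ (by norm_num) (show 3 ≠ 0 by norm_num) 4]
    simp only [Finset.prod_range_succ, Finset.prod_range_zero, one_mul]
  have i0 : J1 2 Q = P 2 * P 4 * P 6 * P 8 * P 10 * P 12 := by
    rw [hP, J1_eq hQ0 hQ (by norm_num), qPoch_pow_eq_prod hQ (by norm_num) (show 6 ≠ 0 by norm_num)]
    simp only [Finset.prod_range_succ, Finset.prod_range_zero, one_mul]
  have t0 : tc 12 Q 1 = P 1 * P 11 * P 12 := by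
    rw [hP]; exact tc_eq (a := 1) (b := 11) hQ0 hQ (by norm_num) rfl
  have t1 : tc 12 Q 2 = P 2 * P 10 * P 12 := by
    rw [hP]; exact tc_eq (a := 2) (b := 10) hQ0 hQ (by norm_num) rfl
  have t2 : tc 12 Q 3 = P 3 * P 9 * P 12 := by
    rw [hP]; exact tc_eq (a := 3) (b := 9) hQ0 hQ (by norm_num) rfl
  have t3 : tc 12 Q 4 = P 4 * P 8 * P 12 := by
    rw [hP]; exact tc_eq (a := 4) (b := 8) hQ0 hQ (by norm_num) rfl
  have t4 : tc 12 Q 5 = P 5 * P 7 * P 12 := by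
    rw [hP]; exact tc_eq (a := 5) (b := 7) hQ0 hQ (by norm_num) rfl
  have t5 : tc 12 Q 6 = P 6 * P 6 * P 12 := by
    rw [hP]; exact tc_eq (a := 6) (b := 6) hQ0 hQ (by norm_num) rfl
  have b : Jbar 3 6 Q = (P 6) ^ 2 * (P 6 * P 12) / (P 3 * P 9) ^ 2 := by
    have u : qPoch (Q ^ 3) (Q ^ 6) = P 3 * P 9 := by
      rw [hP, qPoch_pow_eq_prod hQ (by norm_num) (show 2 ≠ 0 by norm_num)]
      simp only [Finset.prod_range_succ, Finset.prod_range_zero, one_mul]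
    have w : qPoch (Q ^ 6) (Q ^ 6) = P 6 * P 12 := by
      rw [hP, qPoch_pow_eq_prod hQ (by norm_num) (show 2 ≠ 0 by norm_num)]
      simp only [Finset.prod_range_succ, Finset.prod_range_zero, one_mul]
    have e := Jbar_half hQ0 hQ (show 3 ≠ 0 by norm_num)
    norm_num only at e
    rw [u, w] at e
    rw [eq_div_iff (pow_ne_zero _ (mul_ne_zero (hP0 3 (by norm_num)) (hP0 9 (by norm_num))))]
    simp only [hP] at e ⊢
    exact e
  rw [show qPoch (Q ^ 12) (Q ^ 12) = P 12 by rw [hP], j0, i0, t0, t1, t2, t3, t4, t5, b]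
  field_simp

theorem theta_quotient_twelve_one (hQ0 : Q ≠ 0) (hQ : ‖Q‖ < 1) :
    Jbar 3 6 Q * J 3 12 Q / J1 2 Q =
      qPoch (Q ^ 12) (Q ^ 12) ^ 3 * (tc 12 Q 6 /
        (tc 12 Q 2 * tc 12 Q 3 * tc 12 Q 4)) := by
  obtain ⟨P, hP⟩ : ∃ P : ℕ → ℂ, P = fun a => qPoch (Q ^ a) (Q ^ 12) := ⟨_, rfl⟩
  have hP0 : ∀ a, a ≠ 0 → P a ≠ 0 := fun a ha => by
    rw [hP]; exact qPoch_pow_ne_zero hQ ha (by norm_num)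
  have n2 := hP0 2 (by norm_num)
  have n3 := hP0 3 (by norm_num)
  have n4 := hP0 4 (by norm_num)
  have n6 := hP0 6 (by norm_num)
  have n8 := hP0 8 (by norm_num)
  have n9 := hP0 9 (by norm_num)
  have n10 := hP0 10 (by norm_num)
  have n12 := hP0 12 (by norm_num)
  have j0 : J 3 12 Q = P 3 * P 9 * P 12 := by
    rw [hP, J_eq hQ0 (by norm_num)]
  have i0 : J1 2 Q = P 2 * P 4 * P 6 * P 8 * P 10 * P 12 := by
    rw [hP, J1_eq hQ0 hQ (by norm_num), qPoch_pow_eq_prod hQ (by norm_num) (show 6 ≠ 0 by norm_num)]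
    simp only [Finset.prod_range_succ, Finset.prod_range_zero, one_mul]
  have t0 : tc 12 Q 2 = P 2 * P 10 * P 12 := by
    rw [hP]; exact tc_eq (a := 2) (b := 10) hQ0 hQ (by norm_num) rfl
  have t1 : tc 12 Q 3 = P 3 * P 9 * P 12 := by
    rw [hP]; exact tc_eq (a := 3) (b := 9) hQ0 hQ (by norm_num) rfl
  have t2 : tc 12 Q 4 = P 4 * P 8 * P 12 := by
    rw [hP]; exact tc_eq (a := 4) (b := 8) hQ0 hQ (by norm_num) rfl
  have t3 : tc 12 Q 6 = P 6 * P 6 * P 12 := by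
    rw [hP]; exact tc_eq (a := 6) (b := 6) hQ0 hQ (by norm_num) rfl
  have b : Jbar 3 6 Q = (P 6) ^ 2 * (P 6 * P 12) / (P 3 * P 9) ^ 2 := by
    have u : qPoch (Q ^ 3) (Q ^ 6) = P 3 * P 9 := by
      rw [hP, qPoch_pow_eq_prod hQ (by norm_num) (show 2 ≠ 0 by norm_num)]
      simp only [Finset.prod_range_succ, Finset.prod_range_zero, one_mul]
    have w : qPoch (Q ^ 6) (Q ^ 6) = P 6 * P 12 := by
      rw [hP, qPoch_pow_eq_prod hQ (by norm_num) (show 2 ≠ 0 by norm_num)]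
      simp only [Finset.prod_range_succ, Finset.prod_range_zero, one_mul]
    have e := Jbar_half hQ0 hQ (show 3 ≠ 0 by norm_num)
    norm_num only at e
    rw [u, w] at e
    rw [eq_div_iff (pow_ne_zero _ (mul_ne_zero (hP0 3 (by norm_num)) (hP0 9 (by norm_num))))]
    simp only [hP] at e ⊢
    exact e
  rw [show qPoch (Q ^ 12) (Q ^ 12) = P 12 by rw [hP], j0, i0, t0, t1, t2, t3, b]
  field_simp

theorem theta_quotient_twelve_two (hQ0 : Q ≠ 0) (hQ : ‖Q‖ < 1) :
    J 3 12 Q ^ 2 / J 1 4 Q =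
      qPoch (Q ^ 12) (Q ^ 12) ^ 3 * (tc 12 Q 3 /
        (tc 12 Q 1 * tc 12 Q 4 * tc 12 Q 5)) := by
  obtain ⟨P, hP⟩ : ∃ P : ℕ → ℂ, P = fun a => qPoch (Q ^ a) (Q ^ 12) := ⟨_, rfl⟩
  have hP0 : ∀ a, a ≠ 0 → P a ≠ 0 := fun a ha => by
    rw [hP]; exact qPoch_pow_ne_zero hQ ha (by norm_num)
  have n1 := hP0 1 (by norm_num)
  have n3 := hP0 3 (by norm_num)
  have n4 := hP0 4 (by norm_num)
  have n5 := hP0 5 (by norm_num)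
  have n7 := hP0 7 (by norm_num)
  have n8 := hP0 8 (by norm_num)
  have n9 := hP0 9 (by norm_num)
  have n11 := hP0 11 (by norm_num)
  have n12 := hP0 12 (by norm_num)
  have j0 : J 3 12 Q = P 3 * P 9 * P 12 := by
    rw [hP, J_eq hQ0 (by norm_num)]
  have j1 : J 1 4 Q = (P 1 * P 5 * P 9) * (P 3 * P 7 * P 11) * (P 4 * P 8 * P 12) := by
    rw [hP, J_eq hQ0 (by norm_num),
      qPoch_pow_eq_prod hQ (by norm_num) (show 3 ≠ 0 by norm_num) 1,
      qPoch_pow_eq_prod hQ (by norm_num) (show 3 ≠ 0 by norm_num) (4 - 1),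
      qPoch_pow_eq_prod hQ (by norm_num) (show 3 ≠ 0 by norm_num) 4]
    simp only [Finset.prod_range_succ, Finset.prod_range_zero, one_mul]
  have t0 : tc 12 Q 1 = P 1 * P 11 * P 12 := by
    rw [hP]; exact tc_eq (a := 1) (b := 11) hQ0 hQ (by norm_num) rfl
  have t1 : tc 12 Q 3 = P 3 * P 9 * P 12 := by
    rw [hP]; exact tc_eq (a := 3) (b := 9) hQ0 hQ (by norm_num) rfl
  have t2 : tc 12 Q 4 = P 4 * P 8 * P 12 := by
    rw [hP]; exact tc_eq (a := 4) (b := 8) hQ0 hQ (by norm_num) rfl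
  have t3 : tc 12 Q 5 = P 5 * P 7 * P 12 := by
    rw [hP]; exact tc_eq (a := 5) (b := 7) hQ0 hQ (by norm_num) rfl
  rw [show qPoch (Q ^ 12) (Q ^ 12) = P 12 by rw [hP], j0, j1, t0, t1, t2, t3]
  field_simp

/-- A second product form of the quotient in `theta_quotient_twelve_two`. The trisection produces
one form and the third rank difference is stated in the other. -/
theorem theta_quotient_twelve_two' (hQ0 : Q ≠ 0) (hQ : ‖Q‖ < 1) :
    J1 3 Q * J1 12 Q ^ 2 / (J1 4 Q * J 1 6 Q) =
      qPoch (Q ^ 12) (Q ^ 12) ^ 3 * (tc 12 Q 3 /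
        (tc 12 Q 1 * tc 12 Q 4 * tc 12 Q 5)) := by
  obtain ⟨P, hP⟩ : ∃ P : ℕ → ℂ, P = fun a => qPoch (Q ^ a) (Q ^ 12) := ⟨_, rfl⟩
  have hP0 : ∀ a, a ≠ 0 → P a ≠ 0 := fun a ha => by
    rw [hP]; exact qPoch_pow_ne_zero hQ ha (by norm_num)
  have n1 := hP0 1 (by norm_num)
  have n3 := hP0 3 (by norm_num)
  have n4 := hP0 4 (by norm_num)
  have n5 := hP0 5 (by norm_num)
  have n6 := hP0 6 (by norm_num)
  have n7 := hP0 7 (by norm_num)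
  have n8 := hP0 8 (by norm_num)
  have n9 := hP0 9 (by norm_num)
  have n11 := hP0 11 (by norm_num)
  have n12 := hP0 12 (by norm_num)
  have j0 : J 1 6 Q = (P 1 * P 7) * (P 5 * P 11) * (P 6 * P 12) := by
    rw [hP, J_eq hQ0 (by norm_num),
      qPoch_pow_eq_prod hQ (by norm_num) (show 2 ≠ 0 by norm_num) 1,
      qPoch_pow_eq_prod hQ (by norm_num) (show 2 ≠ 0 by norm_num) (6 - 1),
      qPoch_pow_eq_prod hQ (by norm_num) (show 2 ≠ 0 by norm_num) 6]
    simp only [Finset.prod_range_succ, Finset.prod_range_zero, one_mul]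
  have i0 : J1 3 Q = P 3 * P 6 * P 9 * P 12 := by
    rw [hP, J1_eq hQ0 hQ (by norm_num), qPoch_pow_eq_prod hQ (by norm_num) (show 4 ≠ 0 by norm_num)]
    simp only [Finset.prod_range_succ, Finset.prod_range_zero, one_mul]
  have i1 : J1 12 Q = P 12 := by
    rw [hP, J1_eq hQ0 hQ (by norm_num)]
  have i2 : J1 4 Q = P 4 * P 8 * P 12 := by
    rw [hP, J1_eq hQ0 hQ (by norm_num), qPoch_pow_eq_prod hQ (by norm_num) (show 3 ≠ 0 by norm_num)]
    simp only [Finset.prod_range_succ, Finset.prod_range_zero, one_mul]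
  have t0 : tc 12 Q 1 = P 1 * P 11 * P 12 := by
    rw [hP]; exact tc_eq (a := 1) (b := 11) hQ0 hQ (by norm_num) rfl
  have t1 : tc 12 Q 3 = P 3 * P 9 * P 12 := by
    rw [hP]; exact tc_eq (a := 3) (b := 9) hQ0 hQ (by norm_num) rfl
  have t2 : tc 12 Q 4 = P 4 * P 8 * P 12 := by
    rw [hP]; exact tc_eq (a := 4) (b := 8) hQ0 hQ (by norm_num) rfl
  have t3 : tc 12 Q 5 = P 5 * P 7 * P 12 := by
    rw [hP]; exact tc_eq (a := 5) (b := 7) hQ0 hQ (by norm_num) rfl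
  rw [show qPoch (Q ^ 12) (Q ^ 12) = P 12 by rw [hP], j0, i0, i1, i2, t0, t1, t2, t3]
  field_simp

theorem theta_quotient_twenty_zero (hQ0 : Q ≠ 0) (hQ : ‖Q‖ < 1) :
    J 1 10 Q ^ 2 * J 6 20 Q * J 8 20 Q / (J1 1 Q * Jbar 10 40 Q * J1 20 Q) =
      qPoch (Q ^ 20) (Q ^ 20) ^ 3 * (tc 20 Q 1 * tc 20 Q 9 * tc 20 Q 10 /
        (tc 20 Q 2 * tc 20 Q 3 * tc 20 Q 4 * tc 20 Q 5 * tc 20 Q 7)) := by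
  obtain ⟨P, hP⟩ : ∃ P : ℕ → ℂ, P = fun a => qPoch (Q ^ a) (Q ^ 20) := ⟨_, rfl⟩
  have hP0 : ∀ a, a ≠ 0 → P a ≠ 0 := fun a ha => by
    rw [hP]; exact qPoch_pow_ne_zero hQ ha (by norm_num)
  have n1 := hP0 1 (by norm_num)
  have n2 := hP0 2 (by norm_num)
  have n3 := hP0 3 (by norm_num)
  have n4 := hP0 4 (by norm_num)
  have n5 := hP0 5 (by norm_num)
  have n6 := hP0 6 (by norm_num)
  have n7 := hP0 7 (by norm_num)
  have n8 := hP0 8 (by norm_num)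
  have n9 := hP0 9 (by norm_num)
  have n10 := hP0 10 (by norm_num)
  have n11 := hP0 11 (by norm_num)
  have n12 := hP0 12 (by norm_num)
  have n13 := hP0 13 (by norm_num)
  have n14 := hP0 14 (by norm_num)
  have n15 := hP0 15 (by norm_num)
  have n16 := hP0 16 (by norm_num)
  have n17 := hP0 17 (by norm_num)
  have n18 := hP0 18 (by norm_num)
  have n19 := hP0 19 (by norm_num)
  have n20 := hP0 20 (by norm_num)
  have j0 : J 1 10 Q = (P 1 * P 11) * (P 9 * P 19) * (P 10 * P 20) := by
    rw [hP, J_eq hQ0 (by norm_num),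
      qPoch_pow_eq_prod hQ (by norm_num) (show 2 ≠ 0 by norm_num) 1,
      qPoch_pow_eq_prod hQ (by norm_num) (show 2 ≠ 0 by norm_num) (10 - 1),
      qPoch_pow_eq_prod hQ (by norm_num) (show 2 ≠ 0 by norm_num) 10]
    simp only [Finset.prod_range_succ, Finset.prod_range_zero, one_mul]
  have j1 : J 6 20 Q = P 6 * P 14 * P 20 := by
    rw [hP, J_eq hQ0 (by norm_num)]
  have j2 : J 8 20 Q = P 8 * P 12 * P 20 := by
    rw [hP, J_eq hQ0 (by norm_num)]
  have i0 : J1 1 Q = P 1 * P 2 * P 3 * P 4 * P 5 * P 6 * P 7 * P 8 * P 9 * P 10 * P 11 * P 12 * P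
      13 * P 14 * P 15 * P 16 * P 17 * P 18 * P 19 * P 20 := by
    rw [hP, J1_eq hQ0 hQ (by norm_num),
        qPoch_pow_eq_prod hQ (by norm_num) (show 20 ≠ 0 by norm_num)]
    simp only [Finset.prod_range_succ, Finset.prod_range_zero, one_mul]
  have i1 : J1 20 Q = P 20 := by
    rw [hP, J1_eq hQ0 hQ (by norm_num)]
  have t0 : tc 20 Q 1 = P 1 * P 19 * P 20 := by
    rw [hP]; exact tc_eq (a := 1) (b := 19) hQ0 hQ (by norm_num) rfl
  have t1 : tc 20 Q 9 = P 9 * P 11 * P 20 := by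
    rw [hP]; exact tc_eq (a := 9) (b := 11) hQ0 hQ (by norm_num) rfl
  have t2 : tc 20 Q 10 = P 10 * P 10 * P 20 := by
    rw [hP]; exact tc_eq (a := 10) (b := 10) hQ0 hQ (by norm_num) rfl
  have t3 : tc 20 Q 2 = P 2 * P 18 * P 20 := by
    rw [hP]; exact tc_eq (a := 2) (b := 18) hQ0 hQ (by norm_num) rfl
  have t4 : tc 20 Q 3 = P 3 * P 17 * P 20 := by
    rw [hP]; exact tc_eq (a := 3) (b := 17) hQ0 hQ (by norm_num) rfl
  have t5 : tc 20 Q 4 = P 4 * P 16 * P 20 := by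
    rw [hP]; exact tc_eq (a := 4) (b := 16) hQ0 hQ (by norm_num) rfl
  have t6 : tc 20 Q 5 = P 5 * P 15 * P 20 := by
    rw [hP]; exact tc_eq (a := 5) (b := 15) hQ0 hQ (by norm_num) rfl
  have t7 : tc 20 Q 7 = P 7 * P 13 * P 20 := by
    rw [hP]; exact tc_eq (a := 7) (b := 13) hQ0 hQ (by norm_num) rfl
  have b : Jbar 10 40 Q = P 20 / P 10 := by
    rw [eq_div_iff (hP0 10 (by norm_num)), hP]
    exact Jbar_quarter hQ0 hQ (show 10 ≠ 0 by norm_num)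
  rw [show qPoch (Q ^ 20) (Q ^ 20) = P 20 by rw [hP], j0, j1, j2, i0, i1, t0, t1, t2, t3, t4, t5,
      t6, t7, b]
  field_simp

theorem theta_quotient_twenty_one (hQ0 : Q ≠ 0) (hQ : ‖Q‖ < 1) :
    J1 10 Q ^ 4 / (J 2 10 Q * J1 5 Q * J1 20 Q) =
      qPoch (Q ^ 20) (Q ^ 20) ^ 3 * (tc 20 Q 10 /
        (tc 20 Q 2 * tc 20 Q 5 * tc 20 Q 8)) := by
  obtain ⟨P, hP⟩ : ∃ P : ℕ → ℂ, P = fun a => qPoch (Q ^ a) (Q ^ 20) := ⟨_, rfl⟩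
  have hP0 : ∀ a, a ≠ 0 → P a ≠ 0 := fun a ha => by
    rw [hP]; exact qPoch_pow_ne_zero hQ ha (by norm_num)
  have n2 := hP0 2 (by norm_num)
  have n5 := hP0 5 (by norm_num)
  have n8 := hP0 8 (by norm_num)
  have n10 := hP0 10 (by norm_num)
  have n12 := hP0 12 (by norm_num)
  have n15 := hP0 15 (by norm_num)
  have n18 := hP0 18 (by norm_num)
  have n20 := hP0 20 (by norm_num)
  have j0 : J 2 10 Q = (P 2 * P 12) * (P 8 * P 18) * (P 10 * P 20) := by
    rw [hP, J_eq hQ0 (by norm_num),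
      qPoch_pow_eq_prod hQ (by norm_num) (show 2 ≠ 0 by norm_num) 2,
      qPoch_pow_eq_prod hQ (by norm_num) (show 2 ≠ 0 by norm_num) (10 - 2),
      qPoch_pow_eq_prod hQ (by norm_num) (show 2 ≠ 0 by norm_num) 10]
    simp only [Finset.prod_range_succ, Finset.prod_range_zero, one_mul]
  have i0 : J1 10 Q = P 10 * P 20 := by
    rw [hP, J1_eq hQ0 hQ (by norm_num), qPoch_pow_eq_prod hQ (by norm_num) (show 2 ≠ 0 by norm_num)]
    simp only [Finset.prod_range_succ, Finset.prod_range_zero, one_mul]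
  have i1 : J1 5 Q = P 5 * P 10 * P 15 * P 20 := by
    rw [hP, J1_eq hQ0 hQ (by norm_num), qPoch_pow_eq_prod hQ (by norm_num) (show 4 ≠ 0 by norm_num)]
    simp only [Finset.prod_range_succ, Finset.prod_range_zero, one_mul]
  have i2 : J1 20 Q = P 20 := by
    rw [hP, J1_eq hQ0 hQ (by norm_num)]
  have t0 : tc 20 Q 10 = P 10 * P 10 * P 20 := by
    rw [hP]; exact tc_eq (a := 10) (b := 10) hQ0 hQ (by norm_num) rfl
  have t1 : tc 20 Q 2 = P 2 * P 18 * P 20 := by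
    rw [hP]; exact tc_eq (a := 2) (b := 18) hQ0 hQ (by norm_num) rfl
  have t2 : tc 20 Q 5 = P 5 * P 15 * P 20 := by
    rw [hP]; exact tc_eq (a := 5) (b := 15) hQ0 hQ (by norm_num) rfl
  have t3 : tc 20 Q 8 = P 8 * P 12 * P 20 := by
    rw [hP]; exact tc_eq (a := 8) (b := 12) hQ0 hQ (by norm_num) rfl
  rw [show qPoch (Q ^ 20) (Q ^ 20) = P 20 by rw [hP], j0, i0, i1, i2, t0, t1, t2, t3]
  field_simp

theorem theta_quotient_twenty_two (hQ0 : Q ≠ 0) (hQ : ‖Q‖ < 1) :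
    J1 5 Q ^ 2 * J 6 20 Q / (J 2 5 Q * J1 10 Q) =
      qPoch (Q ^ 20) (Q ^ 20) ^ 3 * (tc 20 Q 5 * tc 20 Q 6 /
        (tc 20 Q 2 * tc 20 Q 3 * tc 20 Q 7 * tc 20 Q 8)) := by
  obtain ⟨P, hP⟩ : ∃ P : ℕ → ℂ, P = fun a => qPoch (Q ^ a) (Q ^ 20) := ⟨_, rfl⟩
  have hP0 : ∀ a, a ≠ 0 → P a ≠ 0 := fun a ha => by
    rw [hP]; exact qPoch_pow_ne_zero hQ ha (by norm_num)
  have n2 := hP0 2 (by norm_num)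
  have n3 := hP0 3 (by norm_num)
  have n5 := hP0 5 (by norm_num)
  have n6 := hP0 6 (by norm_num)
  have n7 := hP0 7 (by norm_num)
  have n8 := hP0 8 (by norm_num)
  have n10 := hP0 10 (by norm_num)
  have n12 := hP0 12 (by norm_num)
  have n13 := hP0 13 (by norm_num)
  have n14 := hP0 14 (by norm_num)
  have n15 := hP0 15 (by norm_num)
  have n17 := hP0 17 (by norm_num)
  have n18 := hP0 18 (by norm_num)
  have n20 := hP0 20 (by norm_num)
  have j0 : J 6 20 Q = P 6 * P 14 * P 20 := by
    rw [hP, J_eq hQ0 (by norm_num)]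
  have j1 : J 2 5 Q = (P 2 * P 7 * P 12 * P 17) * (P 3 * P 8 * P 13 * P 18) * (P 5 * P 10 * P 15 *
      P 20) := by
    rw [hP, J_eq hQ0 (by norm_num),
      qPoch_pow_eq_prod hQ (by norm_num) (show 4 ≠ 0 by norm_num) 2,
      qPoch_pow_eq_prod hQ (by norm_num) (show 4 ≠ 0 by norm_num) (5 - 2),
      qPoch_pow_eq_prod hQ (by norm_num) (show 4 ≠ 0 by norm_num) 5]
    simp only [Finset.prod_range_succ, Finset.prod_range_zero, one_mul]
  have i0 : J1 5 Q = P 5 * P 10 * P 15 * P 20 := by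
    rw [hP, J1_eq hQ0 hQ (by norm_num), qPoch_pow_eq_prod hQ (by norm_num) (show 4 ≠ 0 by norm_num)]
    simp only [Finset.prod_range_succ, Finset.prod_range_zero, one_mul]
  have i1 : J1 10 Q = P 10 * P 20 := by
    rw [hP, J1_eq hQ0 hQ (by norm_num), qPoch_pow_eq_prod hQ (by norm_num) (show 2 ≠ 0 by norm_num)]
    simp only [Finset.prod_range_succ, Finset.prod_range_zero, one_mul]
  have t0 : tc 20 Q 5 = P 5 * P 15 * P 20 := by
    rw [hP]; exact tc_eq (a := 5) (b := 15) hQ0 hQ (by norm_num) rfl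
  have t1 : tc 20 Q 6 = P 6 * P 14 * P 20 := by
    rw [hP]; exact tc_eq (a := 6) (b := 14) hQ0 hQ (by norm_num) rfl
  have t2 : tc 20 Q 2 = P 2 * P 18 * P 20 := by
    rw [hP]; exact tc_eq (a := 2) (b := 18) hQ0 hQ (by norm_num) rfl
  have t3 : tc 20 Q 3 = P 3 * P 17 * P 20 := by
    rw [hP]; exact tc_eq (a := 3) (b := 17) hQ0 hQ (by norm_num) rfl
  have t4 : tc 20 Q 7 = P 7 * P 13 * P 20 := by
    rw [hP]; exact tc_eq (a := 7) (b := 13) hQ0 hQ (by norm_num) rfl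
  have t5 : tc 20 Q 8 = P 8 * P 12 * P 20 := by
    rw [hP]; exact tc_eq (a := 8) (b := 12) hQ0 hQ (by norm_num) rfl
  rw [show qPoch (Q ^ 20) (Q ^ 20) = P 20 by rw [hP], j0, j1, i0, i1, t0, t1, t2, t3, t4, t5]
  field_simp

theorem theta_quotient_twenty_two' (hQ0 : Q ≠ 0) (hQ : ‖Q‖ < 1) :
    J 2 20 Q * J1 5 Q ^ 2 / (J 1 5 Q * J1 10 Q) =
      qPoch (Q ^ 20) (Q ^ 20) ^ 3 * (tc 20 Q 2 * tc 20 Q 5 /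
        (tc 20 Q 1 * tc 20 Q 4 * tc 20 Q 6 * tc 20 Q 9)) := by
  obtain ⟨P, hP⟩ : ∃ P : ℕ → ℂ, P = fun a => qPoch (Q ^ a) (Q ^ 20) := ⟨_, rfl⟩
  have hP0 : ∀ a, a ≠ 0 → P a ≠ 0 := fun a ha => by
    rw [hP]; exact qPoch_pow_ne_zero hQ ha (by norm_num)
  have n1 := hP0 1 (by norm_num)
  have n2 := hP0 2 (by norm_num)
  have n4 := hP0 4 (by norm_num)
  have n5 := hP0 5 (by norm_num)
  have n6 := hP0 6 (by norm_num)
  have n9 := hP0 9 (by norm_num)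
  have n10 := hP0 10 (by norm_num)
  have n11 := hP0 11 (by norm_num)
  have n14 := hP0 14 (by norm_num)
  have n15 := hP0 15 (by norm_num)
  have n16 := hP0 16 (by norm_num)
  have n18 := hP0 18 (by norm_num)
  have n19 := hP0 19 (by norm_num)
  have n20 := hP0 20 (by norm_num)
  have j0 : J 2 20 Q = P 2 * P 18 * P 20 := by
    rw [hP, J_eq hQ0 (by norm_num)]
  have j1 : J 1 5 Q = (P 1 * P 6 * P 11 * P 16) * (P 4 * P 9 * P 14 * P 19) * (P 5 * P 10 * P 15 *
      P 20) := by
    rw [hP, J_eq hQ0 (by norm_num),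
      qPoch_pow_eq_prod hQ (by norm_num) (show 4 ≠ 0 by norm_num) 1,
      qPoch_pow_eq_prod hQ (by norm_num) (show 4 ≠ 0 by norm_num) (5 - 1),
      qPoch_pow_eq_prod hQ (by norm_num) (show 4 ≠ 0 by norm_num) 5]
    simp only [Finset.prod_range_succ, Finset.prod_range_zero, one_mul]
  have i0 : J1 5 Q = P 5 * P 10 * P 15 * P 20 := by
    rw [hP, J1_eq hQ0 hQ (by norm_num), qPoch_pow_eq_prod hQ (by norm_num) (show 4 ≠ 0 by norm_num)]
    simp only [Finset.prod_range_succ, Finset.prod_range_zero, one_mul]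
  have i1 : J1 10 Q = P 10 * P 20 := by
    rw [hP, J1_eq hQ0 hQ (by norm_num), qPoch_pow_eq_prod hQ (by norm_num) (show 2 ≠ 0 by norm_num)]
    simp only [Finset.prod_range_succ, Finset.prod_range_zero, one_mul]
  have t0 : tc 20 Q 2 = P 2 * P 18 * P 20 := by
    rw [hP]; exact tc_eq (a := 2) (b := 18) hQ0 hQ (by norm_num) rfl
  have t1 : tc 20 Q 5 = P 5 * P 15 * P 20 := by
    rw [hP]; exact tc_eq (a := 5) (b := 15) hQ0 hQ (by norm_num) rfl
  have t2 : tc 20 Q 1 = P 1 * P 19 * P 20 := by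
    rw [hP]; exact tc_eq (a := 1) (b := 19) hQ0 hQ (by norm_num) rfl
  have t3 : tc 20 Q 4 = P 4 * P 16 * P 20 := by
    rw [hP]; exact tc_eq (a := 4) (b := 16) hQ0 hQ (by norm_num) rfl
  have t4 : tc 20 Q 6 = P 6 * P 14 * P 20 := by
    rw [hP]; exact tc_eq (a := 6) (b := 14) hQ0 hQ (by norm_num) rfl
  have t5 : tc 20 Q 9 = P 9 * P 11 * P 20 := by
    rw [hP]; exact tc_eq (a := 9) (b := 11) hQ0 hQ (by norm_num) rfl
  rw [show qPoch (Q ^ 20) (Q ^ 20) = P 20 by rw [hP], j0, j1, i0, i1, t0, t1, t2, t3, t4, t5]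
  field_simp

theorem theta_quotient_twenty_three (hQ0 : Q ≠ 0) (hQ : ‖Q‖ < 1) :
    Jbar 5 10 Q * J 5 20 Q / J 4 10 Q =
      qPoch (Q ^ 20) (Q ^ 20) ^ 3 * (tc 20 Q 10 /
        (tc 20 Q 4 * tc 20 Q 5 * tc 20 Q 6)) := by
  obtain ⟨P, hP⟩ : ∃ P : ℕ → ℂ, P = fun a => qPoch (Q ^ a) (Q ^ 20) := ⟨_, rfl⟩
  have hP0 : ∀ a, a ≠ 0 → P a ≠ 0 := fun a ha => by
    rw [hP]; exact qPoch_pow_ne_zero hQ ha (by norm_num)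
  have n4 := hP0 4 (by norm_num)
  have n5 := hP0 5 (by norm_num)
  have n6 := hP0 6 (by norm_num)
  have n10 := hP0 10 (by norm_num)
  have n14 := hP0 14 (by norm_num)
  have n15 := hP0 15 (by norm_num)
  have n16 := hP0 16 (by norm_num)
  have n20 := hP0 20 (by norm_num)
  have j0 : J 5 20 Q = P 5 * P 15 * P 20 := by
    rw [hP, J_eq hQ0 (by norm_num)]
  have j1 : J 4 10 Q = (P 4 * P 14) * (P 6 * P 16) * (P 10 * P 20) := by
    rw [hP, J_eq hQ0 (by norm_num),
      qPoch_pow_eq_prod hQ (by norm_num) (show 2 ≠ 0 by norm_num) 4,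
      qPoch_pow_eq_prod hQ (by norm_num) (show 2 ≠ 0 by norm_num) (10 - 4),
      qPoch_pow_eq_prod hQ (by norm_num) (show 2 ≠ 0 by norm_num) 10]
    simp only [Finset.prod_range_succ, Finset.prod_range_zero, one_mul]
  have t0 : tc 20 Q 10 = P 10 * P 10 * P 20 := by
    rw [hP]; exact tc_eq (a := 10) (b := 10) hQ0 hQ (by norm_num) rfl
  have t1 : tc 20 Q 4 = P 4 * P 16 * P 20 := by
    rw [hP]; exact tc_eq (a := 4) (b := 16) hQ0 hQ (by norm_num) rfl
  have t2 : tc 20 Q 5 = P 5 * P 15 * P 20 := by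
    rw [hP]; exact tc_eq (a := 5) (b := 15) hQ0 hQ (by norm_num) rfl
  have t3 : tc 20 Q 6 = P 6 * P 14 * P 20 := by
    rw [hP]; exact tc_eq (a := 6) (b := 14) hQ0 hQ (by norm_num) rfl
  have b : Jbar 5 10 Q = (P 10) ^ 2 * (P 10 * P 20) / (P 5 * P 15) ^ 2 := by
    have u : qPoch (Q ^ 5) (Q ^ 10) = P 5 * P 15 := by
      rw [hP, qPoch_pow_eq_prod hQ (by norm_num) (show 2 ≠ 0 by norm_num)]
      simp only [Finset.prod_range_succ, Finset.prod_range_zero, one_mul]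
    have w : qPoch (Q ^ 10) (Q ^ 10) = P 10 * P 20 := by
      rw [hP, qPoch_pow_eq_prod hQ (by norm_num) (show 2 ≠ 0 by norm_num)]
      simp only [Finset.prod_range_succ, Finset.prod_range_zero, one_mul]
    have e := Jbar_half hQ0 hQ (show 5 ≠ 0 by norm_num)
    norm_num only at e
    rw [u, w] at e
    rw [eq_div_iff (pow_ne_zero _ (mul_ne_zero (hP0 5 (by norm_num)) (hP0 15 (by norm_num))))]
    simp only [hP] at e ⊢
    exact e
  rw [show qPoch (Q ^ 20) (Q ^ 20) = P 20 by rw [hP], j0, j1, t0, t1, t2, t3, b]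
  field_simp

theorem theta_quotient_twenty_four (hQ0 : Q ≠ 0) (hQ : ‖Q‖ < 1) :
    J1 2 Q * J1 20 Q * J 3 10 Q ^ 2 / (J1 1 Q * J 6 20 Q * J 8 20 Q) =
      qPoch (Q ^ 20) (Q ^ 20) ^ 3 * (tc 20 Q 3 * tc 20 Q 7 * tc 20 Q 10 /
        (tc 20 Q 1 * tc 20 Q 5 * tc 20 Q 6 * tc 20 Q 8 * tc 20 Q 9)) := by
  obtain ⟨P, hP⟩ : ∃ P : ℕ → ℂ, P = fun a => qPoch (Q ^ a) (Q ^ 20) := ⟨_, rfl⟩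
  have hP0 : ∀ a, a ≠ 0 → P a ≠ 0 := fun a ha => by
    rw [hP]; exact qPoch_pow_ne_zero hQ ha (by norm_num)
  have n1 := hP0 1 (by norm_num)
  have n2 := hP0 2 (by norm_num)
  have n3 := hP0 3 (by norm_num)
  have n4 := hP0 4 (by norm_num)
  have n5 := hP0 5 (by norm_num)
  have n6 := hP0 6 (by norm_num)
  have n7 := hP0 7 (by norm_num)
  have n8 := hP0 8 (by norm_num)
  have n9 := hP0 9 (by norm_num)
  have n10 := hP0 10 (by norm_num)
  have n11 := hP0 11 (by norm_num)
  have n12 := hP0 12 (by norm_num)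
  have n13 := hP0 13 (by norm_num)
  have n14 := hP0 14 (by norm_num)
  have n15 := hP0 15 (by norm_num)
  have n16 := hP0 16 (by norm_num)
  have n17 := hP0 17 (by norm_num)
  have n18 := hP0 18 (by norm_num)
  have n19 := hP0 19 (by norm_num)
  have n20 := hP0 20 (by norm_num)
  have j0 : J 3 10 Q = (P 3 * P 13) * (P 7 * P 17) * (P 10 * P 20) := by
    rw [hP, J_eq hQ0 (by norm_num),
      qPoch_pow_eq_prod hQ (by norm_num) (show 2 ≠ 0 by norm_num) 3,
      qPoch_pow_eq_prod hQ (by norm_num) (show 2 ≠ 0 by norm_num) (10 - 3),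
      qPoch_pow_eq_prod hQ (by norm_num) (show 2 ≠ 0 by norm_num) 10]
    simp only [Finset.prod_range_succ, Finset.prod_range_zero, one_mul]
  have j1 : J 6 20 Q = P 6 * P 14 * P 20 := by
    rw [hP, J_eq hQ0 (by norm_num)]
  have j2 : J 8 20 Q = P 8 * P 12 * P 20 := by
    rw [hP, J_eq hQ0 (by norm_num)]
  have i0 : J1 2 Q = P 2 * P 4 * P 6 * P 8 * P 10 * P 12 * P 14 * P 16 * P 18 * P 20 := by
    rw [hP, J1_eq hQ0 hQ (by norm_num),
        qPoch_pow_eq_prod hQ (by norm_num) (show 10 ≠ 0 by norm_num)]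
    simp only [Finset.prod_range_succ, Finset.prod_range_zero, one_mul]
  have i1 : J1 20 Q = P 20 := by
    rw [hP, J1_eq hQ0 hQ (by norm_num)]
  have i2 : J1 1 Q = P 1 * P 2 * P 3 * P 4 * P 5 * P 6 * P 7 * P 8 * P 9 * P 10 * P 11 * P 12 * P
      13 * P 14 * P 15 * P 16 * P 17 * P 18 * P 19 * P 20 := by
    rw [hP, J1_eq hQ0 hQ (by norm_num),
        qPoch_pow_eq_prod hQ (by norm_num) (show 20 ≠ 0 by norm_num)]
    simp only [Finset.prod_range_succ, Finset.prod_range_zero, one_mul]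
  have t0 : tc 20 Q 3 = P 3 * P 17 * P 20 := by
    rw [hP]; exact tc_eq (a := 3) (b := 17) hQ0 hQ (by norm_num) rfl
  have t1 : tc 20 Q 7 = P 7 * P 13 * P 20 := by
    rw [hP]; exact tc_eq (a := 7) (b := 13) hQ0 hQ (by norm_num) rfl
  have t2 : tc 20 Q 10 = P 10 * P 10 * P 20 := by
    rw [hP]; exact tc_eq (a := 10) (b := 10) hQ0 hQ (by norm_num) rfl
  have t3 : tc 20 Q 1 = P 1 * P 19 * P 20 := by
    rw [hP]; exact tc_eq (a := 1) (b := 19) hQ0 hQ (by norm_num) rfl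
  have t4 : tc 20 Q 5 = P 5 * P 15 * P 20 := by
    rw [hP]; exact tc_eq (a := 5) (b := 15) hQ0 hQ (by norm_num) rfl
  have t5 : tc 20 Q 6 = P 6 * P 14 * P 20 := by
    rw [hP]; exact tc_eq (a := 6) (b := 14) hQ0 hQ (by norm_num) rfl
  have t6 : tc 20 Q 8 = P 8 * P 12 * P 20 := by
    rw [hP]; exact tc_eq (a := 8) (b := 12) hQ0 hQ (by norm_num) rfl
  have t7 : tc 20 Q 9 = P 9 * P 11 * P 20 := by
    rw [hP]; exact tc_eq (a := 9) (b := 11) hQ0 hQ (by norm_num) rfl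
  rw [show qPoch (Q ^ 20) (Q ^ 20) = P 20 by rw [hP], j0, j1, j2, i0, i1, i2, t0, t1, t2, t3, t4,
      t5, t6, t7]
  field_simp


end

/-! ### Closed forms of the rank series -/

section
variable {q : ℂ}

lemma hasSum_quadTerm (hq0 : q ≠ 0) (hq : ‖q‖ < 1) (s : ℤ) :
    HasSum (quadTerm q s) (th (q ^ 4) (q ^ (s + 2))) := by
  rw [show quadTerm q s = thTerm (q ^ 4) (q ^ (s + 2)) from funext (quadTerm_eq q hq0 s)]
  exact hasSum_th (pow_ne_zero _ hq0) (base_pow_norm_lt hq four_ne_zero) (zpow_ne_zero _ hq0)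

/-- The theta series is split by the same residues as the rank series, so its pieces can be matched
with the coefficients of the transformed Appell sums. -/
theorem th_dissect (hq0 : q ≠ 0) (hq : ‖q‖ < 1) {M : ℕ} (hM : Odd M) :
    th (q ^ 4) q = ∑ b ∈ Finset.range M, quadTerm q (-1) b *
      tc (4 * M) (q ^ M) (2 * M + 4 * b + -1) := by
  have hM0 : M ≠ 0 := hM.pos.ne'
  have hQ0 : q ^ M ≠ 0 := pow_ne_zero _ hq0
  have hQ : ‖q ^ M‖ < 1 := base_pow_norm_lt hq hM0
  have h := hasSum_quadTerm hq0 hq (-1)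
  rw [show (-1 + 2 : ℤ) = 1 by norm_num, zpow_one] at h
  refine h.unique (hasSum_int_residues hM.pos fun b _ => ?_)
  simp only [quadTerm_residue hq0 hM]
  exact (hasSum_th (pow_ne_zero _ hQ0) (base_pow_norm_lt hQ (by positivity))
    (zpow_ne_zero _ hQ0)).mul_left _

lemma quadTerm_nat (q : ℂ) {s : ℤ} {b e : ℕ} (h : 2 * (b : ℤ) ^ 2 + s * b = e) :
    quadTerm q s b = (-1) ^ b * q ^ e := by
  rw [quadTerm, h, zpow_natCast, zpow_natCast]

/-- The denominator of `appellLerch` contains `q ^ (r - 1) * x * z`; the index shift explains the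
exponent `x + w - L`. -/
lemma appellLerch_eq {Q : ℂ} (hQ0 : Q ≠ 0) (hQ : ‖Q‖ < 1) {L : ℕ} (hL : L ≠ 0) {x w r : ℤ}
    (hr : r = x + w - L) :
    appellLerch (Q ^ x) (Q ^ L) (Q ^ w) = ac L Q r w / tc L Q w := by
  have hB0 : Q ^ L ≠ 0 := pow_ne_zero _ hQ0
  rw [appellLerch, theta_eq_th hB0 (base_pow_norm_lt hQ hL) (zpow_ne_zero _ hQ0), ac, apS, tc,
    one_div_mul_eq_div]
  congr 1
  refine tsum_congr fun n => ?_
  rw [thTerm, tri, hr, zpow_sub_one₀ hB0, zpow_sub₀ hQ0, zpow_add₀ hQ0, zpow_natCast]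
  congr 2
  ring

lemma appellLerch_eq_of {Q X B Z : ℂ} (hQ0 : Q ≠ 0) (hQ : ‖Q‖ < 1) {L : ℕ} (hL : L ≠ 0)
    {x w r : ℤ} (hX : Q ^ x = X) (hB : Q ^ L = B) (hZ : Q ^ w = Z) (hr : x + w - L = r) :
    appellLerch X B Z = ac L Q r w / tc L Q w := by
  rw [← hX, ← hB, ← hZ, appellLerch_eq hQ0 hQ hL hr.symm]

lemma pow_zpow_eq (q : ℂ) (n : ℕ) (a : ℤ) : (q ^ n) ^ a = q ^ (n * a) := by
  rw [zpow_mul, zpow_natCast]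

lemma tc_ne_zero {Q : ℂ} (hQ0 : Q ≠ 0) (hQ : ‖Q‖ < 1) {L : ℕ} (hL : L ≠ 0) {n : ℤ}
    (hn : ¬ (L : ℤ) ∣ n) : tc L Q n ≠ 0 :=
  (thetaNet hQ0 hQ hL).ne n hn

lemma th_three (hq0 : q ≠ 0) (hq : ‖q‖ < 1) :
    th (q ^ 4) q = tc 12 (q ^ 3) 5 - q * tc 12 (q ^ 3) 3 - q ^ 3 * tc 12 (q ^ 3) 1 := by
  have hQ0 : q ^ 3 ≠ 0 := pow_ne_zero _ hq0
  have h := thetaNet hQ0 (base_pow_norm_lt hq three_ne_zero) (show 12 ≠ 0 by norm_num)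
  have e1 : tc 12 (q ^ 3) 9 = tc 12 (q ^ 3) 3 := h.refl 3
  have e2 : tc 12 (q ^ 3) 13 = -((q ^ 3) ^ 1)⁻¹ * tc 12 (q ^ 3) 1 := (h.refl 13).symm.trans
      (h.neg_nat 1)
  rw [th_dissect hq0 hq (show Odd 3 by decide)]
  simp only [Finset.sum_range_succ, Finset.sum_range_zero, zero_add]
  rw [quadTerm_nat q (e := 0) (by norm_num), quadTerm_nat q (e := 1) (by norm_num),
    quadTerm_nat q (e := 6) (by norm_num)]
  norm_num
  rw [e1, e2]
  field_simp
  ring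

lemma th_five (hq0 : q ≠ 0) (hq : ‖q‖ < 1) :
    th (q ^ 4) q = tc 20 (q ^ 5) 9 - q * tc 20 (q ^ 5) 7 + q ^ 6 * tc 20 (q ^ 5) 3 +
      q ^ 10 * tc 20 (q ^ 5) 1 - q ^ 3 * tc 20 (q ^ 5) 5 := by
  have hQ0 : q ^ 5 ≠ 0 := pow_ne_zero _ hq0
  have h := thetaNet hQ0 (base_pow_norm_lt hq (show 5 ≠ 0 by norm_num)) (show 20 ≠ 0 by norm_num)
  have e1 : tc 20 (q ^ 5) 13 = tc 20 (q ^ 5) 7 := h.refl 7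
  have e2 : tc 20 (q ^ 5) 17 = tc 20 (q ^ 5) 3 := h.refl 3
  have e3 : tc 20 (q ^ 5) 21 = -((q ^ 5) ^ 1)⁻¹ * tc 20 (q ^ 5) 1 := (h.refl 21).symm.trans
      (h.neg_nat 1)
  have e4 : tc 20 (q ^ 5) 25 = -((q ^ 5) ^ 5)⁻¹ * tc 20 (q ^ 5) 5 := (h.refl 25).symm.trans
      (h.neg_nat 5)
  rw [th_dissect hq0 hq (show Odd 5 by decide)]
  simp only [Finset.sum_range_succ, Finset.sum_range_zero, zero_add]
  rw [quadTerm_nat q (e := 0) (by norm_num), quadTerm_nat q (e := 1) (by norm_num),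
    quadTerm_nat q (e := 6) (by norm_num), quadTerm_nat q (e := 15) (by norm_num),
    quadTerm_nat q (e := 28) (by norm_num)]
  norm_num
  rw [e1, e2, e3, e4]
  field_simp
  ring

/-- The shape `-(1 / 3) - th (q ^ 4) q * D` is the one needed later: multiplied by `-gf q oddFree`,
the reciprocal of the theta factor up to sign, it becomes `gf q oddFree / 3 + D`. -/
theorem hasSum_rank_three (hq0 : q ≠ 0) (hq : ‖q‖ < 1) :
    HasSum (rankTerm q 3 1) (-(1 / 3) - th (q ^ 4) q *
      (-appellLerch (q ^ 15) (q ^ 36) (q ^ 9)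
        - q ^ (-6 : ℤ) * appellLerch (q ^ (-3 : ℤ)) (q ^ 36) (q ^ 27)
        - 1 / 3 * (Jbar 9 18 q ^ 2 * J 3 12 q / J1 6 q ^ 2)
        - q * (1 / 3) * (Jbar 9 18 q * J 9 36 q / J1 6 q)
        - q ^ 2 * (1 / 3) * (J 9 36 q ^ 2 / J 3 12 q))) := by
  have hQ0 : q ^ 3 ≠ 0 := pow_ne_zero _ hq0
  have hQ := base_pow_norm_lt hq three_ne_zero
  have a1 : appellLerch (q ^ 15) (q ^ 36) (q ^ 9) = ac 12 (q ^ 3) (-4) 3 / tc 12 (q ^ 3) 3 := by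
    exact appellLerch_eq_of hQ0 hQ (by norm_num) (x := 5) (w := 3) (by rw [zpow_ofNat]; ring) (by
        ring)
      (by rw [zpow_ofNat]; ring) (by norm_num)
  have a2 : appellLerch (q ^ (-3 : ℤ)) (q ^ 36) (q ^ 27) =
      ac 12 (q ^ 3) (-4) 9 / tc 12 (q ^ 3) 9 := by
    exact appellLerch_eq_of hQ0 hQ (by norm_num) (x := -1) (w := 9) (by rw [pow_zpow_eq]; norm_num)
      (by ring)
      (by rw [zpow_ofNat]; ring) (by norm_num)
  rw [a1, a2, Jbar_mul 3 3 6, J_mul 3 1 4, J1_mul 3 2, J_mul 3 3 12,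
      theta_quotient_twelve_zero hQ0 hQ,
    theta_quotient_twelve_one hQ0 hQ, theta_quotient_twelve_two hQ0 hQ, th_three hq0 hq]
  convert hasSum_rankTerm hq0 hq (show Odd 3 by decide) 1 using 1
  simp only [Finset.sum_range_succ, Finset.sum_range_zero, zero_add]
  rw [quadTerm_nat q (e := 0) (by norm_num), quadTerm_nat q (e := 3) (by norm_num),
    quadTerm_nat q (e := 10) (by norm_num)]
  have h := (appellNet hQ0 hQ (show 12 ≠ 0 by norm_num)).rank_three hq0
  norm_num
  linear_combination -1 * h

theorem hasSum_rank_five_first (hq0 : q ≠ 0) (hq : ‖q‖ < 1) :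
    HasSum (rankTerm q 5 1) (-(2 / 5) - th (q ^ 4) q *
      (-1 + q ^ (-55 : ℤ) * appellLerch (q ^ (-55 : ℤ)) (q ^ 100) (q ^ 75)
        + q ^ (-15 : ℤ) * appellLerch (q ^ (-5 : ℤ)) (q ^ 100) (q ^ 25)
        + 3 / 5 * (J 5 50 q ^ 2 * J 30 100 q * J 40 100 q
            / (J1 5 q * Jbar 50 200 q * J1 100 q))
        - q * (2 / 5) * (J1 50 q ^ 4 / (J 10 50 q * J1 25 q * J1 100 q))
        - q ^ 2 * (1 / 5) *
            (2 * (J1 25 q ^ 2 * J 30 100 q / (J 10 25 q * J1 50 q))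
              - q ^ 5 * (J 10 100 q * J1 25 q ^ 2 / (J 5 25 q * J1 50 q)))
        + q ^ 3 * (1 / 5) * (Jbar 25 50 q * J 25 100 q / J 20 50 q)
        - q ^ 4 * (1 / 5) * (J1 10 q * J1 100 q * J 15 50 q ^ 2
            / (J1 5 q * J 30 100 q * J 40 100 q)))) := by
  have hQ0 : q ^ 5 ≠ 0 := pow_ne_zero _ hq0
  have hQ := base_pow_norm_lt hq (show 5 ≠ 0 by norm_num)
  have hB0 : (q ^ 5) ^ 20 ≠ 0 := pow_ne_zero _ hQ0
  have hB := base_pow_norm_lt hQ (show 20 ≠ 0 by norm_num)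
  have a1 : appellLerch (q ^ (-5 : ℤ)) (q ^ 100) (q ^ 25) =
      ac 20 (q ^ 5) (-16) 5 / tc 20 (q ^ 5) 5 := by
    exact appellLerch_eq_of hQ0 hQ (by norm_num) (x := -1) (w := 5) (by rw [pow_zpow_eq]; norm_num)
      (by ring)
      (by rw [zpow_ofNat]; ring) (by norm_num)
  have a2 : appellLerch (q ^ (-55 : ℤ)) (q ^ 100) (q ^ 75) =
      ac 20 (q ^ 5) (-16) 15 / tc 20 (q ^ 5) 15 := by
    exact appellLerch_eq_of hQ0 hQ (by norm_num) (x := -11) (w := 15)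
      (by rw [pow_zpow_eq]; norm_num)
      (by ring)
      (by rw [zpow_ofNat]; ring) (by norm_num)
  have n15 : tc 20 (q ^ 5) 15 ≠ 0 := tc_ne_zero hQ0 hQ (by norm_num) (by decide)
  -- One step of the functional equation in the first argument reaches the Appell–Lerch sum of the
  -- theorem; its inhomogeneous term is the isolated constant in the deviations for the classes 0
  -- and 1 modulo 5.
  have a3 : ac 20 (q ^ 5) 4 15 / tc 20 (q ^ 5) 15 =
      1 - (q ^ 55)⁻¹ * (ac 20 (q ^ 5) (-16) 15 / tc 20 (q ^ 5) 15) := by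
    have e := apS_base_mul_left hB0 hB (zpow_ne_zero (-16) hQ0) (zpow_ne_zero 15 hQ0)
      (base_pow_mul_ne_one hQ (by decide) hQ0)
    rw [← zpow_natCast (q ^ 5) 20, ← zpow_add₀ hQ0, ← zpow_sub₀ hQ0, zpow_natCast] at e
    have e1 : (q ^ 5) ^ (((20 : ℕ) : ℤ) + -16 - 15) = (q ^ 55)⁻¹ := by
      rw [pow_zpow_eq]; norm_num
    rw [e1] at e
    have e2 : ac 20 (q ^ 5) 4 15 = tc 20 (q ^ 5) 15 - (q ^ 55)⁻¹ * ac 20 (q ^ 5) (-16) 15 := e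
    rw [e2]
    field_simp
  rw [a1, a2]
  rw [J_mul 5 1 10, J_mul 5 6 20, J_mul 5 8 20, J1_mul 5 1, Jbar_mul 5 10 40, J1_mul 5 20,
    J1_mul 5 2 q, J1_mul 5 10 q, J_mul 5 2 10, J1_mul 5 5, J_mul 5 2 5, J_mul 5 2 20, J_mul 5 1 5,
    Jbar_mul 5 5 10, J_mul 5 5 20, J_mul 5 4 10, J_mul 5 3 10,
    theta_quotient_twenty_zero hQ0 hQ, theta_quotient_twenty_one hQ0 hQ,
    theta_quotient_twenty_two hQ0 hQ, theta_quotient_twenty_two' hQ0 hQ,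
    theta_quotient_twenty_three hQ0 hQ, theta_quotient_twenty_four hQ0 hQ, th_five hq0 hq]
  convert hasSum_rankTerm hq0 hq (show Odd 5 by decide) 1 using 1
  simp only [Finset.sum_range_succ, Finset.sum_range_zero, zero_add]
  rw [quadTerm_nat q (e := 0) (by norm_num), quadTerm_nat q (e := 3) (by norm_num),
    quadTerm_nat q (e := 10) (by norm_num), quadTerm_nat q (e := 21) (by norm_num),
    quadTerm_nat q (e := 36) (by norm_num)]
  have h := (appellNet hQ0 hQ (show 20 ≠ 0 by norm_num)).rank_five_first hq0
  rw [a3] at h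
  norm_num
  linear_combination -1 * h

theorem hasSum_rank_five_second (hq0 : q ≠ 0) (hq : ‖q‖ < 1) :
    HasSum (rankTerm q 5 2) (-(1 / 5) - th (q ^ 4) q *
      (q ^ (-1 : ℤ) * appellLerch (q ^ 35) (q ^ 100) (q ^ 25)
        + q ^ (-6 : ℤ) * appellLerch (q ^ 15) (q ^ 100) (q ^ 25)
        - 1 / 5 * (J 5 50 q ^ 2 * J 30 100 q * J 40 100 q
            / (J1 5 q * Jbar 50 200 q * J1 100 q))
        - q * (1 / 5) * (J1 50 q ^ 4 / (J 10 50 q * J1 25 q * J1 100 q))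
        - q ^ 2 * (1 / 5) *
            ((J1 25 q ^ 2 * J 30 100 q / (J 10 25 q * J1 50 q))
              + 2 * q ^ 5 * (J 10 100 q * J1 25 q ^ 2 / (J 5 25 q * J1 50 q)))
        - q ^ 3 * (2 / 5) * (Jbar 25 50 q * J 25 100 q / J 20 50 q)
        - q ^ 4 * (3 / 5) * (J1 10 q * J1 100 q * J 15 50 q ^ 2
            / (J1 5 q * J 30 100 q * J 40 100 q)))) := by
  have hQ0 : q ^ 5 ≠ 0 := pow_ne_zero _ hq0
  have hQ := base_pow_norm_lt hq (show 5 ≠ 0 by norm_num)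
  have hB0 : (q ^ 5) ^ 20 ≠ 0 := pow_ne_zero _ hQ0
  have hB := base_pow_norm_lt hQ (show 20 ≠ 0 by norm_num)
  have a1 : appellLerch (q ^ 35) (q ^ 100) (q ^ 25) =
      ac 20 (q ^ 5) (-8) 5 / tc 20 (q ^ 5) 5 := by
    exact appellLerch_eq_of hQ0 hQ (by norm_num) (x := 7) (w := 5) (by rw [zpow_ofNat]; ring) (by
        ring)
      (by rw [zpow_ofNat]; ring) (by norm_num)
  have a2 : appellLerch (q ^ 15) (q ^ 100) (q ^ 25) =
      ac 20 (q ^ 5) (-12) 5 / tc 20 (q ^ 5) 5 := by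
    exact appellLerch_eq_of hQ0 hQ (by norm_num) (x := 3) (w := 5) (by rw [zpow_ofNat]; ring) (by
        ring)
      (by rw [zpow_ofNat]; ring) (by norm_num)
  have t15 : tc 20 (q ^ 5) 15 = tc 20 (q ^ 5) 5 := (thetaNet hQ0 hQ (by norm_num)).refl 5
  -- The reflection `apS_inv` and a joint shift of both arguments convert the second target of
  -- `AppellNet.rank_five_second` to the required Appell–Lerch sum.
  have a3 : ac 20 (q ^ 5) (-12) 5 = (q ^ 15)⁻¹ * ac 20 (q ^ 5) (-8) 15 := by
    have e := apS_inv hB0 hB (zpow_ne_zero (-12) hQ0) (zpow_ne_zero 5 hQ0)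
    have e' := apS_base_mul_right hB0 hB (zpow_ne_zero (-8) hQ0) (zpow_ne_zero 15 hQ0)
    have e1 : (q ^ 5) ^ 20 * (q ^ 5) ^ (-8 : ℤ) = ((q ^ 5) ^ (-12 : ℤ))⁻¹ := by
      rw [← zpow_natCast (q ^ 5) 20, ← zpow_add₀ hQ0, ← zpow_neg]; norm_num
    have e2 : (q ^ 5) ^ 20 * (q ^ 5) ^ (15 : ℤ) = ((q ^ 5) ^ 20) ^ 2 / (q ^ 5) ^ (5 : ℤ) := by
      rw [zpow_ofNat, zpow_ofNat, eq_div_iff (pow_ne_zero _ hQ0)]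
      ring
    rw [e1, e2] at e'
    have e3 : ((q ^ 5) ^ (-12 : ℤ) * (q ^ 5) ^ (15 : ℤ))⁻¹ = (q ^ 15)⁻¹ := by
      rw [← zpow_add₀ hQ0, pow_zpow_eq]
      norm_num
    rw [e', ← mul_assoc, neg_mul_neg, ← mul_inv, e3] at e
    exact e
  rw [a1, a2, a3]
  rw [J_mul 5 1 10, J_mul 5 6 20, J_mul 5 8 20, J1_mul 5 1, Jbar_mul 5 10 40, J1_mul 5 20,
    J1_mul 5 2 q, J1_mul 5 10 q, J_mul 5 2 10, J1_mul 5 5, J_mul 5 2 5, J_mul 5 2 20, J_mul 5 1 5,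
    Jbar_mul 5 5 10, J_mul 5 5 20, J_mul 5 4 10, J_mul 5 3 10,
    theta_quotient_twenty_zero hQ0 hQ, theta_quotient_twenty_one hQ0 hQ,
    theta_quotient_twenty_two hQ0 hQ, theta_quotient_twenty_two' hQ0 hQ,
    theta_quotient_twenty_three hQ0 hQ, theta_quotient_twenty_four hQ0 hQ, th_five hq0 hq]
  convert hasSum_rankTerm hq0 hq (show Odd 5 by decide) 2 using 1
  simp only [Finset.sum_range_succ, Finset.sum_range_zero, zero_add]
  rw [quadTerm_nat q (e := 0) (by norm_num), quadTerm_nat q (e := 5) (by norm_num),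
    quadTerm_nat q (e := 14) (by norm_num), quadTerm_nat q (e := 27) (by norm_num),
    quadTerm_nat q (e := 44) (by norm_num)]
  have h := (appellNet hQ0 hQ (show 20 ≠ 0 by norm_num)).rank_five_second hq0
  rw [t15] at h
  norm_num
  linear_combination -1 * h

end

/-! ### Multisets without repeated odd parts -/

/-- Multisets of positive integers without repeated odd members. -/
def oddFree : Set (Multiset ℕ) := {s | 0 ∉ s ∧ ∀ i ∈ s, Odd i → s.count i ≤ 1}

/-- The `M₂`-rank of a multiset. -/
def msRank (s : Multiset ℕ) : ℤ := (((s.sup + 1) / 2 : ℕ) : ℤ) - (Multiset.card s : ℤ)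

lemma msRank_zero : msRank 0 = 0 := by simp [msRank]

lemma zero_mem_oddFree : (0 : Multiset ℕ) ∈ oddFree := by simp [oddFree]

lemma sup_mem {s : Multiset ℕ} (hs : s ≠ 0) : s.sup ∈ s := by
  induction s using Multiset.induction with
  | empty => exact absurd rfl hs
  | cons a s ih =>
    rw [Multiset.sup_cons]
    rcases eq_or_ne s 0 with rfl | h
    · simp
    · rcases le_total a s.sup with h1 | h1
      · rw [sup_eq_right.2 h1]; exact Multiset.mem_cons_of_mem (ih h)
      · rw [sup_eq_left.2 h1]; exact Multiset.mem_cons_self a s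

lemma cons_mem_oddFree {L : ℕ} {r : Multiset ℕ} (hr : r ∈ oddFree) (hL : 0 < L) (h1 : r.sup ≤ L)
    (h2 : Odd L → r.sup < L) : L ::ₘ r ∈ oddFree := by
  refine ⟨by simp [hL.ne, hr.1], fun i hi ho => ?_⟩
  rcases eq_or_ne i L with rfl | h
  · have : r.count i = 0 := Multiset.count_eq_zero.2 fun hm =>
      absurd (Multiset.le_sup hm) (not_le.2 (h2 ho))
    rw [Multiset.count_cons_self, this]
  · rw [Multiset.count_cons_of_ne h]
    exact hr.2 i ((Multiset.mem_cons.1 hi).resolve_left h) ho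

lemma mem_oddFree_of_cons {L : ℕ} {r : Multiset ℕ} (h : L ::ₘ r ∈ oddFree) : r ∈ oddFree :=
  ⟨fun h0 => h.1 (Multiset.mem_cons_of_mem h0), fun i hi ho =>
    (Multiset.count_le_count_cons i L r).trans (h.2 i (Multiset.mem_cons_of_mem hi) ho)⟩

/-- Raise all parts of `r` by two and adjoin `j` twos and possibly a one. -/
def raise (t : ℕ × Bool × Multiset ℕ) : Multiset ℕ :=
  t.2.2.map (· + 2) + Multiset.replicate t.1 2 + Multiset.replicate t.2.1.toNat 1

lemma card_raise (t : ℕ × Bool × Multiset ℕ) :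
    Multiset.card (raise t) = Multiset.card t.2.2 + t.1 + t.2.1.toNat := by
  simp [raise]

lemma sum_raise (t : ℕ × Bool × Multiset ℕ) :
    (raise t).sum = t.2.2.sum + 2 * Multiset.card t.2.2 + 2 * t.1 + t.2.1.toNat := by
  simp [raise, Multiset.sum_map_add]
  ring

lemma sup_map_add_two {r : Multiset ℕ} (hr : r ≠ 0) : (r.map (· + 2)).sup = r.sup + 2 := by
  refine le_antisymm (Multiset.sup_le.2 fun b hb => ?_) ?_
  · obtain ⟨a, ha, rfl⟩ := Multiset.mem_map.1 hb
    exact Nat.add_le_add_right (Multiset.le_sup ha) 2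
  · exact Multiset.le_sup (Multiset.mem_map_of_mem _ (sup_mem hr))

lemma sup_replicate {n : ℕ} (hn : n ≠ 0) (a : ℕ) : (Multiset.replicate n a).sup = a := by
  refine le_antisymm (Multiset.sup_le.2 fun b hb => (Multiset.eq_of_mem_replicate hb).le) ?_
  exact Multiset.le_sup (Multiset.mem_replicate.2 ⟨hn, rfl⟩)

/-- Raising all parts by two increases the rounded half of the largest part by exactly one, and the
adjoined parts 1 and 2 keep this true when `r` is empty. Only the empty multiset is excluded. -/
lemma half_sup_raise {t : ℕ × Bool × Multiset ℕ} (ht : t ≠ (0, false, 0)) :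
    ((raise t).sup + 1) / 2 = (t.2.2.sup + 1) / 2 + 1 := by
  obtain ⟨j, e, r⟩ := t
  simp only [raise, Multiset.sup_add]
  rcases eq_or_ne r 0 with rfl | hr
  · rcases eq_or_ne j 0 with rfl | hj
    · cases e
      · exact absurd rfl ht
      · simp
    · rw [sup_replicate hj]
      cases e <;> simp
  · rw [sup_map_add_two hr]
    have h1 : (Multiset.replicate j 2).sup ≤ r.sup + 2 :=
      Multiset.sup_le.2 fun b hb => by rw [Multiset.eq_of_mem_replicate hb]; omega
    have h2 : (Multiset.replicate e.toNat 1).sup ≤ r.sup + 2 :=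
      Multiset.sup_le.2 fun b hb => by rw [Multiset.eq_of_mem_replicate hb]; omega
    rw [sup_eq_left.2 h1, sup_eq_left.2 h2]
    omega

lemma count_two_raise (t : ℕ × Bool × Multiset ℕ) (h : 0 ∉ t.2.2) : (raise t).count 2 = t.1 := by
  have : 2 ∉ t.2.2.map (· + 2) := fun hm => by
    obtain ⟨a, ha, h2⟩ := Multiset.mem_map.1 hm
    exact h (by rwa [show a = 0 by omega] at ha)
  simp [raise, Multiset.count_replicate, Multiset.count_eq_zero.2 this]

lemma count_one_raise (t : ℕ × Bool × Multiset ℕ) : (raise t).count 1 = t.2.1.toNat := by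
  simp [raise, Multiset.count_replicate]

/-- The multiplicities of 2 and of 1 in the image recover the first two components, since raised
parts are at least 3. -/
lemma raise_injOn : Set.InjOn raise {t | t.2.2 ∈ oddFree} := by
  rintro ⟨j, e, r⟩ hr ⟨j', e', r'⟩ hr' h
  have h1 := count_two_raise _ hr.1
  have h2 := count_one_raise (j, e, r)
  rw [h, count_two_raise _ hr'.1] at h1
  rw [h, count_one_raise] at h2
  simp only at h1 h2
  have he : e' = e := by
    cases e <;> cases e' <;> simp_all
  subst h1 he
  simp only [raise, add_left_inj] at h
  rw [Multiset.map_injective (add_left_injective 2) h]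

lemma raise_mem {t : ℕ × Bool × Multiset ℕ} (h : t.2.2 ∈ oddFree) : raise t ∈ oddFree := by
  obtain ⟨j, e, r⟩ := t
  refine ⟨by simp [raise, Multiset.mem_replicate], fun i hi ho => ?_⟩
  rcases eq_or_ne i 1 with rfl | h1
  · rw [count_one_raise]; exact Bool.toNat_le _
  · have h2 : i ≠ 2 := by rintro rfl; exact absurd ho (by decide)
    have hc : (raise (j, e, r)).count i = (r.map (· + 2)).count i := by
      simp [raise, Multiset.count_replicate, h1.symm, h2.symm]
    rw [hc]
    by_cases hm : i ∈ r.map (· + 2)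
    · obtain ⟨a, ha, rfl⟩ := Multiset.mem_map.1 hm
      rw [Multiset.count_map_eq_count' (· + 2) r (add_left_injective 2)]
      exact h.2 a ha (by simpa [parity_simps] using ho)
    · rw [Multiset.count_eq_zero.2 hm]; exact Nat.zero_le _

/-- The preimage collects the twos, records whether the part 1 occurs, and lowers all parts above 2;
odd parts keep their parity and multiplicity. -/
lemma exists_raise {s : Multiset ℕ} (hs : s ∈ oddFree) : ∃ t, t.2.2 ∈ oddFree ∧ raise t = s := by
  obtain ⟨r, hr⟩ : ∃ r, r = (s.filter (2 < ·)).map (· - 2) := ⟨_, rfl⟩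
  have hmap : r.map (· + 2) = s.filter (2 < ·) := by
    rw [hr, Multiset.map_map]
    conv_rhs => rw [← Multiset.map_id (s.filter (2 < ·))]
    refine Multiset.map_congr rfl fun x hx => ?_
    have := (Multiset.mem_filter.1 hx).2
    simp only [Function.comp, id]
    omega
  have hc1 : s.count 1 ≤ 1 := by
    by_cases h : 1 ∈ s
    · exact hs.2 1 h odd_one
    · rw [Multiset.count_eq_zero.2 h]; exact Nat.zero_le _
  refine ⟨(s.count 2, decide (s.count 1 = 1), r), ⟨fun h0 => ?_, fun i hi ho => ?_⟩, ?_⟩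
  · have : 0 + 2 ∈ r.map (· + 2) := Multiset.mem_map_of_mem _ h0
    rw [hmap] at this
    exact absurd (Multiset.mem_filter.1 this).2 (by norm_num)
  · have hm : i + 2 ∈ r.map (· + 2) := Multiset.mem_map_of_mem _ hi
    rw [← Multiset.count_map_eq_count' (· + 2) r (add_left_injective 2), hmap]
    rw [hmap] at hm
    exact (Multiset.count_le_of_le _ (Multiset.filter_le _ _)).trans
      (hs.2 _ (Multiset.mem_filter.1 hm).1 (by simpa [parity_simps] using ho))
  · ext i
    have hb : (decide (s.count 1 = 1)).toNat = s.count 1 := by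
      rcases Nat.le_one_iff_eq_zero_or_eq_one.1 hc1 with h | h <;> simp [h]
    simp only [raise, hmap, hb, Multiset.count_add, Multiset.count_replicate, Multiset.count_filter]
    rcases eq_or_ne i 0 with rfl | h0
    · simp [Multiset.count_eq_zero.2 hs.1]
    · rcases eq_or_ne i 1 with rfl | h1
      · simp
      · rcases eq_or_ne i 2 with rfl | h2
        · simp
        · simp [h1.symm, h2.symm, show 2 < i by omega]

lemma raise_image (K : ℤ) : raise '' {t | t.2.2 ∈ oddFree ∧ msRank (raise t) ≤ K} =
    {s | s ∈ oddFree ∧ msRank s ≤ K} := by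
  ext s
  constructor
  · rintro ⟨t, ⟨h1, h2⟩, rfl⟩
    exact ⟨raise_mem h1, h2⟩
  · rintro ⟨h1, h2⟩
    obtain ⟨t, ht, rfl⟩ := exists_raise h1
    exact ⟨t, ⟨ht, h2⟩, rfl⟩

/-- The largest part of the partition that corresponds to `raise t`. -/
def topPart (K : ℤ) (t : ℕ × Bool × Multiset ℕ) : ℤ :=
  2 * (Multiset.card t.2.2 + t.1) + 2 * K - 1 + t.2.1.toNat

/-- Adjoin the largest part `topPart K t` to the third component of `t`. -/
def attachTop (K : ℤ) (t : ℕ × Bool × Multiset ℕ) : Multiset ℕ :=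
  if 0 < topPart K t then (topPart K t).toNat ::ₘ t.2.2 else t.2.2

/-- The triples which describe multisets of rank at most `K`. -/
def lowRank (K : ℤ) : Set (ℕ × Bool × Multiset ℕ) := {t | t.2.2 ∈ oddFree ∧ msRank (raise t) ≤ K}

lemma eq_zero_of_sup {r : Multiset ℕ} (hr : r ∈ oddFree) (h : r.sup = 0) : r = 0 := by
  by_contra h0
  exact hr.1 (h ▸ sup_mem h0)

/-- The rank bound says that the new part is an admissible largest part: at least `t.2.2.sup`, and
strictly larger when odd. The exception is a new part of size zero, which forces `t.2.2` to be empty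
and `K` to be negative; nothing is then attached. -/
lemma lowRank_cases {K : ℤ} (hK : K ≠ 0) {t : ℕ × Bool × Multiset ℕ} (ht : t ∈ lowRank K) :
    (∃ L : ℕ, topPart K t = L ∧ 0 < L ∧ t.2.2.sup ≤ L ∧ (Odd L → t.2.2.sup < L)) ∨
      (topPart K t = 0 ∧ t.2.2 = 0 ∧ t.2.1 = true ∧ K < 0) := by
  obtain ⟨hr, h⟩ := ht
  rcases eq_or_ne t (0, false, 0) with rfl | ht0
  · left
    simp only [raise, Multiset.map_zero, Multiset.replicate_zero, add_zero, Bool.toNat_false,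
      msRank_zero] at h
    refine ⟨(2 * K - 1).toNat, ?_, ?_, ?_, ?_⟩
    · simp [topPart]; omega
    · omega
    · simp
    · simp; omega
  · rw [msRank, half_sup_raise ht0, card_raise] at h
    obtain ⟨j, e, r⟩ := t
    simp only [topPart] at *
    cases e
    · left
      simp only [Bool.toNat_false] at *
      push_cast at h
      refine ⟨(2 * (Multiset.card r + j) + 2 * K - 1 : ℤ).toNat, ?_, ?_, ?_, ?_⟩ <;> omega
    · simp only [Bool.toNat_true] at *
      push_cast at h
      rcases lt_or_ge 0 (2 * (Multiset.card r + j) + 2 * K - 1 + 1 : ℤ) with h0 | h0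
      · left
        refine ⟨(2 * (Multiset.card r + j) + 2 * K - 1 + 1 : ℤ).toNat, ?_, ?_, ?_, ?_⟩
        · push_cast; omega
        · omega
        · omega
        · intro ho
          exfalso
          obtain ⟨k, hk⟩ := ho
          omega
      · right
        have hs : r.sup = 0 := by omega
        have hr0 := eq_zero_of_sup hr hs
        subst hr0
        simp only [Multiset.card_zero] at *
        refine ⟨?_, by simp, by simp, ?_⟩ <;> push_cast at * <;> omega

lemma sum_attachTop {K : ℤ} (hK : K ≠ 0) {t : ℕ × Bool × Multiset ℕ} (ht : t ∈ lowRank K) :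
    ((attachTop K t).sum : ℤ) = (raise t).sum + (2 * K - 1) := by
  have hL : topPart K t = 2 * (Multiset.card t.2.2 + t.1) + 2 * K - 1 + t.2.1.toNat := rfl
  rw [sum_raise]
  rcases lowRank_cases hK ht with ⟨L, h1, h2, -⟩ | ⟨h1, h2, h3, -⟩
  · rw [attachTop, h1, if_pos (by exact_mod_cast h2), Int.toNat_natCast, Multiset.sum_cons]
    omega
  · rw [attachTop, h1, if_neg (lt_irrefl _)]
    omega

lemma sup_cons_of_le {L : ℕ} {r : Multiset ℕ} (h : r.sup ≤ L) : (L ::ₘ r).sup = L := by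
  rw [Multiset.sup_cons, sup_eq_left.2 h]

/-- The attached part is the supremum of the image. Removing it leaves the third component, its
parity determines the Boolean, and its size then determines the number of twos. -/
lemma attachTop_injOn {K : ℤ} (hK : K ≠ 0) : Set.InjOn (attachTop K) (lowRank K) := by
  have key : ∀ t : ℕ × Bool × Multiset ℕ, ∀ L : ℕ, topPart K t = L → 0 < L →
      attachTop K t = L ::ₘ t.2.2 := fun t L h1 h2 => by
    rw [attachTop, h1, if_pos (by exact_mod_cast h2), Int.toNat_natCast]
  have key0 : ∀ t : ℕ × Bool × Multiset ℕ, topPart K t = 0 → attachTop K t = t.2.2 := fun t h1 => by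
    rw [attachTop, h1, if_neg (lt_irrefl _)]
  have fin : ∀ t t' : ℕ × Bool × Multiset ℕ,
      topPart K t = topPart K t' → t.2.2 = t'.2.2 → t = t' := by
    rintro ⟨j, e, r⟩ ⟨j', e', r'⟩ h1 h2
    simp only [topPart] at h1 h2
    subst h2
    cases e <;> cases e' <;> simp at h1 ⊢ <;> omega
  intro t ht t' ht' h
  rcases lowRank_cases hK ht with ⟨L, h1, h2, h3, -⟩ | ⟨h1, h2, -⟩ <;>
    rcases lowRank_cases hK ht' with ⟨L', h1', h2', h3', -⟩ | ⟨h1', h2', -⟩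
  · rw [key t L h1 h2, key t' L' h1' h2'] at h
    have hL : L = L' := by rw [← sup_cons_of_le h3, h, sup_cons_of_le h3']
    subst hL
    exact fin t t' (h1.trans h1'.symm) (Multiset.cons_inj_right L |>.1 h)
  · rw [key t L h1 h2, key0 t' h1', h2'] at h
    exact absurd h (Multiset.cons_ne_zero)
  · rw [key t' L' h1' h2', key0 t h1, h2] at h
    exact absurd h.symm (Multiset.cons_ne_zero)
  · exact fin t t' (h1.trans h1'.symm) (h2.trans h2'.symm)

/-- If `t` contributes `j` twos and a positive part is attached, the image has rank `K - 1 + j`,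
whatever the Boolean is. Thus `j` is the excess of the rank over `K - 1`, and the Boolean records
whether the largest part is even. -/
lemma attachTop_image {K : ℤ} (hK : K ≠ 0) : attachTop K '' lowRank K =
    {s | s ∈ oddFree ∧ K - 1 ≤ msRank s ∧ (0 < K → s ≠ 0)} := by
  ext s
  constructor
  · rintro ⟨t, ht, rfl⟩
    have hL : topPart K t = 2 * (Multiset.card t.2.2 + t.1) + 2 * K - 1 + t.2.1.toNat := rfl
    rcases lowRank_cases hK ht with ⟨L, h1, h2, h3, h4⟩ | ⟨h1, h2, -, h4⟩
    · rw [attachTop, h1, if_pos (by exact_mod_cast h2), Int.toNat_natCast]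
      refine ⟨cons_mem_oddFree ht.1 h2 h3 h4, ?_, fun _ => Multiset.cons_ne_zero⟩
      rw [msRank, sup_cons_of_le h3, Multiset.card_cons]
      have := Bool.toNat_le t.2.1
      push_cast
      omega
    · rw [attachTop, h1, if_neg (lt_irrefl _), h2]
      exact ⟨zero_mem_oddFree, by rw [msRank_zero]; omega, fun h => absurd h4 (not_lt.2 h.le)⟩
  · rintro ⟨hs, hrk, h0⟩
    rcases eq_or_ne s 0 with rfl | hs0
    · have hK0 : K < 0 := by
        rcases lt_trichotomy K 0 with h | h | h
        · exact h
        · exact absurd h hK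
        · exact absurd rfl (h0 h)
      have ht0 : ((-K).toNat, true, (0 : Multiset ℕ)) ≠ (0, false, 0) := by simp
      -- This triple has `topPart` equal to zero and accounts for the empty multiset when `K` is
      -- negative.
      refine ⟨((-K).toNat, true, 0), ⟨zero_mem_oddFree, ?_⟩, ?_⟩
      · rw [msRank, half_sup_raise ht0, card_raise]
        simp
        omega
      · have : topPart K ((-K).toNat, true, 0) = 0 := by simp [topPart]; omega
        rw [attachTop, this, if_neg (lt_irrefl _)]
    · obtain ⟨L, hL⟩ : ∃ L, L = s.sup := ⟨_, rfl⟩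
      obtain ⟨r, hr⟩ : ∃ r, r = s.erase L := ⟨_, rfl⟩
      have hLs : L ∈ s := hL ▸ sup_mem hs0
      have hsr : s = L ::ₘ r := by rw [hr, Multiset.cons_erase hLs]
      have hr' : r ∈ oddFree := mem_oddFree_of_cons (hsr ▸ hs)
      have hrL : r.sup ≤ L := by
        rw [hL, hsr]
        exact Multiset.sup_mono (Multiset.subset_cons r L)
      have hL0 : L ≠ 0 := fun h => hs.1 (h ▸ hLs)
      have hodd : Odd L → r.sup < L := fun ho => by
        refine lt_of_le_of_ne hrL fun h => ?_
        have h1 : L ∈ r := by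
          have := sup_mem (s := r) (fun h0 => hL0 (by rw [← h, h0]; rfl))
          rwa [h] at this
        have h2 := hs.2 L hLs ho
        rw [hsr, Multiset.count_cons_self] at h2
        have := Multiset.count_pos.2 h1
        omega
      have hcard : msRank s = ((L + 1) / 2 : ℕ) - (Multiset.card r + 1 : ℤ) := by
        rw [msRank, hsr, sup_cons_of_le hrL, Multiset.card_cons]
        push_cast
        ring
      rw [hcard] at hrk
      -- The hypothesis `K - 1 ≤ msRank s` is precisely what makes the number `j` of twos
      -- nonnegative.
      obtain ⟨j, hj⟩ := Int.eq_ofNat_of_zero_le (show 0 ≤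
        (((L + 1) / 2 : ℕ) : ℤ) - (Multiset.card r + 1) - (K - 1) by omega)
      have htop : ∀ e : Bool, (e = true ↔ Even L) → topPart K (j, e, r) = L := by
        intro e he
        simp only [topPart]
        cases e
        · have : Odd L := Nat.not_even_iff_odd.1 fun h => by simpa using he.2 h
          obtain ⟨k, hk⟩ := this
          simp only [Bool.toNat_false]
          push_cast
          omega
        · obtain ⟨k, hk⟩ := he.1 rfl
          simp only [Bool.toNat_true]
          push_cast
          omega
      refine ⟨(j, decide (Even L), r), ⟨hr', ?_⟩, ?_⟩
      · rcases eq_or_ne (j, decide (Even L), r) (0, false, 0) with h | h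
        · rw [h]
          simp only [raise, Multiset.map_zero, Multiset.replicate_zero, add_zero, Bool.toNat_false,
            msRank_zero]
          simp only [Prod.mk.injEq] at h
          have hc : Multiset.card r = 0 := by rw [h.2.2]; rfl
          have : Odd L := Nat.not_even_iff_odd.1 (by simpa using h.2.1)
          obtain ⟨k, hk⟩ := this
          omega
        · rw [msRank, half_sup_raise h, card_raise]
          simp only
          rcases Nat.even_or_odd L with he | ho
          · obtain ⟨k, hk⟩ := id he
            simp only [he, decide_true, Bool.toNat_true]
            push_cast
            omega
          · have h2 := hodd ho
            have h3 : ¬ Even L := Nat.not_even_iff_odd.2 ho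
            obtain ⟨k, hk⟩ := ho
            simp only [h3, decide_false, Bool.toNat_false]
            push_cast
            omega
      · rw [attachTop, htop _ (by simp), if_pos (by omega), Int.toNat_natCast, hsr]


/-! ### Generating functions of multisets without repeated odd parts -/

/-- The generating function of a set of multisets with respect to their sums. -/
noncomputable def gf (q : ℂ) (A : Set (Multiset ℕ)) : ℂ := ∑' s : A, q ^ (s : Multiset ℕ).sum

lemma gf_eq (q : ℂ) (A : Set (Multiset ℕ)) :
    gf q A = ∑' s, A.indicator (fun s => q ^ s.sum) s :=
  tsum_subtype A fun s => q ^ s.sum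

/-- The finite products converge to the reciprocal of `(r; r)_∞`, which is finite because that
product is nonzero. -/
lemma exists_prod_inv_one_sub_le {r : ℝ} (hr0 : 0 ≤ r) (hr1 : r < 1) :
    ∃ C : ℝ, ∀ n : ℕ, ∏ i ∈ Finset.range n, (1 - r ^ (i + 1))⁻¹ ≤ C := by
  have hr : ‖(r : ℂ)‖ < 1 := by simpa [abs_of_nonneg hr0] using hr1
  have h := ((tendsto_qPoch hr r).inv₀ (qPoch_ne_zero hr (pow_mul_self_ne_one hr))).norm
  obtain ⟨C, hC⟩ := h.bddAbove_range
  refine ⟨C, fun n => (le_of_eq ?_).trans (hC ⟨n, rfl⟩)⟩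
  simp only []
  rw [norm_inv, norm_prod, ← Finset.prod_inv_distrib]
  refine Finset.prod_congr rfl fun i _ => ?_
  have h1 : r ^ (i + 1) ≤ 1 := pow_le_one₀ hr0 hr1.le
  rw [show (1 - (r : ℂ) ^ i * r) = ((1 - r ^ (i + 1) : ℝ) : ℂ) by push_cast; ring,
    Complex.norm_real, Real.norm_of_nonneg (sub_nonneg.2 h1)]

lemma sum_eq_sum_count {s : Multiset ℕ} {n : ℕ} (h : ∀ a ∈ s, a ≤ n) :
    s.sum = ∑ i : Fin n, (i + 1 : ℕ) * s.count (i + 1 : ℕ) := by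
  rw [Fin.sum_univ_eq_sum_range fun i => (i + 1) * s.count (i + 1),
    Finset.sum_multiset_count_of_subset s (Finset.range (n + 1)) fun a ha =>
      Finset.mem_range_succ_iff.2 (h a (Multiset.mem_toFinset.1 ha)), Finset.sum_range_succ']
  simp [mul_comm]

/-- A finite family of multisets embeds, through multiplicities, into a box of exponent vectors. Its
sum is then bounded by a product of truncated geometric series, uniformly by Euler's product. -/
lemma summable_pow_sum {r : ℝ} (hr0 : 0 ≤ r) (hr1 : r < 1) :
    Summable fun s : {s : Multiset ℕ | 0 ∉ s} => r ^ (s : Multiset ℕ).sum := by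
  obtain ⟨C, hC⟩ := exists_prod_inv_one_sub_le hr0 hr1
  refine summable_of_sum_le (c := C) (fun s => pow_nonneg hr0 _) fun T => ?_
  obtain ⟨n, hn⟩ : ∃ n, n = T.sup fun s => (s : Multiset ℕ).sum + Multiset.card (s : Multiset ℕ) :=
    ⟨_, rfl⟩
  have hT : ∀ s ∈ T, (s : Multiset ℕ).sum ≤ n ∧ Multiset.card (s : Multiset ℕ) ≤ n := fun s hs => by
    have := Finset.le_sup (f := fun s : {s : Multiset ℕ | 0 ∉ s} =>
      (s : Multiset ℕ).sum + Multiset.card (s : Multiset ℕ)) hs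
    simp only [← hn] at this
    omega
  have hle : ∀ s ∈ T, ∀ a ∈ (s : Multiset ℕ), a ≤ n := fun s hs a ha =>
    (Multiset.single_le_sum (by simp) a ha).trans (hT s hs).1
  let e : {s : Multiset ℕ | 0 ∉ s} → Fin n → ℕ := fun s i => (s : Multiset ℕ).count (i + 1 : ℕ)
  have hinj : Set.InjOn e T := by
    intro s hs t ht hst
    refine Subtype.ext (Multiset.ext.2 fun a => ?_)
    rcases Nat.eq_zero_or_pos a with rfl | ha
    · rw [Multiset.count_eq_zero.2 s.2, Multiset.count_eq_zero.2 t.2]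
    · by_cases han : a ≤ n
      · have := congrFun hst ⟨a - 1, by omega⟩
        simpa [e, Nat.sub_add_cancel ha] using this
      · rw [Multiset.count_eq_zero.2 fun h => han (hle s hs a h),
          Multiset.count_eq_zero.2 fun h => han (hle t ht a h)]
  have h1 : ∑ s ∈ T, r ^ (s : Multiset ℕ).sum = ∑ f ∈ T.image e, ∏ i : Fin n,
      (r ^ (i + 1 : ℕ)) ^ f i := by
    rw [Finset.sum_image hinj]
    refine Finset.sum_congr rfl fun s hs => ?_
    rw [sum_eq_sum_count (hle s hs), ← Finset.prod_pow_eq_pow_sum]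
    simp only [pow_mul, e]
  have h2 : T.image e ⊆ Fintype.piFinset fun _ : Fin n => Finset.range (n + 1) := by
    intro f hf
    obtain ⟨s, hs, rfl⟩ := Finset.mem_image.1 hf
    exact Fintype.mem_piFinset.2 fun i => Finset.mem_range_succ_iff.2
      ((Multiset.count_le_card _ _).trans (hT s hs).2)
  rw [h1]
  refine (Finset.sum_le_sum_of_subset_of_nonneg h2 fun f _ _ =>
    Finset.prod_nonneg fun i _ => by positivity).trans ?_
  rw [← Finset.prod_univ_sum (fun _ : Fin n => Finset.range (n + 1))
    (fun (i : Fin n) j => (r ^ (i + 1 : ℕ)) ^ j)]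
  refine le_trans ?_ (hC n)
  rw [← Fin.prod_univ_eq_prod_range fun i => (1 - r ^ (i + 1))⁻¹]
  refine Finset.prod_le_prod (fun i _ => Finset.sum_nonneg fun j _ => by positivity) fun i _ => ?_
  have h3 : r ^ (i + 1 : ℕ) < 1 := pow_lt_one₀ hr0 hr1 (by simp)
  rw [← tsum_geometric_of_lt_one (by positivity) h3]
  exact (summable_geometric_of_lt_one (by positivity) h3).sum_le_tsum _
    fun j _ => by positivity

section
variable {q : ℂ} (hq : ‖q‖ < 1)
include hq

lemma summable_indicator {A : Set (Multiset ℕ)} (hA : A ⊆ oddFree) :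
    Summable (A.indicator fun s => q ^ s.sum) := by
  have h : Summable ({s : Multiset ℕ | 0 ∉ s}.indicator fun s => ‖q‖ ^ s.sum) :=
    summable_subtype_iff_indicator.1 (summable_pow_sum (norm_nonneg q) hq)
  refine Summable.of_norm_bounded h fun s => ?_
  rw [norm_indicator_eq_indicator_norm]
  simp only [norm_pow]
  exact Set.indicator_le_indicator_of_subset (fun s hs => (hA hs).1) (fun s => by positivity) s

lemma hasSum_gf_fiber {ι : Type*} {A : Set (Multiset ℕ)} (hA : A ⊆ oddFree)
    (g : Multiset ℕ → ι) : HasSum (fun i => gf q {s | s ∈ A ∧ g s = i}) (gf q A) := by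
  have h := (summable_indicator hq hA).hasSum.tsum_fiberwise g
  rw [← gf_eq] at h
  refine h.congr_fun fun i => ?_
  rw [show {s | s ∈ A ∧ g s = i} = g ⁻¹' {i} ∩ A by ext s; simp [and_comm], gf_eq,
    tsum_subtype (g ⁻¹' {i}) (A.indicator fun s => q ^ s.sum), Set.indicator_indicator]

lemma gf_split {A : Set (Multiset ℕ)} (hA : A ⊆ oddFree) (p : Multiset ℕ → Prop) :
    gf q A = gf q {s | s ∈ A ∧ p s} + gf q {s | s ∈ A ∧ ¬ p s} := by
  classical
  have h := (hasSum_gf_fiber hq hA p).tsum_eq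
  rw [← h, tsum_fintype]
  rw [show (Finset.univ : Finset Prop) = {True, False} by ext p; by_cases h : p <;> simp [h],
    Finset.sum_pair (by simp)]
  simp

lemma norm_gf_le {A : Set (Multiset ℕ)} (hA : A ⊆ oddFree) :
    ‖gf q A‖ ≤ ∑' s, {s : Multiset ℕ | 0 ∉ s}.indicator (fun s => ‖q‖ ^ s.sum) s := by
  have h : Summable ({s : Multiset ℕ | 0 ∉ s}.indicator fun s => ‖q‖ ^ s.sum) :=
    summable_subtype_iff_indicator.1 (summable_pow_sum (norm_nonneg q) hq)
  rw [gf_eq]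
  refine tsum_of_norm_bounded h.hasSum fun s => ?_
  rw [norm_indicator_eq_indicator_norm]
  simp only [norm_pow]
  exact Set.indicator_le_indicator_of_subset (fun s hs => (hA hs).1) (fun s => by positivity) s

end

/-- Both sets are parametrised by `lowRank K`, one through `attachTop K` and the other through
`raise`, and the weights of the two images differ by `2 * K - 1`. -/
lemma gf_attachTop {q : ℂ} (hq0 : q ≠ 0) {K : ℤ} (hK : K ≠ 0) :
    gf q {s | s ∈ oddFree ∧ K - 1 ≤ msRank s ∧ (0 < K → s ≠ 0)} =
      q ^ (2 * K - 1) * gf q {s | s ∈ oddFree ∧ msRank s ≤ K} := by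
  rw [gf, gf, ← attachTop_image hK, ← raise_image, tsum_image (fun s => q ^ s.sum)
    (attachTop_injOn hK), tsum_image (fun s => q ^ s.sum) (raise_injOn.mono fun t ht => ht.1),
    ← tsum_mul_left]
  refine tsum_congr fun t => ?_
  rw [← zpow_natCast, ← zpow_natCast, ← zpow_add₀ hq0, sum_attachTop hK t.2, add_comm]


/-! ### The distribution of the rank -/

lemma oddFree_sep_subset (p : Multiset ℕ → Prop) : {s | s ∈ oddFree ∧ p s} ⊆ oddFree :=
  fun _ h => h.1

/-- The exponent `2 n² + n + 2 m n`. -/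
def tailExp (m n : ℕ) : ℕ := 2 * n ^ 2 + n + 2 * m * n

lemma tailExp_succ (m n : ℕ) : tailExp m (n + 1) = tailExp m n + (2 * (m + 2 * n) + 3) := by
  simp only [tailExp]
  ring

lemma le_tailExp (m n : ℕ) : n ≤ tailExp m n := by
  simp only [tailExp]
  nlinarith [Nat.zero_le (m * n), Nat.zero_le (n ^ 2)]

lemma norm_pow_tailExp_le {q : ℂ} (hq : ‖q‖ < 1) (m n : ℕ) : ‖q ^ tailExp m n‖ ≤ ‖q‖ ^ n := by
  rw [norm_pow]
  exact pow_le_pow_of_le_one (norm_nonneg _) hq.le (le_tailExp m n)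

lemma summable_norm_tail {q : ℂ} (hq : ‖q‖ < 1) (m : ℕ) :
    Summable fun n : ℕ => ‖(-1) ^ n * q ^ tailExp m (n + 1)‖ := by
  have h := (summable_geometric_of_lt_one (norm_nonneg q) hq)
  refine Summable.of_nonneg_of_le (fun n => norm_nonneg _) (fun n => ?_)
    ((summable_nat_add_iff 1).2 h)
  rw [norm_mul, norm_pow, norm_neg, norm_one, one_pow, one_mul]
  exact norm_pow_tailExp_le hq m (n + 1)

/-- The solution of a two-step recursion by an alternating series. -/
lemma hasSum_of_recursion {q : ℂ} (hq : ‖q‖ < 1) {g : ℕ → ℂ} {P : ℂ} {C : ℝ}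
    (hg : ∀ m, g m = q ^ (2 * m + 3) * (P - g (m + 2))) (hC : ∀ m, ‖g m‖ ≤ C) (m : ℕ) :
    HasSum (fun n : ℕ => P * ((-1) ^ n * q ^ tailExp m (n + 1))) (g m) := by
  -- Each use of the recursion adds `2 * (m + 2 * n) + 3` to the exponent, which is the increment in
  -- `tailExp_succ`; the remainder is bounded by a multiple of `‖q‖ ^ n`.
  have hpart : ∀ n : ℕ, ∑ i ∈ Finset.range n, P * ((-1) ^ i * q ^ tailExp m (i + 1)) =
      g m - (-1) ^ n * q ^ tailExp m n * g (m + 2 * n) := by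
    intro n
    induction n with
    | zero => simp [tailExp]
    | succ n ih =>
      rw [Finset.sum_range_succ, ih, tailExp_succ, pow_add q, hg (m + 2 * n),
        show m + 2 * (n + 1) = m + 2 * n + 2 by ring]
      ring
  have hs : Summable fun n : ℕ => P * ((-1) ^ n * q ^ tailExp m (n + 1)) :=
    (summable_norm_tail hq m).of_norm.mul_left P
  have hlim : Tendsto (fun n : ℕ => (-1) ^ n * q ^ tailExp m n * g (m + 2 * n)) atTop (𝓝 0) := by
    refine squeeze_zero_norm (a := fun n => ‖q‖ ^ n * C) (fun n => ?_) ?_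
    · rw [norm_mul, norm_mul, norm_pow, norm_neg, norm_one, one_pow, one_mul]
      exact mul_le_mul (norm_pow_tailExp_le hq m n) (hC _) (norm_nonneg _) (by positivity)
    · simpa using (tendsto_pow_atTop_nhds_zero_of_lt_one (norm_nonneg q) hq).mul_const C
  have h1 := hs.hasSum.tendsto_sum_nat
  simp only [hpart] at h1
  have h2 := hlim.const_sub (g m)
  rw [sub_zero] at h2
  rw [← tendsto_nhds_unique h1 h2]
  exact hs.hasSum

/-- After multiplication by `q`, the tail series for ranks above 1 consists of the terms of the
theta series with index at least 2; `P - P * q` supplies the indices 0 and 1. -/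
lemma hasSum_quadTerm_nat {q P a : ℂ}
    (h : HasSum (fun n : ℕ => P * ((-1) ^ n * q ^ tailExp 1 (n + 1))) a) :
    HasSum (fun n : ℕ => P * quadTerm q (-1) n) (q * a + (P - P * q)) := by
  have h2 : ∑ i ∈ Finset.range 2, P * quadTerm q (-1) (i : ℕ) = P - P * q := by
    rw [Finset.sum_range_succ, Finset.sum_range_one, quadTerm_nat q (b := 0) (e := 0) (by norm_num),
      quadTerm_nat q (b := 1) (e := 1) (by norm_num)]
    ring
  rw [← h2]
  refine (hasSum_nat_add_iff (f := fun n : ℕ => P * quadTerm q (-1) n) 2).1 ?_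
  refine (h.mul_left q).congr_fun fun n => ?_
  have he : 2 * ((n + 2 : ℕ) : ℤ) ^ 2 + -1 * ((n + 2 : ℕ) : ℤ) = (tailExp 1 (n + 1) + 1 : ℕ) := by
    simp only [tailExp]
    push_cast
    ring
  rw [quadTerm_nat q he]
  ring

lemma hasSum_quadTerm_neg {q P a : ℂ}
    (h : HasSum (fun n : ℕ => P * ((-1) ^ n * q ^ tailExp 0 (n + 1))) a) :
    HasSum (fun n : ℕ => P * quadTerm q (-1) (-(n + 1))) (-a) := by
  refine h.neg.congr_fun fun n => ?_
  have he : 2 * (-((n : ℤ) + 1)) ^ 2 + -1 * -((n : ℤ) + 1) = (tailExp 0 (n + 1) : ℕ) := by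
    simp only [tailExp]
    push_cast
    ring
  have h1 : (-1 : ℂ) ^ (-((n : ℤ) + 1)) = -(-1) ^ n := by
    rw [zpow_neg, ← inv_zpow, inv_neg_one, zpow_add_one₀ (by norm_num), zpow_natCast]
    ring
  rw [quadTerm, he, h1, zpow_natCast]
  ring

lemma gf_singleton_zero (q : ℂ) : gf q {0} = 1 := by
  rw [gf, tsum_singleton 0 fun s : Multiset ℕ => q ^ s.sum]
  simp

section
variable {q : ℂ} (hq0 : q ≠ 0) (hq : ‖q‖ < 1)
include hq0 hq

/-- The adjoint relation with `K = m + 2`; the empty multiset is irrelevant here because its rank is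
zero. -/
lemma gf_gt_rec (m : ℕ) : gf q {s | s ∈ oddFree ∧ (m : ℤ) < msRank s} = q ^ (2 * m + 3) *
    (gf q oddFree - gf q {s | s ∈ oddFree ∧ ((m + 2 : ℕ) : ℤ) < msRank s}) := by
  have h := gf_attachTop hq0 (K := m + 2) (by omega)
  have h1 := gf_split hq (le_refl oddFree) fun s => ((m + 2 : ℕ) : ℤ) < msRank s
  rw [h1, add_sub_cancel_left]
  convert h using 2
  · congr 1
    ext s
    refine and_congr_right fun _ => ⟨fun hm => ⟨by omega, ?_⟩, fun hm => by omega⟩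
    rintro - rfl
    rw [msRank_zero] at hm
    omega
  · rw [← zpow_natCast]
    congr 1
    push_cast
    ring
  · congr 1
    ext s
    exact and_congr_right fun _ => by rw [not_lt]; push_cast; rfl

/-- The adjoint relation with `K = -m - 1`, read backwards: the negative power of `q` moves to the
other side. Hence both tails satisfy the same recursion. -/
lemma gf_lt_rec (m : ℕ) : gf q {s | s ∈ oddFree ∧ msRank s < -(m : ℤ)} = q ^ (2 * m + 3) *
    (gf q oddFree - gf q {s | s ∈ oddFree ∧ msRank s < -((m + 2 : ℕ) : ℤ)}) := by
  have h := gf_attachTop hq0 (K := -m - 1) (by omega)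
  have h1 := gf_split hq (le_refl oddFree) fun s => msRank s < -((m + 2 : ℕ) : ℤ)
  rw [h1, add_sub_cancel_left]
  have h2 : {s | s ∈ oddFree ∧ ¬ msRank s < -((m + 2 : ℕ) : ℤ)} =
      {s | s ∈ oddFree ∧ (-m - 1 : ℤ) - 1 ≤ msRank s ∧ (0 < (-m - 1 : ℤ) → s ≠ 0)} := by
    ext s
    refine and_congr_right fun _ => ⟨fun hm => ⟨by omega, fun hm => by omega⟩, fun hm => by omega⟩
  rw [h2, h, ← mul_assoc, ← zpow_natCast, ← zpow_add₀ hq0]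
  rw [show ((2 * m + 3 : ℕ) : ℤ) + (2 * (-m - 1) - 1) = 0 by push_cast; ring, zpow_zero, one_mul]
  congr 1
  ext s
  exact and_congr_right fun _ => by omega

lemma hasSum_gf_gt (m : ℕ) : HasSum (fun n : ℕ => gf q oddFree * ((-1) ^ n * q ^ tailExp m (n + 1)))
    (gf q {s | s ∈ oddFree ∧ (m : ℤ) < msRank s}) :=
  hasSum_of_recursion hq (gf_gt_rec hq0 hq) (fun _ => norm_gf_le hq (oddFree_sep_subset _)) m

lemma hasSum_gf_lt (m : ℕ) : HasSum (fun n : ℕ => gf q oddFree * ((-1) ^ n * q ^ tailExp m (n + 1)))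
    (gf q {s | s ∈ oddFree ∧ msRank s < -(m : ℤ)}) :=
  hasSum_of_recursion hq (gf_lt_rec hq0 hq) (fun _ => norm_gf_le hq (oddFree_sep_subset _)) m

/-- All multisets split into rank negative, the empty one, and nonempty of rank at least zero. The
case `K = 1` turns the last class into `q` times those of rank at most 1. Inserting both tail series
gives the full theta series with coefficient `gf q oddFree`. -/
theorem gf_oddFree_mul_th : gf q oddFree * th (q ^ 4) q = 1 := by
  have hG0 := hasSum_gf_lt hq0 hq 0
  have hG1 := hasSum_gf_gt hq0 hq 1
  have h := gf_attachTop hq0 (K := 1) one_ne_zero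
  have e1 := gf_split hq (le_refl oddFree) fun s => msRank s < -((0 : ℕ) : ℤ)
  have e2 := gf_split hq (oddFree_sep_subset fun s => ¬ msRank s < -((0 : ℕ) : ℤ)) fun s => s = 0
  have e3 := gf_split hq (le_refl oddFree) fun s => ((1 : ℕ) : ℤ) < msRank s
  have s1 : {s | s ∈ {s | s ∈ oddFree ∧ ¬ msRank s < -((0 : ℕ) : ℤ)} ∧ s = 0} = {0} := by
    ext s
    simp only [Set.mem_ofPred_eq, Set.mem_singleton_iff]
    refine ⟨fun h => h.2, ?_⟩
    rintro rfl
    exact ⟨⟨zero_mem_oddFree, by simp [msRank_zero]⟩, rfl⟩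
  have s2 : {s | s ∈ {s | s ∈ oddFree ∧ ¬ msRank s < -((0 : ℕ) : ℤ)} ∧ ¬ s = 0} =
      {s | s ∈ oddFree ∧ (1 : ℤ) - 1 ≤ msRank s ∧ (0 < (1 : ℤ) → s ≠ 0)} := by
    ext s
    simp [and_assoc]
  have s3 : {s | s ∈ oddFree ∧ ¬ ((1 : ℕ) : ℤ) < msRank s} =
      {s | s ∈ oddFree ∧ msRank s ≤ (1 : ℤ)} := by
    ext s
    simp
  rw [s1, s2, gf_singleton_zero, h] at e2
  rw [e2] at e1
  rw [s3] at e3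
  have t1 := hasSum_quadTerm_nat hG1
  have t2 := hasSum_quadTerm_neg hG0
  have t3 := HasSum.of_nat_of_neg_add_one (f := fun n : ℤ => gf q oddFree * quadTerm q (-1) n) t1 t2
  have t4 := (hasSum_quadTerm hq0 hq (-1)).mul_left (gf q oddFree)
  rw [show (-1 + 2 : ℤ) = 1 by norm_num, zpow_one] at t4
  rw [t4.unique t3]
  rw [show (2 * 1 - 1 : ℤ) = 1 by norm_num, zpow_one] at e1
  generalize gf q {s | s ∈ oddFree ∧ msRank s < -((0 : ℕ) : ℤ)} = a at e1 ⊢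
  generalize gf q {s | s ∈ oddFree ∧ ((1 : ℕ) : ℤ) < msRank s} = b at e3 ⊢
  generalize gf q {s | s ∈ oddFree ∧ msRank s ≤ (1 : ℤ)} = c at e1 e3
  linear_combination e1 - q * e3

end


/-! ### Rank classes modulo `M` -/

section
variable {q : ℂ} (hq0 : q ≠ 0) (hq : ‖q‖ < 1)
include hq0 hq

/-- Difference of the tails beyond `m` and `m + 1`, whose exponents differ by `2 * (n + 1)`. -/
lemma hasSum_gf_eq_pos (m : ℕ) : HasSum (fun n : ℕ => gf q oddFree *
      ((-1) ^ n * q ^ tailExp m (n + 1) * (1 - q ^ (2 * (n + 1)))))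
    (gf q {s | s ∈ oddFree ∧ msRank s = m + 1}) := by
  have h1 := gf_split hq (oddFree_sep_subset fun s => (m : ℤ) < msRank s)
    fun s => ((m + 1 : ℕ) : ℤ) < msRank s
  have e1 : {s | s ∈ {s | s ∈ oddFree ∧ (m : ℤ) < msRank s} ∧ ((m + 1 : ℕ) : ℤ) < msRank s} =
      {s | s ∈ oddFree ∧ ((m + 1 : ℕ) : ℤ) < msRank s} := by
    ext s
    exact ⟨fun h => ⟨h.1.1, h.2⟩, fun h => ⟨⟨h.1, by have := h.2; omega⟩, h.2⟩⟩
  have e2 : {s | s ∈ {s | s ∈ oddFree ∧ (m : ℤ) < msRank s} ∧ ¬ ((m + 1 : ℕ) : ℤ) < msRank s} =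
      {s | s ∈ oddFree ∧ msRank s = m + 1} := by
    ext s
    exact ⟨fun h => ⟨h.1.1, by have := h.2; have := h.1.2; omega⟩,
      fun h => ⟨⟨h.1, by have := h.2; omega⟩, by have := h.2; omega⟩⟩
  rw [e1, e2] at h1
  rw [← sub_eq_iff_eq_add'.2 h1]
  refine ((hasSum_gf_gt hq0 hq m).sub (hasSum_gf_gt hq0 hq (m + 1))).congr_fun fun n => ?_
  rw [show tailExp (m + 1) (n + 1) = tailExp m (n + 1) + 2 * (n + 1) by simp only [tailExp]; ring,
    pow_add]
  ring

lemma hasSum_gf_eq_neg (m : ℕ) : HasSum (fun n : ℕ => gf q oddFree *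
      ((-1) ^ n * q ^ tailExp m (n + 1) * (1 - q ^ (2 * (n + 1)))))
    (gf q {s | s ∈ oddFree ∧ msRank s = -(m + 1)}) := by
  have h1 := gf_split hq (oddFree_sep_subset fun s => msRank s < -(m : ℤ))
    fun s => msRank s < -((m + 1 : ℕ) : ℤ)
  have e1 : {s | s ∈ {s | s ∈ oddFree ∧ msRank s < -(m : ℤ)} ∧ msRank s < -((m + 1 : ℕ) : ℤ)} =
      {s | s ∈ oddFree ∧ msRank s < -((m + 1 : ℕ) : ℤ)} := by
    ext s
    exact ⟨fun h => ⟨h.1.1, h.2⟩, fun h => ⟨⟨h.1, by have := h.2; omega⟩, h.2⟩⟩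
  have e2 : {s | s ∈ {s | s ∈ oddFree ∧ msRank s < -(m : ℤ)} ∧ ¬ msRank s < -((m + 1 : ℕ) : ℤ)} =
      {s | s ∈ oddFree ∧ msRank s = -(m + 1)} := by
    ext s
    exact ⟨fun h => ⟨h.1.1, by have := h.2; have := h.1.2; omega⟩,
      fun h => ⟨⟨h.1, by have := h.2; omega⟩, by have := h.2; omega⟩⟩
  rw [e1, e2] at h1
  rw [← sub_eq_iff_eq_add'.2 h1]
  refine ((hasSum_gf_lt hq0 hq m).sub (hasSum_gf_lt hq0 hq (m + 1))).congr_fun fun n => ?_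
  rw [show tailExp (m + 1) (n + 1) = tailExp m (n + 1) + 2 * (n + 1) by simp only [tailExp]; ring,
    pow_add]
  ring

/-- The series of `hasSum_gf_eq_pos` summed over the arithmetic progression `m + M ℕ`. -/
lemma hasSum_progression {M : ℕ} (hM : 0 < M) (m : ℕ) {u : ℕ → ℂ}
    (hu : ∀ j, HasSum (fun n : ℕ => gf q oddFree *
      ((-1) ^ n * q ^ tailExp (m + M * j) (n + 1) * (1 - q ^ (2 * (n + 1))))) (u j)) :
    HasSum (fun n : ℕ => gf q oddFree *
      ((-1) ^ n * q ^ tailExp m (n + 1) * (1 - q ^ (2 * (n + 1))) / (1 - q ^ (2 * M * (n + 1)))))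
      (∑' j, u j) := by
  have hlt : ∀ n : ℕ, ‖q ^ (2 * M * (n + 1))‖ < 1 := fun n => by
    rw [norm_pow]
    exact pow_lt_one₀ (norm_nonneg _) hq (by positivity)
  -- Passing from rank parameter `m` to `m + M * j` multiplies the n-th term by the j-th power of a
  -- fixed ratio. Exchanging the two sums turns the progression into a geometric series and creates
  -- the denominator.
  let f : ℕ → ℕ → ℂ := fun n j => gf q oddFree *
    ((-1) ^ n * q ^ tailExp m (n + 1) * (1 - q ^ (2 * (n + 1))) * (q ^ (2 * M * (n + 1))) ^ j)
  have hfj : ∀ n j, f n j = gf q oddFree *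
      ((-1) ^ n * q ^ tailExp (m + M * j) (n + 1) * (1 - q ^ (2 * (n + 1)))) := fun n j => by
    simp only [f]
    rw [show tailExp (m + M * j) (n + 1) = tailExp m (n + 1) + 2 * M * (n + 1) * j by
      simp only [tailExp]; ring, pow_add, pow_mul]
    ring
  have hb : Summable fun p : ℕ × ℕ => (‖gf q oddFree‖ * (2 * ‖q‖ ^ p.1)) * ‖q‖ ^ p.2 := by
    have g := summable_geometric_of_lt_one (norm_nonneg q) hq
    refine summable_mul_of_summable_norm (f := fun n : ℕ => ‖gf q oddFree‖ * (2 * ‖q‖ ^ n))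
      (g := fun n : ℕ => ‖q‖ ^ n) ?_ ?_
    · exact ((g.mul_left 2).mul_left _).norm
    · exact g.norm
  have hf : Summable (Function.uncurry f) := by
    refine Summable.of_norm_bounded hb ?_
    rintro ⟨n, j⟩
    have h1 : ‖q ^ tailExp m (n + 1)‖ ≤ ‖q‖ ^ n :=
      (norm_pow_tailExp_le hq m (n + 1)).trans
        (pow_le_pow_of_le_one (norm_nonneg _) hq.le (Nat.le_succ n))
    have h2 : ‖1 - q ^ (2 * (n + 1))‖ ≤ 2 := by
      refine (norm_sub_le _ _).trans ?_
      rw [norm_one, norm_pow]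
      linarith [pow_le_one₀ (norm_nonneg q) hq.le (n := 2 * (n + 1))]
    have h3 : ‖(q ^ (2 * M * (n + 1))) ^ j‖ ≤ ‖q‖ ^ j := by
      rw [← pow_mul, norm_pow]
      refine pow_le_pow_of_le_one (norm_nonneg _) hq.le ?_
      exact Nat.le_mul_of_pos_left j (by positivity)
    simp only [Function.uncurry, f]
    rw [norm_mul, norm_mul, norm_mul, norm_mul, norm_pow, norm_neg, norm_one, one_pow, one_mul,
      mul_assoc ‖gf q oddFree‖]
    refine mul_le_mul_of_nonneg_left ?_ (norm_nonneg _)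
    refine mul_le_mul ?_ h3 (norm_nonneg _) (by positivity)
    rw [mul_comm (2 : ℝ)]
    exact mul_le_mul h1 h2 (norm_nonneg _) (by positivity)
  have hu' : ∀ j, u j = ∑' n, f n j := fun j => by
    rw [← (hu j).tsum_eq]
    exact tsum_congr fun n => (hfj n j).symm
  have hn : ∀ n, HasSum (fun j => f n j) (gf q oddFree * ((-1) ^ n * q ^ tailExp m (n + 1) *
      (1 - q ^ (2 * (n + 1))) / (1 - q ^ (2 * M * (n + 1))))) := fun n => by
    have := ((hasSum_geometric_of_norm_lt_one (hlt n)).mul_left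
      ((-1) ^ n * q ^ tailExp m (n + 1) * (1 - q ^ (2 * (n + 1))))).mul_left (gf q oddFree)
    rwa [← div_eq_mul_inv] at this
  have h := hf.hasSum.prod_fiberwise hn
  rw [tsum_congr hu', hf.tsum_comm]
  rwa [tsum_congr fun n => (hn n).tsum_eq, h.tsum_eq]

/-- The multisets without repeated odd members whose rank is congruent to `a` modulo `M`. -/
def rankClass (a M : ℕ) : Set (Multiset ℕ) := {s | s ∈ oddFree ∧ msRank s ≡ a [ZMOD M]}

omit hq0 hq in
lemma rankClass_subset (a M : ℕ) : rankClass a M ⊆ oddFree := fun _ h => h.1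

/-- Positive ranks in the class are `a + M * j` with `j ≥ 0`. The index `a - 1` appears because
`hasSum_gf_eq_pos m` concerns rank `m + 1`. -/
lemma hasSum_gf_rankClass_pos {M a : ℕ} (ha : 0 < a) (haM : a < M) :
    HasSum (fun n : ℕ => gf q oddFree * ((-1) ^ n * q ^ tailExp (a - 1) (n + 1) *
      (1 - q ^ (2 * (n + 1))) / (1 - q ^ (2 * M * (n + 1)))))
      (gf q {s | s ∈ rankClass a M ∧ 0 < msRank s}) := by
  have hM : (0 : ℤ) < M := by omega
  have h := hasSum_gf_fiber hq (A := {s | s ∈ rankClass a M ∧ 0 < msRank s}) (fun s hs => hs.1.1)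
    fun s => (msRank s / M).toNat
  rw [← h.tsum_eq]
  refine hasSum_progression hq0 hq (by omega) (a - 1) fun j => ?_
  convert hasSum_gf_eq_pos hq0 hq (a - 1 + M * j) using 2
  ext s
  have hcast : (((a - 1 + M * j : ℕ) : ℤ) + 1) = a + M * j := by
    push_cast [Nat.cast_sub ha]
    ring
  rw [Set.mem_ofPred_eq, Set.mem_ofPred_eq, hcast]
  constructor
  · rintro ⟨⟨⟨h1, h2⟩, h3⟩, h4⟩
    refine ⟨h1, ?_⟩
    have h5 := Int.emod_add_mul_ediv (msRank s) M
    rw [h2, Int.emod_eq_of_lt (by omega) (by omega : (a : ℤ) < M)] at h5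
    have h6 : 0 ≤ msRank s / M := Int.ediv_nonneg h3.le hM.le
    rw [← h4, Int.toNat_of_nonneg h6, h5]
  · rintro ⟨h1, h2⟩
    have h3 : (0 : ℤ) ≤ M * j := by positivity
    refine ⟨⟨⟨h1, ?_⟩, by omega⟩, ?_⟩
    · rw [h2]; exact Int.emod_eq_emod_iff_emod_sub_eq_zero.2 (by simp)
    · rw [h2, Int.add_mul_ediv_left _ _ hM.ne', Int.ediv_eq_zero_of_lt (by omega) (by omega)]
      simp

/-- Rank zero is not in the class since `0 < a < M`, so the remaining ranks are the negatives of `(M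
- a) + M * j`. -/
lemma hasSum_gf_rankClass_neg {M a : ℕ} (ha : 0 < a) (haM : a < M) :
    HasSum (fun n : ℕ => gf q oddFree * ((-1) ^ n * q ^ tailExp (M - a - 1) (n + 1) *
      (1 - q ^ (2 * (n + 1))) / (1 - q ^ (2 * M * (n + 1)))))
      (gf q {s | s ∈ rankClass a M ∧ ¬ 0 < msRank s}) := by
  have hM : (0 : ℤ) < M := by omega
  have h := hasSum_gf_fiber hq (A := {s | s ∈ rankClass a M ∧ ¬ 0 < msRank s}) (fun s hs => hs.1.1)
    fun s => (-msRank s / M).toNat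
  rw [← h.tsum_eq]
  refine hasSum_progression hq0 hq (by omega) (M - a - 1) fun j => ?_
  convert hasSum_gf_eq_neg hq0 hq (M - a - 1 + M * j) using 2
  ext s
  have hcast : -(((M - a - 1 + M * j : ℕ) : ℤ) + 1) = a + M * (-j - 1) := by
    push_cast [Nat.sub_sub, Nat.cast_sub haM]
    ring
  rw [Set.mem_ofPred_eq, Set.mem_ofPred_eq, hcast]
  constructor
  · rintro ⟨⟨⟨h1, h2⟩, h3⟩, h4⟩
    refine ⟨h1, ?_⟩
    obtain ⟨k, hk⟩ := h2.dvd
    have h5 : -msRank s / M = k - 1 := by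
      rw [show -msRank s = (M - a) + M * (k - 1) by linarith, Int.add_mul_ediv_left _ _ hM.ne',
        Int.ediv_eq_zero_of_lt (by omega) (by omega), zero_add]
    have h6 : 0 ≤ -msRank s / M := Int.ediv_nonneg (by omega) hM.le
    rw [← h4, Int.toNat_of_nonneg h6, h5]
    linarith
  · rintro ⟨h1, h2⟩
    have h3 : (0 : ℤ) ≤ M * j := by positivity
    have h4 : -msRank s = (M - a) + M * j := by rw [h2]; ring
    refine ⟨⟨⟨h1, ?_⟩, by omega⟩, ?_⟩
    · rw [h2]; exact Int.emod_eq_emod_iff_emod_sub_eq_zero.2 (by simp)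
    · rw [h4, Int.add_mul_ediv_left _ _ hM.ne', Int.ediv_eq_zero_of_lt (by omega) (by omega)]
      simp

omit hq0 hq in
lemma rankTerm_sub_nat (M a n : ℕ) (ha : 0 < a) :
    rankTerm q M a (n + 1 : ℕ) - rankTerm q M (a + 1) (n + 1 : ℕ) =
      -((-1) ^ n * q ^ tailExp (a - 1) (n + 1) *
        (1 - q ^ (2 * (n + 1))) / (1 - q ^ (2 * M * (n + 1)))) := by
  obtain ⟨a, rfl⟩ := Nat.exists_eq_succ_of_ne_zero ha.ne'
  have e1 : 2 * ((n + 1 : ℕ) : ℤ) ^ 2 + (2 * (a.succ : ℤ) - 1) * ((n + 1 : ℕ) : ℤ) =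
      (tailExp (a.succ - 1) (n + 1) : ℕ) := by
    simp only [tailExp, Nat.succ_eq_add_one, Nat.add_sub_cancel]
    push_cast
    ring
  have e2 : 2 * ((n + 1 : ℕ) : ℤ) ^ 2 + (2 * ((a.succ : ℤ) + 1) - 1) * ((n + 1 : ℕ) : ℤ) =
      (tailExp (a.succ - 1) (n + 1) + 2 * (n + 1) : ℕ) := by
    rw [Nat.cast_add (tailExp _ _), ← e1]
    push_cast
    ring
  rw [rankTerm, rankTerm, quadTerm_nat q e1, quadTerm_nat q e2, zpow_natCast, ← pow_mul, pow_add q]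
  ring

/-- Reversing the index multiplies the denominator by a power of `q` which the numerator absorbs;
this gives the antisymmetry `k ↦ M + 1 - k`. -/
lemma rankTerm_neg {M : ℕ} (hM : 0 < M) (k : ℤ) (n : ℤ) :
    rankTerm q M k (-n) = -rankTerm q M (M + 1 - k) n := by
  rcases eq_or_ne n 0 with rfl | hn
  · simp [rankTerm]
  have h0 : (q ^ (2 * M)) ^ n ≠ 0 := zpow_ne_zero _ (pow_ne_zero _ hq0)
  have h1 : (q ^ (2 * M)) ^ n ≠ 1 := base_zpow_ne_one (base_pow_norm_lt hq (by positivity)) hn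
  have h2 : 1 - (q ^ (2 * M)) ^ n ≠ 0 := sub_ne_zero.2 h1.symm
  have h3 : 1 - ((q ^ (2 * M)) ^ n)⁻¹ ≠ 0 := sub_ne_zero.2 fun h => h1 (inv_eq_one.1 h.symm)
  have e : quadTerm q (2 * (M + 1 - k) - 1) n = quadTerm q (2 * k - 1) (-n) * (q ^ (2 * M)) ^ n :=
      by
    rw [quadTerm, quadTerm, zpow_neg, ← inv_zpow, inv_neg_one, mul_assoc, ← zpow_natCast,
        ← zpow_mul,
      ← zpow_add₀ hq0]
    congr 2
    push_cast
    ring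
  rw [rankTerm, rankTerm, e, zpow_neg]
  field_simp
  ring

/-- The terms of positive index in `V - W` describe the positive ranks, and those of negative index,
folded by `rankTerm_neg`, the negative ranks. The term `n = 0` is zero by convention. -/
theorem gf_rankClass {M a : ℕ} (ha : 0 < a) (haM : a < M) {V W : ℂ}
    (hV : HasSum (rankTerm q M a) V) (hW : HasSum (rankTerm q M (a + 1)) W) :
    gf q (rankClass a M) = -(gf q oddFree * (V - W)) := by
  have h1 := (hasSum_gf_rankClass_pos hq0 hq ha haM).add (hasSum_gf_rankClass_neg hq0 hq ha haM)
  rw [← gf_split hq (rankClass_subset a M)] at h1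
  have h2 := (hasSum_nat_add_iff' 1).2 (hV.sub hW).nat_add_neg
  have h0 : ∀ k : ℤ, rankTerm q M k 0 = 0 := fun k => by simp [rankTerm]
  simp only [Finset.sum_range_one, Nat.cast_zero, neg_zero, h0, sub_zero, add_zero] at h2
  refine h1.unique ((h2.mul_left (gf q oddFree)).neg.congr_fun fun n => ?_)
  have h3 := rankTerm_sub_nat (q := q) M (M - a) n (by omega)
  rw [rankTerm_neg hq0 hq (by omega), rankTerm_neg hq0 hq (by omega), rankTerm_sub_nat M a n ha]
  rw [Nat.cast_sub haM.le] at h3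
  rw [show (M + 1 - (a + 1) : ℤ) = M - a by ring, show (M + 1 - a : ℤ) = M - a + 1 by ring]
  linear_combination gf q oddFree * h3

lemma hasSum_rankTerm_reflect {M : ℕ} (hM : 0 < M) {k l : ℤ} (hkl : k + l = M + 1) {V : ℂ}
    (hV : HasSum (rankTerm q M k) V) : HasSum (rankTerm q M l) (-V) := by
  refine ((Equiv.neg ℤ).hasSum_iff.2 hV).neg.congr_fun fun n => ?_
  simp only [Function.comp, Equiv.neg_apply]
  rw [rankTerm_neg hq0 hq hM, neg_neg]
  congr 1
  linarith

omit hq0 in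
lemma gf_oddFree_eq_sum {M : ℕ} (hM : 0 < M) :
    gf q oddFree = ∑ a ∈ Finset.range M, gf q (rankClass a M) := by
  have hM' : (0 : ℤ) < M := by omega
  have h := hasSum_gf_fiber hq (le_refl oddFree) fun s => (msRank s % M).toNat
  have hs : ∀ a, a < M → {s | s ∈ oddFree ∧ (msRank s % M).toNat = a} = rankClass a M := by
    intro a ha
    ext s
    refine and_congr_right fun _ => ?_
    rw [Int.ModEq, Int.emod_eq_of_lt (by omega : (0 : ℤ) ≤ a) (by omega)]
    have := Int.emod_nonneg (msRank s) hM'.ne'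
    omega
  rw [← Finset.sum_congr rfl fun a ha => congrArg (gf q) (hs a (Finset.mem_range.1 ha))]
  refine h.unique (hasSum_sum_of_ne_finset_zero fun a ha => ?_)
  have he : {s | s ∈ oddFree ∧ (msRank s % M).toNat = a} = ∅ := by
    ext s
    simp only [Set.mem_ofPred_eq, Set.mem_empty_iff_false, iff_false, not_and]
    intro _ hs
    have := Int.emod_lt_of_pos (msRank s) hM'
    rw [Finset.mem_range] at ha
    omega
  rw [he, gf]
  exact tsum_empty

end


/-! ### From multisets to partitions -/

lemma parts_mem_oddFree {n : ℕ} (p : n.Partition) : p.parts ∈ oddFree ↔ NoRepeatedOdd p :=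
  ⟨fun h => h.2, fun h => ⟨fun h0 => lt_irrefl 0 (p.parts_pos h0), h⟩⟩

lemma card_filter_partition {A : Set (Multiset ℕ)} (hA : A ⊆ oddFree) (n : ℕ)
    (P : n.Partition → Prop) [DecidablePred P] (hP : ∀ p, P p ↔ p.parts ∈ A) :
    Nat.card {s | s ∈ A ∧ s.sum = n} = (Finset.univ.filter P).card := by
  have h : {s | s ∈ A ∧ s.sum = n} = Nat.Partition.parts '' ((Finset.univ.filter P : Finset
      n.Partition) : Set n.Partition) := by
    ext s
    simp only [Finset.coe_filter, Finset.mem_univ, true_and]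
    constructor
    · rintro ⟨h1, h2⟩
      refine ⟨⟨s, fun {i} hi => Nat.pos_of_ne_zero fun h0 => (hA h1).1 (h0 ▸ hi), h2⟩, ?_, rfl⟩
      exact (hP _).2 h1
    · rintro ⟨p, hp, rfl⟩
      exact ⟨(hP p).1 hp, p.parts_sum⟩
  rw [h, Nat.card_coe_set_eq, Set.ncard_image_of_injective _ fun p p' h => Nat.Partition.ext h,
    Set.ncard_coe_finset]

lemma hasSum_card {q : ℂ} (hq : ‖q‖ < 1) {A : Set (Multiset ℕ)} (hA : A ⊆ oddFree)
    (P : ∀ n : ℕ, n.Partition → Prop) [∀ n, DecidablePred (P n)]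
    (hP : ∀ n p, P n p ↔ p.parts ∈ A) :
    HasSum (fun n : ℕ => ((Finset.univ.filter (P n)).card : ℂ) * q ^ n) (gf q A) := by
  refine (hasSum_gf_fiber hq hA Multiset.sum).congr_fun fun n => ?_
  rw [← card_filter_partition hA n (P n) (hP n), gf, ← nsmul_eq_mul, ← tsum_const]
  exact tsum_congr fun s => by rw [s.2.2]

lemma hasSum_po {q : ℂ} (hq : ‖q‖ < 1) : HasSum (fun n : ℕ => (po n : ℂ) * q ^ n) (gf q oddFree) :=
  hasSum_card hq (le_refl oddFree) (fun _ p => NoRepeatedOdd p) fun _ p => (parts_mem_oddFree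
      p).symm

lemma hasSum_N2 {q : ℂ} (hq : ‖q‖ < 1) (a M : ℕ) :
    HasSum (fun n : ℕ => (N2 a M n : ℂ) * q ^ n) (gf q (rankClass a M)) :=
  hasSum_card hq (rankClass_subset a M)
    (fun _ p => NoRepeatedOdd p ∧ m2Rank p ≡ (a : ℤ) [ZMOD (M : ℤ)])
    fun _ p => and_congr_left fun _ => (parts_mem_oddFree p).symm

lemma hasSum_deviation {q : ℂ} (hq : ‖q‖ < 1) (a M : ℕ) :
    HasSum (fun n : ℕ => deviationCoeff a M n * q ^ n)
      (gf q (rankClass a M) - gf q oddFree / M) := by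
  refine ((hasSum_N2 hq a M).sub ((hasSum_po hq).div_const (M : ℂ))).congr_fun fun n => ?_
  rw [deviationCoeff]
  ring

/-! ### Rank classes and deviations for the moduli 3 and 5. -/

section
variable {q : ℂ} (hq0 : q ≠ 0) (hq : ‖q‖ < 1)
include hq0 hq

/-- The middle series `rankTerm q 3 2` is antisymmetric and sums to zero. The class 0, which
`gf_rankClass` does not cover, is the complement of the other two. -/
lemma gf_rankClass_three {V : ℂ} (hV : HasSum (rankTerm q 3 1) V) :
    gf q (rankClass 1 3) = -(gf q oddFree * V) ∧
      gf q (rankClass 0 3) = gf q oddFree + 2 * (gf q oddFree * V) := by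
  have hs : Summable (rankTerm q 3 2) := (hasSum_rankTerm hq0 hq (by decide) 2).summable
  obtain ⟨W, hW⟩ := hs
  have hW0 := hW.unique (hasSum_rankTerm_reflect hq0 hq (l := 2) (by norm_num) (by norm_num) hW)
  have hX := hasSum_rankTerm_reflect hq0 hq (l := 3) (by norm_num) (by norm_num) hV
  have h1 := gf_rankClass hq0 hq (M := 3) (a := 1) (by norm_num) (by norm_num)
    (by exact_mod_cast hV) (by norm_num; exact hW)
  have h2 := gf_rankClass hq0 hq (M := 3) (a := 2) (by norm_num) (by norm_num)
    (by exact_mod_cast hW) (by norm_num; exact hX)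
  have h3 := gf_oddFree_eq_sum hq (M := 3) (by norm_num)
  rw [Finset.sum_range_succ, Finset.sum_range_succ, Finset.sum_range_one] at h3
  constructor
  · linear_combination h1 + gf q oddFree / 2 * hW0
  · linear_combination -h3 - h1 - h2

/-- By antisymmetry the third series vanishes, and the fourth and fifth are the negatives of the
second and first. The class 0 is again obtained as a complement. -/
lemma gf_rankClass_five {V W : ℂ} (hV : HasSum (rankTerm q 5 1) V)
    (hW : HasSum (rankTerm q 5 2) W) :
    gf q (rankClass 1 5) = -(gf q oddFree * (V - W)) ∧
      gf q (rankClass 2 5) = -(gf q oddFree * W) ∧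
      gf q (rankClass 0 5) = gf q oddFree + 2 * (gf q oddFree * V) := by
  have hs : Summable (rankTerm q 5 3) := (hasSum_rankTerm hq0 hq (by decide) 3).summable
  obtain ⟨X, hX⟩ := hs
  have hX0 := hX.unique (hasSum_rankTerm_reflect hq0 hq (l := 3) (by norm_num) (by norm_num) hX)
  have hY := hasSum_rankTerm_reflect hq0 hq (l := 4) (by norm_num) (by norm_num) hW
  have hZ := hasSum_rankTerm_reflect hq0 hq (l := 5) (by norm_num) (by norm_num) hV
  have h1 := gf_rankClass hq0 hq (M := 5) (a := 1) (by norm_num) (by norm_num)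
    (by exact_mod_cast hV) (by norm_num; exact hW)
  have h2 := gf_rankClass hq0 hq (M := 5) (a := 2) (by norm_num) (by norm_num)
    (by exact_mod_cast hW) (by norm_num; exact hX)
  have h3 := gf_rankClass hq0 hq (M := 5) (a := 3) (by norm_num) (by norm_num)
    (by exact_mod_cast hX) (by norm_num; exact hY)
  have h4 := gf_rankClass hq0 hq (M := 5) (a := 4) (by norm_num) (by norm_num)
    (by exact_mod_cast hY) (by norm_num; exact hZ)
  have h5 := gf_oddFree_eq_sum hq (M := 5) (by norm_num)
  rw [Finset.sum_range_succ, Finset.sum_range_succ, Finset.sum_range_succ, Finset.sum_range_succ,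
    Finset.sum_range_one] at h5
  refine ⟨h1, ?_, ?_⟩
  · linear_combination h2 + gf q oddFree / 2 * hX0
  · linear_combination -h5 - h1 - h2 - h3 - h4

/-- Since `gf q oddFree` is the reciprocal of `th (q ^ 4) q`, the constant `-(1 / 3)` cancels the
mean value of the class and the theta factor disappears from `D`. -/
theorem hasSum_deviation_three {V D : ℂ} (hV : HasSum (rankTerm q 3 1) V)
    (h : V = -(1 / 3) - th (q ^ 4) q * D) :
    HasSum (fun n : ℕ => deviationCoeff 1 3 n * q ^ n) D ∧
      HasSum (fun n : ℕ => deviationCoeff 0 3 n * q ^ n) (-2 * D) := by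
  obtain ⟨h1, h0⟩ := gf_rankClass_three hq0 hq hV
  have hP := gf_oddFree_mul_th hq0 hq
  subst h
  constructor
  · convert hasSum_deviation hq 1 3 using 1
    rw [h1]
    push_cast
    linear_combination -D * hP
  · convert hasSum_deviation hq 0 3 using 1
    rw [h0]
    push_cast
    linear_combination 2 * D * hP

theorem hasSum_deviation_five {V W D E : ℂ} (hV : HasSum (rankTerm q 5 1) V)
    (hW : HasSum (rankTerm q 5 2) W) (h : V = -(2 / 5) - th (q ^ 4) q * E)
    (h' : W = -(1 / 5) - th (q ^ 4) q * D) :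
    HasSum (fun n : ℕ => deviationCoeff 2 5 n * q ^ n) D ∧
      HasSum (fun n : ℕ => deviationCoeff 1 5 n * q ^ n) (E - D) ∧
      HasSum (fun n : ℕ => deviationCoeff 0 5 n * q ^ n) (-2 * E) := by
  obtain ⟨h1, h2, h0⟩ := gf_rankClass_five hq0 hq hV hW
  have hP := gf_oddFree_mul_th hq0 hq
  subst h h'
  refine ⟨?_, ?_, ?_⟩
  · convert hasSum_deviation hq 2 5 using 1
    rw [h2]
    push_cast
    linear_combination -D * hP
  · convert hasSum_deviation hq 1 5 using 1
    rw [h1]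
    push_cast
    linear_combination (D - E) * hP
  · convert hasSum_deviation hq 0 5 using 1
    rw [h0]
    push_cast
    linear_combination 2 * E * hP

end


/-! ### Rank differences in residue classes modulo three -/

lemma hasSum_of_eq {f g : ℕ → ℂ} {a b : ℂ} (h : HasSum f a) (hg : ∀ n, g n = f n) (hb : b = a) :
    HasSum g b :=
  hb ▸ h.congr_fun hg

/-- A primitive cube root of unity. -/
lemma exists_cube_root_sum : ∃ ω : ℂ, ω ^ 3 = 1 ∧ 1 + ω + ω ^ 2 = 0 := by
  have h := Complex.isPrimitiveRoot_exp 3 (by norm_num)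
  refine ⟨_, h.pow_eq_one, ?_⟩
  have := h.geom_sum_eq_zero (by norm_num)
  rw [Finset.sum_range_succ, Finset.sum_range_succ, Finset.sum_range_one] at this
  simpa using this

lemma cube_root_sum_pow {ω : ℂ} (h3 : ω ^ 3 = 1) (h : 1 + ω + ω ^ 2 = 0) (m : ℕ) :
    1 + ω ^ m + (ω ^ m) ^ 2 = if m % 3 = 0 then 3 else 0 := by
  have hm : ω ^ m = ω ^ (m % 3) := by
    conv_lhs => rw [← Nat.div_add_mod m 3, pow_add, pow_mul, h3, one_pow, one_mul]
  rw [hm]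
  have : m % 3 < 3 := Nat.mod_lt _ (by norm_num)
  interval_cases m % 3
  · norm_num
  · simpa using h
  · simp only [OfNat.ofNat_ne_zero, if_false]
    linear_combination h + ω * h3

/-- A filter by cube roots of unity: the three evaluations are weighted by `1`, `ω ^ (2 * b)` and `ω
^ (4 * b)`, and since `n + 2 * b ≡ n - b` modulo 3, only the indices `n ≡ b` survive. -/
lemma hasSum_residue_three {c : ℕ → ℂ} {p : ℂ} (hp : p ≠ 0) {X : ℕ → ℂ}
    (h : ∀ w : ℂ, w ^ 3 = 1 →
      HasSum (fun n => c n * (w * p) ^ n) (X 0 + w * p * X 1 + (w * p) ^ 2 * X 2))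
    {b : ℕ} (hb : b < 3) : HasSum (fun n => c (3 * n + b) * (p ^ 3) ^ n) (X b) := by
  obtain ⟨ω, h3, h0⟩ := exists_cube_root_sum
  have hS := cube_root_sum_pow h3 h0
  have h1 := h 1 (one_pow 3)
  have h2 := (h ω h3).mul_left (ω ^ (2 * b))
  have h4 := (h (ω ^ 2) (by rw [← pow_mul, mul_comm, pow_mul, h3, one_pow])).mul_left (ω ^ (4 * b))
  have h5 : HasSum (fun n => c n * p ^ n * (1 + ω ^ (n + 2 * b) + (ω ^ (n + 2 * b)) ^ 2) / 3)
      (p ^ b * X b) := by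
    refine hasSum_of_eq (((h1.add h2).add h4).div_const 3) (fun n => ?_) ?_
    · ring
    · have e : ∀ r < 3, 1 + ω ^ (r + 2 * b) + (ω ^ (r + 2 * b)) ^ 2 = if r = b then 3 else 0 := by
        intro r hr
        rw [hS]
        exact if_congr (by omega) rfl rfl
      have e0 := e 0 (by norm_num)
      have e1 := e 1 (by norm_num)
      have e2 := e 2 (by norm_num)
      have e3 : p ^ b * X b = (X 0 * (if 0 = b then 3 else 0) + p * X 1 * (if 1 = b then 3 else 0) +
          p ^ 2 * X 2 * (if 2 = b then 3 else 0)) / 3 := by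
        interval_cases b <;> norm_num
      rw [e3, ← e0, ← e1, ← e2]
      ring
  have hinj : Function.Injective fun n : ℕ => 3 * n + b := fun x y hxy => by
    simp only at hxy
    omega
  have h6 := (hinj.hasSum_iff fun n hn => by
    rw [hS, if_neg, mul_zero, zero_div]
    exact fun hm => hn ⟨n / 3, by simp only; omega⟩).2 h5
  have h7 := h6.mul_left (p ^ b)⁻¹
  have hpb := pow_ne_zero b hp
  rw [inv_mul_cancel_left₀ hpb] at h7
  refine h7.congr_fun fun n => ?_
  simp only [Function.comp]
  rw [hS, if_pos (by omega), pow_add, pow_mul]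
  field_simp

lemma hasSum_trisection {c : ℕ → ℂ} {p X Y Z : ℂ} (hp : p ≠ 0)
    (h : ∀ w : ℂ, w ^ 3 = 1 →
      HasSum (fun n => c n * (w * p) ^ n) (X + w * p * Y + (w * p) ^ 2 * Z)) :
    HasSum (fun n => c (3 * n) * (p ^ 3) ^ n) X ∧ HasSum (fun n => c (3 * n + 1) * (p ^ 3) ^ n) Y ∧
      HasSum (fun n => c (3 * n + 2) * (p ^ 3) ^ n) Z := by
  obtain ⟨F, rfl, rfl, rfl⟩ : ∃ F : ℕ → ℂ, F 0 = X ∧ F 1 = Y ∧ F 2 = Z :=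
    ⟨fun n => if n = 0 then X else if n = 1 then Y else Z, rfl, rfl, rfl⟩
  exact ⟨hasSum_residue_three hp h (by norm_num), hasSum_residue_three hp h (by norm_num),
    hasSum_residue_three hp h (by norm_num)⟩

theorem rank_difference_three {q : ℂ} (hq0 : q ≠ 0) (hq : ‖q‖ < 1) :
    HasSum (fun n : ℕ => ((N2 0 3 n : ℂ) - N2 1 3 n) * q ^ n)
      (3 * appellLerch (q ^ 15) (q ^ 36) (q ^ 9)
        + 3 * q ^ (-6 : ℤ) * appellLerch (q ^ (-3 : ℤ)) (q ^ 36) (q ^ 27)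
        + Jbar 9 18 q ^ 2 * J 3 12 q / J1 6 q ^ 2
        + q * (Jbar 9 18 q * J 9 36 q / J1 6 q)
        + q ^ 2 * (J 9 36 q ^ 2 / J 3 12 q)) := by
  obtain ⟨h1, h0⟩ := hasSum_deviation_three hq0 hq (hasSum_rank_three hq0 hq) rfl
  refine hasSum_of_eq (h0.sub h1) (fun n => ?_) ?_
  · simp only [deviationCoeff]
    ring
  · ring

/-- Writing `q = p ^ 3`, the formula of `rank_difference_three` at `w * p` has components depending
only on `(w * p) ^ 3 = p ^ 3` when `w ^ 3 = 1`, which is what `hasSum_trisection` needs. -/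
theorem rank_difference_three_trisection {q : ℂ} (hq0 : q ≠ 0) (hq : ‖q‖ < 1) :
    HasSum (fun n : ℕ => rankDiffCoeff 0 1 3 0 3 n * q ^ n)
      (3 * appellLerch (q ^ 5) (q ^ 12) (q ^ 3)
        + 3 * q ^ (-2 : ℤ) * appellLerch (q ^ (-1 : ℤ)) (q ^ 12) (q ^ 9)
        + Jbar 3 6 q ^ 2 * J 1 4 q / J1 2 q ^ 2) ∧
    HasSum (fun n : ℕ => rankDiffCoeff 0 1 3 1 3 n * q ^ n) (Jbar 3 6 q * J 3 12 q / J1 2 q) ∧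
    HasSum (fun n : ℕ => rankDiffCoeff 0 1 3 2 3 n * q ^ n) (J 3 12 q ^ 2 / J 1 4 q) := by
  obtain ⟨p, rfl⟩ : ∃ p : ℂ, p ^ 3 = q := IsAlgClosed.exists_pow_nat_eq q (by norm_num)
  have hp0 : p ≠ 0 := fun h => hq0 (by rw [h]; norm_num)
  have hp : ‖p‖ < 1 := by
    by_contra h
    rw [norm_pow] at hq
    exact absurd hq (not_lt.2 (one_le_pow₀ (not_lt.1 h)))
  have hX : ∀ w : ℂ, w ^ 3 = 1 → HasSum (fun n => ((N2 0 3 n : ℂ) - N2 1 3 n) * (w * p) ^ n)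
      ((3 * appellLerch ((p ^ 3) ^ 5) ((p ^ 3) ^ 12) ((p ^ 3) ^ 3)
        + 3 * (p ^ 3) ^ (-2 : ℤ) * appellLerch ((p ^ 3) ^ (-1 : ℤ)) ((p ^ 3) ^ 12) ((p ^ 3) ^ 9)
        + Jbar 3 6 (p ^ 3) ^ 2 * J 1 4 (p ^ 3) / J1 2 (p ^ 3) ^ 2)
        + w * p * (Jbar 3 6 (p ^ 3) * J 3 12 (p ^ 3) / J1 2 (p ^ 3))
        + (w * p) ^ 2 * (J 3 12 (p ^ 3) ^ 2 / J 1 4 (p ^ 3))) := by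
    intro w hw
    have hw0 : w ≠ 0 := fun h => by simp [h] at hw
    have hw1 : ‖w‖ = 1 := by
      have := congrArg norm hw
      rw [norm_pow, norm_one] at this
      exact (pow_eq_one_iff_of_nonneg (norm_nonneg w) (by norm_num)).1 this
    have h := rank_difference_three (mul_ne_zero hw0 hp0) (q := w * p) (by rwa [norm_mul, hw1,
        one_mul])
    obtain ⟨u, hu⟩ : ∃ u, u = w * p := ⟨_, rfl⟩
    have hu3 : p ^ 3 = u ^ 3 := by rw [hu, mul_pow, hw, one_mul]
    rw [← hu] at h ⊢
    rw [hu3]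
    have z2 : (u ^ 3) ^ (-2 : ℤ) = u ^ (-6 : ℤ) := by
      rw [← zpow_natCast, ← zpow_mul]; norm_num
    have z1 : (u ^ 3) ^ (-1 : ℤ) = u ^ (-3 : ℤ) := by
      rw [← zpow_natCast, ← zpow_mul]; norm_num
    rw [z1, z2, ← Jbar_mul 3 3 6, ← J_mul 3 1 4, ← J_mul 3 3 12, ← J1_mul 3 2, ← pow_mul, ← pow_mul,
      ← pow_mul, ← pow_mul]
    exact h
  obtain ⟨t0, t1, t2⟩ := hasSum_trisection (c := fun n => (N2 0 3 n : ℂ) - N2 1 3 n) hp0 hX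
  exact ⟨t0.congr_fun fun n => rfl, t1.congr_fun fun n => rfl, t2.congr_fun fun n => rfl⟩

end MTwoRank

open MTwoRank in
theorem mainTheorem6 (q : ℂ) (hq0 : 0 < ‖q‖) (hq1 : ‖q‖ < 1) :
    -- the deviations for `M = 3`
    HasSum (fun n : ℕ => deviationCoeff 0 3 n * q ^ n)
      (2 * appellLerch (q ^ 15) (q ^ 36) (q ^ 9)
        + 2 * q ^ (-6 : ℤ) * appellLerch (q ^ (-3 : ℤ)) (q ^ 36) (q ^ 27)
        + 2 / 3 * (Jbar 9 18 q ^ 2 * J 3 12 q / J1 6 q ^ 2)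
        + q * (2 / 3) * (Jbar 9 18 q * J 9 36 q / J1 6 q)
        + q ^ 2 * (2 / 3) * (J 9 36 q ^ 2 / J 3 12 q)) ∧
    HasSum (fun n : ℕ => deviationCoeff 1 3 n * q ^ n)
      (-appellLerch (q ^ 15) (q ^ 36) (q ^ 9)
        - q ^ (-6 : ℤ) * appellLerch (q ^ (-3 : ℤ)) (q ^ 36) (q ^ 27)
        - 1 / 3 * (Jbar 9 18 q ^ 2 * J 3 12 q / J1 6 q ^ 2)
        - q * (1 / 3) * (Jbar 9 18 q * J 9 36 q / J1 6 q)
        - q ^ 2 * (1 / 3) * (J 9 36 q ^ 2 / J 3 12 q)) ∧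
    -- the rank differences for `M = m = 3`
    HasSum (fun n : ℕ => rankDiffCoeff 0 1 3 0 3 n * q ^ n)
      (3 * appellLerch (q ^ 5) (q ^ 12) (q ^ 3)
        + 3 * q ^ (-2 : ℤ) * appellLerch (q ^ (-1 : ℤ)) (q ^ 12) (q ^ 9)
        + Jbar 3 6 q ^ 2 * J 1 4 q / J1 2 q ^ 2) ∧
    HasSum (fun n : ℕ => rankDiffCoeff 0 1 3 1 3 n * q ^ n)
      (Jbar 3 6 q * J 3 12 q / J1 2 q) ∧
    HasSum (fun n : ℕ => rankDiffCoeff 0 1 3 2 3 n * q ^ n)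
      (J1 3 q * J1 12 q ^ 2 / (J1 4 q * J 1 6 q)) ∧
    -- the deviations for `M = 5`
    HasSum (fun n : ℕ => deviationCoeff 0 5 n * q ^ n)
      (2 - 2 * q ^ (-55 : ℤ) * appellLerch (q ^ (-55 : ℤ)) (q ^ 100) (q ^ 75)
        - 2 * q ^ (-15 : ℤ) * appellLerch (q ^ (-5 : ℤ)) (q ^ 100) (q ^ 25)
        - 6 / 5 * (J 5 50 q ^ 2 * J 30 100 q * J 40 100 q
            / (J1 5 q * Jbar 50 200 q * J1 100 q))
        + q * (4 / 5) * (J1 50 q ^ 4 / (J 10 50 q * J1 25 q * J1 100 q))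
        + q ^ 2 * (2 / 5) *
            (2 * (J1 25 q ^ 2 * J 30 100 q / (J 10 25 q * J1 50 q))
              - q ^ 5 * (J 10 100 q * J1 25 q ^ 2 / (J 5 25 q * J1 50 q)))
        - q ^ 3 * (2 / 5) * (Jbar 25 50 q * J 25 100 q / J 20 50 q)
        + q ^ 4 * (2 / 5) * (J1 10 q * J1 100 q * J 15 50 q ^ 2
            / (J1 5 q * J 30 100 q * J 40 100 q))) ∧
    HasSum (fun n : ℕ => deviationCoeff 1 5 n * q ^ n)
      (-(q ^ (-1 : ℤ) * appellLerch (q ^ 35) (q ^ 100) (q ^ 25))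
        - q ^ (-6 : ℤ) * appellLerch (q ^ 15) (q ^ 100) (q ^ 25)
        - 1 + q ^ (-55 : ℤ) * appellLerch (q ^ (-55 : ℤ)) (q ^ 100) (q ^ 75)
        + q ^ (-15 : ℤ) * appellLerch (q ^ (-5 : ℤ)) (q ^ 100) (q ^ 25)
        + 4 / 5 * (J 5 50 q ^ 2 * J 30 100 q * J 40 100 q
            / (J1 5 q * Jbar 50 200 q * J1 100 q))
        - q * (1 / 5) * (J1 50 q ^ 4 / (J 10 50 q * J1 25 q * J1 100 q))
        - q ^ 2 * (1 / 5) *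
            (J1 25 q ^ 2 * J 30 100 q / (J 10 25 q * J1 50 q)
              - 3 * q ^ 5 * (J 10 100 q * J1 25 q ^ 2 / (J 5 25 q * J1 50 q)))
        + q ^ 3 * (3 / 5) * (Jbar 25 50 q * J 25 100 q / J 20 50 q)
        + q ^ 4 * (2 / 5) * (J1 10 q * J1 100 q * J 15 50 q ^ 2
            / (J1 5 q * J 30 100 q * J 40 100 q))) ∧
    HasSum (fun n : ℕ => deviationCoeff 2 5 n * q ^ n)
      (q ^ (-1 : ℤ) * appellLerch (q ^ 35) (q ^ 100) (q ^ 25)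
        + q ^ (-6 : ℤ) * appellLerch (q ^ 15) (q ^ 100) (q ^ 25)
        - 1 / 5 * (J 5 50 q ^ 2 * J 30 100 q * J 40 100 q
            / (J1 5 q * Jbar 50 200 q * J1 100 q))
        - q * (1 / 5) * (J1 50 q ^ 4 / (J 10 50 q * J1 25 q * J1 100 q))
        - q ^ 2 * (1 / 5) *
            (J1 25 q ^ 2 * J 30 100 q / (J 10 25 q * J1 50 q)
              + 2 * q ^ 5 * (J 10 100 q * J1 25 q ^ 2 / (J 5 25 q * J1 50 q)))
        - q ^ 3 * (2 / 5) * (Jbar 25 50 q * J 25 100 q / J 20 50 q)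
        - q ^ 4 * (3 / 5) * (J1 10 q * J1 100 q * J 15 50 q ^ 2
            / (J1 5 q * J 30 100 q * J 40 100 q))) := by
  have hq0' : q ≠ 0 := norm_pos_iff.1 hq0
  obtain ⟨d1, d0⟩ := hasSum_deviation_three hq0' hq1 (hasSum_rank_three hq0' hq1) rfl
  obtain ⟨f2, f1, f0⟩ := hasSum_deviation_five hq0' hq1 (hasSum_rank_five_first hq0' hq1)
    (hasSum_rank_five_second hq0' hq1) rfl rfl
  obtain ⟨r0, r1, r2⟩ := rank_difference_three_trisection hq0' hq1
  refine ⟨?_, d1, ?_, ?_, ?_, ?_, ?_, ?_⟩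
  · convert d0 using 1
    ring
  · exact r0
  · exact r1
  -- Both product forms of this rank difference equal the same quotient of theta constants of level
  -- 12.
  · rwa [theta_quotient_twelve_two' hq0' hq1, ← theta_quotient_twelve_two hq0' hq1]
  · convert f0 using 1
    ring
  · convert f1 using 1
    ring
  · exact f2
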